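/- Manifolds with corners are Hausdorff and paracompact, are modelled on $[0,\infty)^k\times\mathbb R^{n-k}$ (the dimension may differ between components), and have embedded boundary hypersurfaces. A b-map is a smooth map for which, near each point, every local boundary defining function of the target pulls back either to $a\,x^{\alpha}$ with $0<a$ smooth, $x$ local boundary defining functions of the source and $\alpha\in\mathbb N^k$, or to $0$; it is an interior b-map if the second case never occurs. Let $X_1,X_2,Y$ be manifolds with corners and $f_i:X_i\to Y$ ($i=1,2$) interior b-maps which are b-transversal: ${}^b(f_1)_*({}^bT_{p_1}X_1)+{}^b(f_2)_*({}^bT_{p_2}X_2)={}^bT_qY$ whenever $f_1(p_1)=f_2(p_2)=q$. For a pair of (connected) boundary faces $F_i$ of $X_i$ let $D(F_1,F_2)$ be the closure of $\{(p_1,p_2): p_i\in F_i\setminus\partial F_i,\ f_1(p_1)=f_2(p_2)\}$ in $X_1\times X_2$. Its boundary faces are the closures of the connected components of its intersections with the sets $(G_1\setminus\partial G_1)\times(G_2\setminus\partial G_2)$, $G_i\subseteq F_i$ a boundary face. The monoid of such a face in the basic monoidal complex $\mathcal P_{D(F_1,F_2)}$ is $\sigma_{G_1}\times_{\sigma_G}\sigma_{G_2}$,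 where $G$ is the smallest boundary face of $Y$ containing $f_1(G_1)$ (equivalently, containing $f_2(G_2)$), $F$ is the smallest boundary face of $Y$ containing $f_i(F_i)$, $\sigma_{G_i}$ (resp. $\sigma_G$) is the free commutative monoid on the boundary hypersurfaces of the manifold $F_i$ (resp. $F$) containing $G_i$ (resp. $G$), and $\sigma_{G_i}\to\sigma_G$ is given by the exponents $\alpha$ of $f_i$. Assume that all the monoids $\sigma_{G_1}\times_{\sigma_G}\sigma_{G_2}$ which occur in the complexes $\mathcal P_{D(F_1,F_2)}$ are smooth, i.e. isomorphic to some $\mathbb N^m$. Then: (1) $X_1\times_YX_2=\{(p_1,p_2): f_1(p_1)=f_2(p_2)\}$ is the union of the sets $D(F_1,F_2)$, only finitely many of which are non-empty if $X_1$ and $X_2$ are compact. (2) Each $D(F_1,F_2)$ has a universal resolution $[D(F_1,F_2);\mathcal P_{D(F_1,F_2)}]$: a manifold with corners $W$ with a proper interior b-map $W\to F_1\times F_2$ taking values in $D(F_1,F_2)$, which is a diffeomorphism of the interiors, maps ${}^bT_wW$ bijectively onto the b-tangent space of $D(F_1,F_2)$ for every $w\in W$, and induces an isomorphism $\mathcal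 P_W\cong\mathcal P_{D(F_1,F_2)}$ of monoidal complexes. Any such $W\to D(F_1,F_2)$ is a homeomorphism, so that the set $D(F_1,F_2)$ acquires a smooth structure. (3) The disjoint union $$\widetilde{X_1\times_YX_2}=\bigsqcup_{F_1,F_2}[D(F_1,F_2);\mathcal P_{D(F_1,F_2)}]$$ is a manifold with corners and is the universal fiber product of $f_1$ and $f_2$: the projections $h_i:\widetilde{X_1\times_YX_2}\to X_i$ are b-maps with $f_1\circ h_1=f_2\circ h_2$, and for every manifold with corners $Z$ and all b-maps $g_i:Z\to X_i$ with $f_1\circ g_1=f_2\circ g_2$ there is a unique interior b-map $g:Z\to\widetilde{X_1\times_YX_2}$ with $h_i\circ g=g_i$, $i=1,2$. -/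

import Mathlib

open Set Filter Topology
open scoped ContDiff NNReal

universe u

noncomputable section

/-! ## Manifolds with corners

Every manifold with corners is locally diffeomorphic to open subsets of the quadrants
`[0, ∞)ⁿ` (a factor `ℝ` is locally `(0, ∞)`), so charts take values in quadrants.  The dimension
may vary from one connected component to another.  In a chart around `p`, the coordinates which
vanish at `p` are local boundary defining functions, the others are interior coordinates. -/

/-- A chart with values in a quadrant `[0, ∞)ⁿ`. -/
abbrev CornerChart (X : Type u) [TopologicalSpace X] : Type u :=
  Σ n : ℕ, OpenPartialHomeomorph X (EuclideanQuadrant n)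

/-- The quadrant, as a subset of Euclidean space. -/
def quadrant (n : ℕ) : Set (EuclideanSpace ℝ (Fin n)) := {x | ∀ i, 0 ≤ x i}

/-- The open quadrant. -/
def openQuadrant (n : ℕ) : Set (EuclideanSpace ℝ (Fin n)) := {x | ∀ i, 0 < x i}

namespace CornerChart

variable {X : Type u} [TopologicalSpace X]

/-- The domain of a chart. -/
def source (e : CornerChart X) : Set X := e.2.source

/-- The coordinates of a point. -/
def coord (e : CornerChart X) (p : X) : EuclideanSpace ℝ (Fin e.1) :=
  modelWithCornersEuclideanQuadrant e.1 (e.2 p)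

/-- The inverse of a chart; only its values on the quadrant matter. -/
def param (e : CornerChart X) (x : EuclideanSpace ℝ (Fin e.1)) : X :=
  e.2.symm ((modelWithCornersEuclideanQuadrant e.1).symm x)

/-- Extension by zero of a chart of a summand to a disjoint union. -/
def sigma {ι : Type u} {M : ι → Type u} [∀ i, TopologicalSpace (M i)] (i : ι)
    (e : CornerChart (M i)) : CornerChart (Σ i, M i) :=
  ⟨e.1, e.2.lift_openEmbedding (IsOpenEmbedding.sigmaMk (i := i))⟩

end CornerChart

/-- A smooth atlas of charts with values in quadrants.  Smoothness of a function on a relatively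
open subset of a quadrant is smoothness up to the boundary. -/
class CornerAtlas (X : Type u) [TopologicalSpace X] where
  charts : Set (CornerChart X)
  cover : ∀ p : X, ∃ e ∈ charts, p ∈ e.source
  compatible : ∀ e ∈ charts, ∀ e' ∈ charts, ∀ p ∈ e.source ∩ e'.source,
    ContDiffWithinAt ℝ ∞ (fun x => e'.coord (e.param x)) (quadrant e.1) (e.coord p)

/-- The disjoint union of manifolds with corners, with the obvious charts. -/
instance CornerAtlas.sigma {ι : Type u} {M : ι → Type u} [∀ i, TopologicalSpace (M i)]
    [∀ i, CornerAtlas (M i)] : CornerAtlas (Σ i, M i) where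
  charts := {e | ∃ i, ∃ e₀ ∈ CornerAtlas.charts (X := M i), e = CornerChart.sigma i e₀}
  cover := by
    rintro ⟨i, p⟩
    obtain ⟨e, he, hp⟩ := CornerAtlas.cover p
    exact ⟨_, ⟨i, e, he, rfl⟩, p, hp, rfl⟩
  compatible := by
    rintro _ ⟨i, e, he, rfl⟩ _ ⟨j, e', he', rfl⟩ _ ⟨⟨p, hp, rfl⟩, ⟨p', hp', hpp'⟩⟩
    obtain ⟨rfl, h⟩ := Sigma.mk.inj_iff.1 hpp'
    obtain rfl := eq_of_heq h
    have key : ∀ (e : CornerChart (M j)) (q : M j),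
        (CornerChart.sigma j e).coord ⟨j, q⟩ = e.coord q := by
      intro e q
      simp only [CornerChart.coord, CornerChart.sigma]
      exact congrArg _ (OpenPartialHomeomorph.lift_openEmbedding_apply _ _)
    have h1 := CornerAtlas.compatible e he e' he' p' ⟨hp, hp'⟩
    have h2 : (fun x => (CornerChart.sigma j e').coord ((CornerChart.sigma j e).param x))
        = fun x => e'.coord (e.param x) := by
      funext x
      exact key e' (e.param x)
    rw [h2, key]
    exact h1

section Faces

variable {X : Type u} [TopologicalSpace X] [CornerAtlas X]

/-- A chart around `p`. -/
def someChart (p : X) : CornerChart X := (CornerAtlas.cover p).choose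

/-- The boundary codimension of a point: the number of coordinates which vanish there. -/
def codim (p : X) : ℕ := {i | (someChart p).coord p i = 0}.ncard

/-- The smallest boundary face containing `p`: the closure of the connected component of `p` in
the set of points of the same codimension as `p`. -/
def faceOf (p : X) : Set X := closure (connectedComponentIn {q | codim q = codim p} p)

variable (X) in
/-- The (connected) boundary faces of `X`, of all codimensions. -/
def Face : Type u := {F : Set X // ∃ p, F = faceOf p}

variable (X) in
/-- The boundary hypersurfaces of `X`: the boundary faces of codimension one. -/
def Hypersurface : Type u := {H : Set X // ∃ p, codim p = 1 ∧ H = faceOf p}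

/-- The smallest face containing `p`, as a face. -/
def faceAt (p : X) : Face X := ⟨faceOf p, p, rfl⟩

/-- The relative interior `F ∖ ∂F` of a boundary face: the points for which `F` is the smallest
boundary face containing them. -/
def Face.int (F : Face X) : Set X := {p | faceOf p = F.1}

variable (X) in
/-- The interior `X ∖ ∂X`. -/
def mInterior : Set X := {p | codim p = 0}

/-- Near `p`, the set `H` is the zero set of the `i`-th coordinate. -/
def IsDefiningCoord (e : CornerChart X) (H : Set X) (p : X) (i : Fin e.1) : Prop :=
  ∀ᶠ q in 𝓝 p, q ∈ H ↔ e.coord q i = 0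

end Faces

/-- Manifolds with corners: Hausdorff, paracompact, and with embedded boundary hypersurfaces
(near each of its points, a boundary hypersurface is the zero set of a single coordinate). -/
class IsManifoldWithCorners (X : Type u) [TopologicalSpace X] [CornerAtlas X] : Prop where
  t2 : T2Space X
  paracompact : ParacompactSpace X
  embedded : ∀ (H : Hypersurface X), ∀ e ∈ CornerAtlas.charts (X := X),
    ∀ p ∈ e.source ∩ H.1, ∃ i, IsDefiningCoord e H.1 p i

/-! ## b-maps and the b-differential -/

section Maps

variable {X Y : Type u} [TopologicalSpace X] [CornerAtlas X] [TopologicalSpace Y] [CornerAtlas Y]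

/-- Near `p`, the `j`-th coordinate of `f` has the form `a(x) ∏ᵢ xᵢ ^ αᵢ` with `a` smooth and
strictly positive. -/
def IsMonomialAt (f : X → Y) (e : CornerChart X) (e' : CornerChart Y) (p : X) (j : Fin e'.1)
    (α : Fin e.1 → ℕ) : Prop :=
  ∃ U ∈ 𝓝 (e.coord p), ∃ a : EuclideanSpace ℝ (Fin e.1) → ℝ,
    ContDiffOn ℝ ∞ a (quadrant e.1 ∩ U) ∧
    ∀ x ∈ quadrant e.1 ∩ U, 0 < a x ∧ e'.coord (f (e.param x)) j = a x * ∏ i, x i ^ α i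

/-- Smooth maps. -/
def IsSmoothMap (f : X → Y) : Prop :=
  Continuous f ∧ ∀ e ∈ CornerAtlas.charts (X := X), ∀ e' ∈ CornerAtlas.charts (X := Y),
    ∀ p ∈ e.source, f p ∈ e'.source →
      ContDiffWithinAt ℝ ∞ (fun x => e'.coord (f (e.param x))) (quadrant e.1) (e.coord p)

/-- b-maps: smooth maps such that each local boundary defining function of `Y` pulls back either
to a positive multiple of a monomial in local boundary defining functions of `X`, or to zero.
(For the coordinates of `Y` which do not vanish at `f p` the condition is void.) -/
def IsBMap (f : X → Y) : Prop :=
  IsSmoothMap f ∧ ∀ e ∈ CornerAtlas.charts (X := X), ∀ e' ∈ CornerAtlas.charts (X := Y),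
    ∀ p ∈ e.source, f p ∈ e'.source → ∀ j,
      (∃ α, IsMonomialAt f e e' p j α) ∨ ∀ᶠ q in 𝓝 p, e'.coord (f q) j = 0

/-- Interior b-maps: b-maps for which no boundary defining function pulls back to zero. -/
def IsInteriorBMap (f : X → Y) : Prop :=
  IsSmoothMap f ∧ ∀ e ∈ CornerAtlas.charts (X := X), ∀ e' ∈ CornerAtlas.charts (X := Y),
    ∀ p ∈ e.source, f p ∈ e'.source → ∀ j, ∃ α, IsMonomialAt f e e' p j α

/-- The b-differential `ᵇT_p X → ᵇT_{f p} Y`, as a matrix in the frames `xᵢ ∂/∂xᵢ` of the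
b-tangent bundles given by the coordinates.  (If `xᵢ(p) ≠ 0` then `xᵢ ∂/∂xᵢ` is a nonzero multiple
of `∂/∂xᵢ`.)  It is the continuous extension of the ordinary differential from the interior, where
the differential maps `xᵢ ∂/∂xᵢ` to `∑ⱼ (xᵢ ∂ᵢfⱼ / fⱼ) yⱼ ∂/∂yⱼ`.  Rows for which `fⱼ` vanishes
identically near `p` are zero. -/
def bDiff (f : X → Y) (e : CornerChart X) (e' : CornerChart Y) (p : X) :
    Matrix (Fin e'.1) (Fin e.1) ℝ := fun j i =>
  limUnder (𝓝[openQuadrant e.1] (e.coord p)) fun x =>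
    x i * fderiv ℝ (fun z => e'.coord (f (e.param z)) j) x (EuclideanSpace.single i 1) /
      e'.coord (f (e.param x)) j

/-- `G = f_#(F)`: the smallest (largest codimension) boundary face of `Y` containing `f(F)`. -/
def IsFaceImage (f : X → Y) (F : Face X) (G : Face Y) : Prop :=
  f '' F.1 ⊆ G.1 ∧ ∀ G' : Face Y, f '' F.1 ⊆ G'.1 → G.1 ⊆ G'.1

/-- `m` is the exponent of the hypersurface `K` of `X` in the pull-back by `f` of the ideal of the
hypersurface `H` of `Y`: along the relative interior of `K`, the map `f` avoids `H` and `m = 0`, or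
the defining function of `H` pulls back to a monomial in which the defining function of `K` has
exponent `m`. -/
def HasBExponent (f : X → Y) (K : Hypersurface X) (H : Hypersurface Y) (m : ℕ) : Prop :=
  ∀ p, faceOf p = K.1 → (f p ∉ H.1 → m = 0) ∧ (f p ∈ H.1 →
    ∀ e ∈ CornerAtlas.charts (X := X), ∀ e' ∈ CornerAtlas.charts (X := Y),
      p ∈ e.source → f p ∈ e'.source →
      ∀ i j, IsDefiningCoord e K.1 p i → IsDefiningCoord e' H.1 (f p) j →
        ∃ α, α i = m ∧ IsMonomialAt f e e' p j α)

/-- The exponent `α(K, H)` of a b-map, for hypersurfaces `H` whose defining function does not pull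
back to zero near `K`. -/
def bExponent (f : X → Y) (K : Hypersurface X) (H : Hypersurface Y) : ℕ :=
  sInf {m | HasBExponent f K H m}

/-- For boundary faces `G ⊆ F`: the monoid `σ_G` of the basic monoidal complex of the manifold `F`.
It is freely generated by the boundary hypersurfaces of `F` containing `G`; these correspond to the
boundary hypersurfaces of `X` which contain `G` but not `F`. -/
abbrev FaceMonoid (F G : Face X) : Type u :=
  {K : Hypersurface X // G.1 ⊆ K.1 ∧ ¬ F.1 ⊆ K.1} →₀ ℕ

/-- The homomorphism `f_♮`, which sends `e_K` to `∑_H α(K, H) e_H`. -/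
def bPush (f : X → Y) (F G : Face X) : FaceMonoid F G →+ (Hypersurface Y → ℕ) :=
  Finsupp.liftAddHom fun K =>
    { toFun := fun n H => n * bExponent f K.1 H
      map_zero' := by funext H; simp
      map_add' := by intro m n; funext H; simp [add_mul] }

end Maps

/-! ## Fiber products -/

section FiberProducts

variable {X₁ X₂ Y : Type u} [TopologicalSpace X₁] [CornerAtlas X₁] [TopologicalSpace X₂]
  [CornerAtlas X₂] [TopologicalSpace Y] [CornerAtlas Y]

/-- b-transversality: the images of the b-differentials span the b-tangent space of `Y` at each
common value. -/
def BTransversal (f₁ : X₁ → Y) (f₂ : X₂ → Y) : Prop :=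
  ∀ p₁ p₂, f₁ p₁ = f₂ p₂ →
    ∀ e₁ ∈ CornerAtlas.charts (X := X₁), ∀ e₂ ∈ CornerAtlas.charts (X := X₂),
    ∀ e ∈ CornerAtlas.charts (X := Y), p₁ ∈ e₁.source → p₂ ∈ e₂.source → f₁ p₁ ∈ e.source →
      ∀ v, ∃ v₁ v₂, (bDiff f₁ e₁ e p₁).mulVec v₁ + (bDiff f₂ e₂ e p₂).mulVec v₂ = v

/-- The set `F₁ ×_Y F₂ ∖ ∂(F₁ × F₂)`. -/
def fiberInt (f₁ : X₁ → Y) (f₂ : X₂ → Y) (F₁ : Face X₁) (F₂ : Face X₂) : Set (X₁ × X₂) :=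
  {p | p.1 ∈ F₁.int ∧ p.2 ∈ F₂.int ∧ f₁ p.1 = f₂ p.2}

/-- The set `D(F₁, F₂)`. -/
def fiberD (f₁ : X₁ → Y) (f₂ : X₂ → Y) (F₁ : Face X₁) (F₂ : Face X₂) : Set (X₁ × X₂) :=
  closure (fiberInt f₁ f₂ F₁ F₂)

/-- For faces `Gᵢ ⊆ Fᵢ` and `G ⊆ F` with `(fᵢ)_#(Gᵢ) = G` and `(fᵢ)_#(Fᵢ) = F`: the fiber product
`σ_{G₁} ×_{σ_G} σ_{G₂}` of monoids of the basic monoidal complexes of `F₁`, `F₂` over `F`. -/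
def fiberMonoid (f₁ : X₁ → Y) (f₂ : X₂ → Y) (F₁ G₁ : Face X₁) (F₂ G₂ : Face X₂) (F G : Face Y) :
    AddSubmonoid (FaceMonoid F₁ G₁ × FaceMonoid F₂ G₂) where
  carrier := {x | ∀ H : Hypersurface Y, G.1 ⊆ H.1 → ¬ F.1 ⊆ H.1 →
    bPush f₁ F₁ G₁ x.1 H = bPush f₂ F₂ G₂ x.2 H}
  zero_mem' := by intro H _ _; simp
  add_mem' := by
    intro x y hx hy H hG hF
    simp [hx H hG hF, hy H hG hF]

/-- Smooth monoids: the finitely and freely generated ones. -/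
def IsSmoothMonoid (M : Type u) [AddCommMonoid M] : Prop :=
  ∃ n : ℕ, Nonempty (M ≃+ (Fin n → ℕ))

/-- The monoids of the basic monoidal complexes of all the `D(F₁, F₂)` are smooth.  These are the
fiber products `σ_{G₁} ×_{σ_G} σ_{G₂}`, with `σ_{Gᵢ}` in the basic monoidal complex of `Fᵢ`, for the
faces `G₁ × G₂` of `F₁ × F₂` whose relative interior meets `D(F₁, F₂)`. -/
def SmoothFiberMonoids (f₁ : X₁ → Y) (f₂ : X₂ → Y) : Prop :=
  ∀ (F₁ G₁ : Face X₁) (F₂ G₂ : Face X₂) (F G : Face Y), G₁.1 ⊆ F₁.1 → G₂.1 ⊆ F₂.1 →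
    IsFaceImage f₁ F₁ F → IsFaceImage f₂ F₂ F → IsFaceImage f₁ G₁ G → IsFaceImage f₂ G₂ G →
    (fiberD f₁ f₂ F₁ F₂ ∩ G₁.int ×ˢ G₂.int).Nonempty →
    IsSmoothMonoid (fiberMonoid f₁ f₂ F₁ G₁ F₂ G₂ F G)

/-- For `p ∈ D = D(F₁, F₂)`: the smallest boundary face of `D` containing `p`.  It is the closure of
the connected component of `p` in the intersection of `D` with the relative interior of the
smallest boundary face of `X₁ × X₂` containing `p`. -/
def fiberFaceOf (f₁ : X₁ → Y) (f₂ : X₂ → Y) (F₁ : Face X₁) (F₂ : Face X₂) (p : X₁ × X₂) :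
    Set (X₁ × X₂) :=
  closure (connectedComponentIn
    {q | q ∈ fiberD f₁ f₂ F₁ F₂ ∧ faceOf q.1 = faceOf p.1 ∧ faceOf q.2 = faceOf p.2} p)

/-- The b-tangent space `ᵇT_p D` of `D = D(F₁, F₂)`, as a subset of the b-tangent space of
`F₁ × F₂` in the frames given by coordinates `x` of `X₁` and `y` of `X₂`.  A b-tangent vector
of `F₁ × F₂` has no components along the coordinates which vanish on `F₁ × F₂`, and `ᵇT_p D` is
the annihilator of the logarithmic differentials
`∑ᵢ γᵢ dxᵢ/xᵢ + ∑ⱼ δⱼ dyⱼ/yⱼ + da/a` of all functions `a x^γ y^δ` (with `a` smooth and positive,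
`γ` and `δ` integral) which are identically `1` on the interior of `D` near `p`. -/
def fiberBTangent (f₁ : X₁ → Y) (f₂ : X₂ → Y) (F₁ : Face X₁) (F₂ : Face X₂)
    (e₁ : CornerChart X₁) (e₂ : CornerChart X₂) (p : X₁ × X₂) :
    Set ((Fin e₁.1 → ℝ) × (Fin e₂.1 → ℝ)) :=
  {v | (∀ i, (∀ᶠ q in 𝓝[fiberInt f₁ f₂ F₁ F₂] p, e₁.coord q.1 i = 0) → v.1 i = 0) ∧
    (∀ j, (∀ᶠ q in 𝓝[fiberInt f₁ f₂ F₁ F₂] p, e₂.coord q.2 j = 0) → v.2 j = 0) ∧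
    ∀ (γ : Fin e₁.1 → ℤ) (δ : Fin e₂.1 → ℤ)
      (a : EuclideanSpace ℝ (Fin e₁.1) × EuclideanSpace ℝ (Fin e₂.1) → ℝ),
      ∀ U ∈ 𝓝 (e₁.coord p.1, e₂.coord p.2),
      ContDiffOn ℝ ∞ a ((quadrant e₁.1 ×ˢ quadrant e₂.1) ∩ U) →
      (∀ x ∈ (quadrant e₁.1 ×ˢ quadrant e₂.1) ∩ U, 0 < a x) →
      (∀ᶠ q in 𝓝[fiberInt f₁ f₂ F₁ F₂] p, a (e₁.coord q.1, e₂.coord q.2) *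
        (∏ i, e₁.coord q.1 i ^ γ i) * (∏ j, e₂.coord q.2 j ^ δ j) = 1) →
      ∑ i, (γ i : ℝ) * v.1 i + ∑ j, (δ j : ℝ) * v.2 j +
        fderivWithin ℝ a (quadrant e₁.1 ×ˢ quadrant e₂.1) (e₁.coord p.1, e₂.coord p.2)
          (WithLp.toLp 2 fun i => e₁.coord p.1 i * v.1 i,
            WithLp.toLp 2 fun j => e₂.coord p.2 j * v.2 j) /
          a (e₁.coord p.1, e₂.coord p.2) = 0}

/-- `(h₁, h₂) : W → D(F₁, F₂)` is the universal resolution `[D; 𝒫_D]` of `D = D(F₁, F₂)`: the proper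
resolution of `D` which realizes the trivial refinement of the basic monoidal complex of `D`. -/
structure IsUniversalResolution (f₁ : X₁ → Y) (f₂ : X₂ → Y) (F₁ : Face X₁) (F₂ : Face X₂)
    {W : Type u} [TopologicalSpace W] [CornerAtlas W] (h₁ : W → X₁) (h₂ : W → X₂) : Prop where
  /-- `(h₁, h₂)` is an interior b-map into `F₁ × F₂`. -/
  bMap₁ : IsBMap h₁
  bMap₂ : IsBMap h₂
  interior : ∀ w ∈ mInterior W, h₁ w ∈ F₁.int ∧ h₂ w ∈ F₂.int
  /-- It takes values in `D`. -/
  mem : ∀ w, (h₁ w, h₂ w) ∈ fiberD f₁ f₂ F₁ F₂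
  proper : IsProperMap fun w => (h₁ w, h₂ w)
  /-- It is a bijection of the interiors (a diffeomorphism, by the next condition). -/
  bijOn_interior : BijOn (fun w => (h₁ w, h₂ w)) (mInterior W) (fiberInt f₁ f₂ F₁ F₂)
  /-- The b-differential is a bijection from the b-tangent space of `W` onto that of `D`. -/
  bijOn_bTangent : ∀ w, ∀ e ∈ CornerAtlas.charts (X := W),
    ∀ e₁ ∈ CornerAtlas.charts (X := X₁), ∀ e₂ ∈ CornerAtlas.charts (X := X₂),
    w ∈ e.source → h₁ w ∈ e₁.source → h₂ w ∈ e₂.source →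
      BijOn (fun v => ((bDiff h₁ e e₁ w).mulVec v, (bDiff h₂ e e₂ w).mulVec v)) univ
        (fiberBTangent f₁ f₂ F₁ F₂ e₁ e₂ (h₁ w, h₂ w))
  /-- It induces an isomorphism from the poset of boundary faces of `W` to that of `D`. -/
  face_le_iff : ∀ w w', faceOf w ⊆ faceOf w' ↔
    fiberFaceOf f₁ f₂ F₁ F₂ (h₁ w, h₂ w) ⊆ fiberFaceOf f₁ f₂ F₁ F₂ (h₁ w', h₂ w')
  face_surj : ∀ p ∈ fiberD f₁ f₂ F₁ F₂, ∃ w,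
    fiberFaceOf f₁ f₂ F₁ F₂ (h₁ w, h₂ w) = fiberFaceOf f₁ f₂ F₁ F₂ p
  /-- It induces isomorphisms from the monoids of the faces of `W` to those of `D`.  (Here `C` is the
  face of codimension zero containing `w`, so the domain of `Φ` is freely generated by all the
  boundary hypersurfaces of `W` through `w`.) -/
  monoid_iso : ∀ (w : W) (C : Face W) (F : Face Y), C.int ⊆ mInterior W → w ∈ C.1 →
    IsFaceImage f₁ F₁ F →
    let Φ : FaceMonoid C (faceAt w) →
        ({K : Hypersurface X₁ // (faceAt (h₁ w)).1 ⊆ K.1 ∧ ¬ F₁.1 ⊆ K.1} → ℕ) ×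
        ({K : Hypersurface X₂ // (faceAt (h₂ w)).1 ⊆ K.1 ∧ ¬ F₂.1 ⊆ K.1} → ℕ) :=
      fun u => (fun K => bPush h₁ C (faceAt w) u K.1, fun K => bPush h₂ C (faceAt w) u K.1)
    Function.Injective Φ ∧ range Φ =
      (fun x : FaceMonoid F₁ (faceAt (h₁ w)) × FaceMonoid F₂ (faceAt (h₂ w)) => (⇑x.1, ⇑x.2)) ''
      (fiberMonoid f₁ f₂ F₁ (faceAt (h₁ w)) F₂ (faceAt (h₂ w)) F (faceAt (f₁ (h₁ w))) :
        Set (FaceMonoid F₁ (faceAt (h₁ w)) × FaceMonoid F₂ (faceAt (h₂ w))))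

/-- `P` with `π₁`, `π₂` is the universal fiber product of `f₁` and `f₂` in manifolds with corners:
the `πᵢ` are b-maps with `f₁ ∘ π₁ = f₂ ∘ π₂`, and any b-maps `gᵢ : Z → Xᵢ` with `f₁ ∘ g₁ = f₂ ∘ g₂`
are of the form `gᵢ = πᵢ ∘ g` for a unique interior b-map `g : Z → P`. -/
def IsUniversalFiberProduct (f₁ : X₁ → Y) (f₂ : X₂ → Y) {P : Type u} [TopologicalSpace P]
    [CornerAtlas P] (π₁ : P → X₁) (π₂ : P → X₂) : Prop :=
  IsBMap π₁ ∧ IsBMap π₂ ∧ f₁ ∘ π₁ = f₂ ∘ π₂ ∧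
  ∀ (Z : Type u) [TopologicalSpace Z] [CornerAtlas Z] [IsManifoldWithCorners Z]
    (g₁ : Z → X₁) (g₂ : Z → X₂), IsBMap g₁ → IsBMap g₂ → f₁ ∘ g₁ = f₂ ∘ g₂ →
    ∃! g : Z → P, IsInteriorBMap g ∧ π₁ ∘ g = g₁ ∧ π₂ ∘ g = g₂

end FiberProducts

end

noncomputable section

/-! ## Germs of smooth functions on subsets of normed spaces -/

section SmoothGerm

variable {E F G : Type*} [NormedAddCommGroup E] [NormedSpace ℝ E] [NormedAddCommGroup F]
  [NormedSpace ℝ F] [NormedAddCommGroup G] [NormedSpace ℝ G]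

/-- `u` is smooth as a function on `Q` at all points of `Q` near `x₀`. -/
def SmoothGerm (Q : Set E) (x₀ : E) (u : E → F) : Prop :=
  ∀ᶠ x in 𝓝[Q] x₀, ContDiffWithinAt ℝ ∞ u Q x

namespace SmoothGerm

variable {Q : Set E} {x₀ : E} {u v : E → F}

theorem congr (hu : SmoothGerm Q x₀ u) (h : v =ᶠ[𝓝[Q] x₀] u) : SmoothGerm Q x₀ v := by
  have h' := eventually_eventually_nhdsWithin.2 h
  filter_upwards [hu, h', h] with x hx hx' hx''
  exact hx.congr_of_eventuallyEq hx' hx''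

theorem self_of_mem (hu : SmoothGerm Q x₀ u) (h : x₀ ∈ Q) : ContDiffWithinAt ℝ ∞ u Q x₀ :=
  hu.self_of_nhdsWithin h

theorem continuousWithinAt (hu : SmoothGerm Q x₀ u) (h : x₀ ∈ Q) : ContinuousWithinAt u Q x₀ :=
  (hu.self_of_mem h).continuousWithinAt

theorem eventually (hu : SmoothGerm Q x₀ u) : ∀ᶠ x in 𝓝[Q] x₀, SmoothGerm Q x u :=
  eventually_eventually_nhdsWithin.2 hu

theorem comp {Q' : Set F} {g : F → G} {f : E → F} (hg : SmoothGerm Q' (f x₀) g)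
    (hf : SmoothGerm Q x₀ f) (hm : Tendsto f (𝓝[Q] x₀) (𝓝[Q'] (f x₀))) :
    SmoothGerm Q x₀ (fun x => g (f x)) := by
  have h1 := hm.eventually hg
  have h2 : ∀ᶠ x in 𝓝[Q] x₀, f x ∈ Q' := hm.eventually self_mem_nhdsWithin
  have h3 := eventually_eventually_nhdsWithin.2 h2
  filter_upwards [hf, h1, h3] with x hx hgx hx3
  exact hgx.comp_of_preimage_mem_nhdsWithin x hx hx3

theorem comp_contDiffAt {g : F → G} {f : E → F} (hx₀ : x₀ ∈ Q)
    (hg : ∀ᶠ y in 𝓝 (f x₀), ContDiffAt ℝ ∞ g y)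
    (hf : SmoothGerm Q x₀ f) : SmoothGerm Q x₀ (fun x => g (f x)) := by
  have hc := (hf.continuousWithinAt hx₀).tendsto
  filter_upwards [hf, hc.eventually hg] with x hx hgx
  exact hgx.comp_contDiffWithinAt x hx

theorem comp_contDiff {g : F → G} {f : E → F} (hg : ContDiff ℝ ∞ g)
    (hf : SmoothGerm Q x₀ f) : SmoothGerm Q x₀ (fun x => g (f x)) := by
  filter_upwards [hf] with x hx
  exact hg.contDiffAt.comp_contDiffWithinAt x hx

theorem of_contDiff (hu : ContDiff ℝ ∞ u) : SmoothGerm Q x₀ u :=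
  Eventually.of_forall fun _ => hu.contDiffAt.contDiffWithinAt

theorem const (c : F) : SmoothGerm Q x₀ (fun _ => c) := of_contDiff contDiff_const

theorem add (hu : SmoothGerm Q x₀ u) (hv : SmoothGerm Q x₀ v) :
    SmoothGerm Q x₀ (fun x => u x + v x) := by
  filter_upwards [hu, hv] with x hx hx' using hx.add hx'

theorem sub (hu : SmoothGerm Q x₀ u) (hv : SmoothGerm Q x₀ v) :
    SmoothGerm Q x₀ (fun x => u x - v x) := by
  filter_upwards [hu, hv] with x hx hx' using hx.sub hx'

theorem neg (hu : SmoothGerm Q x₀ u) : SmoothGerm Q x₀ (fun x => - u x) := by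
  filter_upwards [hu] with x hx using hx.neg

theorem mul {u v : E → ℝ} (hu : SmoothGerm Q x₀ u) (hv : SmoothGerm Q x₀ v) :
    SmoothGerm Q x₀ (fun x => u x * v x) := by
  filter_upwards [hu, hv] with x hx hx' using hx.mul hx'

theorem pow {u : E → ℝ} (hu : SmoothGerm Q x₀ u) (n : ℕ) :
    SmoothGerm Q x₀ (fun x => u x ^ n) := by
  filter_upwards [hu] with x hx using hx.pow n

theorem prod {ι : Type*} (s : Finset ι) {u : ι → E → ℝ} (hu : ∀ i ∈ s, SmoothGerm Q x₀ (u i)) :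
    SmoothGerm Q x₀ (fun x => ∏ i ∈ s, u i x) := by
  have := (eventually_all_finset s).2 hu
  filter_upwards [this] with x hx using contDiffWithinAt_prod hx

theorem pi {ι : Type*} [Fintype ι] {u : E → ι → ℝ} (hu : ∀ i, SmoothGerm Q x₀ (fun x => u x i)) :
    SmoothGerm Q x₀ u := by
  filter_upwards [eventually_all.2 hu] with x hx using contDiffWithinAt_pi.2 hx

theorem euclidean {ι : Type*} [Fintype ι] {u : E → EuclideanSpace ℝ ι}
    (hu : ∀ i, SmoothGerm Q x₀ (fun x => u x i)) : SmoothGerm Q x₀ u := by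
  filter_upwards [eventually_all.2 hu] with x hx using contDiffWithinAt_euclidean.2 hx

theorem prodMk {v : E → G} (hu : SmoothGerm Q x₀ u) (hv : SmoothGerm Q x₀ v) :
    SmoothGerm Q x₀ (fun x => (u x, v x)) := by
  filter_upwards [hu, hv] with x hx hx' using hx.prodMk hx'

theorem inv {u : E → ℝ} (hx₀ : x₀ ∈ Q) (hu : SmoothGerm Q x₀ u) (h : u x₀ ≠ 0) :
    SmoothGerm Q x₀ (fun x => (u x)⁻¹) := by
  refine comp_contDiffAt (g := fun y : ℝ => y⁻¹) hx₀ ?_ hu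
  filter_upwards [isOpen_ne.mem_nhds h] with y hy using contDiffAt_inv ℝ hy

theorem log {u : E → ℝ} (hx₀ : x₀ ∈ Q) (hu : SmoothGerm Q x₀ u) (h : u x₀ ≠ 0) :
    SmoothGerm Q x₀ (fun x => Real.log (u x)) := by
  refine comp_contDiffAt (g := Real.log) hx₀ ?_ hu
  filter_upwards [isOpen_ne.mem_nhds h] with y hy using Real.contDiffAt_log.2 hy

theorem rpow_const {u : E → ℝ} (hx₀ : x₀ ∈ Q) (hu : SmoothGerm Q x₀ u) (h : u x₀ ≠ 0) (r : ℝ) :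
    SmoothGerm Q x₀ (fun x => u x ^ r) := by
  refine comp_contDiffAt (g := fun y : ℝ => y ^ r) hx₀ ?_ hu
  filter_upwards [isOpen_ne.mem_nhds h] with y hy using Real.contDiffAt_rpow_const_of_ne hy

theorem zpow {u : E → ℝ} (hx₀ : x₀ ∈ Q) (hu : SmoothGerm Q x₀ u) (h : u x₀ ≠ 0) (r : ℤ) :
    SmoothGerm Q x₀ (fun x => u x ^ r) := by
  cases r with
  | ofNat n => simpa using hu.pow n
  | negSucc n =>
    simp only [zpow_negSucc]
    exact (hu.pow _).inv hx₀ (pow_ne_zero _ h)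

theorem exp {u : E → ℝ} (hu : SmoothGerm Q x₀ u) : SmoothGerm Q x₀ (fun x => Real.exp (u x)) :=
  comp_contDiff Real.contDiff_exp hu

theorem contDiffOn (hu : SmoothGerm Q x₀ u) :
    ∃ U, IsOpen U ∧ x₀ ∈ U ∧ ContDiffOn ℝ ∞ u (Q ∩ U) := by
  obtain ⟨U, hU, hxU, h⟩ := mem_nhdsWithin.1 hu
  exact ⟨U, hU, hxU, fun x hx =>
    (show ContDiffWithinAt ℝ ∞ u Q x from h ⟨hx.2, hx.1⟩).mono inter_subset_left⟩

theorem of_contDiffOn {U : Set E} (hU : U ∈ 𝓝 x₀) (h : ContDiffOn ℝ ∞ u (Q ∩ U)) :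
    SmoothGerm Q x₀ u := by
  have h1 := eventually_eventually_nhds.2 hU
  filter_upwards [mem_nhdsWithin_of_mem_nhds h1, self_mem_nhdsWithin] with x hx hxQ
  have hxU : U ∈ 𝓝 x := hx
  exact (h x ⟨hxQ, mem_of_mem_nhds hxU⟩).mono_of_mem_nhdsWithin
    (inter_mem self_mem_nhdsWithin (mem_nhdsWithin_of_mem_nhds hxU))

end SmoothGerm

end SmoothGerm

/-! ## Quadrants -/

section Quadrant

variable {n : ℕ} {x₀ : EuclideanSpace ℝ (Fin n)}

theorem quadrant_convex (n : ℕ) : Convex ℝ (quadrant n) := EuclideanQuadrant.convex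

theorem isOpen_openQuadrant (n : ℕ) : IsOpen (openQuadrant n) := by
  have : openQuadrant n = ⋂ i, {x : EuclideanSpace ℝ (Fin n) | 0 < x i} := by
    ext; simp [openQuadrant]
  rw [this]
  exact isOpen_iInter_of_finite fun i => isOpen_lt continuous_const (by fun_prop)

theorem isClosed_quadrant (n : ℕ) : IsClosed (quadrant n) := by
  have : quadrant n = ⋂ i, {x : EuclideanSpace ℝ (Fin n) | 0 ≤ x i} := by
    ext; simp [quadrant]
  rw [this]
  exact isClosed_iInter fun i => isClosed_le continuous_const (by fun_prop)

theorem openQuadrant_subset (n : ℕ) : openQuadrant n ⊆ quadrant n := fun _ hx i => (hx i).le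

theorem interior_quadrant (n : ℕ) : interior (quadrant n) = openQuadrant n :=
  interior_euclideanQuadrant n 2 0

theorem quadrant_subset_closure (n : ℕ) : quadrant n ⊆ closure (openQuadrant n) := by
  intro x hx
  refine mem_closure_of_tendsto (b := 𝓝[>] (0 : ℝ))
    (f := fun t : ℝ => x + t • WithLp.toLp 2 (fun _ => (1 : ℝ))) ?_ ?_
  · have : Continuous fun t : ℝ => x + t • WithLp.toLp 2 (fun _ : Fin n => (1 : ℝ)) := by fun_prop
    have h := (this.tendsto 0).mono_left (nhdsWithin_le_nhds (s := Ioi (0 : ℝ)))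
    simpa using h
  · filter_upwards [self_mem_nhdsWithin] with t ht i
    have := hx i
    simp only [PiLp.add_apply, PiLp.smul_apply, smul_eq_mul, mul_one]
    exact add_pos_of_nonneg_of_pos this ht

theorem nhdsWithin_openQuadrant_neBot (h : x₀ ∈ quadrant n) : (𝓝[openQuadrant n] x₀).NeBot :=
  mem_closure_iff_nhdsWithin_neBot.1 (quadrant_subset_closure n h)

theorem uniqueDiffOn_quadrant (n : ℕ) : UniqueDiffOn ℝ (quadrant n) := by
  refine uniqueDiffOn_convex (quadrant_convex n) ?_
  rw [interior_quadrant]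
  exact ⟨WithLp.toLp 2 fun _ => 1, fun i => by simp⟩

theorem quadrant_mem_nhds {x : EuclideanSpace ℝ (Fin n)} (hx : x ∈ openQuadrant n) :
    quadrant n ∈ 𝓝 x :=
  mem_of_superset ((isOpen_openQuadrant n).mem_nhds hx) (openQuadrant_subset n)

theorem smoothGerm_coord {Q : Set (EuclideanSpace ℝ (Fin n))} (i : Fin n) :
    SmoothGerm Q x₀ (fun x => x i) :=
  SmoothGerm.of_contDiff (contDiff_piLp_apply 2)

theorem eventually_pos_coord {Q : Set (EuclideanSpace ℝ (Fin n))} {i : Fin n} (h : 0 < x₀ i) :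
    ∀ᶠ x in 𝓝[Q] x₀, 0 < x i := by
  apply mem_nhdsWithin_of_mem_nhds
  exact (isOpen_lt continuous_const (by fun_prop : Continuous fun x : EuclideanSpace ℝ (Fin n) =>
    x i)).mem_nhds h

/-- Two continuous functions on a quadrant which agree on its interior agree. -/
theorem eventuallyEq_of_openQuadrant {T : Type*} [TopologicalSpace T] [T2Space T]
    {u v : EuclideanSpace ℝ (Fin n) → T}
    (hu : ∀ᶠ x in 𝓝[quadrant n] x₀, ContinuousWithinAt u (quadrant n) x)
    (hv : ∀ᶠ x in 𝓝[quadrant n] x₀, ContinuousWithinAt v (quadrant n) x)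
    (h : ∀ᶠ x in 𝓝[openQuadrant n] x₀, u x = v x) :
    u =ᶠ[𝓝[quadrant n] x₀] v := by
  rw [eventually_nhdsWithin_iff] at h
  have h' := (eventually_eventually_nhds.2 h).filter_mono (nhdsWithin_le_nhds (s := quadrant n))
  filter_upwards [hu, hv, h', self_mem_nhdsWithin] with x hx hx' hx'' hxQ
  have := nhdsWithin_openQuadrant_neBot hxQ
  have h1 := hx.tendsto.mono_left (nhdsWithin_mono x (openQuadrant_subset n))
  have h2 := hx'.tendsto.mono_left (nhdsWithin_mono x (openQuadrant_subset n))
  refine tendsto_nhds_unique_of_eventuallyEq h1 h2 ?_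
  exact eventually_nhdsWithin_iff.2 hx''

end Quadrant

/-! ## Germs of monomial functions -/

section MonoGerm

variable {n m : ℕ}

/-- Near `x₀`, the function `u` is the product of a positive smooth function with the monomial of
exponent `α`. -/
def MonoGerm (x₀ : EuclideanSpace ℝ (Fin n)) (u : EuclideanSpace ℝ (Fin n) → ℝ)
    (α : Fin n → ℕ) : Prop :=
  ∃ a, SmoothGerm (quadrant n) x₀ a ∧
    ∀ᶠ x in 𝓝[quadrant n] x₀, 0 < a x ∧ u x = a x * ∏ i, x i ^ α i

namespace MonoGerm

variable {x₀ : EuclideanSpace ℝ (Fin n)} {u v : EuclideanSpace ℝ (Fin n) → ℝ} {α β : Fin n → ℕ}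

theorem smoothGerm (h : MonoGerm x₀ u α) : SmoothGerm (quadrant n) x₀ u := by
  obtain ⟨a, ha, hu⟩ := h
  refine (ha.mul (SmoothGerm.prod Finset.univ fun i _ => (smoothGerm_coord i).pow (α i))).congr ?_
  filter_upwards [hu] with x hx using hx.2

theorem congr (h : MonoGerm x₀ u α) (hv : v =ᶠ[𝓝[quadrant n] x₀] u) : MonoGerm x₀ v α := by
  obtain ⟨a, ha, hu⟩ := h
  refine ⟨a, ha, ?_⟩
  filter_upwards [hu, hv] with x hx hx' using ⟨hx.1, hx'.trans hx.2⟩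

theorem eventually (h : MonoGerm x₀ u α) : ∀ᶠ x in 𝓝[quadrant n] x₀, MonoGerm x u α := by
  obtain ⟨a, ha, hu⟩ := h
  filter_upwards [ha.eventually, eventually_eventually_nhdsWithin.2 hu] with x hx hx'
  exact ⟨a, hx, hx'⟩

theorem nonneg (h : MonoGerm x₀ u α) : ∀ᶠ x in 𝓝[quadrant n] x₀, 0 ≤ u x := by
  obtain ⟨a, -, hu⟩ := h
  filter_upwards [hu, self_mem_nhdsWithin] with x hx hxQ
  rw [hx.2]
  exact mul_nonneg hx.1.le (Finset.prod_nonneg fun i _ => pow_nonneg (hxQ i) _)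

theorem eq_zero_iff (h : MonoGerm x₀ u α) :
    ∀ᶠ x in 𝓝[quadrant n] x₀, u x = 0 ↔ ∃ i, x i = 0 ∧ α i ≠ 0 := by
  obtain ⟨a, -, hu⟩ := h
  filter_upwards [hu] with x hx
  rw [hx.2, mul_eq_zero, or_iff_right hx.1.ne', Finset.prod_eq_zero_iff]
  simp [pow_eq_zero_iff']

theorem pos (h : MonoGerm x₀ u α) : ∀ᶠ x in 𝓝[quadrant n] x₀, x ∈ openQuadrant n → 0 < u x := by
  filter_upwards [h.nonneg, h.eq_zero_iff] with x hx hx' hxQ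
  refine lt_of_le_of_ne hx fun h0 => ?_
  obtain ⟨i, hi, -⟩ := hx'.1 h0.symm
  exact (hxQ i).ne' hi

theorem mul (hu : MonoGerm x₀ u α) (hv : MonoGerm x₀ v β) :
    MonoGerm x₀ (fun x => u x * v x) (α + β) := by
  obtain ⟨a, ha, hu⟩ := hu
  obtain ⟨b, hb, hv⟩ := hv
  refine ⟨_, ha.mul hb, ?_⟩
  filter_upwards [hu, hv] with x hx hx'
  refine ⟨mul_pos hx.1 hx'.1, ?_⟩
  rw [hx.2, hx'.2]
  simp only [Pi.add_apply, pow_add, Finset.prod_mul_distrib]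
  ring

theorem one : MonoGerm x₀ (fun _ => 1) 0 :=
  ⟨fun _ => 1, SmoothGerm.const 1, Eventually.of_forall fun x => by simp⟩

theorem pow (hu : MonoGerm x₀ u α) (k : ℕ) : MonoGerm x₀ (fun x => u x ^ k) (k • α) := by
  induction k with
  | zero => simpa using one
  | succ k ih => simpa [pow_succ, add_smul] using ih.mul hu

theorem prod {ι : Type*} (s : Finset ι) {u : ι → EuclideanSpace ℝ (Fin n) → ℝ}
    {α : ι → Fin n → ℕ} (h : ∀ i ∈ s, MonoGerm x₀ (u i) (α i)) :
    MonoGerm x₀ (fun x => ∏ i ∈ s, u i x) (∑ i ∈ s, α i) := by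
  classical
  induction s using Finset.induction_on with
  | empty => simpa using one
  | insert i s hi ih =>
    simp only [Finset.prod_insert hi, Finset.sum_insert hi]
    exact (h i (by simp)).mul (ih fun j hj => h j (by simp [hj]))

theorem of_smoothGerm_pos (hx₀ : x₀ ∈ quadrant n) (hu : SmoothGerm (quadrant n) x₀ u)
    (h : 0 < u x₀) : MonoGerm x₀ u 0 := by
  refine ⟨u, hu, ?_⟩
  have := (hu.continuousWithinAt hx₀).tendsto.eventually (lt_mem_nhds h)
  filter_upwards [this] with x hx
  simpa using hx

/-- The exponents of the coordinates which do not vanish may be dropped. -/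
theorem normalize (hx₀ : x₀ ∈ quadrant n) (hu : MonoGerm x₀ u α)
    (h : ∀ i, x₀ i = 0 → α i = β i) : MonoGerm x₀ u β := by
  obtain ⟨a, ha, hu⟩ := hu
  have hpos : ∀ i, x₀ i ≠ 0 → 0 < x₀ i := fun i hi => lt_of_le_of_ne (hx₀ i) (Ne.symm hi)
  classical
  refine ⟨fun x => a x * ∏ i, if x₀ i = 0 then 1 else x i ^ ((α i : ℤ) - β i), ha.mul ?_, ?_⟩
  · refine SmoothGerm.prod _ fun i _ => ?_
    by_cases hi : x₀ i = 0
    · simpa [hi] using SmoothGerm.const (1 : ℝ)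
    · simp only [hi, if_false]
      exact (smoothGerm_coord i).zpow hx₀ hi _
  · have hev : ∀ᶠ x in 𝓝[quadrant n] x₀, ∀ i, x₀ i ≠ 0 → 0 < x i := by
      rw [eventually_all]
      intro i
      by_cases hi : x₀ i = 0
      · simp [hi]
      · filter_upwards [eventually_pos_coord (hpos i hi)] with x hx _ using hx
    filter_upwards [hu, hev] with x hx hx'
    refine ⟨mul_pos hx.1 (Finset.prod_pos fun i _ => ?_), ?_⟩
    · split_ifs with hi
      · exact one_pos
      · exact zpow_pos (hx' i hi) _
    · rw [hx.2, mul_assoc, ← Finset.prod_mul_distrib]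
      congr 1
      refine Finset.prod_congr rfl fun i _ => ?_
      split_ifs with hi
      · rw [h i hi, one_mul]
      · have := (hx' i hi).ne'
        rw [← zpow_natCast (x i) (β i), ← zpow_add₀ this]
        simp

theorem exponent_eq_zero (hx₀ : x₀ ∈ quadrant n) (hu : MonoGerm x₀ u α) (h : u x₀ ≠ 0) {i : Fin n}
    (hi : x₀ i = 0) : α i = 0 := by
  by_contra h'
  exact h ((hu.eq_zero_iff.self_of_nhdsWithin hx₀).2 ⟨i, hi, h'⟩)

end MonoGerm

/-- A map with monomial components maps quadrants to quadrants. -/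
theorem tendsto_quadrant_of_monoGerm {x₀ : EuclideanSpace ℝ (Fin n)} (hx₀ : x₀ ∈ quadrant n)
    {φ : EuclideanSpace ℝ (Fin n) → EuclideanSpace ℝ (Fin m)} {A : Fin m → Fin n → ℕ}
    (hφ : ∀ j, MonoGerm x₀ (fun x => φ x j) (A j)) :
    Tendsto φ (𝓝[quadrant n] x₀) (𝓝[quadrant m] (φ x₀)) := by
  refine tendsto_nhdsWithin_iff.2 ⟨?_, ?_⟩
  · exact (SmoothGerm.euclidean fun j => (hφ j).smoothGerm).continuousWithinAt hx₀
  · filter_upwards [eventually_all.2 fun j => (hφ j).nonneg] with x hx j using hx j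

theorem tendsto_openQuadrant_of_monoGerm {x₀ : EuclideanSpace ℝ (Fin n)} (hx₀ : x₀ ∈ quadrant n)
    {φ : EuclideanSpace ℝ (Fin n) → EuclideanSpace ℝ (Fin m)} {A : Fin m → Fin n → ℕ}
    (hφ : ∀ j, MonoGerm x₀ (fun x => φ x j) (A j)) :
    Tendsto φ (𝓝[openQuadrant n] x₀) (𝓝[openQuadrant m] (φ x₀)) := by
  have hle := nhdsWithin_mono x₀ (openQuadrant_subset n)
  refine tendsto_nhdsWithin_iff.2 ⟨?_, ?_⟩
  · exact ((SmoothGerm.euclidean fun j => (hφ j).smoothGerm).continuousWithinAt hx₀).mono_left hle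
  · filter_upwards [hle (eventually_all.2 fun j => (hφ j).pos), self_mem_nhdsWithin]
      with x hx hxQ j using hx j hxQ

theorem MonoGerm.comp_of_tendsto {x₀ : EuclideanSpace ℝ (Fin n)} (hx₀ : x₀ ∈ quadrant n)
    {φ : EuclideanSpace ℝ (Fin n) → EuclideanSpace ℝ (Fin m)} {A : Fin m → Fin n → ℕ}
    (hφs : SmoothGerm (quadrant n) x₀ φ)
    (ht : Tendsto φ (𝓝[quadrant n] x₀) (𝓝[quadrant m] (φ x₀)))
    {u : EuclideanSpace ℝ (Fin m) → ℝ} {β : Fin m → ℕ}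
    (hφ : ∀ j, β j ≠ 0 → MonoGerm x₀ (fun x => φ x j) (A j)) (hu : MonoGerm (φ x₀) u β) :
    MonoGerm x₀ (fun x => u (φ x)) (∑ j, β j • A j) := by
  obtain ⟨b, hb, hu⟩ := hu
  have hmem := ht.eventually self_mem_nhdsWithin
  have hb' : MonoGerm x₀ (fun x => b (φ x)) 0 :=
    .of_smoothGerm_pos hx₀ (hb.comp hφs ht)
      (hu.self_of_nhdsWithin (hmem.self_of_nhdsWithin hx₀)).1
  have hpow : ∀ j ∈ Finset.univ, MonoGerm x₀ (fun x => φ x j ^ β j) (β j • A j) := by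
    intro j _
    by_cases hj : β j = 0
    · simpa [hj] using one
    · exact (hφ j hj).pow (β j)
  have := hb'.mul (MonoGerm.prod Finset.univ hpow)
  rw [zero_add] at this
  refine this.congr ?_
  filter_upwards [ht.eventually hu] with x hx using hx.2

theorem MonoGerm.comp {x₀ : EuclideanSpace ℝ (Fin n)} (hx₀ : x₀ ∈ quadrant n)
    {φ : EuclideanSpace ℝ (Fin n) → EuclideanSpace ℝ (Fin m)} {A : Fin m → Fin n → ℕ}
    (hφ : ∀ j, MonoGerm x₀ (fun x => φ x j) (A j)) {u : EuclideanSpace ℝ (Fin m) → ℝ}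
    {β : Fin m → ℕ} (hu : MonoGerm (φ x₀) u β) :
    MonoGerm x₀ (fun x => u (φ x)) (∑ j, β j • A j) :=
  hu.comp_of_tendsto hx₀ (SmoothGerm.euclidean fun j => (hφ j).smoothGerm)
    (tendsto_quadrant_of_monoGerm hx₀ hφ) fun j _ => hφ j

end MonoGerm

end

noncomputable section

/-! ## An implicit function theorem with parameters in a quadrant -/

section ImplicitFunction

/-- The quadrant `[0, ∞)^κ`. -/
def piQuadrant (κ : Type) : Set (κ → ℝ) := {t | ∀ i, 0 ≤ t i}

theorem convex_piQuadrant {κ : Type} : Convex ℝ (piQuadrant κ) := by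
  intro x hx y hy a b ha hb _ i
  have := hx i
  have := hy i
  simp only [Pi.add_apply, Pi.smul_apply, smul_eq_mul]
  positivity

variable {κ : Type} [Fintype κ] {E E' : Type} [NormedAddCommGroup E] [NormedSpace ℝ E]
  [NormedAddCommGroup E'] [NormedSpace ℝ E']

theorem interior_piQuadrant_nonempty : (interior (piQuadrant κ)).Nonempty := by
  refine ⟨fun _ => 1, mem_interior.2 ⟨{t | ∀ i, 0 < t i}, fun t ht i => (ht i).le, ?_, by simp⟩⟩
  have : {t : κ → ℝ | ∀ i, 0 < t i} = ⋂ i, {t : κ → ℝ | 0 < t i} := by ext; simp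
  rw [this]
  exact isOpen_iInter_of_finite fun i => isOpen_lt continuous_const (by fun_prop)

theorem uniqueDiffOn_piQuadrant_prod : UniqueDiffOn ℝ (piQuadrant κ ×ˢ (univ : Set E)) := by
  refine uniqueDiffOn_convex (convex_piQuadrant.prod convex_univ) ?_
  rw [interior_prod_eq, interior_univ]
  exact interior_piQuadrant_nonempty.prod univ_nonempty

theorem contDiffOn_of_local_right_inverse {V W : Type} [NormedAddCommGroup V] [NormedSpace ℝ V]
    [NormedAddCommGroup W] [NormedSpace ℝ W] [CompleteSpace V] {f : V → W} {f' : V → V →L[ℝ] W}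
    {g : W → V} {s : Set V} {t : Set W} (ht : UniqueDiffOn ℝ t)
    (hf : ∀ x ∈ s, HasFDerivWithinAt f (f' x) s x) (hf' : ContDiffOn ℝ ∞ f' s)
    (hinv : ∀ x ∈ s, (f' x).IsInvertible) (hg : ContinuousOn g t) (hm : MapsTo g t s)
    (hfg : ∀ y ∈ t, f (g y) = y) : ContDiffOn ℝ ∞ g t := by
  have hd : ∀ y ∈ t, HasFDerivWithinAt g (ContinuousLinearMap.inverse (f' (g y))) t y := by
    intro y hy
    obtain ⟨M, hM⟩ := hinv (g y) (hm hy)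
    have h1 := hf (g y) (hm hy)
    rw [← hM] at h1 ⊢
    rw [ContinuousLinearMap.inverse_equiv]
    refine h1.of_local_left_inverse ?_ hy ?_
    · exact tendsto_nhdsWithin_iff.2 ⟨hg y hy, eventually_nhdsWithin_of_forall hm⟩
    · exact eventually_nhdsWithin_of_forall hfg
  rw [contDiffOn_infty]
  intro n
  induction n with
  | zero => exact contDiffOn_zero.2 hg
  | succ n ih =>
    have h2 : ContDiffOn ℝ n (fun y => ContinuousLinearMap.inverse (f' (g y))) t := by
      intro y hy
      have h3 := (((contDiffOn_infty.1 hf') n).comp ih hm) y hy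
      exact (hinv (g y) (hm hy)).contDiffAt_map_inverse.comp_contDiffWithinAt y h3
    have := (contDiffOn_succ_iff_hasFDerivWithinAt_of_uniqueDiffOn (n := n) ht).2
      ⟨by simp, _, h2, hd⟩
    exact_mod_cast this

theorem exists_implicit_function [CompleteSpace E] [CompleteSpace E'] {Φ : (κ → ℝ) × E → E'}
    {e₀ : E} (hΦ : SmoothGerm (piQuadrant κ ×ˢ univ) (0, e₀) Φ) (A : E ≃L[ℝ] E')
    (hA : HasFDerivAt (fun e => Φ (0, e)) (A : E →L[ℝ] E') e₀) :
    ∃ S : (κ → ℝ) × E' → E, SmoothGerm (piQuadrant κ ×ˢ univ) (0, Φ (0, e₀)) S ∧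
      S (0, Φ (0, e₀)) = e₀ ∧
      (∀ᶠ y in 𝓝[piQuadrant κ ×ˢ univ] (0, Φ (0, e₀)), Φ (y.1, S y) = y.2) ∧
      ∀ᶠ x in 𝓝[piQuadrant κ ×ˢ univ] (0, e₀), S (x.1, Φ x) = x.2 := by
  set Q : Set ((κ → ℝ) × E) := piQuadrant κ ×ˢ univ
  set Q' : Set ((κ → ℝ) × E') := piQuadrant κ ×ˢ univ
  have h0 : ((0 : κ → ℝ), e₀) ∈ Q := ⟨fun i => le_rfl, mem_univ _⟩
  have h0' : ((0 : κ → ℝ), Φ (0, e₀)) ∈ Q' := ⟨fun i => le_rfl, mem_univ _⟩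
  obtain ⟨U, hU, hxU, hcd⟩ := hΦ.contDiffOn
  -- square the parameters
  set sq : (κ → ℝ) × E → (κ → ℝ) × E := fun x => (fun i => x.1 i ^ 2, x.2) with hsq
  have hsq_mem : ∀ x, sq x ∈ Q := fun x => ⟨fun i => sq_nonneg _, mem_univ _⟩
  have hsq_smooth : ContDiff ℝ ∞ sq := by
    refine ContDiff.prodMk ?_ contDiff_snd
    refine contDiff_pi.2 fun i => ?_
    exact ((contDiff_apply ℝ ℝ i).comp contDiff_fst).pow 2
  have hsq0 : sq (0, e₀) = (0, e₀) := by
    simp [hsq]; rfl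
  have hsq_deriv : HasFDerivAt sq ((0 : (κ → ℝ) × E →L[ℝ] (κ → ℝ)).prod
      (ContinuousLinearMap.snd ℝ _ _)) (0, e₀) := by
    refine HasFDerivAt.prodMk ?_ hasFDerivAt_snd
    rw [hasFDerivAt_pi']
    intro i
    have h1 : HasFDerivAt (fun x : (κ → ℝ) × E => x.1 i)
        ((ContinuousLinearMap.proj i).comp (ContinuousLinearMap.fst ℝ (κ → ℝ) E)) (0, e₀) :=
      ((ContinuousLinearMap.proj i).comp (ContinuousLinearMap.fst ℝ (κ → ℝ) E)).hasFDerivAt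
    have := h1.pow 2
    simpa using this
  set Θ : (κ → ℝ) × E → (κ → ℝ) × E' := fun x => (x.1, Φ (sq x)) with hΘ
  have hΦsq : ContDiffAt ℝ ∞ (fun x => Φ (sq x)) (0, e₀) := by
    have h1 : ContDiffWithinAt ℝ ∞ Φ Q (sq (0, e₀)) := by
      rw [hsq0]; exact hΦ.self_of_mem h0
    have h2 := h1.comp_of_preimage_mem_nhdsWithin (0, e₀) (s := univ)
      hsq_smooth.contDiffAt.contDiffWithinAt
      (by simp [show sq ⁻¹' Q = univ from eq_univ_of_forall hsq_mem])
    exact contDiffWithinAt_univ.1 h2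
  have hΘ_smooth : ContDiffAt ℝ ∞ Θ (0, e₀) := contDiffAt_fst.prodMk hΦsq
  -- the derivative of `Φ`
  have hΦd : HasFDerivWithinAt Φ (fderivWithin ℝ Φ Q (0, e₀)) Q (0, e₀) :=
    ((hΦ.self_of_mem h0).differentiableWithinAt (by simp)).hasFDerivWithinAt
  have hA' : (fderivWithin ℝ Φ Q (0, e₀)).comp (ContinuousLinearMap.inr ℝ (κ → ℝ) E) = A := by
    have h1 : HasFDerivAt (fun e : E => ((0 : κ → ℝ), e)) (ContinuousLinearMap.inr ℝ (κ → ℝ) E) e₀ :=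
      hasFDerivAt_prodMk_right _ _
    have h2 := hΦd.comp_hasFDerivAt e₀ h1 (Eventually.of_forall fun e => ⟨fun i => le_rfl, mem_univ _⟩)
    exact h2.unique hA
  set B : ((κ → ℝ) × E) ≃L[ℝ] ((κ → ℝ) × E') := (ContinuousLinearEquiv.refl ℝ _).prodCongr A
  have hΘ_deriv : HasFDerivAt Θ (B : (κ → ℝ) × E →L[ℝ] (κ → ℝ) × E') (0, e₀) := by
    have h1 : HasFDerivAt (fun x => Φ (sq x)) _ (0, e₀) :=
      HasFDerivWithinAt.comp_hasFDerivAt (t := Q) (g := Φ) (f := sq)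
        (g' := fderivWithin ℝ Φ Q (0, e₀)) (0, e₀)
        (by rw [hsq0]; exact hΦd) hsq_deriv (Eventually.of_forall hsq_mem)
    have h2 : HasFDerivAt Θ _ (0, e₀) := hasFDerivAt_fst.prodMk h1
    refine h2.congr_fderiv (ContinuousLinearMap.ext fun v => ?_)
    have := congrArg (fun L => L v.2) hA'
    exact Prod.ext rfl this
  have hstrict : HasStrictFDerivAt Θ (B : (κ → ℝ) × E →L[ℝ] (κ → ℝ) × E') (0, e₀) :=
    hΘ_smooth.hasStrictFDerivAt' hΘ_deriv (by simp)
  set G := hstrict.toOpenPartialHomeomorph Θ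
  have hΘ0 : Θ (0, e₀) = (0, Φ (0, e₀)) := by simp only [hΘ, hsq0]
  have hGs : ((0 : κ → ℝ), e₀) ∈ G.source := hstrict.mem_toOpenPartialHomeomorph_source
  have hGt : ((0 : κ → ℝ), Φ (0, e₀)) ∈ G.target := by
    rw [← hΘ0]; exact hstrict.image_mem_toOpenPartialHomeomorph_target
  have hG0 : G.symm (0, Φ (0, e₀)) = (0, e₀) := by
    rw [← hΘ0]; exact G.left_inv hGs
  have hGright : ∀ y ∈ G.target, (G.symm y).1 = y.1 ∧ Φ (sq (G.symm y)) = y.2 := by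
    intro y hy
    have : Θ (G.symm y) = y := G.right_inv hy
    exact ⟨congrArg Prod.fst this, congrArg Prod.snd this⟩
  set rt : (κ → ℝ) × E' → (κ → ℝ) × E' := fun y => (fun i => √(y.1 i), y.2) with hrt
  have hrt_cont : Continuous rt := by
    refine Continuous.prodMk ?_ continuous_snd
    exact continuous_pi fun i => Real.continuous_sqrt.comp (by fun_prop)
  have hrt0 : rt (0, Φ (0, e₀)) = (0, Φ (0, e₀)) := by simp [hrt]; rfl
  set S : (κ → ℝ) × E' → E := fun y => (G.symm (rt y)).2 with hS
  have hS0 : S (0, Φ (0, e₀)) = e₀ := by simp only [hS, hrt0, hG0]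
  have hrtev : ∀ᶠ y in 𝓝 ((0 : κ → ℝ), Φ (0, e₀)), rt y ∈ G.target :=
    hrt_cont.continuousAt.eventually (by rw [hrt0]; exact G.open_target.mem_nhds hGt)
  have hScont : ∀ y, rt y ∈ G.target → ContinuousAt S y := by
    intro y hy
    exact (continuous_snd.continuousAt).comp
      ((G.symm.continuousAt hy).comp hrt_cont.continuousAt)
  have hSΦ : ∀ y ∈ Q', rt y ∈ G.target → Φ (y.1, S y) = y.2 := by
    intro y hyQ hy
    obtain ⟨h1, h2⟩ := hGright _ hy
    have : sq (G.symm (rt y)) = (y.1, S y) := by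
      refine Prod.ext ?_ rfl
      funext i
      change (G.symm (rt y)).1 i ^ 2 = y.1 i
      rw [h1]
      exact Real.sq_sqrt (hyQ.1 i)
    rw [← this, h2]
  -- the set where the partial derivative is invertible
  set Ξ : (κ → ℝ) × E → (κ → ℝ) × E' := fun x => (x.1, Φ x) with hΞ
  set Ξ' : (κ → ℝ) × E → ((κ → ℝ) × E →L[ℝ] (κ → ℝ) × E') := fun x =>
    (ContinuousLinearMap.fst ℝ _ _).prod (fderivWithin ℝ Φ (Q ∩ U) x) with hΞ'
  have hud : UniqueDiffOn ℝ (Q ∩ U) := uniqueDiffOn_piQuadrant_prod.inter hU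
  have hΞ'_smooth : ContDiffOn ℝ ∞ Ξ' (Q ∩ U) := by
    have h1 := hcd.fderivWithin hud (m := ∞) (by simp)
    have h2 : ContDiffOn ℝ ∞ (fun _ : (κ → ℝ) × E => ContinuousLinearMap.fst ℝ (κ → ℝ) E) (Q ∩ U) :=
      contDiffOn_const
    exact (ContinuousLinearMap.prodₗᵢ ℝ).contDiff.comp_contDiffOn (h2.prodMk h1)
  have hinv0 : (Ξ' (0, e₀)).IsInvertible := by
    have hfd : fderivWithin ℝ Φ (Q ∩ U) (0, e₀) = fderivWithin ℝ Φ Q (0, e₀) :=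
      fderivWithin_inter (hU.mem_nhds hxU)
    set C : (κ → ℝ) →L[ℝ] E' :=
      (fderivWithin ℝ Φ Q (0, e₀)).comp (ContinuousLinearMap.inl ℝ (κ → ℝ) E)
    have hsplit : ∀ v : (κ → ℝ) × E, fderivWithin ℝ Φ Q (0, e₀) v = C v.1 + A v.2 := by
      intro v
      have := congrArg (fun L => L v.2) hA'
      simp only [ContinuousLinearMap.comp_apply, ContinuousLinearMap.inr_apply,
        ContinuousLinearEquiv.coe_coe] at this
      rw [← this]
      simp only [C, ContinuousLinearMap.comp_apply, ContinuousLinearMap.inl_apply, ← map_add]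
      simp
    refine ⟨ContinuousLinearEquiv.equivOfInverse (Ξ' (0, e₀))
      ((ContinuousLinearMap.fst ℝ _ _).prod
        ((A.symm : E' →L[ℝ] E).comp
          (ContinuousLinearMap.snd ℝ _ _ - C.comp (ContinuousLinearMap.fst ℝ _ _)))) ?_ ?_, ?_⟩
    · intro v
      simp [hΞ', hfd, hsplit]
    · intro v
      simp [hΞ', hfd, hsplit]
    · ext <;> rfl
  have hopen : ∀ᶠ x in 𝓝[Q ∩ U] (0, e₀), (Ξ' x).IsInvertible := by
    have h1 := (hΞ'_smooth.continuousOn (0, e₀) ⟨h0, hxU⟩).tendsto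
    obtain ⟨M, hM⟩ := hinv0
    refine h1.eventually ?_
    rw [← hM]
    filter_upwards [ContinuousLinearEquiv.nhds M] with L hL
    exact hL
  obtain ⟨U', hU', hxU', hsub⟩ := mem_nhdsWithin.1 hopen
  refine ⟨S, ?_, hS0, ?_, ?_⟩
  · -- smoothness
    set N : Set ((κ → ℝ) × E') := {y | (y.1, S y) ∈ U ∩ U' ∧ rt y ∈ G.target} with hN
    have hNev : ∀ᶠ y in 𝓝 ((0 : κ → ℝ), Φ (0, e₀)), y ∈ N := by
      have h1 : ContinuousAt (fun y : (κ → ℝ) × E' => (y.1, S y)) (0, Φ (0, e₀)) :=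
        continuousAt_fst.prodMk (hScont _ (by rw [hrt0]; exact hGt))
      have h2 : U ∩ U' ∈ 𝓝 ((0 : κ → ℝ), S (0, Φ (0, e₀))) := by
        rw [hS0]; exact (hU.inter hU').mem_nhds ⟨hxU, hxU'⟩
      exact (h1.eventually h2).and hrtev
    obtain ⟨N', hN'sub, hN', hmemN'⟩ := mem_nhds_iff.1 hNev
    have hudN : UniqueDiffOn ℝ (Q' ∩ N') := uniqueDiffOn_piQuadrant_prod.inter hN'
    have hmain : ContDiffOn ℝ ∞ (fun y : (κ → ℝ) × E' => (y.1, S y)) (Q' ∩ N') := by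
      refine contDiffOn_of_local_right_inverse (f := Ξ) (f' := Ξ') (s := Q ∩ U ∩ U') hudN ?_
        (hΞ'_smooth.mono inter_subset_left) (fun x hx => hsub ⟨hx.2, hx.1⟩) ?_ ?_ ?_
      · intro x hx
        have h1 : HasFDerivWithinAt Φ (fderivWithin ℝ Φ (Q ∩ U) x) (Q ∩ U) x :=
          ((hcd x hx.1).differentiableWithinAt (by simp)).hasFDerivWithinAt
        exact (hasFDerivWithinAt_fst.prodMk (h1.mono inter_subset_left))
      · intro y hy
        exact (continuousAt_fst.prodMk (hScont y (hN'sub hy.2).2)).continuousWithinAt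
      · intro y hy
        exact ⟨⟨⟨hy.1.1, mem_univ _⟩, (hN'sub hy.2).1.1⟩, (hN'sub hy.2).1.2⟩
      · intro y hy
        exact Prod.ext rfl (hSΦ y hy.1 (hN'sub hy.2).2)
    have hsnd := contDiff_snd.comp_contDiffOn hmain
    exact SmoothGerm.of_contDiffOn (hN'.mem_nhds hmemN') hsnd
  · filter_upwards [mem_nhdsWithin_of_mem_nhds hrtev, self_mem_nhdsWithin] with y hy hyQ
    exact hSΦ y hyQ hy
  · have hcont : Continuous fun x : (κ → ℝ) × E => ((fun i => √(x.1 i) : κ → ℝ), x.2) := by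
      refine Continuous.prodMk ?_ continuous_snd
      exact continuous_pi fun i => Real.continuous_sqrt.comp (by fun_prop)
    have h1 : ∀ᶠ x in 𝓝 ((0 : κ → ℝ), e₀), ((fun i => √(x.1 i) : κ → ℝ), x.2) ∈ G.source := by
      refine hcont.continuousAt.eventually (G.open_source.mem_nhds ?_)
      have : (fun i => √((0 : κ → ℝ) i)) = 0 := by ext; simp
      simpa only [this] using hGs
    filter_upwards [mem_nhdsWithin_of_mem_nhds h1, self_mem_nhdsWithin] with x hx hxQ
    have h2 := G.left_inv hx
    have h3 : sq ((fun i => √(x.1 i) : κ → ℝ), x.2) = x := by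
      refine Prod.ext ?_ rfl
      funext i
      exact Real.sq_sqrt (hxQ.1 i)
    have h4 : G ((fun i => √(x.1 i) : κ → ℝ), x.2) = rt (x.1, Φ x) := by
      change Θ _ = _
      simp only [hΘ, h3, hrt]
    rw [h4] at h2
    change (G.symm (rt (x.1, Φ x))).2 = x.2
    rw [h2]

end ImplicitFunction

end

noncomputable section

/-! ## Division of smooth functions by coordinates -/

section Hadamard

variable {E F : Type} [NormedAddCommGroup E] [NormedSpace ℝ E] [NormedAddCommGroup F]
  [NormedSpace ℝ F]

theorem hasFDerivWithinAt_integral_of_continuousOn {K : Set E} (hK : Convex ℝ K)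
    {G : E × ℝ → F} {G' : E × ℝ → E →L[ℝ] F}
    (hG : ContinuousOn G (K ×ˢ Icc 0 1)) (hG' : ContinuousOn G' (K ×ˢ Icc 0 1))
    (hd : ∀ s ∈ Icc (0 : ℝ) 1, ∀ x ∈ K, HasFDerivWithinAt (fun x => G (x, s)) (G' (x, s)) K x)
    {x : E} (hx : x ∈ K) :
    HasFDerivWithinAt (fun x => ∫ s in (0 : ℝ)..1, G (x, s)) (∫ s in (0 : ℝ)..1, G' (x, s)) K x := by
  have hcs : ∀ y ∈ K, ContinuousOn (fun s : ℝ => (y, s)) (Icc 0 1) := fun y _ => by fun_prop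
  have hI : ∀ y ∈ K, IntervalIntegrable (fun s => G (y, s)) MeasureTheory.volume 0 1 := by
    intro y hy
    refine ContinuousOn.intervalIntegrable ?_
    rw [uIcc_of_le zero_le_one]
    exact hG.comp (hcs y hy) fun s hs => ⟨hy, hs⟩
  have hI' : IntervalIntegrable (fun s => G' (x, s)) MeasureTheory.volume 0 1 := by
    refine ContinuousOn.intervalIntegrable ?_
    rw [uIcc_of_le zero_le_one]
    exact hG'.comp (hcs x hx) fun s hs => ⟨hx, hs⟩
  rw [hasFDerivWithinAt_iff_isLittleO, Asymptotics.isLittleO_iff]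
  intro ε hε
  have htube : ∀ᶠ y in 𝓝 x, ∀ s ∈ Icc (0 : ℝ) 1, y ∈ K → s ∈ Icc (0 : ℝ) 1 →
      ‖G' (y, s) - G' (x, s)‖ ≤ ε := by
    refine (isCompact_Icc (a := (0 : ℝ)) (b := 1)).eventually_forall_of_forall_eventually
      (P := fun y s => y ∈ K → s ∈ Icc (0 : ℝ) 1 → ‖G' (y, s) - G' (x, s)‖ ≤ ε) ?_
    intro s hs
    have h1 : ContinuousOn (fun z : E × ℝ => ‖G' z - G' (x, z.2)‖) (K ×ˢ Icc 0 1) := by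
      have h3 : ContinuousOn (fun z : E × ℝ => G' (x, z.2)) (K ×ˢ Icc 0 1) :=
        hG'.comp (f := fun z : E × ℝ => (x, z.2)) (by fun_prop) fun z hz => ⟨hx, hz.2⟩
      exact (hG'.sub h3).norm
    have h2 := (h1 (x, s) ⟨hx, hs⟩).tendsto.eventually (gt_mem_nhds (show _ < ε by simpa using hε))
    filter_upwards [eventually_nhdsWithin_iff.1 h2] with z hz hzK hzs
    exact (hz ⟨hzK, hzs⟩).le
  obtain ⟨r, hr, hball⟩ := Metric.eventually_nhds_iff_ball.1 htube
  have hmem : K ∩ Metric.ball x r ∈ 𝓝[K] x :=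
    inter_mem self_mem_nhdsWithin (mem_nhdsWithin_of_mem_nhds (Metric.ball_mem_nhds x hr))
  filter_upwards [hmem] with y hy
  have hconv : Convex ℝ (K ∩ Metric.ball x r) := hK.inter (convex_ball x r)
  have hxy : ∀ s ∈ Icc (0 : ℝ) 1,
      ‖G (y, s) - G (x, s) - G' (x, s) (y - x)‖ ≤ ε * ‖y - x‖ := by
    intro s hs
    refine hconv.norm_image_sub_le_of_norm_hasFDerivWithin_le' (f := fun x => G (x, s))
      (f' := fun x => G' (x, s)) ?_ ?_ ⟨hx, Metric.mem_ball_self hr⟩ hy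
    · exact fun z hz => (hd s hs z hz.1).mono inter_subset_left
    · exact fun z hz => hball z hz.2 s hs hz.1 hs
  have hsplit : (∫ s in (0 : ℝ)..1, G (y, s)) - (∫ s in (0 : ℝ)..1, G (x, s)) -
      (∫ s in (0 : ℝ)..1, G' (x, s)) (y - x) =
      ∫ s in (0 : ℝ)..1, (G (y, s) - G (x, s) - G' (x, s) (y - x)) := by
    rw [intervalIntegral.integral_sub ((hI y hy.1).sub (hI x hx)),
      intervalIntegral.integral_sub (hI y hy.1) (hI x hx),
      ContinuousLinearMap.intervalIntegral_apply hI']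
    exact ⟨(ContinuousLinearMap.apply ℝ F (y - x)).integrable_comp hI'.1,
      (ContinuousLinearMap.apply ℝ F (y - x)).integrable_comp hI'.2⟩
  rw [hsplit]
  have := intervalIntegral.norm_integral_le_of_norm_le_const (a := (0 : ℝ)) (b := 1)
    (C := ε * ‖y - x‖) (f := fun s => G (y, s) - G (x, s) - G' (x, s) (y - x))
    (fun s hs => hxy s (by rw [uIoc_of_le zero_le_one] at hs; exact ⟨hs.1.le, hs.2⟩))
  simpa using this

theorem contDiffOn_integral {K : Set E} (hK : Convex ℝ K) (hKu : UniqueDiffOn ℝ K)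
    {G : E × ℝ → F} (hG : ContDiffOn ℝ ∞ G (K ×ˢ Icc 0 1)) :
    ContDiffOn ℝ ∞ (fun x => ∫ s in (0 : ℝ)..1, G (x, s)) K := by
  have hud : UniqueDiffOn ℝ (K ×ˢ Icc (0 : ℝ) 1) := hKu.prod (uniqueDiffOn_Icc one_pos)
  have key : ∀ {F : Type} [NormedAddCommGroup F] [NormedSpace ℝ F] {G : E × ℝ → F},
      ContDiffOn ℝ ∞ G (K ×ˢ Icc 0 1) → ∃ G' : E × ℝ → E →L[ℝ] F,
        ContDiffOn ℝ ∞ G' (K ×ˢ Icc 0 1) ∧ ∀ x ∈ K, HasFDerivWithinAt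
          (fun x => ∫ s in (0 : ℝ)..1, G (x, s)) (∫ s in (0 : ℝ)..1, G' (x, s)) K x := by
    intro F _ _ G hG
    have h1 := hG.fderivWithin hud (m := ∞) (by simp)
    have h2 : ContDiffOn ℝ ∞ (fun z : E × ℝ => (fderivWithin ℝ G (K ×ˢ Icc 0 1) z).comp
        (ContinuousLinearMap.inl ℝ E ℝ)) (K ×ˢ Icc 0 1) := h1.clm_comp contDiffOn_const
    refine ⟨_, h2, fun x hx => hasFDerivWithinAt_integral_of_continuousOn hK hG.continuousOn
      h2.continuousOn ?_ hx⟩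
    intro s hs y hy
    have h3 := ((hG (y, s) ⟨hy, hs⟩).differentiableWithinAt (by simp)).hasFDerivWithinAt
    have h4 : HasFDerivWithinAt (fun y : E => (y, s)) (ContinuousLinearMap.inl ℝ E ℝ) K y :=
      (hasFDerivAt_prodMk_left y s).hasFDerivWithinAt
    have hm : MapsTo (fun y : E => (y, s)) K (K ×ˢ Icc (0 : ℝ) 1) := fun z hz => ⟨hz, hs⟩
    exact h3.comp y h4 hm
  rw [contDiffOn_infty]
  intro n
  induction n generalizing F with
  | zero =>
    obtain ⟨G', -, h⟩ := key hG
    exact contDiffOn_zero.2 fun x hx => (h x hx).continuousWithinAt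
  | succ n ih =>
    obtain ⟨G', hG', h⟩ := key hG
    have := (contDiffOn_succ_iff_hasFDerivWithinAt_of_uniqueDiffOn (n := n) hKu).2
      ⟨by simp, _, ih hG', h⟩
    exact_mod_cast this

end Hadamard

section Box

variable {n : ℕ}

/-- An open cube in Euclidean space. -/
def cube (x₀ : EuclideanSpace ℝ (Fin n)) (r : ℝ) : Set (EuclideanSpace ℝ (Fin n)) :=
  {x | ∀ i, |x i - x₀ i| < r}

theorem isOpen_cube (x₀ : EuclideanSpace ℝ (Fin n)) (r : ℝ) : IsOpen (cube x₀ r) := by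
  have : cube x₀ r = ⋂ i, {x : EuclideanSpace ℝ (Fin n) | |x i - x₀ i| < r} := by
    ext; simp [cube]
  rw [this]
  exact isOpen_iInter_of_finite fun i => isOpen_lt (by fun_prop) continuous_const

theorem convex_cube (x₀ : EuclideanSpace ℝ (Fin n)) (r : ℝ) : Convex ℝ (cube x₀ r) := by
  have : cube x₀ r = ⋂ i, (EuclideanSpace.proj i : EuclideanSpace ℝ (Fin n) →L[ℝ] ℝ) ⁻¹'
      Metric.ball (x₀ i) r := by
    ext; simp [cube, Real.dist_eq]
  rw [this]
  exact convex_iInter fun i => (convex_ball _ _).linear_preimage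
    (EuclideanSpace.proj i : EuclideanSpace ℝ (Fin n) →L[ℝ] ℝ).toLinearMap

theorem mem_cube_self {x₀ : EuclideanSpace ℝ (Fin n)} {r : ℝ} (hr : 0 < r) : x₀ ∈ cube x₀ r :=
  fun i => by simpa using hr

theorem exists_cube_subset {x₀ : EuclideanSpace ℝ (Fin n)} {U : Set (EuclideanSpace ℝ (Fin n))}
    (hU : U ∈ 𝓝 x₀) : ∃ r > 0, cube x₀ r ⊆ U := by
  have h1 : Continuous (fun y : Fin n → ℝ => WithLp.toLp 2 y : _ → EuclideanSpace ℝ (Fin n)) :=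
    PiLp.continuous_toLp 2 _
  have h2 : (fun y : Fin n → ℝ => (WithLp.toLp 2 y : EuclideanSpace ℝ (Fin n))) ⁻¹' U ∈
      𝓝 (WithLp.ofLp x₀) := h1.continuousAt.preimage_mem_nhds hU
  obtain ⟨r, hr, hsub⟩ := Metric.mem_nhds_iff.1 h2
  refine ⟨r, hr, fun x hx => ?_⟩
  have : WithLp.ofLp x ∈ Metric.ball (WithLp.ofLp x₀) r := by
    rw [Metric.mem_ball, dist_pi_lt_iff hr]
    exact fun i => by rw [Real.dist_eq]; exact hx i
  exact hsub this

/-- The point with the same coordinates, except for the `i`-th, which is multiplied by `s`. -/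
def scaleCoord (i : Fin n) (s : ℝ) (x : EuclideanSpace ℝ (Fin n)) : EuclideanSpace ℝ (Fin n) :=
  x + ((s - 1) * x i) • EuclideanSpace.single i 1

theorem scaleCoord_apply_self (i : Fin n) (s : ℝ) (x : EuclideanSpace ℝ (Fin n)) :
    scaleCoord i s x i = s * x i := by
  simp [scaleCoord]; ring

theorem scaleCoord_apply_of_ne {i j : Fin n} (h : j ≠ i) (s : ℝ) (x : EuclideanSpace ℝ (Fin n)) :
    scaleCoord i s x j = x j := by
  simp [scaleCoord, h]

/-- A smooth function which vanishes where the `i`-th coordinate does is divisible by it. -/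
theorem SmoothGerm.exists_eq_mul {x₀ : EuclideanSpace ℝ (Fin n)}
    {u : EuclideanSpace ℝ (Fin n) → ℝ} (hu : SmoothGerm (quadrant n) x₀ u) {i : Fin n}
    (hi : x₀ i = 0) (h0 : ∀ᶠ x in 𝓝[quadrant n] x₀, x i = 0 → u x = 0) :
    ∃ a, SmoothGerm (quadrant n) x₀ a ∧ ∀ᶠ x in 𝓝[quadrant n] x₀, u x = x i * a x := by
  obtain ⟨U, hU, hxU, hcd⟩ := hu.contDiffOn
  obtain ⟨U', hU', hU'0⟩ := mem_nhdsWithin_iff_exists_mem_nhds_inter.1 h0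
  obtain ⟨r, hr, hsub⟩ := exists_cube_subset (inter_mem (hU.mem_nhds hxU) hU')
  set K := quadrant n ∩ cube x₀ r with hKdef
  have hKc : Convex ℝ K := (quadrant_convex n).inter (convex_cube x₀ r)
  have hKu : UniqueDiffOn ℝ K := (uniqueDiffOn_quadrant n).inter (isOpen_cube x₀ r)
  have huK : ContDiffOn ℝ ∞ u K := hcd.mono fun x hx => ⟨hx.1, (hsub hx.2).1⟩
  have hscale : ∀ x ∈ K, ∀ s ∈ Icc (0 : ℝ) 1, scaleCoord i s x ∈ K := by
    intro x hx s hs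
    refine ⟨fun j => ?_, fun j => ?_⟩
    · rcases eq_or_ne j i with rfl | hj
      · rw [scaleCoord_apply_self]; exact mul_nonneg hs.1 (hx.1 j)
      · rw [scaleCoord_apply_of_ne hj]; exact hx.1 j
    · rcases eq_or_ne j i with rfl | hj
      · have := hx.2 j
        rw [scaleCoord_apply_self]
        rw [hi, sub_zero] at this ⊢
        rw [abs_mul, abs_of_nonneg hs.1]
        exact lt_of_le_of_lt (mul_le_of_le_one_left (abs_nonneg _) hs.2) this
      · rw [scaleCoord_apply_of_ne hj]; exact hx.2 j
  have hscale_smooth : ContDiff ℝ ∞ fun z : EuclideanSpace ℝ (Fin n) × ℝ => scaleCoord i z.2 z.1 := by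
    have h1 : ContDiff ℝ ∞ fun z : EuclideanSpace ℝ (Fin n) × ℝ => (z.2 - 1) * z.1 i :=
      (contDiff_snd.sub contDiff_const).mul ((contDiff_piLp_apply 2).comp contDiff_fst)
    exact contDiff_fst.add (h1.smul contDiff_const)
  set g : EuclideanSpace ℝ (Fin n) → ℝ := fun x =>
    fderivWithin ℝ u K x (EuclideanSpace.single i 1) with hg
  have hgK : ContDiffOn ℝ ∞ g K :=
    (huK.fderivWithin hKu (m := ∞) (by simp)).clm_apply contDiffOn_const
  have hG : ContDiffOn ℝ ∞ (fun z : EuclideanSpace ℝ (Fin n) × ℝ => g (scaleCoord i z.2 z.1))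
      (K ×ˢ Icc 0 1) :=
    hgK.comp hscale_smooth.contDiffOn fun z hz => hscale z.1 hz.1 z.2 hz.2
  have hKmem : cube x₀ r ∈ 𝓝 x₀ := (isOpen_cube x₀ r).mem_nhds (mem_cube_self hr)
  refine ⟨_, SmoothGerm.of_contDiffOn hKmem (contDiffOn_integral hKc hKu hG), ?_⟩
  have hKev : ∀ᶠ x in 𝓝[quadrant n] x₀, x ∈ K := by
    filter_upwards [self_mem_nhdsWithin, mem_nhdsWithin_of_mem_nhds hKmem] with x h1 h2
    exact ⟨h1, h2⟩
  filter_upwards [hKev] with x hx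
  have hcurve : ∀ s : ℝ, HasDerivAt (fun s => scaleCoord i s x) (x i • EuclideanSpace.single i 1) s := by
    intro s
    have h1 : HasDerivAt (fun s : ℝ => (s - 1) * x i) (x i) s := by
      simpa using ((hasDerivAt_id s).sub_const 1).mul_const (x i)
    simpa [scaleCoord] using (h1.smul_const (EuclideanSpace.single i (1 : ℝ))).const_add x
  have hcomp : ∀ s ∈ Icc (0 : ℝ) 1, HasDerivWithinAt (fun s => u (scaleCoord i s x))
      (x i * g (scaleCoord i s x)) (Icc 0 1) s := by
    intro s hs
    have h1 := ((huK _ (hscale x hx s hs)).differentiableWithinAt (by simp)).hasFDerivWithinAt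
    have h2 := h1.comp_hasDerivWithinAt s (hcurve s).hasDerivWithinAt fun s' hs' => hscale x hx s' hs'
    rw [map_smul, smul_eq_mul] at h2
    exact h2
  have hcont : ContinuousOn (fun s => x i * g (scaleCoord i s x)) (Icc 0 1) := by
    refine continuousOn_const.mul (hG.continuousOn.comp (f := fun s => (x, s)) (by fun_prop) ?_)
    exact fun s hs => ⟨hx, hs⟩
  have hftc := intervalIntegral.integral_eq_sub_of_hasDerivAt_of_le (zero_le_one (α := ℝ))
    (fun s hs => (hcomp s hs).continuousWithinAt)
    (fun s hs => (hcomp s ⟨hs.1.le, hs.2.le⟩).hasDerivAt (Icc_mem_nhds hs.1 hs.2))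
    (by
      refine ContinuousOn.intervalIntegrable ?_
      rwa [uIcc_of_le zero_le_one])
  have h1 : scaleCoord i 1 x = x := by simp [scaleCoord]
  have h2 : u (scaleCoord i 0 x) = 0 := by
    have hm := hscale x hx 0 ⟨le_rfl, zero_le_one⟩
    exact hU'0 ⟨(hsub hm.2).2, hm.1⟩ (by rw [scaleCoord_apply_self, zero_mul])
  rw [h1, h2, sub_zero, intervalIntegral.integral_const_mul] at hftc
  exact hftc.symm

end Box

end

noncomputable section

/-! ## Logarithmic derivatives -/

section LogDeriv

variable {n m : ℕ}

/-- The function `xᵢ ∂ᵢu / u` on the interior of the quadrant extends continuously to `x₀`, with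
value `L`. -/
def HasLogDeriv (x₀ : EuclideanSpace ℝ (Fin n)) (u : EuclideanSpace ℝ (Fin n) → ℝ) (i : Fin n)
    (L : ℝ) : Prop :=
  (∀ᶠ x in 𝓝[openQuadrant n] x₀, DifferentiableAt ℝ u x ∧ u x ≠ 0) ∧
  Tendsto (fun x => x i * fderiv ℝ u x (EuclideanSpace.single i 1) / u x) (𝓝[openQuadrant n] x₀)
    (𝓝 L)

variable {x₀ : EuclideanSpace ℝ (Fin n)} {u v : EuclideanSpace ℝ (Fin n) → ℝ} {i : Fin n}
  {L L' : ℝ}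

theorem limUnder_logDeriv_of_eq_zero (hx₀ : x₀ ∈ quadrant n)
    (hu : ∀ᶠ x in 𝓝[quadrant n] x₀, u x = 0) :
    limUnder (𝓝[openQuadrant n] x₀)
      (fun x => x i * fderiv ℝ u x (EuclideanSpace.single i 1) / u x) = 0 := by
  have := nhdsWithin_openQuadrant_neBot hx₀
  refine Tendsto.limUnder_eq (tendsto_const_nhds.congr' ?_)
  have h := hu.filter_mono (nhdsWithin_mono x₀ (openQuadrant_subset n))
  filter_upwards [h] with x hx
  simp [hx]

namespace HasLogDeriv

theorem limUnder_eq (hx₀ : x₀ ∈ quadrant n) (h : HasLogDeriv x₀ u i L) :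
    limUnder (𝓝[openQuadrant n] x₀)
      (fun x => x i * fderiv ℝ u x (EuclideanSpace.single i 1) / u x) = L := by
  have := nhdsWithin_openQuadrant_neBot hx₀
  exact h.2.limUnder_eq

theorem unique (hx₀ : x₀ ∈ quadrant n) (h : HasLogDeriv x₀ u i L) (h' : HasLogDeriv x₀ u i L') :
    L = L' := by
  have := nhdsWithin_openQuadrant_neBot hx₀
  exact tendsto_nhds_unique h.2 h'.2

theorem congr (h : HasLogDeriv x₀ u i L) (hv : ∀ᶠ x in 𝓝[openQuadrant n] x₀, v x = u x) :
    HasLogDeriv x₀ v i L := by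
  have h1 : ∀ᶠ x in 𝓝[openQuadrant n] x₀, v =ᶠ[𝓝 x] u := by
    have := eventually_eventually_nhdsWithin.2 hv
    filter_upwards [this, self_mem_nhdsWithin] with x hx hxQ
    rwa [(isOpen_openQuadrant n).nhdsWithin_eq hxQ] at hx
  refine ⟨?_, h.2.congr' ?_⟩
  · filter_upwards [h.1, h1] with x hx hx'
    exact ⟨hx'.differentiableAt_iff.2 hx.1, by rw [hx'.eq_of_nhds]; exact hx.2⟩
  · filter_upwards [h1] with x hx
    rw [hx.fderiv_eq, hx.eq_of_nhds]

theorem mul (hu : HasLogDeriv x₀ u i L) (hv : HasLogDeriv x₀ v i L') :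
    HasLogDeriv x₀ (fun x => u x * v x) i (L + L') := by
  refine ⟨?_, (hu.2.add hv.2).congr' ?_⟩
  · filter_upwards [hu.1, hv.1] with x hx hx'
    exact ⟨hx.1.mul hx'.1, mul_ne_zero hx.2 hx'.2⟩
  · filter_upwards [hu.1, hv.1] with x hx hx'
    rw [fderiv_fun_mul hx.1 hx'.1]
    have := hx.2
    have := hx'.2
    simp only [add_apply, smul_apply, smul_eq_mul]
    field_simp
    ring

theorem const {c : ℝ} (hc : c ≠ 0) : HasLogDeriv x₀ (fun _ => c) i 0 := by
  refine ⟨Eventually.of_forall fun x => ⟨differentiableAt_const _, hc⟩, ?_⟩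
  simpa using tendsto_const_nhds

theorem inv (hu : HasLogDeriv x₀ u i L) : HasLogDeriv x₀ (fun x => (u x)⁻¹) i (-L) := by
  refine ⟨?_, hu.2.neg.congr' ?_⟩
  · filter_upwards [hu.1] with x hx using ⟨hx.1.inv hx.2, inv_ne_zero hx.2⟩
  · filter_upwards [hu.1] with x hx
    have h1 := ((hasDerivAt_inv hx.2).comp_hasFDerivAt x hx.1.hasFDerivAt).fderiv
    have h2 : fderiv ℝ (fun x => (u x)⁻¹) x = _ := h1
    have := hx.2
    rw [h2]
    simp only [smul_apply, smul_eq_mul]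
    field_simp

theorem pow (hu : HasLogDeriv x₀ u i L) (k : ℕ) : HasLogDeriv x₀ (fun x => u x ^ k) i (k * L) := by
  induction k with
  | zero => simpa using const one_ne_zero
  | succ k ih =>
    simp only [pow_succ]
    convert ih.mul hu using 1
    push_cast; ring

theorem zpow (hu : HasLogDeriv x₀ u i L) (k : ℤ) : HasLogDeriv x₀ (fun x => u x ^ k) i (k * L) := by
  cases k with
  | ofNat k => simpa using hu.pow k
  | negSucc k =>
    simp only [zpow_negSucc]
    convert (hu.pow (k + 1)).inv using 1
    push_cast; ring

theorem prod {ι : Type*} (s : Finset ι) {u : ι → EuclideanSpace ℝ (Fin n) → ℝ} {L : ι → ℝ}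
    (h : ∀ j ∈ s, HasLogDeriv x₀ (u j) i (L j)) :
    HasLogDeriv x₀ (fun x => ∏ j ∈ s, u j x) i (∑ j ∈ s, L j) := by
  classical
  induction s using Finset.induction_on with
  | empty => simpa using const one_ne_zero
  | insert j s hj ih =>
    simp only [Finset.prod_insert hj, Finset.sum_insert hj]
    exact (h j (by simp)).mul (ih fun k hk => h k (by simp [hk]))

/-- The logarithmic derivative of the composition of a positive smooth function with a smooth
map. -/
theorem comp_pos {V : Type*} [NormedAddCommGroup V] [NormedSpace ℝ V] {K : Set V}
    (hK : UniqueDiffOn ℝ K) (hx₀ : x₀ ∈ quadrant n) {g : EuclideanSpace ℝ (Fin n) → V}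
    (hg : SmoothGerm (quadrant n) x₀ g) (hgK : Tendsto g (𝓝[quadrant n] x₀) (𝓝[K] (g x₀)))
    {a : V → ℝ} (ha : SmoothGerm K (g x₀) a) (ha0 : 0 < a (g x₀)) {w : V}
    (hw : Tendsto (fun x => x i • fderiv ℝ g x (EuclideanSpace.single i 1))
      (𝓝[openQuadrant n] x₀) (𝓝 w)) :
    HasLogDeriv x₀ (fun x => a (g x)) i (fderivWithin ℝ a K (g x₀) w / a (g x₀)) := by
  have hle := nhdsWithin_mono x₀ (openQuadrant_subset n)
  have hmem : ∀ᶠ x in 𝓝[quadrant n] x₀, g x ∈ K := hgK.eventually self_mem_nhdsWithin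
  have hgx₀ : g x₀ ∈ K := hmem.self_of_nhdsWithin hx₀
  have hac := ha.continuousWithinAt hgx₀
  have hcont : Tendsto (fun x => a (g x)) (𝓝[openQuadrant n] x₀) (𝓝 (a (g x₀))) :=
    hac.tendsto.comp (hgK.mono_left hle)
  have hDa : ContinuousWithinAt (fderivWithin ℝ a K) K (g x₀) :=
    ((ha.self_of_mem hgx₀).fderivWithin_right (m := 0) hK (by simp) hgx₀).continuousWithinAt
  have hDag : Tendsto (fun x => fderivWithin ℝ a K (g x)) (𝓝[openQuadrant n] x₀)
      (𝓝 (fderivWithin ℝ a K (g x₀))) := hDa.tendsto.comp (hgK.mono_left hle)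
  have hchain : ∀ᶠ x in 𝓝[openQuadrant n] x₀, HasFDerivAt (fun x => a (g x))
      ((fderivWithin ℝ a K (g x)).comp (fderiv ℝ g x)) x := by
    have h1 := hle hg
    have h2 := hle (hgK.eventually ha)
    have h3 := hle (eventually_eventually_nhdsWithin.2 hmem)
    filter_upwards [h1, h2, h3, self_mem_nhdsWithin] with x hx1 hx2 hx3 hxQ
    have hx1' : ContDiffAt ℝ ∞ g x := hx1.contDiffAt (quadrant_mem_nhds hxQ)
    have hx3' : ∀ᶠ y in 𝓝 x, g y ∈ K := by
      rwa [nhdsWithin_eq_nhds.2 (quadrant_mem_nhds hxQ)] at hx3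
    have hx2' : HasFDerivWithinAt a (fderivWithin ℝ a K (g x)) K (g x) :=
      (ContDiffWithinAt.differentiableWithinAt hx2 (by simp)).hasFDerivWithinAt
    exact hx2'.comp_hasFDerivAt x (hx1'.differentiableAt (by simp)).hasFDerivAt hx3'
  refine ⟨?_, ?_⟩
  · filter_upwards [hchain, hcont.eventually (lt_mem_nhds ha0)] with x hx hx'
    exact ⟨hx.differentiableAt, hx'.ne'⟩
  · have h1 := ((isBoundedBilinearMap_apply.continuous.tendsto _).comp
      (hDag.prodMk_nhds hw)).div hcont ha0.ne'
    refine h1.congr' ?_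
    filter_upwards [hchain] with x hx
    rw [hx.fderiv]
    simp

theorem coord (j : Fin n) :
    HasLogDeriv x₀ (fun x => x j) i (if i = j then 1 else 0) := by
  have hd : ∀ x : EuclideanSpace ℝ (Fin n), fderiv ℝ (fun x : EuclideanSpace ℝ (Fin n) => x j) x
      (EuclideanSpace.single i 1) = if i = j then 1 else 0 := by
    intro x
    have : HasFDerivAt (fun x : EuclideanSpace ℝ (Fin n) => x j)
        (EuclideanSpace.proj j : EuclideanSpace ℝ (Fin n) →L[ℝ] ℝ) x :=
      (EuclideanSpace.proj j : EuclideanSpace ℝ (Fin n) →L[ℝ] ℝ).hasFDerivAt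
    rw [this.fderiv]
    simp [PiLp.single_apply, eq_comm]
  refine ⟨?_, ?_⟩
  · filter_upwards [self_mem_nhdsWithin] with x hx
    exact ⟨by fun_prop, (hx j).ne'⟩
  · refine tendsto_const_nhds.congr' ?_
    filter_upwards [self_mem_nhdsWithin] with x hx
    rw [hd]
    split_ifs with h
    · subst h; field_simp [(hx i).ne']
    · simp

theorem of_pos (hx₀ : x₀ ∈ quadrant n) (hu : SmoothGerm (quadrant n) x₀ u) (h : 0 < u x₀) :
    HasLogDeriv x₀ u i
      (x₀ i * fderivWithin ℝ u (quadrant n) x₀ (EuclideanSpace.single i 1) / u x₀) := by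
  have h1 : Tendsto (fun x : EuclideanSpace ℝ (Fin n) => x i • fderiv ℝ (fun y => y) x
      (EuclideanSpace.single i (1 : ℝ))) (𝓝[openQuadrant n] x₀)
      (𝓝 (x₀ i • EuclideanSpace.single i (1 : ℝ))) := by
    simp only [fderiv_fun_id, ContinuousLinearMap.id_apply]
    have : Continuous fun x : EuclideanSpace ℝ (Fin n) => x i • EuclideanSpace.single i (1 : ℝ) := by
      fun_prop
    exact (this.tendsto x₀).mono_left nhdsWithin_le_nhds
  have := comp_pos (i := i) (uniqueDiffOn_quadrant n) hx₀ (g := fun x => x)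
    (SmoothGerm.of_contDiff contDiff_id) tendsto_id hu h h1
  simpa using this

end HasLogDeriv

/-- The logarithmic derivatives of a germ of the form `a x^α`. -/
theorem MonoGerm.hasLogDeriv' {α : Fin n → ℕ} (hx₀ : x₀ ∈ quadrant n)
    {a : EuclideanSpace ℝ (Fin n) → ℝ} (ha : SmoothGerm (quadrant n) x₀ a)
    (hu : ∀ᶠ x in 𝓝[quadrant n] x₀, 0 < a x ∧ u x = a x * ∏ i, x i ^ α i) (i : Fin n) :
    HasLogDeriv x₀ u i (α i +
      x₀ i * fderivWithin ℝ a (quadrant n) x₀ (EuclideanSpace.single i 1) / a x₀) := by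
  have h1 := HasLogDeriv.of_pos (i := i) hx₀ ha (hu.self_of_nhdsWithin hx₀).1
  have h2 := h1.mul (HasLogDeriv.prod Finset.univ fun j _ =>
    (HasLogDeriv.coord (i := i) j).pow (α j))
  have h3 := h2.congr (v := u) (by
    filter_upwards [hu.filter_mono (nhdsWithin_mono x₀ (openQuadrant_subset n))] with x hx
    exact hx.2)
  convert h3 using 1
  simp [add_comm]

theorem MonoGerm.hasLogDeriv {α : Fin n → ℕ} (hx₀ : x₀ ∈ quadrant n) (hu : MonoGerm x₀ u α)
    (i : Fin n) : HasLogDeriv x₀ u i (limUnder (𝓝[openQuadrant n] x₀)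
      (fun x => x i * fderiv ℝ u x (EuclideanSpace.single i 1) / u x)) := by
  obtain ⟨a, ha, h⟩ := hu
  have := MonoGerm.hasLogDeriv' hx₀ ha h i
  rwa [this.limUnder_eq hx₀]

theorem HasLogDeriv.tendsto_mul_fderiv (h : HasLogDeriv x₀ u i L)
    (hu : Tendsto u (𝓝[openQuadrant n] x₀) (𝓝 (u x₀))) :
    Tendsto (fun x => x i * fderiv ℝ u x (EuclideanSpace.single i 1)) (𝓝[openQuadrant n] x₀)
      (𝓝 (u x₀ * L)) := by
  refine (hu.mul h.2).congr' ?_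
  filter_upwards [h.1] with x hx
  have := hx.2
  field_simp

/-- The chain rule for logarithmic derivatives. -/
theorem HasLogDeriv.comp (hx₀ : x₀ ∈ quadrant n)
    {φ : EuclideanSpace ℝ (Fin n) → EuclideanSpace ℝ (Fin m)} {A : Fin m → Fin n → ℕ}
    (hφ : ∀ j, MonoGerm x₀ (fun x => φ x j) (A j)) {w : EuclideanSpace ℝ (Fin m) → ℝ}
    {L M : Fin m → ℝ} (hL : ∀ j, HasLogDeriv x₀ (fun x => φ x j) i (L j))
    (hM : ∀ j, HasLogDeriv (φ x₀) w j (M j)) (hw : ∀ᶠ y in 𝓝[openQuadrant m] (φ x₀),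
      DifferentiableAt ℝ w y ∧ w y ≠ 0) :
    HasLogDeriv x₀ (fun x => w (φ x)) i (∑ j, M j * L j) := by
  have ht := tendsto_openQuadrant_of_monoGerm hx₀ hφ
  have hle := nhdsWithin_mono x₀ (openQuadrant_subset n)
  have hφd : ∀ᶠ x in 𝓝[openQuadrant n] x₀, ∀ j, DifferentiableAt ℝ (fun x => φ x j) x ∧ φ x j ≠ 0 :=
    eventually_all.2 fun j => (hL j).1
  have hchain : ∀ᶠ x in 𝓝[openQuadrant n] x₀, HasFDerivAt (fun x => w (φ x))
      ((fderiv ℝ w (φ x)).comp (fderiv ℝ φ x)) x := by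
    filter_upwards [hφd, ht.eventually hw] with x hx hx'
    have hd : DifferentiableAt ℝ φ x := differentiableAt_euclidean.2 fun j => (hx j).1
    exact hx'.1.hasFDerivAt.comp x hd.hasFDerivAt
  refine ⟨?_, ?_⟩
  · filter_upwards [hchain, ht.eventually hw] with x hx hx'
    exact ⟨hx.differentiableAt, hx'.2⟩
  · have h1 := tendsto_finsetSum Finset.univ fun j _ => ((hM j).2.comp ht).mul (hL j).2
    refine h1.congr' ?_
    filter_upwards [hchain, hφd, ht.eventually hw] with x hx hx' hx''
    have hd : DifferentiableAt ℝ φ x := differentiableAt_euclidean.2 fun j => (hx' j).1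
    rw [hx.fderiv]
    have hcoord : ∀ j, fderiv ℝ φ x (EuclideanSpace.single i 1) j =
        fderiv ℝ (fun x => φ x j) x (EuclideanSpace.single i 1) := by
      intro j
      have := ((EuclideanSpace.proj j : EuclideanSpace ℝ (Fin m) →L[ℝ] ℝ).hasFDerivAt.comp x
        hd.hasFDerivAt).fderiv
      exact (congrArg (fun T => T (EuclideanSpace.single i 1)) this).symm
    have hsum : fderiv ℝ φ x (EuclideanSpace.single i 1) =
        ∑ j, fderiv ℝ (fun x => φ x j) x (EuclideanSpace.single i 1) •
          EuclideanSpace.single j (1 : ℝ) := by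
      ext k
      simp [hcoord, Pi.single_apply]
    rw [ContinuousLinearMap.comp_apply, hsum, map_sum, Finset.mul_sum, Finset.sum_div]
    refine Finset.sum_congr rfl fun j _ => ?_
    have := (hx' j).2
    have := hx''.2
    simp only [Function.comp_apply, map_smul, smul_eq_mul]
    field_simp

end LogDeriv

end

noncomputable section

/-! ## Charts with values in quadrants -/

namespace CornerChart

variable {X : Type u} [TopologicalSpace X] {e : CornerChart X} {p : X}

theorem coord_mem (e : CornerChart X) (p : X) : e.coord p ∈ quadrant e.1 := (e.2 p).2

theorem coord_nonneg (e : CornerChart X) (p : X) (i : Fin e.1) : 0 ≤ e.coord p i := (e.2 p).2 i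

theorem isOpen_source (e : CornerChart X) : IsOpen e.source := e.2.open_source

theorem param_coord (hp : p ∈ e.source) : e.param (e.coord p) = p := by
  unfold param coord
  rw [ModelWithCorners.left_inv]
  exact e.2.left_inv hp

theorem continuousAt_coord (hp : p ∈ e.source) : ContinuousAt e.coord p :=
  (ModelWithCorners.continuous _).continuousAt.comp (e.2.continuousAt hp)

theorem tendsto_coord (hp : p ∈ e.source) :
    Tendsto e.coord (𝓝 p) (𝓝[quadrant e.1] (e.coord p)) :=
  tendsto_nhdsWithin_iff.2 ⟨continuousAt_coord hp, Eventually.of_forall e.coord_mem⟩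

theorem coord_param_of_mem {x : EuclideanSpace ℝ (Fin e.1)} (hx : x ∈ quadrant e.1)
    (h : (modelWithCornersEuclideanQuadrant e.1).symm x ∈ e.2.target) :
    e.param x ∈ e.source ∧ e.coord (e.param x) = x := by
  refine ⟨e.2.map_target h, ?_⟩
  unfold param coord
  rw [e.2.right_inv h]
  exact (modelWithCornersEuclideanQuadrant e.1).right_inv' hx

theorem eventually_mem_target (hp : p ∈ e.source) :
    ∀ᶠ x in 𝓝 (e.coord p), (modelWithCornersEuclideanQuadrant e.1).symm x ∈ e.2.target := by
  refine (modelWithCornersEuclideanQuadrant e.1).continuous_symm.continuousAt.eventually ?_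
  refine e.2.open_target.mem_nhds ?_
  unfold coord
  rw [ModelWithCorners.left_inv]
  exact e.2.map_source hp

theorem eventually_coord_param (hp : p ∈ e.source) :
    ∀ᶠ x in 𝓝[quadrant e.1] (e.coord p), e.param x ∈ e.source ∧ e.coord (e.param x) = x := by
  filter_upwards [mem_nhdsWithin_of_mem_nhds (eventually_mem_target hp), self_mem_nhdsWithin]
    with x hx hxQ
  exact coord_param_of_mem hxQ hx

theorem tendsto_param (hp : p ∈ e.source) :
    Tendsto e.param (𝓝[quadrant e.1] (e.coord p)) (𝓝 p) := by
  have h1 : ContinuousAt e.param (e.coord p) := by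
    refine ContinuousAt.comp (g := e.2.symm) ?_
      (modelWithCornersEuclideanQuadrant e.1).continuous_symm.continuousAt
    refine e.2.symm.continuousAt ?_
    exact (eventually_mem_target hp).self_of_nhds
  have h2 := h1.tendsto
  rw [param_coord hp] at h2
  exact h2.mono_left nhdsWithin_le_nhds

theorem eventually_iff (hp : p ∈ e.source) {P : X → Prop} :
    (∀ᶠ q in 𝓝 p, P q) ↔ ∀ᶠ x in 𝓝[quadrant e.1] (e.coord p), P (e.param x) := by
  refine ⟨fun h => (tendsto_param hp).eventually h, fun h => ?_⟩
  filter_upwards [(tendsto_coord hp).eventually h, e.isOpen_source.mem_nhds hp] with q hq hqs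
  rwa [param_coord hqs] at hq

/-- The set of the coordinates which vanish at a point. -/
def zeros (e : CornerChart X) (p : X) : Set (Fin e.1) := {i | e.coord p i = 0}

theorem mem_zeros {i : Fin e.1} : i ∈ e.zeros p ↔ e.coord p i = 0 := Iff.rfl

theorem coord_pos {i : Fin e.1} (h : i ∉ e.zeros p) : 0 < e.coord p i :=
  lt_of_le_of_ne (e.coord_nonneg p i) (Ne.symm h)

theorem eventually_zeros_subset (hp : p ∈ e.source) : ∀ᶠ q in 𝓝 p, e.zeros q ⊆ e.zeros p := by
  have h : ∀ᶠ q in 𝓝 p, ∀ i, i ∉ e.zeros p → i ∉ e.zeros q := by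
    rw [eventually_all]
    intro i
    by_cases hi : i ∈ e.zeros p
    · simp [hi]
    · have h1 := (tendsto_coord hp).eventually (eventually_pos_coord (coord_pos hi))
      filter_upwards [h1] with q hq _ h0
      exact hq.ne' h0
  filter_upwards [h] with q hq i hi
  by_contra h'
  exact hq i h' hi

theorem eventually_zeros_eq_iff (hp : p ∈ e.source) :
    ∀ᶠ q in 𝓝 p, (e.zeros q = e.zeros p ↔ (e.zeros q).ncard = (e.zeros p).ncard) := by
  filter_upwards [eventually_zeros_subset hp] with q hq
  exact ⟨fun h => by rw [h], fun h => eq_of_subset_of_ncard_le hq h.ge (toFinite _)⟩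

end CornerChart

/-! ## The codimension -/

section Codim

/-- Smooth maps between quadrants which are inverse to each other preserve the number of vanishing
coordinates. -/
theorem card_le_of_leftInverse {n m : ℕ} {x₀ : EuclideanSpace ℝ (Fin n)}
    (hx₀ : x₀ ∈ quadrant n)
    {φ : EuclideanSpace ℝ (Fin n) → EuclideanSpace ℝ (Fin m)}
    {ψ : EuclideanSpace ℝ (Fin m) → EuclideanSpace ℝ (Fin n)}
    (hφ : ContDiffWithinAt ℝ ∞ φ (quadrant n) x₀)
    (hψ : ContDiffWithinAt ℝ ∞ ψ (quadrant m) (φ x₀))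
    (hφm : ∀ᶠ x in 𝓝[quadrant n] x₀, φ x ∈ quadrant m)
    (hinv : ∀ᶠ x in 𝓝[quadrant n] x₀, ψ (φ x) = x) :
    n ≤ m ∧ Fintype.card {i // x₀ i ≠ 0} ≤ Fintype.card {j // φ x₀ j ≠ 0} := by
  classical
  set A := fderivWithin ℝ φ (quadrant n) x₀
  set B := fderivWithin ℝ ψ (quadrant m) (φ x₀)
  have hA : HasFDerivWithinAt φ A (quadrant n) x₀ :=
    (hφ.differentiableWithinAt (by simp)).hasFDerivWithinAt
  have hB : HasFDerivWithinAt ψ B (quadrant m) (φ x₀) :=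
    (hψ.differentiableWithinAt (by simp)).hasFDerivWithinAt
  have hBA : ∀ v, B (A v) = v := by
    have ht : Tendsto φ (𝓝[quadrant n] x₀) (𝓝[quadrant m] (φ x₀)) :=
      tendsto_nhdsWithin_iff.2 ⟨hφ.continuousWithinAt, hφm⟩
    have h1 : HasFDerivWithinAt (ψ ∘ φ) (B.comp A) (quadrant n) x₀ :=
      HasFDerivWithinAt.comp_of_tendsto x₀ hB hA ht
    have h2 : HasFDerivWithinAt (fun x => x) (B.comp A) (quadrant n) x₀ :=
      h1.congr_of_eventuallyEq (by filter_upwards [hinv] with x hx using hx.symm)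
        (hinv.self_of_nhdsWithin hx₀).symm
    have h3 := (uniqueDiffOn_quadrant n x₀ hx₀).eq h2 (hasFDerivWithinAt_id x₀ _)
    intro v
    exact congrArg (fun T => T v) h3
  have hpos : ∀ v : EuclideanSpace ℝ (Fin n), (∀ i, x₀ i = 0 → v i = 0) →
      ∀ j, φ x₀ j = 0 → A v j = 0 := by
    intro v hv j hj
    have hc : HasDerivAt (fun t : ℝ => x₀ + t • v) v 0 := by
      simpa using ((hasDerivAt_id (0 : ℝ)).smul_const v).const_add x₀
    have hcQ : ∀ᶠ t in 𝓝 (0 : ℝ), x₀ + t • v ∈ quadrant n := by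
      have : ∀ i, ∀ᶠ t in 𝓝 (0 : ℝ), 0 ≤ (x₀ + t • v) i := by
        intro i
        by_cases hi : x₀ i = 0
        · exact Eventually.of_forall fun t => by simp [hi, hv i hi]
        · have hi' : 0 < x₀ i := lt_of_le_of_ne (hx₀ i) (Ne.symm hi)
          have hcont : Continuous fun t : ℝ => x₀ i + t * v i := by fun_prop
          have := hcont.continuousAt (x := (0 : ℝ)) |>.eventually
            (lt_mem_nhds (show 0 < x₀ i + 0 * v i by simpa using hi'))
          filter_upwards [this] with t ht
          simpa using ht.le
      exact eventually_all.2 this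
    have h0 : x₀ + (0 : ℝ) • v = x₀ := by simp
    have h1 : HasDerivAt (fun t : ℝ => φ (x₀ + t • v)) (A v) 0 :=
      HasFDerivWithinAt.comp_hasDerivAt (t := quadrant n) (l := φ) (l' := A) (0 : ℝ)
        (by rw [h0]; exact hA) hc hcQ
    have h2 : HasDerivAt (fun t : ℝ => φ (x₀ + t • v) j) (A v j) 0 :=
      (EuclideanSpace.proj j : EuclideanSpace ℝ (Fin m) →L[ℝ] ℝ).hasFDerivAt.comp_hasDerivAt 0 h1
    have hmin : IsLocalMin (fun t : ℝ => φ (x₀ + t • v) j) 0 := by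
      have ht : Tendsto (fun t : ℝ => x₀ + t • v) (𝓝 0) (𝓝[quadrant n] x₀) :=
        tendsto_nhdsWithin_iff.2 ⟨by simpa using hc.continuousAt.tendsto, hcQ⟩
      filter_upwards [ht.eventually hφm] with t ht
      rw [h0, hj]
      exact ht j
    exact hmin.hasDerivAt_eq_zero h2
  refine ⟨?_, ?_⟩
  · have := LinearMap.finrank_le_finrank_of_injective (f := A.toLinearMap)
      (Function.LeftInverse.injective (g := B) hBA)
    simpa using this
  · set ext : ({i // x₀ i ≠ 0} → ℝ) →ₗ[ℝ] EuclideanSpace ℝ (Fin n) :=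
      { toFun := fun v => WithLp.toLp 2 fun i => if h : x₀ i ≠ 0 then v ⟨i, h⟩ else 0
        map_add' := by intro v w; ext i; by_cases h : x₀ i = 0 <;> simp [h]
        map_smul' := by intro c v; ext i; by_cases h : x₀ i = 0 <;> simp [h] }
    set res : EuclideanSpace ℝ (Fin m) →ₗ[ℝ] ({j // φ x₀ j ≠ 0} → ℝ) :=
      { toFun := fun w j => w j
        map_add' := by intro v w; rfl
        map_smul' := by intro c v; rfl }
    have hext0 : ∀ v i, x₀ i = 0 → ext v i = 0 := by
      intro v i hi
      simp [ext, hi]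
    have hinj : Function.Injective (res ∘ₗ A.toLinearMap ∘ₗ ext) := by
      rw [← LinearMap.ker_eq_bot, LinearMap.ker_eq_bot']
      intro v hv
      have h1 : A (ext v) = 0 := by
        ext j
        by_cases hj : φ x₀ j = 0
        · exact hpos _ (hext0 v) j hj
        · exact congrFun hv ⟨j, hj⟩
      have h2 : ext v = 0 := by rw [← hBA (ext v), h1, map_zero]
      funext i
      have := congrArg (fun w : EuclideanSpace ℝ (Fin n) => w i) h2
      simpa [ext, i.2] using this
    have := LinearMap.finrank_le_finrank_of_injective hinj
    simpa using this

theorem ncard_zeros_add_card {X : Type u} [TopologicalSpace X] (e : CornerChart X) (p : X) :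
    (e.zeros p).ncard + Fintype.card {i // e.coord p i ≠ 0} = e.1 := by
  classical
  have h1 : (e.zeros p).ncard = Fintype.card {i // e.coord p i = 0} := by
    rw [← Nat.card_coe_set_eq, Nat.card_eq_fintype_card]; rfl
  rw [h1, Fintype.card_subtype_compl, Fintype.card_fin]
  have := Fintype.card_subtype_le fun i => e.coord p i = 0
  rw [Fintype.card_fin] at this
  omega

variable {X : Type u} [TopologicalSpace X] [CornerAtlas X]

open CornerChart in
theorem CornerAtlas.card_le {e e' : CornerChart X} (he : e ∈ CornerAtlas.charts)
    (he' : e' ∈ CornerAtlas.charts) {p : X} (hp : p ∈ e.source) (hp' : p ∈ e'.source) :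
    e.1 ≤ e'.1 ∧ Fintype.card {i // e.coord p i ≠ 0} ≤ Fintype.card {j // e'.coord p j ≠ 0} := by
  have h1 := compatible e he e' he' p ⟨hp, hp'⟩
  have h2 := compatible e' he' e he p ⟨hp', hp⟩
  have hpp : e'.coord (e.param (e.coord p)) = e'.coord p := by rw [param_coord hp]
  have := card_le_of_leftInverse (e.coord_mem p) h1 (by rw [hpp]; exact h2)
    (Eventually.of_forall fun x => e'.coord_mem _) ?_
  · simpa only [hpp] using this
  · filter_upwards [(tendsto_param hp).eventually (e'.isOpen_source.mem_nhds hp'),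
      eventually_coord_param hp] with x hx hx'
    rw [param_coord hx, hx'.2]

theorem codim_eq {e : CornerChart X} (he : e ∈ CornerAtlas.charts) {p : X} (hp : p ∈ e.source) :
    codim p = (e.zeros p).ncard := by
  have hs : someChart p ∈ CornerAtlas.charts ∧ p ∈ (someChart p).source :=
    (CornerAtlas.cover p).choose_spec
  have h1 := CornerAtlas.card_le he hs.1 hp hs.2
  have h2 := CornerAtlas.card_le hs.1 he hs.2 hp
  have h3 := ncard_zeros_add_card e p
  have h4 := ncard_zeros_add_card (someChart p) p
  change ((someChart p).zeros p).ncard = _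
  omega

theorem eventually_codim_eq_iff {e : CornerChart X} (he : e ∈ CornerAtlas.charts) {p : X}
    (hp : p ∈ e.source) : ∀ᶠ q in 𝓝 p, codim q = codim p ↔ e.zeros q = e.zeros p := by
  filter_upwards [CornerChart.eventually_zeros_eq_iff hp, e.isOpen_source.mem_nhds hp] with q hq hqs
  rw [hq, codim_eq he hp, codim_eq he hqs]

theorem mem_mInterior_iff {e : CornerChart X} (he : e ∈ CornerAtlas.charts) {p : X}
    (hp : p ∈ e.source) : p ∈ mInterior X ↔ e.coord p ∈ openQuadrant e.1 := by
  change codim p = 0 ↔ _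
  rw [codim_eq he hp, ncard_eq_zero (toFinite _)]
  refine ⟨fun h i => CornerChart.coord_pos (by rw [h]; simp), fun h => ?_⟩
  exact eq_empty_of_forall_notMem fun i hi => (h i).ne' hi

end Codim

end

noncomputable section

/-! ## Boundary faces -/

section Strata

variable {X : Type u} [TopologicalSpace X] [CornerAtlas X]

theorem exists_chart (p : X) : ∃ e ∈ CornerAtlas.charts (X := X), p ∈ e.source :=
  CornerAtlas.cover p

/-- The connected component of `p` in the set of points of the same codimension. -/
def stratum (p : X) : Set X := connectedComponentIn {q | codim q = codim p} p

theorem faceOf_eq_closure (p : X) : faceOf p = closure (stratum p) := rfl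

theorem mem_stratum_self (p : X) : p ∈ stratum p := mem_connectedComponentIn rfl

theorem codim_eq_of_mem_stratum {p q : X} (h : q ∈ stratum p) : codim q = codim p := by
  have h1 := connectedComponentIn_subset {q : X | codim q = codim p} p
  exact h1 h

theorem mem_faceOf_self (p : X) : p ∈ faceOf p := subset_closure (mem_stratum_self p)

theorem isClosed_faceOf (p : X) : IsClosed (faceOf p) := isClosed_closure

theorem eventually_codim_le (p : X) : ∀ᶠ q in 𝓝 p, codim q ≤ codim p := by
  obtain ⟨e, he, hp⟩ := exists_chart p
  filter_upwards [CornerChart.eventually_zeros_subset hp, e.isOpen_source.mem_nhds hp] with q hq hqs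
  rw [codim_eq he hp, codim_eq he hqs]
  exact ncard_le_ncard hq (toFinite _)

theorem stratum_eq_of_mem {p q : X} (h : q ∈ stratum p) : stratum q = stratum p := by
  have := connectedComponentIn_eq h
  unfold stratum at *
  rw [this, codim_eq_of_mem_stratum h]

theorem codim_le_of_mem_faceOf {p q : X} (h : q ∈ faceOf p) : codim p ≤ codim q := by
  rw [faceOf_eq_closure, mem_closure_iff_frequently] at h
  obtain ⟨r, hr, hr'⟩ := (h.and_eventually (eventually_codim_le q)).exists
  rwa [codim_eq_of_mem_stratum hr] at hr'

theorem mem_stratum_of_mem_faceOf {p q : X} (h : q ∈ faceOf p) (hc : codim q = codim p) :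
    q ∈ stratum p := by
  have h1 : IsPreconnected (insert q (stratum p)) :=
    isPreconnected_connectedComponentIn.subset_closure (subset_insert _ _)
      (insert_subset h subset_closure)
  have h2 := h1.subset_connectedComponentIn (F := {q | codim q = codim p})
    (mem_insert_of_mem q (mem_stratum_self p))
    (insert_subset hc fun r hr => codim_eq_of_mem_stratum hr)
  exact h2 (mem_insert _ _)

theorem faceOf_eq_of_mem_stratum {p q : X} (h : q ∈ stratum p) : faceOf q = faceOf p := by
  rw [faceOf_eq_closure, stratum_eq_of_mem h, faceOf_eq_closure]

theorem faceOf_eq_of_mem {p q : X} (h : q ∈ faceOf p) (hc : codim q = codim p) :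
    faceOf q = faceOf p :=
  faceOf_eq_of_mem_stratum (mem_stratum_of_mem_faceOf h hc)

theorem codim_eq_of_faceOf_eq {p q : X} (h : faceOf q = faceOf p) : codim q = codim p :=
  le_antisymm (codim_le_of_mem_faceOf (by rw [h]; exact mem_faceOf_self p))
    (codim_le_of_mem_faceOf (by rw [← h]; exact mem_faceOf_self q))

theorem mem_stratum_of_faceOf_eq {p q : X} (h : faceOf q = faceOf p) : q ∈ stratum p :=
  mem_stratum_of_mem_faceOf (by rw [← h]; exact mem_faceOf_self q) (codim_eq_of_faceOf_eq h)

/-- A locally constant function on a preconnected set is constant. -/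
theorem IsPreconnected.eq_of_eventually_eq {T α : Type*} [TopologicalSpace T] {C : Set T}
    (hC : IsPreconnected C) {P : T → α} (h : ∀ q ∈ C, ∀ᶠ q' in 𝓝[C] q, P q' = P q) {p q : T}
    (hp : p ∈ C) (hq : q ∈ C) : P p = P q := by
  let _ : TopologicalSpace α := ⊥
  have : DiscreteTopology α := ⟨rfl⟩
  refine hC.constant (f := P) (fun r hr => ?_) hp hq
  exact tendsto_const_nhds.congr' (by filter_upwards [h r hr] with q' hq' using hq'.symm)

/-- A function which is locally constant along the strata is constant on the relative interiors of
the boundary faces. -/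
theorem eq_of_faceOf_eq {α : Type*} {P : X → α}
    (h : ∀ q, ∀ᶠ q' in 𝓝 q, codim q' = codim q → P q' = P q) {p q : X}
    (hpq : faceOf q = faceOf p) : P q = P p := by
  refine isPreconnected_connectedComponentIn.eq_of_eventually_eq (C := stratum p) (P := P) ?_
    (mem_stratum_of_faceOf_eq hpq) (mem_stratum_self p)
  intro r hr
  filter_upwards [mem_nhdsWithin_of_mem_nhds (h r), self_mem_nhdsWithin] with q' hq' hq'C
  exact hq' ((codim_eq_of_mem_stratum hq'C).trans (codim_eq_of_mem_stratum hr).symm)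

variable {e : CornerChart X} {p : X}

/-- All sets of the coordinates which vanish at `p` are the sets of vanishing coordinates of points
close to `p`. -/
theorem CornerChart.frequently_zeros_eq {X : Type u} [TopologicalSpace X] {e : CornerChart X}
    {p : X} (hp : p ∈ e.source) {S : Set (Fin e.1)}
    (hS : S ⊆ e.zeros p) : ∃ᶠ q in 𝓝 p, e.zeros q = S := by
  classical
  rw [frequently_iff_forall_eventually_exists_and]
  intro P hP
  rw [eventually_iff hp] at hP
  have hcont : Continuous fun t : ℝ =>
      e.coord p + t • WithLp.toLp 2 (fun i => if i ∈ S then (0 : ℝ) else 1) := by fun_prop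
  have h1 : Tendsto (fun t : ℝ =>
      e.coord p + t • WithLp.toLp 2 (fun i => if i ∈ S then (0 : ℝ) else 1)) (𝓝[>] 0)
      (𝓝[quadrant e.1] (e.coord p)) := by
    refine tendsto_nhdsWithin_iff.2 ⟨?_, ?_⟩
    · simpa using (hcont.tendsto 0).mono_left (nhdsWithin_le_nhds (s := Ioi (0 : ℝ)))
    · filter_upwards [self_mem_nhdsWithin] with t ht i
      have := e.coord_nonneg p i
      have := (mem_Ioi.1 ht).le
      simp only [PiLp.add_apply, PiLp.smul_apply, smul_eq_mul]
      split_ifs <;> nlinarith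
  obtain ⟨t, ⟨h2, h3⟩, ht⟩ := ((h1.eventually (hP.and (eventually_coord_param hp))).and
    self_mem_nhdsWithin).exists
  refine ⟨_, ?_, h2⟩
  ext i
  rw [mem_zeros, h3.2]
  have hi0 := e.coord_nonneg p i
  have ht0 : 0 < t := ht
  simp only [PiLp.add_apply, PiLp.smul_apply, smul_eq_mul]
  by_cases hi : i ∈ S
  · simp [hi, mem_zeros.1 (hS hi)]
  · simp only [hi, if_false, mul_one, iff_false]
    positivity

/-- Points near `p` with the same vanishing coordinates have the same smallest face. -/
theorem exists_nhds_faceOf_eq (he : e ∈ CornerAtlas.charts) (hp : p ∈ e.source) :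
    ∃ N, IsOpen N ∧ p ∈ N ∧ N ⊆ e.source ∧
      ∀ q ∈ N, ∀ q' ∈ N, e.zeros q = e.zeros q' → faceOf q = faceOf q' := by
  obtain ⟨r, hr, hsub⟩ := exists_cube_subset (CornerChart.eventually_mem_target hp)
  set N := e.source ∩ e.coord ⁻¹' cube (e.coord p) r with hN
  have hNo : IsOpen N := by
    rw [isOpen_iff_mem_nhds]
    intro q hq
    exact inter_mem (e.isOpen_source.mem_nhds hq.1)
      ((CornerChart.continuousAt_coord hq.1).preimage_mem_nhds ((isOpen_cube _ _).mem_nhds hq.2))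
  refine ⟨N, hNo, ⟨hp, mem_cube_self hr⟩, inter_subset_left, ?_⟩
  intro q hq q' hq' hz
  set T : Set (EuclideanSpace ℝ (Fin e.1)) :=
    (quadrant e.1 ∩ cube (e.coord p) r) ∩ {x | {i | x i = 0} = e.zeros q'} with hT
  have hTc : Convex ℝ T := by
    intro x hx y hy a b ha hb hab
    refine ⟨((quadrant_convex _).inter (convex_cube _ _)) hx.1 hy.1 ha hb hab, ?_⟩
    have hx2 : {i | x i = 0} = e.zeros q' := hx.2
    have hy2 : {i | y i = 0} = e.zeros q' := hy.2
    change {i | (a • x + b • y) i = 0} = e.zeros q'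
    ext i
    have h1 : x i = 0 ↔ i ∈ e.zeros q' := by rw [← hx2]; rfl
    have h2 : y i = 0 ↔ i ∈ e.zeros q' := by rw [← hy2]; rfl
    rw [← h1]
    simp only [mem_ofPred_eq, PiLp.add_apply, PiLp.smul_apply, smul_eq_mul]
    by_cases h : x i = 0
    · have : y i = 0 := h2.2 (h1.1 h)
      simp [h, this]
    · have h' : y i ≠ 0 := fun h0 => h (h1.2 (h2.1 h0))
      have hxp : 0 < x i := lt_of_le_of_ne (hx.1.1 i) (Ne.symm h)
      have hyp : 0 < y i := lt_of_le_of_ne (hy.1.1 i) (Ne.symm h')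
      have : 0 < a * x i + b * y i := by
        rcases ha.eq_or_lt with rfl | ha'
        · have : b = 1 := by linarith
          subst this
          simpa using hyp
        · have := mul_pos ha' hxp
          have := mul_nonneg hb hyp.le
          linarith
      simp [h, this.ne']
  have hTm : ∀ x ∈ T, e.param x ∈ e.source ∧ e.coord (e.param x) = x := fun x hx =>
    CornerChart.coord_param_of_mem hx.1.1 (hsub hx.1.2)
  have hcont : ContinuousOn e.param T := by
    intro x hx
    have h1 := hTm x hx
    have h2 := CornerChart.tendsto_param h1.1
    rw [h1.2] at h2
    exact h2.mono_left (nhdsWithin_mono x fun y hy => hy.1.1)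
  have hpre : IsPreconnected (e.param '' T) := hTc.isPreconnected.image _ hcont
  have hmem : ∀ s ∈ N, e.zeros s = e.zeros q' → s ∈ e.param '' T := fun s hs hsz =>
    ⟨e.coord s, ⟨⟨e.coord_mem s, hs.2⟩, hsz⟩, CornerChart.param_coord hs.1⟩
  have hcod : e.param '' T ⊆ {s | codim s = codim q'} := by
    rintro _ ⟨x, hx, rfl⟩
    have h1 := hTm x hx
    have h2 : e.zeros (e.param x) = e.zeros q' := by
      rw [← hx.2]; unfold CornerChart.zeros; rw [h1.2]
    change codim _ = codim _
    rw [codim_eq he h1.1, codim_eq he hq'.1, h2]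
  exact faceOf_eq_of_mem_stratum
    (hpre.subset_connectedComponentIn (hmem q' hq' rfl) hcod (hmem q hq hz))

end Strata

section Hypersurfaces

variable {X : Type u} [TopologicalSpace X] [CornerAtlas X] {e : CornerChart X} {p : X}

theorem Hypersurface.isClosed (K : Hypersurface X) : IsClosed K.1 := by
  obtain ⟨_, r, -, rfl⟩ := K
  exact isClosed_faceOf r

theorem Hypersurface.faceOf_eq (K : Hypersurface X) {q : X} (hq : q ∈ K.1) (hc : codim q = 1) :
    faceOf q = K.1 := by
  obtain ⟨_, r, hr, rfl⟩ := K
  exact faceOf_eq_of_mem hq (hc.trans hr.symm)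

theorem IsDefiningCoord.mem_zeros_iff {X : Type u} [TopologicalSpace X] {e : CornerChart X}
    {p : X} {H : Set X} {i : Fin e.1} (h : IsDefiningCoord e H p i) :
    p ∈ H ↔ i ∈ e.zeros p :=
  Eventually.self_of_nhds (p := fun q => q ∈ H ↔ e.coord q i = 0) h

theorem IsDefiningCoord.eventually {X : Type u} [TopologicalSpace X] {e : CornerChart X} {p : X}
    {H : Set X} {i : Fin e.1} (h : IsDefiningCoord e H p i) :
    ∀ᶠ q in 𝓝 p, IsDefiningCoord e H q i := eventually_eventually_nhds.2 h

theorem IsDefiningCoord.coord_unique {X : Type u} [TopologicalSpace X] {e : CornerChart X}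
    {p : X} (hp : p ∈ e.source) {H : Set X} {i j : Fin e.1}
    (hi : IsDefiningCoord e H p i) (hj : IsDefiningCoord e H p j) (hpH : p ∈ H) : i = j := by
  have h1 : ({i} : Set (Fin e.1)) ⊆ e.zeros p := by
    rw [singleton_subset_iff]; exact hi.mem_zeros_iff.1 hpH
  obtain ⟨q, hq, hq1, hq2⟩ := ((CornerChart.frequently_zeros_eq hp h1).and_eventually
    (Eventually.and hi hj)).exists
  have h2 : i ∈ e.zeros q := by rw [hq]; rfl
  have h3 : j ∈ e.zeros q := hq2.1 (hq1.2 h2)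
  rw [hq] at h3
  exact h3.symm

theorem IsDefiningCoord.hypersurface_unique (he : e ∈ CornerAtlas.charts) (hp : p ∈ e.source)
    {K K' : Hypersurface X} {i : Fin e.1} (hK : IsDefiningCoord e K.1 p i)
    (hK' : IsDefiningCoord e K'.1 p i) (hpK : p ∈ K.1) : K = K' := by
  have h1 : ({i} : Set (Fin e.1)) ⊆ e.zeros p := by
    rw [singleton_subset_iff]; exact hK.mem_zeros_iff.1 hpK
  obtain ⟨q, hq, ⟨hq1, hq2⟩, hqs⟩ := ((CornerChart.frequently_zeros_eq hp h1).and_eventually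
    ((Eventually.and hK hK').and (e.isOpen_source.mem_nhds hp))).exists
  have h2 : i ∈ e.zeros q := by rw [hq]; rfl
  have hc : codim q = 1 := by rw [codim_eq he hqs, hq, ncard_singleton]
  exact Subtype.ext ((K.faceOf_eq (hq1.2 h2) hc).symm.trans (K'.faceOf_eq (hq2.2 h2) hc))

variable [hX : IsManifoldWithCorners X]

theorem Hypersurface.exists_isDefiningCoord (K : Hypersurface X) (he : e ∈ CornerAtlas.charts)
    (hp : p ∈ e.source) (hpK : p ∈ K.1) : ∃ i, IsDefiningCoord e K.1 p i :=
  hX.embedded K e he p ⟨hp, hpK⟩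

theorem Hypersurface.mem_iff_of_faceOf_eq (K : Hypersurface X) {q q' : X}
    (h : faceOf q = faceOf q') : q ∈ K.1 ↔ q' ∈ K.1 := by
  refine Eq.to_iff (eq_of_faceOf_eq (P := fun q => q ∈ K.1) ?_ h)
  intro q
  by_cases hq : q ∈ K.1
  · obtain ⟨e, he, hqe⟩ := exists_chart q
    obtain ⟨i, hi⟩ := K.exists_isDefiningCoord he hqe hq
    filter_upwards [hi, eventually_codim_eq_iff he hqe] with q' h1 h2 h3
    have h4 : q' ∈ K.1 := by
      rw [h1]
      have : i ∈ e.zeros q' := by rw [h2.1 h3]; exact hi.mem_zeros_iff.1 hq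
      exact this
    simp [hq, h4]
  · filter_upwards [K.isClosed.isOpen_compl.mem_nhds hq] with q' hq' _
    have : q' ∉ K.1 := hq'
    simp [hq, this]

/-- The hypersurface defined by a coordinate which vanishes at `p`. -/
theorem exists_hypersurface (he : e ∈ CornerAtlas.charts) (hp : p ∈ e.source) {i : Fin e.1}
    (hi : i ∈ e.zeros p) : ∃ K : Hypersurface X, IsDefiningCoord e K.1 p i := by
  obtain ⟨N, hNo, hpN, hNs, hN⟩ := exists_nhds_faceOf_eq he hp
  obtain ⟨q₀, hq₀, hq₀N⟩ := ((CornerChart.frequently_zeros_eq hp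
    (singleton_subset_iff.2 hi)).and_eventually (hNo.mem_nhds hpN)).exists
  have hc : codim q₀ = 1 := by rw [codim_eq he (hNs hq₀N), hq₀, ncard_singleton]
  set K : Hypersurface X := ⟨faceOf q₀, q₀, hc, rfl⟩
  have hK : ∀ q ∈ N, i ∈ e.zeros q → q ∈ K.1 := by
    intro q hq hiq
    refine isClosed_faceOf q₀ |>.mem_of_frequently_of_tendsto ?_ (tendsto_id (x := 𝓝 q))
    refine ((CornerChart.frequently_zeros_eq (hNs hq)
      (singleton_subset_iff.2 hiq)).and_eventually (hNo.mem_nhds hq)).mono ?_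
    rintro q' ⟨h1, h2⟩
    have := hN q' h2 q₀ hq₀N (h1.trans hq₀.symm)
    change q' ∈ faceOf q₀
    rw [← this]
    exact mem_faceOf_self q'
  obtain ⟨i', hi'⟩ := K.exists_isDefiningCoord he hp (hK p hpN hi)
  obtain ⟨q, hq, hqN, hq'⟩ := ((CornerChart.frequently_zeros_eq hp
    (singleton_subset_iff.2 hi)).and_eventually ((hNo.eventually_mem hpN).and hi')).exists
  have h1 : i' ∈ e.zeros q := hq'.1 (hK q hqN (by rw [hq]; rfl))
  rw [hq] at h1
  obtain rfl : i' = i := h1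
  exact ⟨K, hi'⟩

/-- Near `p`, the smallest face containing a point is determined by its vanishing coordinates and
conversely. -/
theorem exists_nhds_faceOf_eq_iff (he : e ∈ CornerAtlas.charts) (hp : p ∈ e.source) :
    ∃ N, IsOpen N ∧ p ∈ N ∧ N ⊆ e.source ∧ (∀ q ∈ N, e.zeros q ⊆ e.zeros p) ∧
      ∀ q ∈ N, ∀ q' ∈ N, faceOf q = faceOf q' ↔ e.zeros q = e.zeros q' := by
  obtain ⟨N, hNo, hpN, hNs, hN⟩ := exists_nhds_faceOf_eq he hp
  choose K hK using fun i : e.zeros p => exists_hypersurface he hp i.2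
  have h2 : ∀ᶠ q in 𝓝 p, ∀ i : e.zeros p, q ∈ (K i).1 ↔ e.coord q i = 0 := eventually_all.2 hK
  have h3 := (h2.and (CornerChart.eventually_zeros_subset hp)).and (hNo.mem_nhds hpN)
  obtain ⟨N', hN', hN'o, hpN'⟩ := mem_nhds_iff.1 h3
  refine ⟨N', hN'o, hpN', fun q hq => hNs (hN' hq).2, fun q hq => (hN' hq).1.2,
    fun q hq q' hq' => ⟨fun h => ?_, hN q (hN' hq).2 q' (hN' hq').2⟩⟩
  have hsub : ∀ q ∈ N', ∀ q' ∈ N', faceOf q = faceOf q' → e.zeros q ⊆ e.zeros q' := by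
    intro q hq q' hq' h i hi
    have hip := (hN' hq).1.2 hi
    have h4 := ((hN' hq).1.1 ⟨i, hip⟩).2 hi
    exact ((hN' hq').1.1 ⟨i, hip⟩).1 (((K ⟨i, hip⟩).mem_iff_of_faceOf_eq h).1 h4)
  exact Subset.antisymm (hsub q hq q' hq' h) (hsub q' hq' q hq h.symm)

end Hypersurfaces

section Faces

variable {X : Type u} [TopologicalSpace X] [CornerAtlas X] {e : CornerChart X} {p : X}

theorem Face.isClosed (F : Face X) : IsClosed F.1 := by
  obtain ⟨_, r, rfl⟩ := F
  exact isClosed_faceOf r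

theorem mem_int_faceAt (p : X) : p ∈ (faceAt p).int := rfl

theorem Face.int_subset (F : Face X) : F.int ⊆ F.1 := by
  intro q hq
  rw [← show faceOf q = F.1 from hq]
  exact mem_faceOf_self q

theorem Face.closure_int (F : Face X) : closure F.int = F.1 := by
  refine Subset.antisymm (closure_minimal F.int_subset F.isClosed) ?_
  obtain ⟨_, r, rfl⟩ := F
  exact closure_mono fun q hq => faceOf_eq_of_mem_stratum hq

variable [hX : IsManifoldWithCorners X]

/-- In a chart around one of its points, a boundary face is given by the vanishing of some of the
coordinates. -/
theorem Face.exists_local_form (F : Face X) (he : e ∈ CornerAtlas.charts) (hp : p ∈ e.source)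
    (hpF : p ∈ F.1) : ∃ S ⊆ e.zeros p, (∀ᶠ q in 𝓝 p, q ∈ F.int ↔ e.zeros q = S) ∧
      ∀ᶠ q in 𝓝 p, q ∈ F.1 ↔ S ⊆ e.zeros q := by
  obtain ⟨N, hNo, hpN, hNs, hNz, hN⟩ := exists_nhds_faceOf_eq_iff he hp
  rw [← F.closure_int, mem_closure_iff_frequently] at hpF
  obtain ⟨q₀, hq₀, hq₀N⟩ := (hpF.and_eventually (hNo.mem_nhds hpN)).exists
  have h1 : ∀ q ∈ N, q ∈ F.int ↔ e.zeros q = e.zeros q₀ := by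
    intro q hq
    rw [← hN q hq q₀ hq₀N, show faceOf q₀ = F.1 from hq₀]
    rfl
  refine ⟨e.zeros q₀, hNz q₀ hq₀N, ?_, ?_⟩
  · filter_upwards [hNo.mem_nhds hpN] with q hq using h1 q hq
  · filter_upwards [hNo.mem_nhds hpN] with q hq
    rw [← F.closure_int, mem_closure_iff_frequently]
    constructor
    · intro h
      obtain ⟨q', hq'F, hq'N, hq'z⟩ := (h.and_eventually ((hNo.eventually_mem hq).and
        (CornerChart.eventually_zeros_subset (hNs hq)))).exists
      rw [← (h1 q' hq'N).1 hq'F]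
      exact hq'z
    · intro h
      refine ((CornerChart.frequently_zeros_eq (hNs hq) h).and_eventually
        (hNo.mem_nhds hq)).mono ?_
      rintro q' ⟨h2, h3⟩
      exact (h1 q' h3).2 h2

theorem Face.mem_iff_of_faceOf_eq (F : Face X) {q q' : X} (h : faceOf q = faceOf q') :
    q ∈ F.1 ↔ q' ∈ F.1 := by
  refine Eq.to_iff (eq_of_faceOf_eq (P := fun q => q ∈ F.1) ?_ h)
  intro q
  by_cases hq : q ∈ F.1
  · obtain ⟨e, he, hqe⟩ := exists_chart q
    obtain ⟨S, hS, -, hF⟩ := F.exists_local_form he hqe hq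
    filter_upwards [hF, eventually_codim_eq_iff he hqe] with q' h1 h2 h3
    have h4 : q' ∈ F.1 := by rw [h1, h2.1 h3]; exact hS
    simp [hq, h4]
  · filter_upwards [F.isClosed.isOpen_compl.mem_nhds hq] with q' hq' _
    have : q' ∉ F.1 := hq'
    simp [hq, this]

theorem Face.faceOf_subset_iff (F : Face X) {q : X} : faceOf q ⊆ F.1 ↔ q ∈ F.1 := by
  refine ⟨fun h => h (mem_faceOf_self q), fun h => closure_minimal (fun r hr => ?_) F.isClosed⟩
  exact (F.mem_iff_of_faceOf_eq (faceOf_eq_of_mem_stratum hr)).2 h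

theorem Hypersurface.faceOf_subset_iff (K : Hypersurface X) {q : X} :
    faceOf q ⊆ K.1 ↔ q ∈ K.1 := by
  refine ⟨fun h => h (mem_faceOf_self q), fun h => closure_minimal (fun r hr => ?_) K.isClosed⟩
  exact (K.mem_iff_of_faceOf_eq (faceOf_eq_of_mem_stratum hr)).2 h

theorem Face.subset_hypersurface_iff (F : Face X) (K : Hypersurface X) {q : X} (hq : q ∈ F.int) :
    F.1 ⊆ K.1 ↔ q ∈ K.1 := by
  rw [← show faceOf q = F.1 from hq, K.faceOf_subset_iff]

/-- Among the hypersurfaces through `p`, those which contain a face `F ∋ p` correspond to the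
coordinates which vanish on `F`. -/
theorem IsDefiningCoord.subset_iff {F : Face X} {K : Hypersurface X} {i : Fin e.1}
    (hK : IsDefiningCoord e K.1 p i) (hpF : p ∈ F.1) {S : Set (Fin e.1)}
    (hS : ∀ᶠ q in 𝓝 p, q ∈ F.int ↔ e.zeros q = S) : F.1 ⊆ K.1 ↔ i ∈ S := by
  rw [← F.closure_int, mem_closure_iff_frequently] at hpF
  obtain ⟨q, hq, hqK, hqS⟩ := (hpF.and_eventually (Eventually.and hK hS)).exists
  rw [F.subset_hypersurface_iff K hq, hqK, ← hqS.1 hq]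
  rfl

end Faces

end

noncomputable section

/-! ## b-maps in local coordinates -/

section BGerm

variable {X Y : Type u} [TopologicalSpace X] [CornerAtlas X] [TopologicalSpace Y] [CornerAtlas Y]
  {n : ℕ}

theorem MonoGerm.exponent_unique {x₀ : EuclideanSpace ℝ (Fin n)} (hx₀ : x₀ ∈ quadrant n)
    {u : EuclideanSpace ℝ (Fin n) → ℝ} {α β : Fin n → ℕ} (hα : MonoGerm x₀ u α)
    (hβ : MonoGerm x₀ u β) {i : Fin n} (hi : x₀ i = 0) : α i = β i := by
  obtain ⟨a, ha, h⟩ := hα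
  obtain ⟨b, hb, h'⟩ := hβ
  have := (MonoGerm.hasLogDeriv' hx₀ ha h i).unique hx₀ (MonoGerm.hasLogDeriv' hx₀ hb h' i)
  simpa [hi] using this

theorem isMonomialAt_iff {X Y : Type u} [TopologicalSpace X] [TopologicalSpace Y] {f : X → Y} {e : CornerChart X} {e' : CornerChart Y} {p : X}
    {j : Fin e'.1} {α : Fin e.1 → ℕ} : IsMonomialAt f e e' p j α ↔
      MonoGerm (e.coord p) (fun x => e'.coord (f (e.param x)) j) α := by
  constructor
  · rintro ⟨U, hU, a, ha, h⟩
    refine ⟨a, SmoothGerm.of_contDiffOn hU ha, ?_⟩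
    filter_upwards [self_mem_nhdsWithin, mem_nhdsWithin_of_mem_nhds hU] with x h1 h2
    exact h x ⟨h1, h2⟩
  · rintro ⟨a, ha, h⟩
    obtain ⟨U, hU, hxU, hcd⟩ := ha.contDiffOn
    obtain ⟨V, hV, hVh⟩ := mem_nhdsWithin_iff_exists_mem_nhds_inter.1 h
    refine ⟨U ∩ V, inter_mem (hU.mem_nhds hxU) hV, a, hcd.mono fun x hx => ⟨hx.1, hx.2.1⟩, ?_⟩
    exact fun x hx => hVh ⟨hx.2.2, hx.1⟩

/-- The germ at `x₀` of a b-map from a quadrant to a manifold with corners. -/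
def BGerm (x₀ : EuclideanSpace ℝ (Fin n)) (g : EuclideanSpace ℝ (Fin n) → Y) : Prop :=
  Tendsto g (𝓝[quadrant n] x₀) (𝓝 (g x₀)) ∧
  ∀ e ∈ CornerAtlas.charts (X := Y), g x₀ ∈ e.source → ∀ j,
    (∃ α, MonoGerm x₀ (fun x => e.coord (g x) j) α) ∨
      ∀ᶠ x in 𝓝[quadrant n] x₀, e.coord (g x) j = 0

theorem CornerAtlas.smoothGerm_transition {e e' : CornerChart X} (he : e ∈ CornerAtlas.charts)
    (he' : e' ∈ CornerAtlas.charts) {p : X} (hp : p ∈ e.source) (hp' : p ∈ e'.source) :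
    SmoothGerm (quadrant e.1) (e.coord p) (fun x => e'.coord (e.param x)) := by
  filter_upwards [CornerChart.eventually_coord_param hp,
    (CornerChart.tendsto_param hp).eventually (e'.isOpen_source.mem_nhds hp')] with x hx hx'
  have := compatible e he e' he' (e.param x) ⟨hx.1, hx'⟩
  rwa [hx.2] at this

theorem IsSmoothMap.smoothGerm {f : X → Y} (hf : IsSmoothMap f) {e : CornerChart X}
    {e' : CornerChart Y} (he : e ∈ CornerAtlas.charts) (he' : e' ∈ CornerAtlas.charts) {p : X}
    (hp : p ∈ e.source) (hp' : f p ∈ e'.source) :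
    SmoothGerm (quadrant e.1) (e.coord p) (fun x => e'.coord (f (e.param x))) := by
  filter_upwards [CornerChart.eventually_coord_param hp,
    (CornerChart.tendsto_param hp).eventually
      (hf.1.continuousAt.eventually (e'.isOpen_source.mem_nhds hp'))] with x hx hx'
  have := hf.2 e he e' he' (e.param x) hx.1 hx'
  rwa [hx.2] at this

section Transition

variable {e e' : CornerChart X} {p : X}

theorem CornerAtlas.exists_eq_coord_mul (he : e ∈ CornerAtlas.charts)
    (he' : e' ∈ CornerAtlas.charts) (hp : p ∈ e.source) (hp' : p ∈ e'.source) {H : Set X}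
    (hpH : p ∈ H) {i : Fin e.1} {j : Fin e'.1} (hi : IsDefiningCoord e H p i)
    (hj : IsDefiningCoord e' H p j) :
    ∃ a, SmoothGerm (quadrant e.1) (e.coord p) a ∧
      ∀ᶠ x in 𝓝[quadrant e.1] (e.coord p), e'.coord (e.param x) j = x i * a x := by
  have h1 := smoothGerm_transition he he' hp hp'
  have h2 : SmoothGerm (quadrant e.1) (e.coord p) (fun x => e'.coord (e.param x) j) :=
    SmoothGerm.comp_contDiff (g := fun y : EuclideanSpace ℝ (Fin e'.1) => y j)
      (contDiff_piLp_apply 2) h1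
  refine h2.exists_eq_mul (hi.mem_zeros_iff.1 hpH) ?_
  filter_upwards [CornerChart.eventually_coord_param hp,
    (CornerChart.tendsto_param hp).eventually (Eventually.and hi hj)] with x hx hx' h0
  rw [← hx'.2, hx'.1, hx.2]
  exact h0

/-- Defining functions of the same hypersurface differ by positive smooth factors. -/
theorem CornerAtlas.monoGerm_transition (he : e ∈ CornerAtlas.charts)
    (he' : e' ∈ CornerAtlas.charts) (hp : p ∈ e.source) (hp' : p ∈ e'.source) {H : Set X}
    (hpH : p ∈ H) {i : Fin e.1} {j : Fin e'.1} (hi : IsDefiningCoord e H p i)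
    (hj : IsDefiningCoord e' H p j) :
    MonoGerm (e.coord p) (fun x => e'.coord (e.param x) j) (Pi.single i 1) := by
  classical
  obtain ⟨a, ha, hau⟩ := exists_eq_coord_mul he he' hp hp' hpH hi hj
  obtain ⟨b, hb, hbu⟩ := exists_eq_coord_mul he' he hp' hp hpH hj hi
  set x₀ := e.coord p with hx₀
  have hx₀Q : x₀ ∈ quadrant e.1 := e.coord_mem p
  have hφ : Tendsto (fun x => e'.coord (e.param x)) (𝓝[quadrant e.1] x₀)
      (𝓝[quadrant e'.1] (e'.coord p)) :=
    (CornerChart.tendsto_coord hp').comp (CornerChart.tendsto_param hp)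
  have hab : ∀ᶠ x in 𝓝[openQuadrant e.1] x₀, a x * b (e'.coord (e.param x)) = 1 ∧ 0 ≤ a x := by
    have hev : ∀ᶠ x in 𝓝[quadrant e.1] x₀, x ∈ openQuadrant e.1 →
        a x * b (e'.coord (e.param x)) = 1 ∧ 0 ≤ a x := by
      filter_upwards [hau, hφ.eventually hbu, CornerChart.eventually_coord_param hp,
        (CornerChart.tendsto_param hp).eventually (e'.isOpen_source.mem_nhds hp')]
        with x h1 h2 h3 h4 hxo
      have hxi := hxo i
      rw [CornerChart.param_coord h4, h3.2, h1] at h2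
      refine ⟨?_, ?_⟩
      · have h5 : x i * (a x * b (e'.coord (e.param x))) = x i * 1 := by
          rw [mul_one, ← mul_assoc, ← h2]
        exact mul_left_cancel₀ hxi.ne' h5
      · have h6 := e'.coord_nonneg (e.param x) j
        rw [h1] at h6
        exact nonneg_of_mul_nonneg_right h6 hxi
    filter_upwards [hev.filter_mono (nhdsWithin_mono x₀ (openQuadrant_subset _)),
      self_mem_nhdsWithin] with x h1 h2 using h1 h2
  have hne := nhdsWithin_openQuadrant_neBot hx₀Q
  have hle := nhdsWithin_mono x₀ (openQuadrant_subset e.1)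
  have hac := (ha.continuousWithinAt hx₀Q).tendsto.mono_left hle
  have hbc : Tendsto (fun x => b (e'.coord (e.param x))) (𝓝[openQuadrant e.1] x₀)
      (𝓝 (b (e'.coord p))) :=
    ((hb.continuousWithinAt (e'.coord_mem p)).tendsto.comp hφ).mono_left hle
  have h1 : a x₀ * b (e'.coord p) = 1 :=
    tendsto_nhds_unique_of_eventuallyEq (hac.mul hbc) tendsto_const_nhds
      (hab.mono fun x hx => hx.1)
  have h2 : 0 ≤ a x₀ := ge_of_tendsto hac (hab.mono fun x hx => hx.2)
  have h3 : 0 < a x₀ := lt_of_le_of_ne h2 fun h => by rw [← h, zero_mul] at h1; exact zero_ne_one h1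
  have h4 := (ha.continuousWithinAt hx₀Q).tendsto.eventually (lt_mem_nhds h3)
  refine ⟨a, ha, ?_⟩
  filter_upwards [hau, h4] with x hx hx'
  refine ⟨hx', ?_⟩
  rw [hx, Finset.prod_eq_single i]
  · simp [mul_comm]
  · intro k _ hk; simp [hk]
  · simp

theorem CornerAtlas.exists_monoGerm_transition [IsManifoldWithCorners X]
    (he : e ∈ CornerAtlas.charts)
    (he' : e' ∈ CornerAtlas.charts) (hp : p ∈ e.source) (hp' : p ∈ e'.source) (j : Fin e'.1) :
    ∃ α, MonoGerm (e.coord p) (fun x => e'.coord (e.param x) j) α := by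
  classical
  by_cases hj : j ∈ e'.zeros p
  · obtain ⟨K, hK⟩ := exists_hypersurface he' hp' hj
    have hpK := hK.mem_zeros_iff.2 hj
    obtain ⟨i, hi⟩ := K.exists_isDefiningCoord he hp hpK
    exact ⟨_, monoGerm_transition he he' hp hp' hpK hi hK⟩
  · refine ⟨0, MonoGerm.of_smoothGerm_pos (e.coord_mem p) ?_ ?_⟩
    · exact SmoothGerm.comp_contDiff (g := fun y : EuclideanSpace ℝ (Fin e'.1) => y j)
        (contDiff_piLp_apply 2) (smoothGerm_transition he he' hp hp')
    · rw [CornerChart.param_coord hp]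
      exact CornerChart.coord_pos hj

end Transition

variable {x₀ : EuclideanSpace ℝ (Fin n)} {g : EuclideanSpace ℝ (Fin n) → Y}

theorem smoothGerm_of_monoGerm_or_zero {u : EuclideanSpace ℝ (Fin n) → ℝ}
    (h : (∃ α, MonoGerm x₀ u α) ∨ ∀ᶠ x in 𝓝[quadrant n] x₀, u x = 0) :
    SmoothGerm (quadrant n) x₀ u := by
  rcases h with ⟨α, h⟩ | h
  · exact h.smoothGerm
  · exact (SmoothGerm.const (0 : ℝ)).congr h

/-- It suffices to check that a germ is that of a b-map in one chart. -/
theorem BGerm.of_chart [IsManifoldWithCorners Y] (hx₀ : x₀ ∈ quadrant n)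
    (ht : Tendsto g (𝓝[quadrant n] x₀) (𝓝 (g x₀))) {e : CornerChart Y}
    (he : e ∈ CornerAtlas.charts) (hge : g x₀ ∈ e.source)
    (h : ∀ j, (∃ α, MonoGerm x₀ (fun x => e.coord (g x) j) α) ∨
      ∀ᶠ x in 𝓝[quadrant n] x₀, e.coord (g x) j = 0) : BGerm x₀ g := by
  classical
  refine ⟨ht, fun e' he' hge' j => ?_⟩
  obtain ⟨β, hβ⟩ := CornerAtlas.exists_monoGerm_transition he he' hge hge' j
  have hφt : Tendsto (fun x => e.coord (g x)) (𝓝[quadrant n] x₀)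
      (𝓝[quadrant e.1] (e.coord (g x₀))) := (CornerChart.tendsto_coord hge).comp ht
  have hφs : SmoothGerm (quadrant n) x₀ (fun x => e.coord (g x)) :=
    SmoothGerm.euclidean fun j => smoothGerm_of_monoGerm_or_zero (h j)
  have hsrc : ∀ᶠ x in 𝓝[quadrant n] x₀, g x ∈ e.source :=
    ht.eventually (e.isOpen_source.mem_nhds hge)
  by_cases hz : ∃ l, β l ≠ 0 ∧ ∀ᶠ x in 𝓝[quadrant n] x₀, e.coord (g x) l = 0
  · obtain ⟨l, hl, hl0⟩ := hz
    right
    filter_upwards [hφt.eventually hβ.eq_zero_iff, hl0, hsrc] with x h1 h2 h3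
    rw [CornerChart.param_coord h3] at h1
    exact h1.2 ⟨l, h2, hl⟩
  · left
    have h1 : ∀ l, ∃ α, β l ≠ 0 → MonoGerm x₀ (fun x => e.coord (g x) l) α := by
      intro l
      by_cases hl : β l = 0
      · exact ⟨0, fun h => (h hl).elim⟩
      · rcases h l with ⟨α, hα⟩ | h0
        · exact ⟨α, fun _ => hα⟩
        · exact (hz ⟨l, hl, h0⟩).elim
    choose A hA using h1
    refine ⟨_, (hβ.comp_of_tendsto (A := A) hx₀ hφs hφt hA).congr ?_⟩
    filter_upwards [hsrc] with x hx
    rw [CornerChart.param_coord hx]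

/-- Near `x₀`, the smallest face containing `g x` is determined by the vanishing coordinates
of `x`. -/
theorem BGerm.exists_mem_nhds_faceOf_eq (hg : BGerm x₀ g) :
    ∃ N ∈ 𝓝[quadrant n] x₀, ∀ x ∈ N, ∀ x' ∈ N, (∀ i, x i = 0 ↔ x' i = 0) →
      faceOf (g x) = faceOf (g x') := by
  obtain ⟨e, he, hge⟩ := exists_chart (g x₀)
  obtain ⟨N, hNo, hpN, -, hN⟩ := exists_nhds_faceOf_eq he hge
  have h1 : ∀ j, ∃ N ∈ 𝓝[quadrant n] x₀, ∀ x ∈ N, ∀ x' ∈ N, (∀ i, x i = 0 ↔ x' i = 0) →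
      (e.coord (g x) j = 0 ↔ e.coord (g x') j = 0) := by
    intro j
    rcases hg.2 e he hge j with ⟨α, hα⟩ | h0
    · refine ⟨_, hα.eq_zero_iff, fun x hx x' hx' hxx' => ?_⟩
      have h1 : e.coord (g x) j = 0 ↔ _ := hx
      have h2 : e.coord (g x') j = 0 ↔ _ := hx'
      rw [h1, h2]
      simp only [hxx']
    · refine ⟨_, h0, fun x hx x' hx' _ => ?_⟩
      have h1 : e.coord (g x) j = 0 := hx
      have h2 : e.coord (g x') j = 0 := hx'
      rw [h1, h2]
  choose M hM hM' using h1
  refine ⟨(⋂ j, M j) ∩ g ⁻¹' N, inter_mem (iInter_mem.2 hM) (hg.1 (hNo.mem_nhds hpN)), ?_⟩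
  intro x hx x' hx' hxx'
  refine hN _ hx.2 _ hx'.2 ?_
  ext j
  exact hM' j x (mem_iInter.1 hx.1 j) x' (mem_iInter.1 hx'.1 j) hxx'

end BGerm

section BMap

variable {X Y : Type u} [TopologicalSpace X] [CornerAtlas X] [TopologicalSpace Y] [CornerAtlas Y]
  {f : X → Y}

theorem IsInteriorBMap.isBMap (hf : IsInteriorBMap f) : IsBMap f :=
  ⟨hf.1, fun e he e' he' p hp hp' j => Or.inl (hf.2 e he e' he' p hp hp' j)⟩

theorem IsBMap.bGerm (hf : IsBMap f) {e : CornerChart X} (he : e ∈ CornerAtlas.charts) {p : X}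
    (hp : p ∈ e.source) : BGerm (e.coord p) (fun x => f (e.param x)) := by
  have hpp := CornerChart.param_coord hp
  refine ⟨?_, fun e' he' hp' j => ?_⟩
  · change Tendsto _ _ (𝓝 (f (e.param (e.coord p))))
    rw [hpp]
    exact hf.1.1.continuousAt.tendsto.comp (CornerChart.tendsto_param hp)
  · replace hp' : f p ∈ e'.source := by rw [← hpp]; exact hp'
    rcases hf.2 e he e' he' p hp hp' j with ⟨α, hα⟩ | h0
    · exact Or.inl ⟨α, isMonomialAt_iff.1 hα⟩
    · exact Or.inr ((CornerChart.eventually_iff hp).1 h0)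

theorem isBMap_of_bGerm (h : ∀ e ∈ CornerAtlas.charts (X := X), ∀ p ∈ e.source,
    BGerm (e.coord p) (fun x => f (e.param x))) : IsBMap f := by
  refine ⟨⟨?_, ?_⟩, ?_⟩
  · rw [continuous_iff_continuousAt]
    intro p
    obtain ⟨e, he, hp⟩ := exists_chart p
    have h1 := (h e he p hp).1.comp (CornerChart.tendsto_coord hp)
    simp only [CornerChart.param_coord hp] at h1
    refine h1.congr' ?_
    filter_upwards [e.isOpen_source.mem_nhds hp] with q hq
    exact congrArg f (CornerChart.param_coord hq)
  · intro e he e' he' p hp hp'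
    have h1 := h e he p hp
    refine (SmoothGerm.euclidean fun j => smoothGerm_of_monoGerm_or_zero
      (h1.2 e' he' (by simpa only [CornerChart.param_coord hp] using hp') j)).self_of_mem (e.coord_mem p)
  · intro e he e' he' p hp hp' j
    rcases (h e he p hp).2 e' he' (by simpa only [CornerChart.param_coord hp] using hp') j with ⟨α, hα⟩ | h0
    · exact Or.inl ⟨α, isMonomialAt_iff.2 hα⟩
    · exact Or.inr ((CornerChart.eventually_iff hp).2 h0)

theorem IsBMap.faceOf_eq (hf : IsBMap f) {p q : X} (h : faceOf p = faceOf q) :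
    faceOf (f p) = faceOf (f q) := by
  refine eq_of_faceOf_eq (P := fun p => faceOf (f p)) (fun q => ?_) h
  obtain ⟨e, he, hq⟩ := exists_chart q
  obtain ⟨N, hN, hN'⟩ := (hf.bGerm he hq).exists_mem_nhds_faceOf_eq
  have hqN : e.coord q ∈ N := mem_of_mem_nhdsWithin (e.coord_mem q) hN
  filter_upwards [CornerChart.tendsto_coord hq hN, eventually_codim_eq_iff he hq,
    e.isOpen_source.mem_nhds hq] with q' h1 h2 h3 h4
  have h5 := hN' _ h1 _ hqN fun i => by
    have : i ∈ e.zeros q' ↔ i ∈ e.zeros q := by rw [h2.1 h4]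
    exact this
  rwa [CornerChart.param_coord hq, CornerChart.param_coord h3] at h5

theorem IsBMap.isFaceImage [IsManifoldWithCorners Y] (hf : IsBMap f) {F : Face X} {p : X}
    (hp : p ∈ F.int) : IsFaceImage f F (faceAt (f p)) := by
  refine ⟨?_, fun G' hG' => ?_⟩
  · rw [← F.closure_int]
    refine (image_closure_subset_closure_image hf.1.1).trans ?_
    refine closure_minimal ?_ (isClosed_faceOf _)
    rintro _ ⟨q, hq, rfl⟩
    have : faceOf (f q) = faceOf (f p) :=
      hf.faceOf_eq ((show faceOf q = F.1 from hq).trans (show faceOf p = F.1 from hp).symm)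
    change f q ∈ faceOf (f p)
    rw [← this]
    exact mem_faceOf_self _
  · exact G'.faceOf_subset_iff.2 (hG' ⟨p, F.int_subset hp, rfl⟩)

theorem IsInteriorBMap.mapsTo_interior (hf : IsInteriorBMap f) {p : X} (hp : p ∈ mInterior X) :
    f p ∈ mInterior Y := by
  obtain ⟨e, he, hpe⟩ := exists_chart p
  obtain ⟨e', he', hpe'⟩ := exists_chart (f p)
  rw [mem_mInterior_iff he hpe] at hp
  rw [mem_mInterior_iff he' hpe']
  intro j
  obtain ⟨α, hα⟩ := hf.2 e he e' he' p hpe hpe' j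
  have := (isMonomialAt_iff.1 hα).pos.self_of_nhdsWithin (e.coord_mem p) hp
  rwa [CornerChart.param_coord hpe] at this

theorem Hypersurface.notMem_of_mem_mInterior [IsManifoldWithCorners X] (K : Hypersurface X) {p : X}
    (hp : p ∈ mInterior X) : p ∉ K.1 := by
  intro h
  obtain ⟨e, he, hpe⟩ := exists_chart p
  obtain ⟨i, hi⟩ := K.exists_isDefiningCoord he hpe h
  rw [mem_mInterior_iff he hpe] at hp
  exact (hp i).ne' (hi.mem_zeros_iff.1 h)

/-- The interior of a manifold with corners is dense. -/
theorem frequently_mem_mInterior (p : X) : ∃ᶠ q in 𝓝 p, q ∈ mInterior X := by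
  obtain ⟨e, he, hp⟩ := exists_chart p
  refine ((CornerChart.frequently_zeros_eq hp (empty_subset _)).and_eventually
    (e.isOpen_source.mem_nhds hp)).mono ?_
  rintro q ⟨h1, h2⟩
  change codim q = 0
  rw [codim_eq he h2, h1, ncard_empty]

end BMap

end

noncomputable section

/-! ## Exponents of b-maps along hypersurfaces -/

section Exponents

variable {X Y : Type u} [TopologicalSpace X] [CornerAtlas X] [TopologicalSpace Y] [CornerAtlas Y]
  {f : X → Y}

/-- The condition in `HasBExponent` at the point `q`. -/
def HasBExponentAt (f : X → Y) (K : Hypersurface X) (H : Hypersurface Y) (m : ℕ) (q : X) : Prop :=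
  (f q ∉ H.1 → m = 0) ∧ (f q ∈ H.1 →
    ∀ e ∈ CornerAtlas.charts (X := X), ∀ e' ∈ CornerAtlas.charts (X := Y),
      q ∈ e.source → f q ∈ e'.source →
      ∀ i j, IsDefiningCoord e K.1 q i → IsDefiningCoord e' H.1 (f q) j →
        ∃ α, α i = m ∧ IsMonomialAt f e e' q j α)

theorem MonoGerm.single_comp {n m : ℕ} {x₀ : EuclideanSpace ℝ (Fin n)} (hx₀ : x₀ ∈ quadrant n)
    {φ : EuclideanSpace ℝ (Fin n) → EuclideanSpace ℝ (Fin m)}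
    (hφs : SmoothGerm (quadrant n) x₀ φ)
    (ht : Tendsto φ (𝓝[quadrant n] x₀) (𝓝[quadrant m] (φ x₀)))
    {u : EuclideanSpace ℝ (Fin m) → ℝ} {j : Fin m} (hu : MonoGerm (φ x₀) u (Pi.single j 1))
    {α : Fin n → ℕ} (hφ : MonoGerm x₀ (fun x => φ x j) α) :
    MonoGerm x₀ (fun x => u (φ x)) α := by
  have := hu.comp_of_tendsto (A := fun _ => α) hx₀ hφs ht (fun k hk => by
    obtain rfl : k = j := by
      by_contra h
      exact hk (by simp [h])
    exact hφ)
  convert this using 1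
  funext i
  rw [Finset.sum_apply, Finset.sum_eq_single j] <;> simp +contextual

variable [IsManifoldWithCorners X] [IsManifoldWithCorners Y]

/-- At a generic point of a hypersurface, the exponent does not depend on the charts. -/
theorem hasBExponentAt_iff (hf : IsBMap f) {K : Hypersurface X} {H : Hypersurface Y} {q : X}
    (hqK : faceOf q = K.1) (hqH : f q ∈ H.1) {e : CornerChart X} (he : e ∈ CornerAtlas.charts)
    {e' : CornerChart Y} (he' : e' ∈ CornerAtlas.charts) (hq : q ∈ e.source)
    (hq' : f q ∈ e'.source) {i : Fin e.1} {j : Fin e'.1} (hi : IsDefiningCoord e K.1 q i)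
    (hj : IsDefiningCoord e' H.1 (f q) j) {α : Fin e.1 → ℕ}
    (hα : MonoGerm (e.coord q) (fun x => e'.coord (f (e.param x)) j) α) (m : ℕ) :
    HasBExponentAt f K H m q ↔ m = α i := by
  have hqK' : q ∈ K.1 := by rw [← hqK]; exact mem_faceOf_self q
  have hcodim : codim q = 1 := by
    obtain ⟨_, r, hr, rfl⟩ := K
    rw [codim_eq_of_faceOf_eq hqK, hr]
  constructor
  · rintro ⟨-, h⟩
    obtain ⟨α', rfl, hα'⟩ := h hqH e he e' he' hq hq' i j hi hj
    exact (isMonomialAt_iff.1 hα').exponent_unique (e.coord_mem q) hα (hi.mem_zeros_iff.1 hqK')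
  · rintro rfl
    refine ⟨fun h => (h hqH).elim, fun _ e₂ he₂ e₂' he₂' hq₂ hq₂' i₂ j₂ hi₂ hj₂ => ?_⟩
    have hi₂z : e₂.coord q i₂ = 0 := hi₂.mem_zeros_iff.1 hqK'
    choose B hB using fun l => CornerAtlas.exists_monoGerm_transition he₂ he hq₂ hq l
    -- the transition functions on the source
    have hB0 : ∀ l, l ≠ i → B l i₂ = 0 := by
      intro l hl
      refine (hB l).exponent_eq_zero (e₂.coord_mem q) ?_ hi₂z
      rw [CornerChart.param_coord hq₂]
      intro h0
      rw [codim_eq he hq, ncard_eq_one] at hcodim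
      obtain ⟨k, hk⟩ := hcodim
      have h1 : l ∈ e.zeros q := h0
      have h2 : i ∈ e.zeros q := hi.mem_zeros_iff.1 hqK'
      rw [hk, mem_singleton_iff] at h1 h2
      exact hl (h1.trans h2.symm)
    have hBi : B i i₂ = 1 := by
      have := (hB i).exponent_unique (e₂.coord_mem q)
        (CornerAtlas.monoGerm_transition he₂ he hq₂ hq hqK' hi₂ hi) hi₂z
      simpa using this
    have hpp := CornerChart.param_coord hq₂
    -- compose
    have h1 : MonoGerm (e₂.coord q)
        (fun x => e'.coord (f (e.param (e.coord (e₂.param x)))) j) (∑ l, α l • B l) := by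
      refine MonoGerm.comp (φ := fun x => e.coord (e₂.param x)) (e₂.coord_mem q) hB
        (u := fun y => e'.coord (f (e.param y)) j) ?_
      rw [hpp]; exact hα
    have hev : ∀ᶠ x in 𝓝[quadrant e₂.1] (e₂.coord q), e₂.param x ∈ e.source :=
      (CornerChart.tendsto_param hq₂).eventually (e.isOpen_source.mem_nhds hq)
    have h2 : MonoGerm (e₂.coord q) (fun x => e'.coord (f (e₂.param x)) j) (∑ l, α l • B l) := by
      refine h1.congr ?_
      filter_upwards [hev] with x hx
      rw [CornerChart.param_coord hx]
    have hft : Tendsto (fun x => f (e₂.param x)) (𝓝[quadrant e₂.1] (e₂.coord q)) (𝓝 (f q)) :=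
      hf.1.1.continuousAt.tendsto.comp (CornerChart.tendsto_param hq₂)
    have h3 : MonoGerm (e₂.coord q)
        (fun x => e₂'.coord (e'.param (e'.coord (f (e₂.param x)))) j₂) (∑ l, α l • B l) := by
      refine MonoGerm.single_comp (φ := fun x => e'.coord (f (e₂.param x)))
        (u := fun y => e₂'.coord (e'.param y) j₂) (j := j) (e₂.coord_mem q)
        (hf.1.smoothGerm he₂ he' hq₂ hq') ?_ ?_ h2
      · rw [hpp]
        exact (CornerChart.tendsto_coord hq').comp hft
      · rw [hpp]
        exact CornerAtlas.monoGerm_transition he' he₂' hq' hq₂' hqH hj hj₂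
    refine ⟨∑ l, α l • B l, ?_, isMonomialAt_iff.2 (h3.congr ?_)⟩
    · rw [Finset.sum_apply, Finset.sum_eq_single i]
      · simp [hBi]
      · intro l _ hl; simp [hB0 l hl]
      · simp
    · filter_upwards [hft.eventually (e'.isOpen_source.mem_nhds hq')] with x hx
      rw [CornerChart.param_coord hx]

theorem IsBMap.exists_monoGerm (hf : IsBMap f) {H : Hypersurface Y}
    (hH : ∀ p ∈ mInterior X, f p ∉ H.1) {e : CornerChart X} (he : e ∈ CornerAtlas.charts)
    {e' : CornerChart Y} (he' : e' ∈ CornerAtlas.charts) {p : X} (hp : p ∈ e.source)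
    (hp' : f p ∈ e'.source) {j : Fin e'.1} (hj : IsDefiningCoord e' H.1 (f p) j) :
    ∃ α, MonoGerm (e.coord p) (fun x => e'.coord (f (e.param x)) j) α := by
  rcases hf.2 e he e' he' p hp hp' j with ⟨α, hα⟩ | h0
  · exact ⟨α, isMonomialAt_iff.1 hα⟩
  · obtain ⟨q, hq, hq0, hqH⟩ := ((frequently_mem_mInterior p).and_eventually
      (h0.and (hf.1.1.continuousAt.eventually hj))).exists
    exact (hH q hq (hqH.2 hq0)).elim

/-- The exponent of a b-map along a pair of hypersurfaces may be computed at any common point. -/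
theorem bExponent_eq (hf : IsBMap f) {K : Hypersurface X} {H : Hypersurface Y}
    (hH : ∀ p ∈ mInterior X, f p ∉ H.1) {e : CornerChart X} (he : e ∈ CornerAtlas.charts)
    {e' : CornerChart Y} (he' : e' ∈ CornerAtlas.charts) {p : X} (hp : p ∈ e.source)
    (hp' : f p ∈ e'.source) {i : Fin e.1} {j : Fin e'.1} (hpK : p ∈ K.1)
    (hi : IsDefiningCoord e K.1 p i) (hj : IsDefiningCoord e' H.1 (f p) j) {α : Fin e.1 → ℕ}
    (hα : MonoGerm (e.coord p) (fun x => e'.coord (f (e.param x)) j) α) :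
    bExponent f K H = α i := by
  -- the exponent is locally constant along the relative interior of `K`
  obtain ⟨r₀, hr₀, hr₀K⟩ : ∃ r, codim r = 1 ∧ K.1 = faceOf r := K.2
  have hint : ∀ q, faceOf q = K.1 ↔ q ∈ stratum r₀ := fun q => by
    rw [hr₀K]
    exact ⟨mem_stratum_of_faceOf_eq, faceOf_eq_of_mem_stratum⟩
  have hconst : ∀ q ∈ stratum r₀, ∀ᶠ q' in 𝓝[stratum r₀] q,
      {m | HasBExponentAt f K H m q'} = {m | HasBExponentAt f K H m q} := by
    intro q hq
    have hqK := (hint q).2 hq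
    by_cases hqH : f q ∈ H.1
    · obtain ⟨e₁, he₁, hq₁⟩ := exists_chart q
      obtain ⟨e₂, he₂, hq₂⟩ := exists_chart (f q)
      have hqK' : q ∈ K.1 := by rw [← hqK]; exact mem_faceOf_self q
      obtain ⟨k, hk⟩ := K.exists_isDefiningCoord he₁ hq₁ hqK'
      obtain ⟨l, hl⟩ := H.exists_isDefiningCoord he₂ hq₂ hqH
      obtain ⟨β, hβ⟩ := hf.exists_monoGerm hH he₁ he₂ hq₁ hq₂ hl
      have hev := (CornerChart.tendsto_coord hq₁).eventually hβ.eventually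
      have hc := hf.1.1.continuousAt (x := q)
      have hβk : β k ≠ 0 := by
        have h1 := hβ.eq_zero_iff.self_of_nhdsWithin (e₁.coord_mem q)
        rw [CornerChart.param_coord hq₁] at h1
        obtain ⟨k', hk', hk'β⟩ := h1.1 (hl.mem_zeros_iff.1 hqH)
        have h2 : codim q = 1 := by rw [codim_eq_of_mem_stratum hq, hr₀]
        rw [codim_eq he₁ hq₁, ncard_eq_one] at h2
        obtain ⟨k'', h2⟩ := h2
        have h3 : k' ∈ e₁.zeros q := hk'
        have h4 : k ∈ e₁.zeros q := hk.mem_zeros_iff.1 hqK'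
        rw [h2, mem_singleton_iff] at h3 h4
        rwa [h4, ← h3]
      have h0 := (CornerChart.tendsto_coord hq₁).eventually hβ.eq_zero_iff
      filter_upwards [mem_nhdsWithin_of_mem_nhds hev, self_mem_nhdsWithin,
        mem_nhdsWithin_of_mem_nhds (e₁.isOpen_source.mem_nhds hq₁),
        mem_nhdsWithin_of_mem_nhds (hc.eventually (e₂.isOpen_source.mem_nhds hq₂)),
        mem_nhdsWithin_of_mem_nhds hk.eventually,
        mem_nhdsWithin_of_mem_nhds (hc.eventually hl.eventually),
        mem_nhdsWithin_of_mem_nhds h0] with q' h1 h2 h3 h4 h5 h6 h7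
      have hq'K := (hint q').2 h2
      have hq'K' : q' ∈ K.1 := by rw [← hq'K]; exact mem_faceOf_self q'
      have hq'H : f q' ∈ H.1 := by
        rw [CornerChart.param_coord h3] at h7
        exact h6.mem_zeros_iff.2 (h7.2 ⟨k, h5.mem_zeros_iff.1 hq'K', hβk⟩)
      ext m
      exact (hasBExponentAt_iff hf hq'K hq'H he₁ he₂ h3 h4 h5 h6 h1 m).trans
        (hasBExponentAt_iff hf hqK hqH he₁ he₂ hq₁ hq₂ hk hl hβ m).symm
    · have h1 : ∀ q, f q ∉ H.1 → {m | HasBExponentAt f K H m q} = {0} := by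
        intro q hq
        ext m
        exact ⟨fun h => h.1 hq, fun h => ⟨fun _ => h, fun h' => (hq h').elim⟩⟩
      have h2 := hf.1.1.continuousAt.eventually (H.isClosed.isOpen_compl.mem_nhds hqH)
      filter_upwards [mem_nhdsWithin_of_mem_nhds h2] with q' hq'
      rw [h1 q hqH, h1 q' hq']
  -- a point of the relative interior close to `p`
  have hiz := hi.mem_zeros_iff.1 hpK
  obtain ⟨r, hr, hre, hrK, hrα, hr', hrj⟩ := ((CornerChart.frequently_zeros_eq hp
    (singleton_subset_iff.2 hiz)).and_eventually ((e.isOpen_source.eventually_mem hp).and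
      (hi.eventually.and (((CornerChart.tendsto_coord hp).eventually hα.eventually).and
        ((hf.1.1.continuousAt.eventually (e'.isOpen_source.mem_nhds hp')).and
          (hf.1.1.continuousAt.eventually hj.eventually)))))).exists
  have hrz : i ∈ e.zeros r := by rw [hr]; rfl
  have hrK' : r ∈ K.1 := hrK.mem_zeros_iff.2 hrz
  have hrint : faceOf r = K.1 :=
    K.faceOf_eq hrK' (by rw [codim_eq he hre, hr, ncard_singleton])
  have hset : {m | HasBExponentAt f K H m r} = {α i} := by
    ext m
    by_cases hrH : f r ∈ H.1
    · exact hasBExponentAt_iff hf hrint hrH he he' hre hr' hrK hrj hrα m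
    · have h1 : α i = 0 := by
        refine hrα.exponent_eq_zero (e.coord_mem r) ?_ hrz
        rw [CornerChart.param_coord hre]
        exact fun h => hrH (hrj.mem_zeros_iff.2 h)
      rw [h1]
      exact ⟨fun h => h.1 hrH, fun h => ⟨fun _ => h, fun h' => (hrH h').elim⟩⟩
  have hall : {m | HasBExponent f K H m} = {α i} := by
    rw [← hset]
    ext m
    refine ⟨fun h => h r hrint, fun h q hq => ?_⟩
    have h1 := isPreconnected_connectedComponentIn.eq_of_eventually_eq (C := stratum r₀)
      (P := fun q => {m | HasBExponentAt f K H m q}) hconst ((hint q).1 hq) ((hint r).1 hrint)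
    have h2 : m ∈ {m | HasBExponentAt f K H m q} := by rw [h1]; exact h
    exact h2
  rw [bExponent, hall, csInf_singleton]

end Exponents

end

noncomputable section

section Kernel

variable {J V κ : Type} [Fintype V] [Fintype κ]

/-- The columns of `M` freely generate the monoid of nonnegative integral solutions of `γ n = 0`. -/
structure IsKernelBasis (γ : J → V → ℤ) (M : V → κ → ℕ) : Prop where
  ker : ∀ j k, ∑ i, γ j i * (M i k : ℤ) = 0
  span : ∀ n : V → ℕ, (∀ j, ∑ i, γ j i * (n i : ℤ) = 0) →
    ∃ p : κ → ℕ, ∀ i, n i = ∑ k, M i k * p k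
  inj : ∀ p q : κ → ℕ, (∀ i, ∑ k, M i k * p k = ∑ k, M i k * q k) → p = q

namespace IsKernelBasis

variable {γ : J → V → ℤ} {M : V → κ → ℕ}

/-- Each column of `M` has an entry which is the only nonzero one in its row. -/
theorem exists_row (h : IsKernelBasis γ M) (k : κ) :
    ∃ i, M i k ≠ 0 ∧ ∀ k', k' ≠ k → M i k' = 0 := by
  classical
  by_contra! hcon
  set N : ℕ := ∑ i, M i k with hN
  have hle : ∀ i, M i k ≤ N * ∑ k' ∈ Finset.univ.erase k, M i k' := by
    intro i
    by_cases hi : M i k = 0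
    · simp [hi]
    obtain ⟨k', hk', hne⟩ := hcon i hi
    have h1 : M i k ≤ N := Finset.single_le_sum (f := fun i => M i k) (by simp) (Finset.mem_univ i)
    have h2 : M i k' ≤ ∑ k' ∈ Finset.univ.erase k, M i k' :=
      Finset.single_le_sum (f := fun k' => M i k') (by simp) (by simp [hk'])
    nlinarith [Nat.pos_of_ne_zero hne]
  obtain ⟨p, hp⟩ := h.span (fun i => N * ∑ k' ∈ Finset.univ.erase k, M i k' - M i k) (by
    intro j
    have : ∀ i, γ j i * ((N * ∑ k' ∈ Finset.univ.erase k, M i k' - M i k : ℕ) : ℤ) =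
        N * ∑ k' ∈ Finset.univ.erase k, γ j i * (M i k' : ℤ) - γ j i * (M i k : ℤ) := by
      intro i
      rw [Nat.cast_sub (hle i), ← Finset.mul_sum]
      push_cast
      ring
    simp only [this, Finset.sum_sub_distrib, h.ker, sub_zero]
    rw [← Finset.mul_sum, Finset.sum_comm]
    simp [h.ker])
  have h1 : p + Pi.single k 1 = fun k' => if k' = k then 0 else N := by
    refine h.inj _ _ fun i => ?_
    have h2 := hp i
    have h3 := hle i
    have h4 : ∑ k', M i k' * (p + Pi.single k 1 : κ → ℕ) k' = (∑ k', M i k' * p k') + M i k := by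
      simp [mul_add, Finset.sum_add_distrib, Pi.single_apply]
    have h5 : ∑ k', M i k' * (if k' = k then 0 else N) = N * ∑ k' ∈ Finset.univ.erase k, M i k' := by
      rw [← Finset.add_sum_erase _ _ (Finset.mem_univ k), Finset.mul_sum]
      simp only [if_true, mul_zero, zero_add]
      refine Finset.sum_congr rfl fun k' hk' => ?_
      rw [if_neg (Finset.ne_of_mem_erase hk'), mul_comm]
    rw [h4, h5, ← h2]
    omega
  have := congrFun h1 k
  simp at this

variable {r : κ → V}

theorem apply_row {V : Type} {M : V → κ → ℕ} {r : κ → V} (hr : ∀ k, ∀ k', k' ≠ k → M (r k) k' = 0) {R : Type*} [CommSemiring R]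
    (p : κ → R) (k : κ) : ∑ k', (M (r k) k' : R) * p k' = M (r k) k * p k := by
  classical
  refine Finset.sum_eq_single k (fun k' _ hk' => ?_) (by simp)
  simp [hr k k' hk']

theorem eq_int (h : IsKernelBasis γ M) (hr0 : ∀ k, M (r k) k ≠ 0)
    (hr : ∀ k, ∀ k', k' ≠ k → M (r k) k' = 0) {n₀ : V → ℕ} (hn₀ : ∀ i, 0 < n₀ i)
    (hker : ∀ j, ∑ i, γ j i * (n₀ i : ℤ) = 0) (v : V → ℤ) (hv : ∀ j, ∑ i, γ j i * v i = 0) (i : V) :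
    (v i : ℚ) = ∑ k, (M i k : ℚ) * (v (r k) / M (r k) k) := by
  set N : ℕ := ∑ i, (v i).natAbs
  have hN : ∀ i, 0 ≤ v i + N * n₀ i := by
    intro i
    have h1 : (v i).natAbs ≤ N :=
      Finset.single_le_sum (f := fun i => (v i).natAbs) (by simp) (Finset.mem_univ i)
    have h2 : (N : ℤ) ≤ N * n₀ i := by
      have : (1 : ℤ) ≤ n₀ i := by exact_mod_cast hn₀ i
      nlinarith [Int.natCast_nonneg N]
    omega
  obtain ⟨p, hp⟩ := h.span (fun i => (v i + N * n₀ i).toNat) (by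
    intro j
    have : ∀ i, γ j i * (((v i + N * n₀ i).toNat : ℕ) : ℤ) = γ j i * v i + N * (γ j i * n₀ i) := by
      intro i
      rw [Int.toNat_of_nonneg (hN i)]; ring
    simp only [this, Finset.sum_add_distrib, hv j, ← Finset.mul_sum, hker j]
    simp)
  obtain ⟨q, hq⟩ := h.span (fun i => N * n₀ i) (by
    intro j
    have : ∀ i, γ j i * (((N * n₀ i : ℕ)) : ℤ) = N * (γ j i * n₀ i) := by
      intro i; push_cast; ring
    simp only [this, ← Finset.mul_sum, hker j]
    simp)
  have key : ∀ i, (v i : ℚ) = ∑ k, (M i k : ℚ) * ((p k : ℚ) - q k) := by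
    intro i
    have h1 : (((v i + N * n₀ i).toNat : ℕ) : ℤ) = ∑ k, (M i k : ℤ) * p k := by
      rw [hp i]; push_cast; rfl
    have h2 : ((N * n₀ i : ℕ) : ℤ) = ∑ k, (M i k : ℤ) * q k := by
      rw [hq i]; push_cast; rfl
    rw [Int.toNat_of_nonneg (hN i)] at h1
    have h3 : v i = ∑ k, (M i k : ℤ) * ((p k : ℤ) - q k) := by
      simp only [mul_sub, Finset.sum_sub_distrib, ← h1, ← h2]
      push_cast; ring
    exact_mod_cast congrArg (fun z : ℤ => (z : ℚ)) h3
  rw [key i]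
  refine Finset.sum_congr rfl fun k _ => ?_
  rw [key (r k), apply_row hr]
  have : (M (r k) k : ℚ) ≠ 0 := by exact_mod_cast hr0 k
  field_simp

theorem eq_rat (h : IsKernelBasis γ M) (hr0 : ∀ k, M (r k) k ≠ 0)
    (hr : ∀ k, ∀ k', k' ≠ k → M (r k) k' = 0) {n₀ : V → ℕ} (hn₀ : ∀ i, 0 < n₀ i)
    (hker : ∀ j, ∑ i, γ j i * (n₀ i : ℤ) = 0) (v : V → ℚ) (hv : ∀ j, ∑ i, γ j i * v i = 0) (i : V) :
    v i = ∑ k, (M i k : ℚ) * (v (r k) / M (r k) k) := by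
  classical
  obtain ⟨d, hd0, z, hz⟩ : ∃ d : ℤ, d ≠ 0 ∧ ∃ z : V → ℤ, ∀ i, (z i : ℚ) = d * v i := by
    refine ⟨∏ i, ((v i).den : ℤ), Finset.prod_ne_zero_iff.2 fun i _ => by exact_mod_cast (v i).den_nz,
      fun i => (v i).num * ∏ j ∈ Finset.univ.erase i, ((v j).den : ℤ), fun i => ?_⟩
    rw [← Finset.mul_prod_erase _ _ (Finset.mem_univ i)]
    push_cast
    have := Rat.mul_den_eq_num (v i)
    rw [← this]; ring
  have hd : (d : ℚ) ≠ 0 := by exact_mod_cast hd0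
  have h1 := h.eq_int hr0 hr hn₀ hker z (by
    intro j
    have : ((∑ i, γ j i * z i : ℤ) : ℚ) = d * ∑ i, γ j i * v i := by
      push_cast
      rw [Finset.mul_sum]
      exact Finset.sum_congr rfl fun i _ => by rw [hz]; ring
    rw [hv j, mul_zero] at this
    exact_mod_cast this) i
  refine mul_left_cancel₀ hd ?_
  rw [← hz, h1, Finset.mul_sum]
  exact Finset.sum_congr rfl fun k _ => by rw [hz]; ring

/-- If the monoid contains a positive vector, its real span is the real kernel. -/
theorem eq_real (h : IsKernelBasis γ M) (hr0 : ∀ k, M (r k) k ≠ 0)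
    (hr : ∀ k, ∀ k', k' ≠ k → M (r k) k' = 0) {n₀ : V → ℕ} (hn₀ : ∀ i, 0 < n₀ i)
    (hker : ∀ j, ∑ i, γ j i * (n₀ i : ℤ) = 0) (v : V → ℝ) (hv : ∀ j, ∑ i, γ j i * v i = 0) (i : V) :
    v i = ∑ k, (M i k : ℝ) * (v (r k) / M (r k) k) := by
  rw [← sub_eq_zero, ← Module.forall_dual_apply_eq_zero_iff ℚ]
  intro l
  have hl : ∀ (q : ℚ) (x : ℝ), l (q * x) = q * l x := fun q x => by
    rw [← Rat.smul_def, map_smul, smul_eq_mul]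
  have h1 := h.eq_rat hr0 hr hn₀ hker (fun i => l (v i)) (by
    intro j
    have := congrArg l (hv j)
    rw [map_sum, map_zero] at this
    rw [← this]
    refine Finset.sum_congr rfl fun i _ => ?_
    have := hl (γ j i : ℚ) (v i)
    push_cast at this
    exact this.symm) i
  rw [map_sub, map_sum, h1, sub_eq_zero]
  refine Finset.sum_congr rfl fun k _ => ?_
  have := hl ((M i k : ℚ) / M (r k) k) (v (r k))
  push_cast at this
  rw [show (M i k : ℝ) * (v (r k) / M (r k) k) = (M i k / M (r k) k : ℝ) * v (r k) by ring, this]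
  ring

end IsKernelBasis

theorem IsKernelBasis.of_addEquiv {P : Type*} [AddCommMonoid P] {m : ℕ} {γ : J → V → ℤ}
    (ψ : P →+ (V → ℕ)) (hinj : Function.Injective ψ)
    (hψ : ∀ n, (∃ x, ψ x = n) ↔ ∀ j, ∑ i, γ j i * (n i : ℤ) = 0) (φ : P ≃+ (Fin m → ℕ)) :
    IsKernelBasis γ (fun i k => ψ (φ.symm (Pi.single k 1)) i) := by
  have key : ∀ (p : Fin m → ℕ) i, ψ (φ.symm p) i = ∑ k, ψ (φ.symm (Pi.single k 1)) i * p k := by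
    intro p i
    have h1 : p = ∑ k, p k • (Pi.single k 1 : Fin m → ℕ) := by
      ext k; simp [Finset.sum_apply, Pi.single_apply]
    conv_lhs => rw [h1]
    simp only [map_sum, map_nsmul, Finset.sum_apply, Pi.smul_apply, smul_eq_mul]
    exact Finset.sum_congr rfl fun k _ => mul_comm _ _
  refine ⟨fun j k => (hψ _).1 ⟨_, rfl⟩ j, fun n hn => ?_, fun p q hpq => ?_⟩
  · obtain ⟨x, rfl⟩ := (hψ n).2 hn
    refine ⟨φ x, fun i => ?_⟩
    rw [← key]
    simp
  · refine φ.symm.injective (hinj (funext fun i => ?_))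
    rw [key, key]
    exact hpq i

/-- A sequence of positive solutions of `c z ^ γ = 1` tending to zero yields a positive
integral vector in the kernel of `γ`. -/
theorem exists_pos_mem_ker [Finite J] {T : Type*} {l : Filter T} [l.NeBot] (γ : J → V → ℤ)
    (w : T → V → ℝ) (hw : ∀ i, Tendsto (fun t => w t i) l atTop) (b : J → ℝ)
    (hb : ∀ j, Tendsto (fun t => ∑ i, γ j i * w t i) l (𝓝 (b j))) :
    ∃ n₀ : V → ℕ, (∀ i, 0 < n₀ i) ∧ ∀ j, ∑ i, γ j i * (n₀ i : ℤ) = 0 := by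
  set U : Ultrafilter T := Ultrafilter.of l
  have hU : (U : Filter T) ≤ l := Ultrafilter.of_le l
  obtain ⟨θ, -, hθ⟩ := (isCompact_univ_pi fun _ : V => isCompact_Icc (a := (0 : ℝ)) (b := 1)).ultrafilter_le_nhds
    (U.map fun t i => Int.fract (w t i)) (by
      rw [le_principal_iff]
      have : ∀ᶠ t in (U : Filter T), (fun i => Int.fract (w t i)) ∈
          univ.pi fun _ : V => Icc (0 : ℝ) 1 :=
        Eventually.of_forall fun t i _ => ⟨Int.fract_nonneg _, (Int.fract_lt_one _).le⟩
      exact this)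
  have hθ' : Tendsto (fun t i => Int.fract (w t i)) U (𝓝 θ) := hθ
  have hθγ : ∀ j, Tendsto (fun t => ∑ i, γ j i * Int.fract (w t i)) U (𝓝 (∑ i, γ j i * θ i)) :=
    fun j => tendsto_finsetSum _ fun i _ => ((tendsto_pi_nhds.1 hθ') i).const_mul _
  have hev : ∀ᶠ t in (U : Filter T), ∀ j, |∑ i, γ j i * w t i - b j| < 1 / 4 ∧
      |∑ i, γ j i * Int.fract (w t i) - ∑ i, γ j i * θ i| < 1 / 4 := by
    refine eventually_all.2 fun j => ?_
    have h1 := (hb j).mono_left hU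
    have h2 := hθγ j
    rw [Metric.tendsto_nhds] at h1 h2
    filter_upwards [h1 _ (by norm_num : (0 : ℝ) < 1 / 4), h2 _ (by norm_num : (0 : ℝ) < 1 / 4)]
      with t h h' using ⟨by simpa [Real.dist_eq] using h, by simpa [Real.dist_eq] using h'⟩
  obtain ⟨t₁, h₁⟩ := hev.exists
  have hbig : ∀ᶠ t in (U : Filter T), ∀ i, w t₁ i + 2 < w t i :=
    eventually_all.2 fun i => ((hw i).mono_left hU).eventually (eventually_gt_atTop _)
  obtain ⟨t₂, h₂, h₃⟩ := (hev.and hbig).exists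
  have hpos : ∀ i, 0 < ⌊w t₂ i⌋ - ⌊w t₁ i⌋ := by
    intro i
    have h4 := Int.floor_le (w t₁ i)
    have h5 := Int.lt_floor_add_one (w t₂ i)
    have h6 := h₃ i
    have : (0 : ℝ) < ((⌊w t₂ i⌋ - ⌊w t₁ i⌋ : ℤ) : ℝ) := by push_cast; linarith
    exact_mod_cast this
  refine ⟨fun i => (⌊w t₂ i⌋ - ⌊w t₁ i⌋).toNat, fun i => by simpa using hpos i, fun j => ?_⟩
  have h4 : ∀ i, γ j i * (((⌊w t₂ i⌋ - ⌊w t₁ i⌋).toNat : ℕ) : ℤ) =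
      γ j i * (⌊w t₂ i⌋ - ⌊w t₁ i⌋) := fun i => by rw [Int.toNat_of_nonneg (hpos i).le]
  simp only [h4]
  rw [← Int.abs_lt_one_iff]
  have h5 : ((∑ i, γ j i * (⌊w t₂ i⌋ - ⌊w t₁ i⌋) : ℤ) : ℝ) =
      (∑ i, γ j i * w t₂ i - ∑ i, γ j i * Int.fract (w t₂ i)) -
      (∑ i, γ j i * w t₁ i - ∑ i, γ j i * Int.fract (w t₁ i)) := by
    simp only [← Finset.sum_sub_distrib, ← mul_sub, Int.self_sub_fract]
    push_cast; rfl
  have h6 : |((∑ i, γ j i * (⌊w t₂ i⌋ - ⌊w t₁ i⌋) : ℤ) : ℝ)| < 1 := by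
    rw [h5, abs_lt]
    have a1 := abs_lt.1 (h₁ j).1
    have a2 := abs_lt.1 (h₁ j).2
    have a3 := abs_lt.1 (h₂ j).1
    have a4 := abs_lt.1 (h₂ j).2
    constructor <;> linarith
  exact_mod_cast h6

end Kernel

end

noncomputable section

theorem isClosed_piQuadrant (κ : Type) : IsClosed (piQuadrant κ) := by
  have : piQuadrant κ = ⋂ i, {t : κ → ℝ | 0 ≤ t i} := by ext; simp [piQuadrant]
  rw [this]
  exact isClosed_iInter fun i => isClosed_le continuous_const (continuous_apply i)

/-- Continuous functions on a closed set `Q` which agree on `S ⊆ Q` agree on its closure. -/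
theorem eventually_eq_closure {E T : Type*} [TopologicalSpace E] [TopologicalSpace T] [T2Space T]
    {Q S : Set E} {z₀ : E} {F G : E → T} (hQ : IsClosed Q) (hS : S ⊆ Q)
    (hF : ∀ᶠ z in 𝓝[Q] z₀, ContinuousWithinAt F Q z)
    (hG : ∀ᶠ z in 𝓝[Q] z₀, ContinuousWithinAt G Q z) (h : ∀ᶠ z in 𝓝[S] z₀, F z = G z) :
    ∀ᶠ z in 𝓝[closure S] z₀, F z = G z := by
  have hSQ : closure S ⊆ Q := closure_minimal hS hQ
  rw [eventually_nhdsWithin_iff] at h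
  filter_upwards [nhdsWithin_mono _ hSQ hF, nhdsWithin_mono _ hSQ hG, self_mem_nhdsWithin,
    mem_nhdsWithin_of_mem_nhds (eventually_eventually_nhds.2 h)] with z hz hz' hzS hz''
  have : (𝓝[S] z).NeBot := mem_closure_iff_nhdsWithin_neBot.1 hzS
  have h1 := (show ContinuousWithinAt F Q z from hz).tendsto.mono_left (nhdsWithin_mono z hS)
  have h2 := (show ContinuousWithinAt G Q z from hz').tendsto.mono_left (nhdsWithin_mono z hS)
  refine tendsto_nhds_unique_of_eventuallyEq h1 h2 ?_
  exact eventually_nhdsWithin_iff.2 hz''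

theorem MonoGerm.rpow_inv {n : ℕ} {x₀ : EuclideanSpace ℝ (Fin n)} {u : EuclideanSpace ℝ (Fin n) → ℝ}
    {β : Fin n → ℕ} {d : ℕ} (hx₀ : x₀ ∈ quadrant n) (hd : d ≠ 0) (h : MonoGerm x₀ u (d • β)) :
    MonoGerm x₀ (fun x => u x ^ (d : ℝ)⁻¹) β := by
  obtain ⟨a, ha, hu⟩ := h
  refine ⟨fun x => a x ^ (d : ℝ)⁻¹,
    ha.rpow_const hx₀ (hu.self_of_nhdsWithin hx₀).1.ne' _, ?_⟩
  filter_upwards [hu, self_mem_nhdsWithin] with x hx hxQ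
  refine ⟨Real.rpow_pos_of_pos hx.1 _, ?_⟩
  have h1 : ∏ i, x i ^ (d • β) i = (∏ i, x i ^ β i) ^ d := by
    rw [← Finset.prod_pow]
    exact Finset.prod_congr rfl fun i _ => by rw [← pow_mul]; simp [mul_comm]
  have h2 : 0 ≤ ∏ i, x i ^ β i := Finset.prod_nonneg fun i _ => pow_nonneg (hxQ i) _
  rw [hx.2, h1, Real.mul_rpow hx.1.le (pow_nonneg h2 _), Real.pow_rpow_inv_natCast h2 hd]

/-- A system of equations `c_j z * ∏ z_i ^ γ_{ji} = 1` in the quadrant, near a point `z₀` in the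
closure of the set of solutions, such that the logarithmic differentials of the equations are
independent at `z₀` and the monoid of `n ∈ ℕ^ι`, supported where `z₀` vanishes, with `γ n = 0` is
freely generated by the columns of `M`. -/
structure MonomialSystem (ι J κ : Type) [Fintype ι] [Fintype κ] where
  z₀ : ι → ℝ
  γ : J → ι → ℤ
  c : J → (ι → ℝ) → ℝ
  M : ι → κ → ℕ
  nonneg : ∀ i, 0 ≤ z₀ i
  γ_eq_zero : ∀ j i, z₀ i ≠ 0 → γ j i = 0
  M_eq_zero : ∀ i k, z₀ i ≠ 0 → M i k = 0
  smooth : ∀ j, SmoothGerm (piQuadrant ι) z₀ (c j)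
  pos : ∀ j, 0 < c j z₀
  basis : IsKernelBasis (fun j (i : {i // z₀ i = 0}) => γ j i) (fun i k => M i k)
  mem_closure : z₀ ∈ closure {z | (∀ i, 0 < z i) ∧ ∀ j, c j z * ∏ i, z i ^ γ j i = 1}
  surj : ∀ b : J → ℝ, ∃ v : ι → ℝ, ∀ j, ∑ i, γ j i * v i +
    fderivWithin ℝ (c j) (piQuadrant ι) z₀ (fun i => z₀ i * v i) / c j z₀ = b j

namespace MonomialSystem

variable {ι J κ : Type} [Fintype ι] [Fintype κ] (D : MonomialSystem ι J κ)

def sol : Set (ι → ℝ) := {z | (∀ i, 0 < z i) ∧ ∀ j, D.c j z * ∏ i, z i ^ D.γ j i = 1}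

theorem sol_subset : D.sol ⊆ piQuadrant ι := fun _ hz i => (hz.1 i).le

theorem closure_sol_subset : closure D.sol ⊆ piQuadrant ι :=
  closure_minimal D.sol_subset (isClosed_piQuadrant ι)

theorem z₀_mem : D.z₀ ∈ piQuadrant ι := D.nonneg

theorem neBot : (𝓝[D.sol] D.z₀).NeBot := mem_closure_iff_nhdsWithin_neBot.1 D.mem_closure

theorem sum_eq (j : J) (v : ι → ℝ) :
    ∑ i : {i // D.z₀ i = 0}, D.γ j i * v i = ∑ i, D.γ j i * v i := by
  classical
  rw [← Finset.sum_subtype (Finset.univ.filter fun i => D.z₀ i = 0) (by simp)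
    (fun i => (D.γ j i : ℝ) * v i), Finset.sum_filter]
  refine Finset.sum_congr rfl fun i _ => ?_
  split_ifs with h
  · rfl
  · simp [D.γ_eq_zero j i h]

def mat : (ι → ℝ) →ₗ[ℝ] (J → ℝ) where
  toFun v j := ∑ i, D.γ j i * v i
  map_add' v w := by ext j; simp [mul_add, Finset.sum_add_distrib]
  map_smul' t v := by
    ext j
    simp only [Pi.smul_apply, smul_eq_mul, RingHom.id_apply, Finset.mul_sum]
    exact Finset.sum_congr rfl fun i _ => by ring

theorem mat_apply (v : ι → ℝ) (j : J) : D.mat v j = ∑ i, D.γ j i * v i := rfl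

theorem c_pos {z : ι → ℝ} (hz : z ∈ D.sol) (j : J) : 0 < D.c j z := by
  have h1 : 0 < ∏ i, z i ^ D.γ j i := Finset.prod_pos fun i _ => zpow_pos (hz.1 i) _
  have h2 := hz.2 j
  by_contra h
  nlinarith

theorem mat_log {z : ι → ℝ} (hz : z ∈ D.sol) :
    D.mat (fun i => Real.log (z i)) = fun j => - Real.log (D.c j z) := by
  ext j
  have h1 := congrArg Real.log (hz.2 j)
  have h2 : ∀ i, z i ^ D.γ j i ≠ 0 := fun i => (zpow_pos (hz.1 i) _).ne'
  rw [Real.log_mul (D.c_pos hz j).ne' (Finset.prod_ne_zero_iff.2 fun i _ => h2 i),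
    Real.log_prod fun i _ => h2 i, Real.log_one] at h1
  simp only [Real.log_zpow] at h1
  rw [mat_apply]
  linarith

theorem mat_M (p : κ → ℝ) : D.mat (fun i => ∑ k, D.M i k * p k) = 0 := by
  ext j
  rw [mat_apply, ← D.sum_eq]
  have h := D.basis.ker j
  simp only [Finset.mul_sum]
  rw [Finset.sum_comm, Pi.zero_apply]
  refine Finset.sum_eq_zero fun k _ => ?_
  have h1 : ((∑ i : {i // D.z₀ i = 0}, D.γ j i * (D.M i k : ℤ) : ℤ) : ℝ) = 0 := by
    exact_mod_cast h k
  push_cast at h1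
  calc _ = (∑ i : {i // D.z₀ i = 0}, (D.γ j i : ℝ) * (D.M i k)) * p k := by
        rw [Finset.sum_mul]; exact Finset.sum_congr rfl fun i _ => by ring
    _ = 0 := by rw [h1, zero_mul]

theorem tendsto_log_c (j : J) :
    Tendsto (fun z => Real.log (D.c j z)) (𝓝[D.sol] D.z₀) (𝓝 (Real.log (D.c j D.z₀))) :=
  (((D.smooth j).log D.z₀_mem (D.pos j).ne').continuousWithinAt D.z₀_mem).tendsto.mono_left
    (nhdsWithin_mono _ D.sol_subset)

variable [Fintype J]

theorem exists_pos_ker : ∃ n₀ : {i // D.z₀ i = 0} → ℕ, (∀ i, 0 < n₀ i) ∧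
    ∀ j, ∑ i : {i // D.z₀ i = 0}, D.γ j i * (n₀ i : ℤ) = 0 := by
  have := D.neBot
  refine exists_pos_mem_ker (l := 𝓝[D.sol] D.z₀) _ (fun z i => - Real.log (z i)) ?_
    (fun j => Real.log (D.c j D.z₀)) ?_
  · intro i
    refine tendsto_neg_atBot_atTop.comp (Real.tendsto_log_nhdsGT_zero.comp ?_)
    refine tendsto_nhdsWithin_iff.2 ⟨?_, ?_⟩
    · have h := ((continuous_apply i.1).tendsto D.z₀).mono_left
        (nhdsWithin_le_nhds (s := D.sol))
      rwa [i.2] at h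
    · filter_upwards [self_mem_nhdsWithin] with z hz using hz.1 i
  · intro j
    refine (D.tendsto_log_c j).congr' ?_
    filter_upwards [self_mem_nhdsWithin] with z hz
    have h1 := congrFun (D.mat_log hz) j
    rw [mat_apply, ← D.sum_eq] at h1
    simp only [mul_neg, Finset.sum_neg_distrib]
    rw [h1, neg_neg]

/-- Solving the linear equations: the entries `v (r k)` are free parameters, and the remaining part
of `v` is determined by `γ v`. -/
theorem exists_section : ∃ (r : κ → ι) (L : (J → ℝ) →ₗ[ℝ] (ι → ℝ)), (∀ k, D.z₀ (r k) = 0) ∧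
    (∀ k, D.M (r k) k ≠ 0) ∧ (∀ k k', k' ≠ k → D.M (r k) k' = 0) ∧ (∀ b k, L b (r k) = 0) ∧
    ∀ v i, D.z₀ i = 0 → v i = ∑ k, (D.M i k : ℝ) * (v (r k) / D.M (r k) k) + L (D.mat v) i := by
  obtain ⟨n₀, hn₀, hker⟩ := D.exists_pos_ker
  choose r hr0 hr using D.basis.exists_row
  have hspan := fun v => D.basis.eq_real hr0 hr hn₀ hker v
  let E₀ : Submodule ℝ (ι → ℝ) :=
    { carrier := {v | (∀ i, D.z₀ i ≠ 0 → v i = 0) ∧ ∀ k, v (r k) = 0}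
      zero_mem' := ⟨fun _ _ => rfl, fun _ => rfl⟩
      add_mem' := fun {a b} ha hb => ⟨fun i hi => by simp [ha.1 i hi, hb.1 i hi],
        fun k => by simp [ha.2 k, hb.2 k]⟩
      smul_mem' := fun t a ha => ⟨fun i hi => by simp [ha.1 i hi], fun k => by simp [ha.2 k]⟩ }
  have hinj : (D.mat ∘ₗ E₀.subtype).ker = ⊥ := by
    refine LinearMap.ker_eq_bot'.2 fun v hv => Subtype.ext (funext fun i => ?_)
    by_cases hi : D.z₀ i = 0
    · have h1 := hspan (fun i => v.1 i) (fun j => by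
        rw [D.sum_eq j v.1]; exact congrFun hv j) ⟨i, hi⟩
      simp only [v.2.2, zero_div, mul_zero, Finset.sum_const_zero] at h1
      exact h1
    · exact v.2.1 i hi
  obtain ⟨L₀, hL₀⟩ := LinearMap.exists_leftInverse_of_injective _ hinj
  refine ⟨fun k => r k, E₀.subtype ∘ₗ L₀, fun k => (r k).2, hr0, hr, fun b k => (L₀ b).2.2 k,
    fun v i hi => ?_⟩
  classical
  set p : κ → ℝ := fun k => v (r k) / D.M (r k) k with hp
  let w : ι → ℝ := fun i => if D.z₀ i = 0 then v i - ∑ k, D.M i k * p k else 0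
  have hw : w ∈ E₀ := by
    refine ⟨fun i hi => if_neg hi, fun k => ?_⟩
    have h1 := IsKernelBasis.apply_row (M := fun (i : {i // D.z₀ i = 0}) k => D.M i k) hr p k
    have h2 : (D.M (r k) k : ℝ) ≠ 0 := by exact_mod_cast hr0 k
    simp only [w, if_pos (r k).2]
    rw [h1, hp]
    field_simp
    simp
  have hmat : D.mat w = D.mat v := by
    have h1 : D.mat w = D.mat (v - fun i => ∑ k, D.M i k * p k) := by
      ext j
      rw [mat_apply, mat_apply, ← D.sum_eq, ← D.sum_eq]
      refine Finset.sum_congr rfl fun i _ => ?_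
      simp [w, i.2]
    rw [h1, map_sub, mat_M, sub_zero]
  have h3 := congrArg Subtype.val (LinearMap.congr_fun hL₀ ⟨w, hw⟩)
  have h4 : (L₀ (D.mat v) : ι → ℝ) = w := by rw [← hmat]; exact h3
  change v i = _ + (L₀ (D.mat v) : ι → ℝ) i
  rw [h4]
  simp [w, hi, hp]

theorem exists_M_ne_zero {i : ι} (hi : D.z₀ i = 0) : ∃ k, D.M i k ≠ 0 := by
  obtain ⟨n₀, hn₀, hker⟩ := D.exists_pos_ker
  obtain ⟨p, hp⟩ := D.basis.span n₀ hker
  by_contra! h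
  have := hn₀ ⟨i, hi⟩
  rw [hp] at this
  simp [h] at this

end MonomialSystem

/-- A surjective linear map is the first component of an isomorphism. -/
theorem exists_equiv_prod_of_surjective {E F : Type*} [AddCommGroup E] [Module ℝ E]
    [FiniteDimensional ℝ E] [AddCommGroup F] [Module ℝ F] [FiniteDimensional ℝ F]
    (f : E →ₗ[ℝ] F) (hf : Function.Surjective f) :
    ∃ (l : ℕ) (π : E →ₗ[ℝ] (Fin l → ℝ)) (e : E ≃ₗ[ℝ] F × (Fin l → ℝ)), (∀ x, e x = (f x, π x)) ∧
      Module.finrank ℝ E = Module.finrank ℝ F + l := by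
  obtain ⟨q, hq⟩ := Submodule.exists_isCompl f.ker
  let b := (Module.finBasis ℝ f.ker).equivFun
  let π : E →ₗ[ℝ] (Fin (Module.finrank ℝ f.ker) → ℝ) :=
    b.toLinearMap ∘ₗ f.ker.projectionOnto q hq
  have hπ : π.range = ⊤ := LinearMap.range_eq_top.2
    (b.surjective.comp (Submodule.projectionOnto_surjective hq))
  have hker : π.ker = q := by
    rw [LinearEquiv.ker_comp, Submodule.ker_projectionOnto]
  refine ⟨_, π, LinearMap.equivProdOfSurjectiveOfIsCompl f π (LinearMap.range_eq_top.2 hf) hπ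
    (by rw [hker]; exact hq), fun x => rfl, ?_⟩
  have := LinearMap.finrank_range_add_finrank_ker f
  rw [LinearMap.range_eq_top.2 hf, finrank_top] at this
  exact this.symm

end

noncomputable section

namespace MonomialSystem

variable {ι J κ : Type} [Fintype ι] [Fintype κ] (D : MonomialSystem ι J κ)

/-- The data of `MonomialSystem.exists_section`. -/
structure IsSection (r : κ → ι) (L : (J → ℝ) →ₗ[ℝ] (ι → ℝ)) : Prop where
  z₀_row : ∀ k, D.z₀ (r k) = 0
  M_row : ∀ k, D.M (r k) k ≠ 0
  M_row' : ∀ k k', k' ≠ k → D.M (r k) k' = 0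
  apply_row : ∀ b k, L b (r k) = 0
  decomp : ∀ v i, D.z₀ i = 0 →
    v i = ∑ k, (D.M i k : ℝ) * (v (r k) / D.M (r k) k) + L (D.mat v) i

/-- The logarithms of the cofactors of the monomials in a monomial parametrization. -/
def logPart (L : (J → ℝ) →ₗ[ℝ] (ι → ℝ)) (z : ι → ℝ) (i : ι) : ℝ :=
  open Classical in
  if D.z₀ i = 0 then L (fun j => - Real.log (D.c j z)) i else Real.log (z i)

/-- The monomials with exponents `M` and cofactors `exp s`. -/
def mono (t : κ → ℝ) (s : ι → ℝ) (i : ι) : ℝ := (∏ k, t k ^ D.M i k) * Real.exp (s i)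

def root (r : κ → ι) (z : ι → ℝ) (k : κ) : ℝ := z (r k) ^ (D.M (r k) k : ℝ)⁻¹

theorem mat_congr {v w : ι → ℝ} (h : ∀ i, D.z₀ i = 0 → v i = w i) : D.mat v = D.mat w := by
  ext j
  rw [mat_apply, mat_apply, ← D.sum_eq, ← D.sum_eq]
  exact Finset.sum_congr rfl fun i _ => by rw [h i i.2]

theorem mono_nonneg {t : κ → ℝ} (ht : t ∈ piQuadrant κ) (s : ι → ℝ) : D.mono t s ∈ piQuadrant ι :=
  fun _ => mul_nonneg (Finset.prod_nonneg fun k _ => pow_nonneg (ht k) _) (Real.exp_pos _).le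

theorem mono_pos {t : κ → ℝ} (ht : ∀ k, 0 < t k) (s : ι → ℝ) (i : ι) : 0 < D.mono t s i :=
  mul_pos (Finset.prod_pos fun k _ => pow_pos (ht k) _) (Real.exp_pos _)

theorem continuous_root (r : κ → ι) : Continuous (D.root r) :=
  continuous_pi fun k => (continuous_apply (r k)).rpow_const fun _ => Or.inr (by positivity)

theorem root_mem (r : κ → ι) {z : ι → ℝ} (hz : z ∈ piQuadrant ι) : D.root r z ∈ piQuadrant κ :=
  fun k => Real.rpow_nonneg (hz (r k)) _

section

variable {r : κ → ι} {L : (J → ℝ) →ₗ[ℝ] (ι → ℝ)} (h : D.IsSection r L)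

include h

theorem logPart_row (z : ι → ℝ) (k : κ) : D.logPart L z (r k) = 0 := by
  rw [logPart, if_pos (h.z₀_row k), h.apply_row]

theorem mat_logPart {z : ι → ℝ} (hz : z ∈ D.sol) :
    D.mat (D.logPart L z) = fun j => - Real.log (D.c j z) := by
  have h1 := D.mat_log hz
  have h2 : D.mat (fun i => Real.log (z i)) = D.mat ((fun i => ∑ k, (D.M i k : ℝ) *
      (Real.log (z (r k)) / D.M (r k) k)) + D.logPart L z) := by
    refine D.mat_congr fun i hi => ?_
    rw [h.decomp (fun i => Real.log (z i)) i hi, h1, Pi.add_apply, logPart, if_pos hi]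
  rw [h1, map_add, mat_M, zero_add] at h2
  exact h2.symm

theorem root_z₀ : D.root r D.z₀ = 0 := by
  ext k
  have : (D.M (r k) k : ℝ)⁻¹ ≠ 0 := inv_ne_zero (by exact_mod_cast h.M_row k)
  simp [root, h.z₀_row, Real.zero_rpow this]

theorem mono_root {z : ι → ℝ} (hz : z ∈ D.sol) : D.mono (D.root r z) (D.logPart L z) = z := by
  ext i
  have hroot : ∀ k, 0 < D.root r z k := fun k => Real.rpow_pos_of_pos (hz.1 _) _
  by_cases hi : D.z₀ i = 0
  · refine Real.log_injOn_pos (D.mono_pos hroot _ i) (hz.1 i) ?_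
    rw [mono, Real.log_mul (Finset.prod_pos fun k _ => pow_pos (hroot k) _).ne' (Real.exp_pos _).ne',
      Real.log_exp, Real.log_prod fun k _ => (pow_pos (hroot k) _).ne',
      h.decomp (fun i => Real.log (z i)) i hi, D.mat_log hz, logPart, if_pos hi]
    congr 1
    refine Finset.sum_congr rfl fun k _ => ?_
    rw [Real.log_pow, root, Real.log_rpow (hz.1 _)]
    ring
  · simp [mono, D.M_eq_zero i _ hi, logPart, hi, Real.exp_log (hz.1 i)]

theorem root_mono {t : κ → ℝ} (ht : t ∈ piQuadrant κ) {s : ι → ℝ} (hs : ∀ k, s (r k) = 0) :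
    D.root r (D.mono t s) = t := by
  ext k
  have h1 : ∏ k', t k' ^ D.M (r k) k' = t k ^ D.M (r k) k :=
    Finset.prod_eq_single k (fun k' _ hk' => by simp [h.M_row' k k' hk']) (by simp)
  rw [root, mono, h1, hs, Real.exp_zero, mul_one, Real.pow_rpow_inv_natCast (ht k) (h.M_row k)]

theorem eq_of_mat {v : ι → ℝ} (hv : ∀ k, v (r k) = 0) {i : ι} (hi : D.z₀ i = 0) :
    L (D.mat v) i = v i := by
  have := h.decomp v i hi
  simpa [hv] using this.symm

end

theorem smoothGerm_logPart [Fintype J] (L : (J → ℝ) →ₗ[ℝ] (ι → ℝ)) :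
    SmoothGerm (piQuadrant ι) D.z₀ (D.logPart L) := by
  refine SmoothGerm.pi fun i => ?_
  by_cases hi : D.z₀ i = 0
  · simp only [logPart, if_pos hi]
    have h1 : SmoothGerm (piQuadrant ι) D.z₀ (fun z j => - Real.log (D.c j z)) :=
      SmoothGerm.pi fun j => ((D.smooth j).log D.z₀_mem (D.pos j).ne').neg
    exact h1.comp_contDiff (g := fun b => L b i)
      ((LinearMap.toContinuousLinearMap ((LinearMap.proj i).comp L)).contDiff)
  · simp only [logPart, if_neg hi]
    exact (SmoothGerm.of_contDiff (contDiff_apply ℝ ℝ i)).log D.z₀_mem hi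

theorem smoothGerm_mono {Q : Set ((κ → ℝ) × (ι → ℝ))} {x : (κ → ℝ) × (ι → ℝ)} :
    SmoothGerm Q x (fun x => D.mono x.1 x.2) := by
  refine SmoothGerm.pi fun i => ?_
  have h1 : ∀ k, ContDiff ℝ ∞ (fun x : (κ → ℝ) × (ι → ℝ) => x.1 k) := fun k =>
    (contDiff_apply ℝ ℝ k).comp contDiff_fst
  have h2 : ∀ k, ContDiff ℝ ∞ (fun x : (κ → ℝ) × (ι → ℝ) => x.2 k) := fun k =>
    (contDiff_apply ℝ ℝ k).comp contDiff_snd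
  exact (SmoothGerm.prod _ fun k _ => (SmoothGerm.of_contDiff (h1 k)).pow _).mul
    (SmoothGerm.of_contDiff (h2 i)).exp

/-- The logarithmic differentials of the equations. -/
def logDiff : (ι → ℝ) →ₗ[ℝ] (J → ℝ) :=
  D.mat + LinearMap.pi fun j => (D.c j D.z₀)⁻¹ •
    ((fderivWithin ℝ (D.c j) (piQuadrant ι) D.z₀).comp (ContinuousLinearMap.pi fun i =>
      D.z₀ i • (ContinuousLinearMap.proj i : (ι → ℝ) →L[ℝ] ℝ))).toLinearMap

theorem logDiff_apply (v : ι → ℝ) (j : J) : D.logDiff v j = ∑ i, D.γ j i * v i +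
    fderivWithin ℝ (D.c j) (piQuadrant ι) D.z₀ (fun i => D.z₀ i * v i) / D.c j D.z₀ := by
  rw [div_eq_inv_mul]
  rfl

theorem logDiff_of_support {v : ι → ℝ} (hv : ∀ i, D.z₀ i ≠ 0 → v i = 0) :
    D.logDiff v = D.mat v := by
  ext j
  have : (fun i => D.z₀ i * v i) = 0 := by
    ext i
    by_cases hi : D.z₀ i = 0
    · simp [hi]
    · simp [hv i hi]
  rw [logDiff_apply, this]
  simp [mat_apply]

theorem mono_zero [Fintype J] (s : ι → ℝ) (i : ι) :
    D.mono 0 s i = open Classical in if D.z₀ i = 0 then 0 else Real.exp (s i) := by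
  split_ifs with hi
  · obtain ⟨k, hk⟩ := D.exists_M_ne_zero hi
    rw [mono, Finset.prod_eq_zero (Finset.mem_univ k) (by simp [hk]), zero_mul]
  · simp [mono, D.M_eq_zero i _ hi]

theorem mono_zero_logPart [Fintype J] (L : (J → ℝ) →ₗ[ℝ] (ι → ℝ)) : D.mono 0 (D.logPart L D.z₀) = D.z₀ := by
  ext i
  rw [mono_zero]
  split_ifs with hi
  · exact hi.symm
  · rw [logPart, if_neg hi, Real.exp_log (lt_of_le_of_ne (D.nonneg i) (Ne.symm hi))]

theorem hasFDerivAt_mono_zero [Fintype J] (L : (J → ℝ) →ₗ[ℝ] (ι → ℝ)) :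
    HasFDerivAt (D.mono 0) (ContinuousLinearMap.pi fun i =>
      D.z₀ i • (ContinuousLinearMap.proj i : (ι → ℝ) →L[ℝ] ℝ)) (D.logPart L D.z₀) := by
  refine hasFDerivAt_pi.2 fun i => ?_
  by_cases hi : D.z₀ i = 0
  · have : (fun s => D.mono 0 s i) = fun _ => 0 := by
      ext s; rw [mono_zero, if_pos hi]
    rw [this, hi, zero_smul]
    exact hasFDerivAt_const _ _
  · have : (fun s => D.mono 0 s i) = fun s => Real.exp (s i) := by
      ext s; rw [mono_zero, if_neg hi]
    rw [this]
    have h1 := (hasFDerivAt_apply (𝕜 := ℝ) i (D.logPart L D.z₀)).exp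
    rwa [logPart, if_neg hi, Real.exp_log (lt_of_le_of_ne (D.nonneg i) (Ne.symm hi))] at h1

theorem logDiff_prod_surjective {r : κ → ι} {L : (J → ℝ) →ₗ[ℝ] (ι → ℝ)} (h : D.IsSection r L) :
    Function.Surjective (D.logDiff.prod (LinearMap.funLeft ℝ ℝ r)) := by
  rintro ⟨a, b⟩
  obtain ⟨v, hv⟩ := D.surj a
  set p : κ → ℝ := fun k => (b k - v (r k)) / D.M (r k) k with hp
  refine ⟨v + fun i => ∑ k, D.M i k * p k, ?_⟩
  have h1 : D.logDiff (fun i => ∑ k, D.M i k * p k) = 0 := by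
    rw [D.logDiff_of_support fun i hi => by simp [D.M_eq_zero i _ hi], mat_M]
  ext x
  · change D.logDiff (v + _) x = a x
    rw [map_add, h1, add_zero]
    exact (D.logDiff_apply v x).trans (hv x)
  · have h2 : ∑ k, (D.M (r x) k : ℝ) * p k = D.M (r x) x * p x :=
      Finset.sum_eq_single x (fun k _ hk => by simp [h.M_row' x k hk]) (by simp)
    have h3 : (D.M (r x) x : ℝ) ≠ 0 := by exact_mod_cast h.M_row x
    change v (r x) + ∑ k, (D.M (r x) k : ℝ) * p k = b x
    rw [h2, hp]
    field_simp
    ring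

/-- The equations for the cofactors, completed to a local coordinate system by `π`. -/
def eqs {l : ℕ} (r : κ → ι) (π : (ι → ℝ) →ₗ[ℝ] (Fin l → ℝ)) (x : (κ → ℝ) × (ι → ℝ)) :
    ((J → ℝ) × (κ → ℝ)) × (Fin l → ℝ) :=
  ((fun j => Real.log (D.c j (D.mono x.1 x.2)) + D.mat x.2 j, fun k => x.2 (r k)), π x.2)

theorem smoothGerm_eqs [Fintype J] {l : ℕ} (r : κ → ι) (π : (ι → ℝ) →ₗ[ℝ] (Fin l → ℝ))
    (L : (J → ℝ) →ₗ[ℝ] (ι → ℝ)) :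
    SmoothGerm (piQuadrant κ ×ˢ univ) (0, D.logPart L D.z₀) (D.eqs r π) := by
  have h0 : ((0 : κ → ℝ), D.logPart L D.z₀) ∈ piQuadrant κ ×ˢ (univ : Set (ι → ℝ)) :=
    ⟨fun _ => le_rfl, mem_univ _⟩
  have hlin : ∀ {F : Type} [NormedAddCommGroup F] [NormedSpace ℝ F] (f : (ι → ℝ) →ₗ[ℝ] F),
      SmoothGerm (piQuadrant κ ×ˢ univ) ((0 : κ → ℝ), D.logPart L D.z₀)
        (fun x : (κ → ℝ) × (ι → ℝ) => f x.2) := fun f =>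
    SmoothGerm.of_contDiff ((LinearMap.toContinuousLinearMap f).contDiff.comp contDiff_snd)
  have hm := D.smoothGerm_mono (Q := piQuadrant κ ×ˢ univ) (x := (0, D.logPart L D.z₀))
  have hmz : D.mono (0, D.logPart L D.z₀).1 (0, D.logPart L D.z₀).2 = D.z₀ :=
    D.mono_zero_logPart L
  refine ((SmoothGerm.pi fun j => ?_).prodMk (SmoothGerm.pi fun k => ?_)).prodMk (hlin π)
  · refine SmoothGerm.add (SmoothGerm.log h0 (SmoothGerm.comp (Q' := piQuadrant ι) ?_ hm ?_) ?_) ?_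
    · rw [hmz]; exact D.smooth j
    · refine tendsto_nhdsWithin_iff.2 ⟨(hm.continuousWithinAt h0).tendsto, ?_⟩
      filter_upwards [self_mem_nhdsWithin] with x hx using D.mono_nonneg hx.1 _
    · rw [hmz]; exact (D.pos j).ne'
    · exact hlin ((LinearMap.proj j).comp D.mat)
  · exact hlin (LinearMap.proj (r k))

theorem hasFDerivAt_eqs [Fintype J] {l : ℕ} (r : κ → ι) (π : (ι → ℝ) →ₗ[ℝ] (Fin l → ℝ))
    (L : (J → ℝ) →ₗ[ℝ] (ι → ℝ)) : HasFDerivAt (fun s => D.eqs r π (0, s))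
      (LinearMap.toContinuousLinearMap ((D.logDiff.prod (LinearMap.funLeft ℝ ℝ r)).prod π))
      (D.logPart L D.z₀) := by
  have h2 := (LinearMap.toContinuousLinearMap (LinearMap.funLeft ℝ ℝ r)).hasFDerivAt
    (x := D.logPart L D.z₀)
  have h3 := (LinearMap.toContinuousLinearMap π).hasFDerivAt (x := D.logPart L D.z₀)
  have h1 : ∀ j, HasFDerivAt (fun s => Real.log (D.c j (D.mono 0 s)) + D.mat s j)
      (LinearMap.toContinuousLinearMap ((LinearMap.proj j).comp D.logDiff))
      (D.logPart L D.z₀) := by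
    intro j
    have h4 := (((D.smooth j).self_of_mem D.z₀_mem).differentiableWithinAt
      (by simp)).hasFDerivWithinAt.comp_hasFDerivAt_of_eq _ (D.hasFDerivAt_mono_zero L)
      (Eventually.of_forall fun s => D.mono_nonneg (fun _ => le_rfl) s) (D.mono_zero_logPart L).symm
    have h5 := h4.log (by
      change D.c j (D.mono 0 _) ≠ 0
      rw [D.mono_zero_logPart L]; exact (D.pos j).ne')
    have h6 := (LinearMap.toContinuousLinearMap ((LinearMap.proj j).comp D.mat)).hasFDerivAt
      (x := D.logPart L D.z₀)
    refine (h5.add h6).congr_fderiv ?_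
    ext1 v
    change (D.c j (D.mono 0 (D.logPart L D.z₀)))⁻¹ * (fderivWithin ℝ (D.c j) (piQuadrant ι) D.z₀
      (fun i => D.z₀ i * v i)) + D.mat v j = D.logDiff v j
    rw [D.mono_zero_logPart L, logDiff_apply, mat_apply]
    ring
  exact ((hasFDerivAt_pi.2 h1).prodMk h2).prodMk h3

end MonomialSystem

end

noncomputable section

namespace MonomialSystem

variable {ι J κ : Type} [Fintype ι] [Fintype κ] (D : MonomialSystem ι J κ)

/-- A local parametrization of the closure of the set of solutions by a quadrant. -/
structure Resolution where
  n : ℕ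
  T : (ι → ℝ) → EuclideanSpace ℝ (Fin n)
  H : EuclideanSpace ℝ (Fin n) → ι → ℝ
  A : ι → Fin n → ℕ
  emb : κ → Fin n
  emb_inj : Function.Injective emb
  mem : T D.z₀ ∈ quadrant n
  zero_iff : ∀ b, T D.z₀ b = 0 ↔ ∃ k, emb k = b
  A_emb : ∀ i k, A i (emb k) = D.M i k
  monoGerm : ∀ i, MonoGerm (T D.z₀) (fun x => H x i) (A i)
  mem_sol : ∀ᶠ x in 𝓝[openQuadrant n] (T D.z₀), H x ∈ D.sol
  right_inv : ∀ᶠ z in 𝓝[closure D.sol] D.z₀,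
    H (T z) = z ∧ T z ∈ quadrant n ∧ ContinuousWithinAt T (closure D.sol) z
  left_inv : ∀ᶠ x in 𝓝[quadrant n] (T D.z₀), T (H x) = x
  lift : ∀ᶠ z in 𝓝[piQuadrant ι] D.z₀, ∀ (N : ℕ) (y₀ : EuclideanSpace ℝ (Fin N))
    (g : EuclideanSpace ℝ (Fin N) → ι → ℝ), y₀ ∈ quadrant N → g y₀ = z →
    (∀ i, ∃ α, MonoGerm y₀ (fun y => g y i) α) → (∀ᶠ y in 𝓝[openQuadrant N] y₀, g y ∈ D.sol) →
    ∀ b, ∃ α, MonoGerm y₀ (fun y => T (g y) b) α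
  exists_eq_pow : ∀ b, ∃ d : ℕ, d ≠ 0 ∧ ∃ (a : (ι → ℝ) → ℝ) (β : ι → ℕ),
    SmoothGerm (piQuadrant ι) D.z₀ a ∧ 0 < a D.z₀ ∧
    ∀ᶠ x in 𝓝[quadrant n] (T D.z₀), a (H x) * ∏ i, H x i ^ β i = x b ^ d

/-- The exponents of a family of monomials solving the equations satisfy `γ α = 0`. -/
theorem sum_exponent_eq_zero {N : ℕ} {y₀ : EuclideanSpace ℝ (Fin N)}
    {g : EuclideanSpace ℝ (Fin N) → ι → ℝ} (hy₀ : y₀ ∈ quadrant N) {α : ι → Fin N → ℕ}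
    (hg : ∀ i, MonoGerm y₀ (fun y => g y i) (α i))
    (hsol : ∀ᶠ y in 𝓝[openQuadrant N] y₀, g y ∈ D.sol)
    {j : J} (hc : SmoothGerm (piQuadrant ι) (g y₀) (D.c j)) (hpos : 0 < D.c j (g y₀))
    {b : Fin N} (hb : y₀ b = 0) : ∑ i, D.γ j i * (α i b : ℤ) = 0 := by
  have hgs : SmoothGerm (quadrant N) y₀ g := SmoothGerm.pi fun i => (hg i).smoothGerm
  have hgt : Tendsto g (𝓝[quadrant N] y₀) (𝓝[piQuadrant ι] (g y₀)) := by
    refine tendsto_nhdsWithin_iff.2 ⟨(hgs.continuousWithinAt hy₀).tendsto, ?_⟩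
    filter_upwards [eventually_all.2 fun i => (hg i).nonneg] with y hy using hy
  have h1 : MonoGerm y₀ (fun y => D.c j (g y)) 0 :=
    MonoGerm.of_smoothGerm_pos hy₀ (hc.comp hgs hgt) hpos
  have h2 := h1.mul (MonoGerm.prod Finset.univ fun i _ => (hg i).pow (D.γ j i).toNat)
  have h3 := MonoGerm.prod Finset.univ fun i _ => (hg i).pow (-D.γ j i).toNat
  have h4 : (fun y => D.c j (g y) * ∏ i, g y i ^ (D.γ j i).toNat) =ᶠ[𝓝[quadrant N] y₀]
      fun y => ∏ i, g y i ^ (-D.γ j i).toNat := by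
    refine eventuallyEq_of_openQuadrant ?_ ?_ ?_
    · filter_upwards [h2.smoothGerm] with y hy using hy.continuousWithinAt
    · filter_upwards [h3.smoothGerm] with y hy using hy.continuousWithinAt
    · filter_upwards [hsol] with y hy
      have h5 : ∏ i, g y i ^ (D.γ j i).toNat =
          (∏ i, g y i ^ D.γ j i) * ∏ i, g y i ^ (-D.γ j i).toNat := by
        rw [← Finset.prod_mul_distrib]
        refine Finset.prod_congr rfl fun i _ => ?_
        rw [← zpow_natCast, ← zpow_natCast, ← zpow_add₀ (hy.1 i).ne']
        congr 1
        omega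
      rw [h5, ← mul_assoc, hy.2 j, one_mul]
  have h6 := h2.exponent_unique hy₀ (h3.congr h4) hb
  simp only [zero_add, Finset.sum_apply, Pi.smul_apply, smul_eq_mul] at h6
  have h7 : ∑ i, D.γ j i * (α i b : ℤ) = ((∑ i, (D.γ j i).toNat * α i b : ℕ) : ℤ) -
      ((∑ i, (-D.γ j i).toNat * α i b : ℕ) : ℤ) := by
    push_cast
    rw [← Finset.sum_sub_distrib]
    refine Finset.sum_congr rfl fun i _ => ?_
    rw [← sub_mul]
    congr 1
    omega
  rw [h7, h6, sub_self]

variable {m : ℕ} (D : MonomialSystem ι J (Fin m)) {r : Fin m → ι} {L : (J → ℝ) →ₗ[ℝ] (ι → ℝ)}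
  {l : ℕ} {π : (ι → ℝ) →ₗ[ℝ] (Fin l → ℝ)}

/-- The monomial coordinates of solutions have smooth roots. -/
theorem monoGerm_root (h : D.IsSection r L) {N : ℕ} {y₀ : EuclideanSpace ℝ (Fin N)}
    {g : EuclideanSpace ℝ (Fin N) → ι → ℝ} (hy₀ : y₀ ∈ quadrant N)
    (hg : ∀ i, ∃ α, MonoGerm y₀ (fun y => g y i) α)
    (hsol : ∀ᶠ y in 𝓝[openQuadrant N] y₀, g y ∈ D.sol)
    (hc : ∀ j, SmoothGerm (piQuadrant ι) (g y₀) (D.c j)) (hpos : ∀ j, 0 < D.c j (g y₀))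
    (hne : ∀ i, D.z₀ i ≠ 0 → g y₀ i ≠ 0) (k : Fin m) :
    ∃ α, MonoGerm y₀ (fun y => D.root r (g y) k) α := by
  choose α hα using hg
  have h1 : ∀ b, y₀ b = 0 → ∃ p : ℕ, α (r k) b = D.M (r k) k * p := by
    intro b hb
    obtain ⟨p, hp⟩ := D.basis.span (fun i => α i b) (fun j => by
      have h2 := D.sum_exponent_eq_zero hy₀ hα hsol (hc j) (hpos j) hb
      classical
      rw [← h2, ← Finset.sum_subtype (Finset.univ.filter fun i => D.z₀ i = 0) (by simp)
        (fun i => D.γ j i * (α i b : ℤ)), Finset.sum_filter]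
      refine Finset.sum_congr rfl fun i _ => ?_
      split_ifs with hi
      · rfl
      · simp [(hα i).exponent_eq_zero hy₀ (hne i hi) hb])
    refine ⟨p k, (hp ⟨r k, h.z₀_row k⟩).trans ?_⟩
    exact Finset.sum_eq_single k (fun k' _ hk' => by simp [h.M_row' k k' hk']) (by simp)
  choose! p hp using h1
  exact ⟨p, MonoGerm.rpow_inv hy₀ (h.M_row k) ((hα (r k)).normalize hy₀ fun b hb => by
    rw [hp b hb]; rfl)⟩

def fwd (r : Fin m → ι) (L : (J → ℝ) →ₗ[ℝ] (ι → ℝ)) (π : (ι → ℝ) →ₗ[ℝ] (Fin l → ℝ)) (z : ι → ℝ) :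
    EuclideanSpace ℝ (Fin (m + l)) :=
  WithLp.toLp 2 (Fin.append (D.root r z) (π (D.logPart L z) - π (D.logPart L D.z₀) + 1))

theorem fwd_castAdd (z : ι → ℝ) (k : Fin m) :
    D.fwd r L π z (Fin.castAdd l k) = D.root r z k := by
  simp [fwd]

theorem fwd_natAdd (z : ι → ℝ) (a : Fin l) : D.fwd r L π z (Fin.natAdd m a) =
    π (D.logPart L z) a - π (D.logPart L D.z₀) a + 1 := by
  simp [fwd]

theorem smoothGerm_fwd_natAdd [Fintype J] (a : Fin l) :
    SmoothGerm (piQuadrant ι) D.z₀ (fun z => D.fwd r L π z (Fin.natAdd m a)) := by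
  simp only [fwd_natAdd]
  refine SmoothGerm.add (SmoothGerm.sub ?_ (SmoothGerm.const _)) (SmoothGerm.const _)
  exact (D.smoothGerm_logPart L).comp_contDiff (g := fun s => π s a)
    (LinearMap.toContinuousLinearMap ((LinearMap.proj a).comp π)).contDiff

theorem fwd_natAdd_z₀ (a : Fin l) : D.fwd r L π D.z₀ (Fin.natAdd m a) = 1 := by
  rw [fwd_natAdd]; ring

theorem fwd_castAdd_z₀ (h : D.IsSection r L) (k : Fin m) :
    D.fwd r L π D.z₀ (Fin.castAdd l k) = 0 := by
  rw [fwd_castAdd, D.root_z₀ h]; rfl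

theorem fwd_z₀_mem (h : D.IsSection r L) : D.fwd r L π D.z₀ ∈ quadrant (m + l) := by
  intro b
  induction b using Fin.addCases with
  | left k => rw [D.fwd_castAdd_z₀ h]
  | right a => rw [D.fwd_natAdd_z₀]; exact zero_le_one

theorem lift_fwd [Fintype J] (h : D.IsSection r L) : ∀ᶠ z in 𝓝[piQuadrant ι] D.z₀, ∀ (N : ℕ)
    (y₀ : EuclideanSpace ℝ (Fin N)) (g : EuclideanSpace ℝ (Fin N) → ι → ℝ), y₀ ∈ quadrant N →
    g y₀ = z → (∀ i, ∃ α, MonoGerm y₀ (fun y => g y i) α) →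
    (∀ᶠ y in 𝓝[openQuadrant N] y₀, g y ∈ D.sol) →
    ∀ b, ∃ α, MonoGerm y₀ (fun y => D.fwd r L π (g y) b) α := by
  have h1 : ∀ᶠ z in 𝓝[piQuadrant ι] D.z₀, ∀ j, SmoothGerm (piQuadrant ι) z (D.c j) ∧ 0 < D.c j z :=
    eventually_all.2 fun j => (D.smooth j).eventually.and
      (((D.smooth j).continuousWithinAt D.z₀_mem).tendsto.eventually (lt_mem_nhds (D.pos j)))
  have h2 : ∀ᶠ z in 𝓝[piQuadrant ι] D.z₀, ∀ i, D.z₀ i ≠ 0 → z i ≠ 0 := by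
    refine eventually_all.2 fun i => ?_
    by_cases hi : D.z₀ i = 0
    · exact Eventually.of_forall fun z h => absurd hi h
    · refine mem_nhdsWithin_of_mem_nhds ?_
      filter_upwards [(isOpen_ne.preimage (continuous_apply i)).mem_nhds hi] with z hz _ using hz
  have h3 : ∀ᶠ z in 𝓝[piQuadrant ι] D.z₀, ∀ a,
      SmoothGerm (piQuadrant ι) z (fun z => D.fwd r L π z (Fin.natAdd m a)) ∧
      0 < D.fwd r L π z (Fin.natAdd m a) := by
    refine eventually_all.2 fun a => (D.smoothGerm_fwd_natAdd a).eventually.and ?_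
    refine ((D.smoothGerm_fwd_natAdd a).continuousWithinAt D.z₀_mem).tendsto.eventually
      (lt_mem_nhds ?_)
    rw [fwd_natAdd_z₀]; exact zero_lt_one
  filter_upwards [h1, h2, h3] with z h1 h2 h3 N y₀ g hy₀ hgz hg hsol b
  subst hgz
  induction b using Fin.addCases with
  | left k =>
    simp only [fwd_castAdd]
    exact D.monoGerm_root h hy₀ hg hsol (fun j => (h1 j).1) (fun j => (h1 j).2) h2 k
  | right a =>
    choose α hα using hg
    have hgs : SmoothGerm (quadrant N) y₀ g := SmoothGerm.pi fun i => (hα i).smoothGerm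
    have hgt : Tendsto g (𝓝[quadrant N] y₀) (𝓝[piQuadrant ι] (g y₀)) := by
      refine tendsto_nhdsWithin_iff.2 ⟨(hgs.continuousWithinAt hy₀).tendsto, ?_⟩
      filter_upwards [eventually_all.2 fun i => (hα i).nonneg] with y hy using hy
    exact ⟨0, MonoGerm.of_smoothGerm_pos hy₀ ((h3 a).1.comp hgs hgt) (h3 a).2⟩

theorem mat_logPart_z₀ [Fintype J] (h : D.IsSection r L) :
    D.mat (D.logPart L D.z₀) = fun j => - Real.log (D.c j D.z₀) := by
  ext j
  have := D.neBot
  have h1 : Tendsto (fun z => D.mat (D.logPart L z) j) (𝓝[D.sol] D.z₀)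
      (𝓝 (D.mat (D.logPart L D.z₀) j)) := by
    have h2 := ((D.smoothGerm_logPart L).comp_contDiff (g := fun s => D.mat s j)
      (LinearMap.toContinuousLinearMap ((LinearMap.proj j).comp D.mat)).contDiff)
    exact (h2.continuousWithinAt D.z₀_mem).tendsto.mono_left (nhdsWithin_mono _ D.sol_subset)
  refine tendsto_nhds_unique_of_eventuallyEq h1 (D.tendsto_log_c j).neg ?_
  filter_upwards [self_mem_nhdsWithin] with z hz
  exact congrFun (D.mat_logPart h hz) j

theorem eqs_root {z : ι → ℝ} (h : D.IsSection r L) (hz : z ∈ D.sol) :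
    D.eqs r π (D.root r z, D.logPart L z) = (0, π (D.logPart L z)) := by
  refine Prod.ext (Prod.ext (funext fun j => ?_) (funext fun k => ?_)) rfl
  · simp only [eqs, D.mono_root h hz, D.mat_logPart h hz]
    simp
  · simp [eqs, D.logPart_row h]

theorem eqs_z₀ [Fintype J] (h : D.IsSection r L) :
    D.eqs r π (0, D.logPart L D.z₀) = (0, π (D.logPart L D.z₀)) := by
  refine Prod.ext (Prod.ext (funext fun j => ?_) (funext fun k => ?_)) rfl
  · simp only [eqs, D.mono_zero_logPart, D.mat_logPart_z₀ h]
    simp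
  · simp [eqs, D.logPart_row h]

/-- Recovering the cofactors from a solution of the equations. -/
theorem logPart_mono (h : D.IsSection r L) {t : Fin m → ℝ} {s : ι → ℝ} {y : Fin l → ℝ}
    (hs : D.eqs r π (t, s) = (0, y)) : D.logPart L (D.mono t s) = s := by
  have h1 : ∀ j, Real.log (D.c j (D.mono t s)) + D.mat s j = 0 := fun j =>
    congrFun (congrArg (fun x => x.1.1) hs) j
  have h2 : ∀ k, s (r k) = 0 := fun k => congrFun (congrArg (fun x => x.1.2) hs) k
  ext i
  by_cases hi : D.z₀ i = 0
  · rw [logPart, if_pos hi, show (fun j => - Real.log (D.c j (D.mono t s))) = D.mat s from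
      funext fun j => by linarith [h1 j], D.eq_of_mat h h2 hi]
  · rw [logPart, if_neg hi]
    simp [mono, D.M_eq_zero i _ hi]

theorem mono_mem_sol {t : Fin m → ℝ} (ht : ∀ k, 0 < t k) {s : ι → ℝ} {y : Fin l → ℝ}
    (hs : D.eqs r π (t, s) = (0, y)) (hc : ∀ j, 0 < D.c j (D.mono t s)) : D.mono t s ∈ D.sol := by
  refine ⟨D.mono_pos ht s, fun j => ?_⟩
  have h1 : Real.log (D.c j (D.mono t s)) + D.mat s j = 0 :=
    congrFun (congrArg (fun x => x.1.1) hs) j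
  have hz : ∀ i, 0 < D.mono t s i ^ D.γ j i := fun i => zpow_pos (D.mono_pos ht s i) _
  have hprod := Finset.prod_pos fun i (_ : i ∈ Finset.univ) => hz i
  refine Real.log_injOn_pos (mul_pos (hc j) hprod) (show (0 : ℝ) < 1 from one_pos) ?_
  rw [Real.log_mul (hc j).ne' hprod.ne', Real.log_prod fun i _ => (hz i).ne', Real.log_one]
  have h2 : D.mat (fun i => Real.log (D.mono t s i)) = D.mat s := by
    have : (fun i => Real.log (D.mono t s i)) =
        (fun i => ∑ k, (D.M i k : ℝ) * Real.log (t k)) + s := by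
      ext i
      rw [mono, Real.log_mul (Finset.prod_pos fun k _ => pow_pos (ht k) _).ne' (Real.exp_pos _).ne',
        Real.log_exp, Real.log_prod fun k _ => (pow_pos (ht k) _).ne']
      simp [Real.log_pow]
    rw [this, map_add, mat_M, zero_add]
  have h3 := congrFun h2 j
  rw [mat_apply] at h3
  simp only [Real.log_zpow]
  rw [h3, h1]

end MonomialSystem

end

noncomputable section

namespace MonomialSystem

variable {ι J : Type} [Fintype ι] [Fintype J] {m : ℕ} (D : MonomialSystem ι J (Fin m))

theorem exists_resolution : ∃ R : D.Resolution, R.n + Fintype.card J = Fintype.card ι := by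
  obtain ⟨r, L, hz, hM, hM', hL, hdec⟩ := D.exists_section
  have h : D.IsSection r L := ⟨hz, hM, hM', hL, hdec⟩
  obtain ⟨l, π, e, he, hcard⟩ := exists_equiv_prod_of_surjective _ (D.logDiff_prod_surjective h)
  set s₀ := D.logPart L D.z₀ with hs₀
  set x₀ : EuclideanSpace ℝ (Fin (m + l)) := D.fwd r L π D.z₀ with hx₀def
  have hx₀ : x₀ ∈ quadrant (m + l) := D.fwd_z₀_mem h
  obtain ⟨S, hS, hS0, hΦS, hSΦ⟩ := exists_implicit_function (D.smoothGerm_eqs r π L)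
    e.toContinuousLinearEquiv (by
      refine (D.hasFDerivAt_eqs r π L).congr_fderiv ?_
      ext1 v
      exact (he v).symm)
  rw [D.eqs_z₀ h] at hS hS0 hΦS
  set tp : EuclideanSpace ℝ (Fin (m + l)) → Fin m → ℝ := fun x k => x (Fin.castAdd l k) with htp
  set yp : EuclideanSpace ℝ (Fin (m + l)) → Fin l → ℝ :=
    fun x a => x (Fin.natAdd m a) + π s₀ a - 1 with hyp
  set ev : EuclideanSpace ℝ (Fin (m + l)) →
    (Fin m → ℝ) × (((J → ℝ) × (Fin m → ℝ)) × (Fin l → ℝ)) := fun x => (tp x, (0, yp x)) with hev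
  have htp0 : tp x₀ = 0 := funext fun k => D.fwd_castAdd_z₀ h k
  have hyp0 : yp x₀ = π s₀ := funext fun a => by
    simp only [hyp, hx₀def, D.fwd_natAdd_z₀]; ring
  have hev0 : ev x₀ = (0, (0, π s₀)) := by simp only [hev, htp0, hyp0]
  have hevs : SmoothGerm (quadrant (m + l)) x₀ ev :=
    (SmoothGerm.pi fun k => smoothGerm_coord _).prodMk ((SmoothGerm.const 0).prodMk
      (SmoothGerm.pi fun a => ((smoothGerm_coord _).add (SmoothGerm.const _)).sub
        (SmoothGerm.const _)))
  have hevt : Tendsto ev (𝓝[quadrant (m + l)] x₀)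
      (𝓝[piQuadrant (Fin m) ×ˢ univ] (0, (0, π s₀))) := by
    rw [← hev0]
    refine tendsto_nhdsWithin_iff.2 ⟨(hevs.continuousWithinAt hx₀).tendsto, ?_⟩
    filter_upwards [self_mem_nhdsWithin] with x hx using ⟨fun k => hx _, mem_univ _⟩
  set s : EuclideanSpace ℝ (Fin (m + l)) → ι → ℝ := fun x => S (ev x) with hs
  have hss : SmoothGerm (quadrant (m + l)) x₀ s :=
    SmoothGerm.comp (Q' := piQuadrant (Fin m) ×ˢ univ) (by rw [hev0]; exact hS) hevs
      (by rw [hev0]; exact hevt)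
  set H : EuclideanSpace ℝ (Fin (m + l)) → ι → ℝ := fun x => D.mono (tp x) (s x) with hH
  have hH0 : H x₀ = D.z₀ := by
    simp only [hH, hs, hev0, htp0]
    rw [show S (0, 0, π s₀) = s₀ from hS0]
    exact D.mono_zero_logPart L
  have heq : ∀ᶠ x in 𝓝[quadrant (m + l)] x₀, D.eqs r π (tp x, s x) = (0, yp x) :=
    hevt.eventually hΦS
  set A : ι → Fin (m + l) → ℕ := fun i => Fin.append (D.M i) 0 with hA
  have hmono : ∀ i, MonoGerm x₀ (fun x => H x i) (A i) := by
    intro i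
    refine ⟨fun x => Real.exp (s x i),
      (hss.comp_contDiff (g := fun v : ι → ℝ => v i) (contDiff_apply ℝ ℝ i)).exp,
      Eventually.of_forall fun x => ⟨Real.exp_pos _, ?_⟩⟩
    rw [Fin.prod_univ_add]
    simp only [hH, mono, hA, htp, Fin.append_left, Fin.append_right, Pi.zero_apply, pow_zero,
      Finset.prod_const_one, mul_one]
    rw [mul_comm]
  have hHs : SmoothGerm (quadrant (m + l)) x₀ H := SmoothGerm.pi fun i => (hmono i).smoothGerm
  have hHt : Tendsto H (𝓝[quadrant (m + l)] x₀) (𝓝[piQuadrant ι] D.z₀) := by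
    refine tendsto_nhdsWithin_iff.2 ⟨?_, ?_⟩
    · rw [← hH0]; exact (hHs.continuousWithinAt hx₀).tendsto
    · filter_upwards [self_mem_nhdsWithin] with x hx using D.mono_nonneg (fun k => hx _) _
  have hTH : ∀ᶠ x in 𝓝[quadrant (m + l)] x₀, D.fwd r L π (H x) = x := by
    filter_upwards [heq, self_mem_nhdsWithin] with x hx hxQ
    ext b
    induction b using Fin.addCases with
    | left k =>
      rw [fwd_castAdd]
      exact congrFun (D.root_mono h (fun k => hxQ _)
        fun k => congrFun (congrArg (fun x => x.1.2) hx) k) k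
    | right a =>
      rw [fwd_natAdd]
      simp only [hH, D.logPart_mono h hx]
      have h1 : π (s x) a = yp x a := congrFun (congrArg (fun x => x.2) hx) a
      rw [h1]
      simp only [hyp]
      ring
  refine ⟨⟨m + l, D.fwd r L π, H, A, Fin.castAdd l, Fin.castAdd_injective m l, hx₀, ?_, ?_, hmono, ?_,
    ?_, hTH, D.lift_fwd h, ?_⟩, ?_⟩
  · intro b
    induction b using Fin.addCases with
    | left k => simp [D.fwd_castAdd_z₀ h]
    | right a =>
      simp only [D.fwd_natAdd_z₀, one_ne_zero, false_iff, not_exists]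
      intro k hk
      have := congrArg Fin.val hk
      simp only [Fin.val_castAdd, Fin.val_natAdd] at this
      omega
  · intro i k
    simp [hA]
  · have h1 : ∀ᶠ z in 𝓝[piQuadrant ι] D.z₀, ∀ j, 0 < D.c j z := eventually_all.2 fun j =>
      ((D.smooth j).continuousWithinAt D.z₀_mem).tendsto.eventually (lt_mem_nhds (D.pos j))
    have hle := nhdsWithin_mono x₀ (openQuadrant_subset (m + l))
    filter_upwards [hle heq, hle (hHt.eventually h1), self_mem_nhdsWithin] with x hx hx' hxQ
    exact D.mono_mem_sol (fun k => hxQ _) hx hx'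
  · have hTs : ∀ᶠ z in 𝓝[piQuadrant ι] D.z₀, ContinuousWithinAt (D.fwd r L π) (piQuadrant ι) z := by
      have h1 : ∀ᶠ z in 𝓝[piQuadrant ι] D.z₀, ∀ b,
          ContinuousWithinAt (fun z => D.fwd r L π z b) (piQuadrant ι) z := by
        refine eventually_all.2 fun b => ?_
        induction b using Fin.addCases with
        | left k =>
          refine Eventually.of_forall fun z => ?_
          simp only [fwd_castAdd]
          exact ((continuous_apply k).comp (D.continuous_root r)).continuousWithinAt
        | right a =>
          filter_upwards [D.smoothGerm_fwd_natAdd (r := r) (L := L) (π := π) a] with z hz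
          exact hz.continuousWithinAt
      filter_upwards [h1] with z hz
      have := (PiLp.continuous_toLp 2 (fun _ : Fin (m + l) => ℝ)).continuousAt.comp_continuousWithinAt
        (continuousWithinAt_pi.2 hz)
      exact this
    have hTt : Tendsto (D.fwd r L π) (𝓝[piQuadrant ι] D.z₀) (𝓝[quadrant (m + l)] x₀) := by
      refine tendsto_nhdsWithin_iff.2 ⟨(hTs.self_of_nhdsWithin D.z₀_mem).tendsto, ?_⟩
      have h1 : ∀ᶠ z in 𝓝[piQuadrant ι] D.z₀, ∀ a, 0 < D.fwd r L π z (Fin.natAdd m a) := by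
        refine eventually_all.2 fun a => ?_
        refine ((D.smoothGerm_fwd_natAdd a).continuousWithinAt D.z₀_mem).tendsto.eventually
          (lt_mem_nhds ?_)
        change (0 : ℝ) < D.fwd r L π D.z₀ _
        rw [fwd_natAdd_z₀]; exact zero_lt_one
      filter_upwards [h1, self_mem_nhdsWithin] with z hz hzQ b
      induction b using Fin.addCases with
      | left k => rw [fwd_castAdd]; exact D.root_mem r hzQ k
      | right a => exact (hz a).le
    have hHc : ∀ᶠ z in 𝓝[piQuadrant ι] D.z₀,
        ContinuousWithinAt (fun z => H (D.fwd r L π z)) (piQuadrant ι) z := by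
      have h1 := hTt.eventually hHs
      have h2 := hTt.eventually (self_mem_nhdsWithin (s := quadrant (m + l)))
      filter_upwards [hTs, h1, eventually_eventually_nhdsWithin.2 h2] with z hz hz' hz''
      exact hz'.continuousWithinAt.tendsto.comp (tendsto_nhdsWithin_iff.2 ⟨hz.tendsto, hz''⟩)
    have hroot : ContinuousWithinAt (fun z => (D.root r z, D.logPart L z)) (piQuadrant ι) D.z₀ :=
      ((D.continuous_root r).continuousWithinAt).prodMk
        ((D.smoothGerm_logPart L).continuousWithinAt D.z₀_mem)
    have hroott : Tendsto (fun z => (D.root r z, D.logPart L z)) (𝓝[piQuadrant ι] D.z₀)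
        (𝓝[piQuadrant (Fin m) ×ˢ univ] (0, s₀)) := by
      refine tendsto_nhdsWithin_iff.2 ⟨?_, ?_⟩
      · have := hroot.tendsto
        rwa [D.root_z₀ h] at this
      · filter_upwards [self_mem_nhdsWithin] with z hz using ⟨D.root_mem r hz, mem_univ _⟩
    have h3 : ∀ᶠ z in 𝓝[D.sol] D.z₀, H (D.fwd r L π z) = z := by
      filter_upwards [nhdsWithin_mono _ D.sol_subset (hroott.eventually hSΦ),
        self_mem_nhdsWithin] with z hz hzs
      have h4 : tp (D.fwd r L π z) = D.root r z := funext fun k => D.fwd_castAdd z k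
      have h5 : yp (D.fwd r L π z) = π (D.logPart L z) := funext fun a => by
        simp only [hyp, fwd_natAdd]; ring
      replace hz : S (D.root r z, D.eqs r π (D.root r z, D.logPart L z)) = D.logPart L z := hz
      rw [D.eqs_root h hzs] at hz
      simp only [hH, hs, hev, h4, h5, hz]
      exact D.mono_root h hzs
    have h4 := eventually_eq_closure (isClosed_piQuadrant ι) D.sol_subset hHc
      (Eventually.of_forall fun z => continuousWithinAt_id) h3
    have hle := nhdsWithin_mono D.z₀ D.closure_sol_subset
    filter_upwards [h4, hle hTs, hle (hTt.eventually self_mem_nhdsWithin)] with z hz hz' hz''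
    exact ⟨hz, hz'', (show ContinuousWithinAt _ _ _ from hz').mono D.closure_sol_subset⟩
  · intro b
    induction b using Fin.addCases with
    | left k =>
      classical
      refine ⟨D.M (r k) k, hM k, fun _ => 1, Pi.single (r k) 1, SmoothGerm.const 1, one_pos, ?_⟩
      filter_upwards [hTH, hHt.eventually self_mem_nhdsWithin] with x hx hx'
      have h1 : ∏ i, H x i ^ (Pi.single (r k) 1 : ι → ℕ) i = H x (r k) := by
        rw [Finset.prod_eq_single (r k) (fun i _ hi => by simp [Pi.single_eq_of_ne hi]) (by simp)]
        simp
      have h2 : x (Fin.castAdd l k) = D.root r (H x) k := by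
        rw [← D.fwd_castAdd (L := L) (π := π), hx]
      rw [one_mul, h1, h2, root, Real.rpow_inv_natCast_pow (hx' (r k)) (hM k)]
    | right a =>
      refine ⟨1, one_ne_zero, fun z => D.fwd r L π z (Fin.natAdd m a), 0,
        D.smoothGerm_fwd_natAdd a, one_pos.trans_eq (D.fwd_natAdd_z₀ a).symm, ?_⟩
      filter_upwards [hTH] with x hx
      simp [hx]
  · simp only [Module.finrank_prod, Module.finrank_fintype_fun_eq_card, Fintype.card_fin] at hcard
    simp only
    omega

end MonomialSystem

end

noncomputable section

section

variable {X Y : Type u} [TopologicalSpace X] [CornerAtlas X] [TopologicalSpace Y]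

/-- The boundary hypersurfaces which contain `p` but not the face `F` correspond to the coordinates
which vanish at `p` but not identically on `F`. -/
theorem exists_hypersurface_equiv [IsManifoldWithCorners X] {F : Face X} {e : CornerChart X} {p : X}
    (he : e ∈ CornerAtlas.charts) (hp : p ∈ e.source) (hpF : p ∈ F.1) {S : Set (Fin e.1)}
    (hS : ∀ᶠ q in 𝓝 p, q ∈ F.int ↔ e.zeros q = S) :
    ∃ σ : {K : Hypersurface X // (faceAt p).1 ⊆ K.1 ∧ ¬ F.1 ⊆ K.1} ≃
      {a : {i // i ∉ S} // e.coord p a.1 = 0}, ∀ K, IsDefiningCoord e K.1.1 p (σ K).1.1 := by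
  have h1 : ∀ K : {K : Hypersurface X // (faceAt p).1 ⊆ K.1 ∧ ¬ F.1 ⊆ K.1}, p ∈ K.1.1 := fun K =>
    K.1.faceOf_subset_iff.1 K.2.1
  have h2 : ∀ K : {K : Hypersurface X // (faceAt p).1 ⊆ K.1 ∧ ¬ F.1 ⊆ K.1},
      ∃ a : {a : {i // i ∉ S} // e.coord p a.1 = 0}, IsDefiningCoord e K.1.1 p a.1.1 := by
    intro K
    obtain ⟨i, hi⟩ := K.1.exists_isDefiningCoord he hp (h1 K)
    exact ⟨⟨⟨i, fun hiS => K.2.2 ((hi.subset_iff hpF hS).2 hiS)⟩, hi.mem_zeros_iff.1 (h1 K)⟩, hi⟩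
  choose σ hσ using h2
  refine ⟨Equiv.ofBijective σ ⟨fun K K' h => ?_, fun a => ?_⟩, hσ⟩
  · refine Subtype.ext (IsDefiningCoord.hypersurface_unique he hp (hσ K) ?_ (h1 K))
    rw [h]
    exact hσ K'
  · obtain ⟨K, hK⟩ := exists_hypersurface he hp (i := a.1.1) a.2
    refine ⟨⟨K, K.faceOf_subset_iff.2 (hK.mem_zeros_iff.2 a.2),
      fun h => a.1.2 ((hK.subset_iff hpF hS).1 h)⟩, Subtype.ext (Subtype.ext ?_)⟩
    exact (hσ _).coord_unique hp hK (hK.mem_zeros_iff.2 a.2)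

/-- The local form of an interior b-map near a point `p` of a face `F`: the coordinates in `S` are
those which vanish on `F`, those in `T` vanish on a face containing the image of `F`. -/
structure MonoForm (f : X → Y) (F : Face X) (e : CornerChart X) (e' : CornerChart Y) (p : X)
    (T : Set (Fin e'.1)) where
  mem : p ∈ e.source
  map_mem : f p ∈ e'.source
  S : Set (Fin e.1)
  S_subset : S ⊆ e.zeros p
  int_iff : ∀ᶠ q in 𝓝 p, q ∈ F.int ↔ e.zeros q = S
  mem_iff : ∀ᶠ q in 𝓝 p, q ∈ F.1 ↔ S ⊆ e.zeros q
  α : Fin e'.1 → Fin e.1 → ℕ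
  a : Fin e'.1 → EuclideanSpace ℝ (Fin e.1) → ℝ
  smooth : ∀ j, SmoothGerm (quadrant e.1) (e.coord p) (a j)
  eq : ∀ᶠ x in 𝓝[quadrant e.1] (e.coord p), ∀ j, 0 < a j x ∧
    e'.coord (f (e.param x)) j = a j x * ∏ i, x i ^ α j i
  α_eq_zero : ∀ j i, e.coord p i ≠ 0 → α j i = 0
  α_eq_zero_of_notMem : ∀ j i, j ∉ T → i ∈ S → α j i = 0
  exists_α_ne_zero : ∀ j ∈ T, ∃ i ∈ S, α j i ≠ 0

theorem exists_monoForm [CornerAtlas Y] [IsManifoldWithCorners X] {f : X → Y} (hf : IsInteriorBMap f) {F : Face X}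
    {G : Face Y} (hFG : ∀ q ∈ F.int, f q ∈ G.int) {e : CornerChart X} (he : e ∈ CornerAtlas.charts)
    {e' : CornerChart Y} (he' : e' ∈ CornerAtlas.charts) {p : X} (hp : p ∈ e.source)
    (hp' : f p ∈ e'.source) (hpF : p ∈ F.1) {T : Set (Fin e'.1)}
    (hT : ∀ᶠ q in 𝓝 (f p), q ∈ G.int ↔ e'.zeros q = T) : Nonempty (MonoForm f F e e' p T) := by
  obtain ⟨S, hSz, hS, hS'⟩ := F.exists_local_form he hp hpF
  have h1 : ∀ j, ∃ α : Fin e.1 → ℕ, (∀ i, e.coord p i ≠ 0 → α i = 0) ∧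
      MonoGerm (e.coord p) (fun x => e'.coord (f (e.param x)) j) α := by
    intro j
    obtain ⟨α, hα⟩ := hf.2 e he e' he' p hp hp' j
    classical
    refine ⟨fun i => if e.coord p i = 0 then α i else 0, fun i hi => if_neg hi, ?_⟩
    exact (isMonomialAt_iff.1 hα).normalize (e.coord_mem p) fun i hi => by rw [if_pos hi]
  choose α hα0 hα using h1
  have hzero : ∀ᶠ q in 𝓝 p, ∀ j, (j ∈ e'.zeros (f q) ↔ ∃ i ∈ e.zeros q, α j i ≠ 0) := by
    refine eventually_all.2 fun j => ?_
    have h2 := (CornerChart.tendsto_coord hp).eventually (hα j).eq_zero_iff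
    filter_upwards [h2, e.isOpen_source.mem_nhds hp] with q hq hqs
    rw [CornerChart.param_coord hqs] at hq
    exact hq
  have hne : ∃ᶠ q in 𝓝 p, q ∈ F.int := by
    rw [← mem_closure_iff_frequently, F.closure_int]; exact hpF
  obtain ⟨q, hqF, h3, h4, h5⟩ := (hne.and_eventually
    (hS.and ((hf.1.1.tendsto p |>.eventually hT).and hzero))).exists
  have hqS := h3.1 hqF
  have hqT := h4.1 (hFG q hqF)
  rw [hqS, hqT] at h5
  choose a ha hae using hα
  exact ⟨⟨hp, hp', S, hSz, hS, hS', α, a, ha, eventually_all.2 hae, hα0,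
    fun j i hj hi => by by_contra h; exact hj ((h5 j).2 ⟨i, hi, h⟩), fun j hj => (h5 j).1 hj⟩⟩

namespace MonoForm

variable {f : X → Y} {F : Face X} {e : CornerChart X} {e' : CornerChart Y} {p : X}
  {T : Set (Fin e'.1)} (D : MonoForm f F e e' p T)

include D in
theorem monoGerm (j : Fin e'.1) :
    MonoGerm (e.coord p) (fun x => e'.coord (f (e.param x)) j) (D.α j) :=
  ⟨D.a j, D.smooth j, D.eq.mono fun _ hx => hx j⟩

theorem pos (j : Fin e'.1) : 0 < D.a j (e.coord p) :=
  (D.eq.self_of_nhdsWithin (e.coord_mem p) j).1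

theorem bDiff_apply (j : Fin e'.1) (i : Fin e.1) : bDiff f e e' p j i = D.α j i +
    e.coord p i * fderivWithin ℝ (D.a j) (quadrant e.1) (e.coord p) (EuclideanSpace.single i 1) /
      D.a j (e.coord p) := by
  have h := MonoGerm.hasLogDeriv' (e.coord_mem p) (D.smooth j) (D.eq.mono fun _ hx => hx j) i
  exact h.limUnder_eq (e.coord_mem p)

theorem bDiff_mulVec (j : Fin e'.1) (v : Fin e.1 → ℝ) :
    (bDiff f e e' p).mulVec v j = ∑ i, D.α j i * v i +
      fderivWithin ℝ (D.a j) (quadrant e.1) (e.coord p)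
        (WithLp.toLp 2 fun i => e.coord p i * v i) / D.a j (e.coord p) := by
  have h1 : (WithLp.toLp 2 fun i => e.coord p i * v i : EuclideanSpace ℝ (Fin e.1)) =
      ∑ i, (e.coord p i * v i) • EuclideanSpace.single i (1 : ℝ) := by
    ext k
    simp [Finset.sum_apply, Pi.single_apply]
  rw [h1, map_sum, Finset.sum_div, ← Finset.sum_add_distrib]
  change ∑ i, bDiff f e e' p j i * v i = _
  refine Finset.sum_congr rfl fun i _ => ?_
  rw [D.bDiff_apply, map_smul, smul_eq_mul]
  ring

theorem exponent_pos_mem (j : Fin e'.1) (hj : e'.coord (f p) j ≠ 0) (i : Fin e.1) :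
    D.α j i = 0 := by
  by_cases hi : e.coord p i = 0
  · refine (D.monoGerm j).exponent_eq_zero (e.coord_mem p) ?_ hi
    rwa [CornerChart.param_coord D.mem]
  · exact D.α_eq_zero j i hi

/-- The homomorphism of monoids given by a b-map, in terms of exponents. -/
theorem bPush_eq [CornerAtlas Y] [IsManifoldWithCorners X] [IsManifoldWithCorners Y] (hf : IsInteriorBMap f)
    (he : e ∈ CornerAtlas.charts) (he' : e' ∈ CornerAtlas.charts)
    {σ : {K : Hypersurface X // (faceAt p).1 ⊆ K.1 ∧ ¬ F.1 ⊆ K.1} ≃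
      {a : {i // i ∉ D.S} // e.coord p a.1 = 0}} (hσ : ∀ K, IsDefiningCoord e K.1.1 p (σ K).1.1)
    {H : Hypersurface Y} {j : Fin e'.1} (hj : IsDefiningCoord e' H.1 (f p) j)
    (u : FaceMonoid F (faceAt p)) :
    bPush f F (faceAt p) u H =
      open Classical in ∑ i : {a : {i // i ∉ D.S} // e.coord p a.1 = 0}, D.α j i.1.1 * u (σ.symm i) := by
  classical
  let _ : Fintype {K : Hypersurface X // (faceAt p).1 ⊆ K.1 ∧ ¬ F.1 ⊆ K.1} := Fintype.ofEquiv _ σ.symm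
  rw [bPush, Finsupp.liftAddHom_apply, Finsupp.sum_fintype _ _ (fun K => by ext; simp), Finset.sum_apply,
    ← σ.sum_comp]
  refine Finset.sum_congr rfl fun K _ => ?_
  have h1 : bExponent f K.1 H = D.α j (σ K).1.1 :=
    bExponent_eq hf.isBMap (fun q hq => H.notMem_of_mem_mInterior (hf.mapsTo_interior hq)) he he'
      D.mem D.map_mem (K.1.faceOf_subset_iff.1 K.2.1) (hσ K) hj (D.monoGerm j)
  simp only [AddMonoidHom.coe_mk, ZeroHom.coe_mk, h1, σ.symm_apply_apply]
  rw [mul_comm]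

end MonoForm

end

end

noncomputable section

section

open scoped Classical

/-- Extension by zero to the coordinates in `S`. -/
def extendZero {n : ℕ} (S : Set (Fin n)) {ι : Type} [Fintype ι] (σ : {i // i ∉ S} → ι) :
    (ι → ℝ) →L[ℝ] EuclideanSpace ℝ (Fin n) :=
  (EuclideanSpace.equiv (Fin n) ℝ).symm.toContinuousLinearMap ∘L
    ContinuousLinearMap.pi fun i => if h : i ∈ S then 0 else ContinuousLinearMap.proj (σ ⟨i, h⟩)

section

variable {n : ℕ} {S : Set (Fin n)} {ι : Type} [Fintype ι] {σ : {i // i ∉ S} → ι}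

theorem extendZero_of_mem (z : ι → ℝ) {i : Fin n} (hi : i ∈ S) : extendZero S σ z i = 0 := by
  simp [extendZero, hi]

theorem extendZero_of_notMem (z : ι → ℝ) {i : Fin n} (hi : i ∉ S) :
    extendZero S σ z i = z (σ ⟨i, hi⟩) := by
  simp [extendZero, hi]

theorem extendZero_mem {z : ι → ℝ} (hz : z ∈ piQuadrant ι) : extendZero S σ z ∈ quadrant n := by
  intro i
  by_cases hi : i ∈ S
  · rw [extendZero_of_mem z hi]
  · rw [extendZero_of_notMem z hi]; exact hz _

theorem prod_extendZero (z : ι → ℝ) {α : Fin n → ℕ} (hα : ∀ i ∈ S, α i = 0) :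
    ∏ i, extendZero S σ z i ^ α i = ∏ i : {i // i ∉ S}, z (σ i) ^ α i := by
  rw [← Finset.prod_subset (Finset.filter_subset (fun i => i ∉ S) Finset.univ) (fun i _ hi => by
    have : i ∈ S := by simpa using hi
    simp [hα i this]), Finset.prod_subtype (p := fun i => i ∉ S) _ (by simp)]
  exact Finset.prod_congr rfl fun i _ => by rw [extendZero_of_notMem z i.2]

theorem sum_extendZero {α : Fin n → ℝ} (hα : ∀ i ∈ S, α i = 0) (v : Fin n → ℝ) :
    ∑ i, α i * v i = ∑ i : {i // i ∉ S}, α i * v i := by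
  rw [← Finset.sum_subset (Finset.filter_subset (fun i => i ∉ S) Finset.univ) (fun i _ hi => by
    have : i ∈ S := by simpa using hi
    simp [hα i this]), Finset.sum_subtype (p := fun i => i ∉ S) _ (by simp)]

end

variable {X₁ X₂ Y : Type u} [TopologicalSpace X₁] [CornerAtlas X₁] [TopologicalSpace X₂]
  [CornerAtlas X₂] [TopologicalSpace Y] [CornerAtlas Y]

/-- Charts around a point of the fiber product and its images, and the local forms of the maps. -/
structure FiberModel (f₁ : X₁ → Y) (f₂ : X₂ → Y) (F₁ : Face X₁) (F₂ : Face X₂) (p : X₁ × X₂) where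
  e₁ : CornerChart X₁
  e₂ : CornerChart X₂
  e : CornerChart Y
  he₁ : e₁ ∈ CornerAtlas.charts
  he₂ : e₂ ∈ CornerAtlas.charts
  he : e ∈ CornerAtlas.charts
  T : Set (Fin e.1)
  D₁ : MonoForm f₁ F₁ e₁ e p.1 T
  D₂ : MonoForm f₂ F₂ e₂ e p.2 T
  mem : p ∈ fiberD f₁ f₂ F₁ F₂
  eq : f₁ p.1 = f₂ p.2
  G : Face Y
  isFaceImage₁ : IsFaceImage f₁ F₁ G
  isFaceImage₂ : IsFaceImage f₂ F₂ G
  mem_G : f₁ p.1 ∈ G.1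
  int_iff : ∀ᶠ q in 𝓝 (f₁ p.1), q ∈ G.int ↔ e.zeros q = T

namespace FiberModel

variable {f₁ : X₁ → Y} {f₂ : X₂ → Y} {F₁ : Face X₁} {F₂ : Face X₂} {p : X₁ × X₂}
  (D : FiberModel f₁ f₂ F₁ F₂ p)

/-- The coordinates which do not vanish identically on `F₁ × F₂`. -/
abbrev Idx : Type := {i // i ∉ D.D₁.S} ⊕ {i // i ∉ D.D₂.S}

/-- The equations of the fiber product. -/
abbrev EqIdx : Type := {j // j ∉ D.T}

def coord (q : X₁ × X₂) : D.Idx → ℝ :=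
  Sum.elim (fun i => D.e₁.coord q.1 i) (fun i => D.e₂.coord q.2 i)

def ext₁ : (D.Idx → ℝ) →L[ℝ] EuclideanSpace ℝ (Fin D.e₁.1) := extendZero D.D₁.S Sum.inl

def ext₂ : (D.Idx → ℝ) →L[ℝ] EuclideanSpace ℝ (Fin D.e₂.1) := extendZero D.D₂.S Sum.inr

def param (z : D.Idx → ℝ) : X₁ × X₂ := (D.e₁.param (D.ext₁ z), D.e₂.param (D.ext₂ z))

def γ (j : D.EqIdx) : D.Idx → ℤ :=
  Sum.elim (fun i => (D.D₁.α j i : ℤ)) (fun i => - (D.D₂.α j i : ℤ))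

def c (j : D.EqIdx) (z : D.Idx → ℝ) : ℝ := D.D₁.a j (D.ext₁ z) * (D.D₂.a j (D.ext₂ z))⁻¹

def sol : Set (D.Idx → ℝ) := {z | (∀ i, 0 < z i) ∧ ∀ j, D.c j z * ∏ i, z i ^ D.γ j i = 1}

theorem coord_mem (q : X₁ × X₂) : D.coord q ∈ piQuadrant D.Idx := by
  rintro (i | i)
  · exact D.e₁.coord_nonneg _ _
  · exact D.e₂.coord_nonneg _ _

theorem ext₁_coord {q : X₁ × X₂} (h : D.D₁.S ⊆ D.e₁.zeros q.1) :
    D.ext₁ (D.coord q) = D.e₁.coord q.1 := by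
  ext i
  by_cases hi : i ∈ D.D₁.S
  · rw [ext₁, extendZero_of_mem _ hi]; exact (h hi).symm
  · rw [ext₁, extendZero_of_notMem _ hi]; rfl

theorem ext₂_coord {q : X₁ × X₂} (h : D.D₂.S ⊆ D.e₂.zeros q.2) :
    D.ext₂ (D.coord q) = D.e₂.coord q.2 := by
  ext i
  by_cases hi : i ∈ D.D₂.S
  · rw [ext₂, extendZero_of_mem _ hi]; exact (h hi).symm
  · rw [ext₂, extendZero_of_notMem _ hi]; rfl

theorem ext₁_center : D.ext₁ (D.coord p) = D.e₁.coord p.1 := D.ext₁_coord D.D₁.S_subset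

theorem ext₂_center : D.ext₂ (D.coord p) = D.e₂.coord p.2 := D.ext₂_coord D.D₂.S_subset

theorem tendsto_ext₁ : Tendsto D.ext₁ (𝓝[piQuadrant D.Idx] (D.coord p))
    (𝓝[quadrant D.e₁.1] (D.e₁.coord p.1)) := by
  rw [← D.ext₁_center]
  refine tendsto_nhdsWithin_iff.2 ⟨D.ext₁.continuous.continuousWithinAt, ?_⟩
  filter_upwards [self_mem_nhdsWithin] with z hz using extendZero_mem hz

theorem tendsto_ext₂ : Tendsto D.ext₂ (𝓝[piQuadrant D.Idx] (D.coord p))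
    (𝓝[quadrant D.e₂.1] (D.e₂.coord p.2)) := by
  rw [← D.ext₂_center]
  refine tendsto_nhdsWithin_iff.2 ⟨D.ext₂.continuous.continuousWithinAt, ?_⟩
  filter_upwards [self_mem_nhdsWithin] with z hz using extendZero_mem hz

theorem tendsto_param : Tendsto D.param (𝓝[piQuadrant D.Idx] (D.coord p)) (𝓝 p) :=
  ((CornerChart.tendsto_param D.D₁.mem).comp D.tendsto_ext₁).prodMk_nhds
    ((CornerChart.tendsto_param D.D₂.mem).comp D.tendsto_ext₂)

theorem continuousAt_coord {q : X₁ × X₂} (h₁ : q.1 ∈ D.e₁.source) (h₂ : q.2 ∈ D.e₂.source) :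
    ContinuousAt D.coord q := by
  refine continuousAt_pi.2 fun i => ?_
  cases i with
  | inl i =>
    exact (PiLp.continuous_apply 2 _ i.1).continuousAt.comp
      ((CornerChart.continuousAt_coord h₁).comp continuousAt_fst)
  | inr i =>
    exact (PiLp.continuous_apply 2 _ i.1).continuousAt.comp
      ((CornerChart.continuousAt_coord h₂).comp continuousAt_snd)

theorem eventually_source : ∀ᶠ q in 𝓝 p, q.1 ∈ D.e₁.source ∧ q.2 ∈ D.e₂.source :=
  (continuousAt_fst.eventually (D.e₁.isOpen_source.mem_nhds D.D₁.mem)).and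
    (continuousAt_snd.eventually (D.e₂.isOpen_source.mem_nhds D.D₂.mem))

theorem eventually_param_coord :
    ∀ᶠ q in 𝓝 p, q.1 ∈ F₁.1 → q.2 ∈ F₂.1 → D.param (D.coord q) = q := by
  filter_upwards [D.eventually_source, continuousAt_fst.eventually D.D₁.mem_iff,
    continuousAt_snd.eventually D.D₂.mem_iff] with q hs h1 h2 hq1 hq2
  rw [param, D.ext₁_coord (h1.1 hq1), D.ext₂_coord (h2.1 hq2), CornerChart.param_coord hs.1,
    CornerChart.param_coord hs.2]

theorem eventually_coord_param :
    ∀ᶠ z in 𝓝[piQuadrant D.Idx] (D.coord p), D.coord (D.param z) = z ∧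
      (D.param z).1 ∈ D.e₁.source ∧ (D.param z).2 ∈ D.e₂.source ∧
      D.e₁.coord (D.param z).1 = D.ext₁ z ∧ D.e₂.coord (D.param z).2 = D.ext₂ z := by
  filter_upwards [D.tendsto_ext₁.eventually (CornerChart.eventually_coord_param D.D₁.mem),
    D.tendsto_ext₂.eventually (CornerChart.eventually_coord_param D.D₂.mem)] with z h1 h2
  refine ⟨?_, h1.1, h2.1, h1.2, h2.2⟩
  ext i
  cases i with
  | inl i =>
    change D.e₁.coord (D.e₁.param _) i.1 = _
    rw [h1.2, ext₁, extendZero_of_notMem _ i.2]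
  | inr i =>
    change D.e₂.coord (D.e₂.param _) i.1 = _
    rw [h2.2, ext₂, extendZero_of_notMem _ i.2]

theorem prod_γ {z : D.Idx → ℝ} (j : D.EqIdx) : ∏ i, z i ^ D.γ j i =
    (∏ i, D.ext₁ z i ^ D.D₁.α j i) * (∏ i, D.ext₂ z i ^ D.D₂.α j i)⁻¹ := by
  rw [Fintype.prod_sum_type, ext₁, ext₂,
    prod_extendZero z fun i hi => D.D₁.α_eq_zero_of_notMem j i j.2 hi,
    prod_extendZero z fun i hi => D.D₂.α_eq_zero_of_notMem j i j.2 hi, ← Finset.prod_inv_distrib]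
  simp [γ]

/-- The equation of index `j` says that the `j`-th coordinates of the images agree. -/
theorem equation_iff {z : D.Idx → ℝ} (hz : ∀ i, 0 < z i) (j : D.EqIdx)
    (h₂ : 0 < D.D₂.a j (D.ext₂ z)) : D.c j z * ∏ i, z i ^ D.γ j i = 1 ↔
    D.D₁.a j (D.ext₁ z) * ∏ i, D.ext₁ z i ^ D.D₁.α j i =
      D.D₂.a j (D.ext₂ z) * ∏ i, D.ext₂ z i ^ D.D₂.α j i := by
  have h3 : 0 < ∏ i, D.ext₂ z i ^ D.D₂.α j i := by
    rw [ext₂, prod_extendZero z fun i hi => D.D₂.α_eq_zero_of_notMem j i j.2 hi]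
    exact Finset.prod_pos fun i _ => pow_pos (hz _) _
  rw [prod_γ, c]
  field_simp

theorem eventually_coord_mem_sol : ∀ᶠ q in 𝓝 p, q ∈ fiberInt f₁ f₂ F₁ F₂ → D.coord q ∈ D.sol := by
  filter_upwards [D.eventually_source, continuousAt_fst.eventually D.D₁.int_iff,
    continuousAt_snd.eventually D.D₂.int_iff,
    continuousAt_fst.eventually ((CornerChart.tendsto_coord D.D₁.mem).eventually D.D₁.eq),
    continuousAt_snd.eventually ((CornerChart.tendsto_coord D.D₂.mem).eventually D.D₂.eq)]
    with q hs h1 h2 h3 h4 hq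
  have hz1 := h1.1 hq.1
  have hz2 := h2.1 hq.2.1
  have hpos : ∀ i, 0 < D.coord q i := by
    rintro (i | i)
    · exact CornerChart.coord_pos (fun h => i.2 (hz1.subset h))
    · exact CornerChart.coord_pos (fun h => i.2 (hz2.subset h))
  have hx1 := D.ext₁_coord (q := q) hz1.ge
  have hx2 := D.ext₂_coord (q := q) hz2.ge
  refine ⟨hpos, fun j => ?_⟩
  rw [D.equation_iff hpos j (by rw [hx2]; exact (h4 j).1), hx1, hx2, ← (h3 j).2, ← (h4 j).2,
    CornerChart.param_coord hs.1, CornerChart.param_coord hs.2, hq.2.2]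

theorem eventually_param_mem (hf₁ : Continuous f₁) (hf₂ : Continuous f₂) :
    ∀ᶠ z in 𝓝[piQuadrant D.Idx] (D.coord p), z ∈ D.sol → D.param z ∈ fiberInt f₁ f₂ F₁ F₂ := by
  have hs1 : ∀ᶠ q in 𝓝 p, f₁ q.1 ∈ D.e.source :=
    (hf₁.comp continuous_fst).continuousAt.eventually (D.e.isOpen_source.mem_nhds D.D₁.map_mem)
  have hs2 : ∀ᶠ q in 𝓝 p, f₂ q.2 ∈ D.e.source :=
    (hf₂.comp continuous_snd).continuousAt.eventually (D.e.isOpen_source.mem_nhds D.D₂.map_mem)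
  filter_upwards [D.eventually_coord_param, self_mem_nhdsWithin,
    D.tendsto_param.eventually (continuousAt_fst.eventually D.D₁.int_iff),
    D.tendsto_param.eventually (continuousAt_snd.eventually D.D₂.int_iff),
    D.tendsto_ext₁.eventually D.D₁.eq, D.tendsto_ext₂.eventually D.D₂.eq,
    D.tendsto_param.eventually hs1, D.tendsto_param.eventually hs2]
    with z hz hzQ h1 h2 h3 h4 h5 h6 hsol
  refine ⟨h1.2 ?_, h2.2 ?_, ?_⟩
  · ext i
    rw [CornerChart.mem_zeros, hz.2.2.2.1]
    by_cases hi : i ∈ D.D₁.S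
    · simp [ext₁, extendZero_of_mem _ hi, hi]
    · simp [ext₁, extendZero_of_notMem _ hi, hi, (hsol.1 _).ne']
  · ext i
    rw [CornerChart.mem_zeros, hz.2.2.2.2]
    by_cases hi : i ∈ D.D₂.S
    · simp [ext₂, extendZero_of_mem _ hi, hi]
    · simp [ext₂, extendZero_of_notMem _ hi, hi, (hsol.1 _).ne']
  · rw [← CornerChart.param_coord h5, ← CornerChart.param_coord h6]
    congr 1
    ext j
    have h7 : D.e.coord (f₁ (D.param z).1) j = _ := (h3 j).2
    have h8 : D.e.coord (f₂ (D.param z).2) j = _ := (h4 j).2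
    rw [h7, h8]
    by_cases hj : j ∈ D.T
    · obtain ⟨i, hi, hα⟩ := D.D₁.exists_α_ne_zero j hj
      obtain ⟨i', hi', hα'⟩ := D.D₂.exists_α_ne_zero j hj
      rw [Finset.prod_eq_zero (Finset.mem_univ i) (by simp [ext₁, extendZero_of_mem _ hi, hα]),
        Finset.prod_eq_zero (Finset.mem_univ i') (by simp [ext₂, extendZero_of_mem _ hi', hα'])]
      simp
    · exact (D.equation_iff hsol.1 ⟨j, hj⟩ (h4 j).1).1 (hsol.2 ⟨j, hj⟩)

theorem coord_mem_closure : D.coord p ∈ closure D.sol := by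
  have : (𝓝[fiberInt f₁ f₂ F₁ F₂] p).NeBot := mem_closure_iff_nhdsWithin_neBot.1 D.mem
  refine mem_closure_of_tendsto
    ((D.continuousAt_coord D.D₁.mem D.D₂.mem).tendsto.mono_left
      (nhdsWithin_le_nhds (s := fiberInt f₁ f₂ F₁ F₂))) ?_
  exact eventually_nhdsWithin_iff.2 D.eventually_coord_mem_sol

theorem smoothGerm_c (j : D.EqIdx) : SmoothGerm (piQuadrant D.Idx) (D.coord p) (D.c j) := by
  have h0 : D.coord p ∈ piQuadrant D.Idx := D.coord_mem p
  have h1 : SmoothGerm (piQuadrant D.Idx) (D.coord p) (fun z => D.D₁.a j (D.ext₁ z)) := by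
    refine SmoothGerm.comp (Q' := quadrant D.e₁.1) ?_ (SmoothGerm.of_contDiff D.ext₁.contDiff) ?_
    · rw [D.ext₁_center]; exact D.D₁.smooth j
    · rw [D.ext₁_center]; exact D.tendsto_ext₁
  have h2 : SmoothGerm (piQuadrant D.Idx) (D.coord p) (fun z => D.D₂.a j (D.ext₂ z)) := by
    refine SmoothGerm.comp (Q' := quadrant D.e₂.1) ?_ (SmoothGerm.of_contDiff D.ext₂.contDiff) ?_
    · rw [D.ext₂_center]; exact D.D₂.smooth j
    · rw [D.ext₂_center]; exact D.tendsto_ext₂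
  exact h1.mul (h2.inv h0 (by rw [D.ext₂_center]; exact (D.D₂.pos j).ne'))

theorem c_pos (j : D.EqIdx) : 0 < D.c j (D.coord p) := by
  rw [c, D.ext₁_center, D.ext₂_center]
  exact mul_pos (D.D₁.pos j) (inv_pos.2 (D.D₂.pos j))

theorem fderivWithin_c (j : D.EqIdx) (v : D.Idx → ℝ) :
    fderivWithin ℝ (D.c j) (piQuadrant D.Idx) (D.coord p) v / D.c j (D.coord p) =
      fderivWithin ℝ (D.D₁.a j) (quadrant D.e₁.1) (D.e₁.coord p.1) (D.ext₁ v) /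
        D.D₁.a j (D.e₁.coord p.1) -
      fderivWithin ℝ (D.D₂.a j) (quadrant D.e₂.1) (D.e₂.coord p.2) (D.ext₂ v) /
        D.D₂.a j (D.e₂.coord p.2) := by
  have h1 := ((D.D₁.smooth j).self_of_mem (D.e₁.coord_mem p.1)).differentiableWithinAt
    (by simp) |>.hasFDerivWithinAt
  have h2 := ((D.D₂.smooth j).self_of_mem (D.e₂.coord_mem p.2)).differentiableWithinAt
    (by simp) |>.hasFDerivWithinAt
  rw [← D.ext₁_center] at h1
  rw [← D.ext₂_center] at h2
  have h3 := h1.comp (D.coord p) (D.ext₁.hasFDerivWithinAt (s := piQuadrant D.Idx))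
    fun z hz => extendZero_mem hz
  have h4 := h2.comp (D.coord p) (D.ext₂.hasFDerivWithinAt (s := piQuadrant D.Idx))
    fun z hz => extendZero_mem hz
  have hne1 := (D.D₁.pos j).ne'
  have hne2 := (D.D₂.pos j).ne'
  rw [← D.ext₁_center] at hne1 ⊢
  rw [← D.ext₂_center] at hne2 ⊢
  have h5 := h3.mul (HasDerivAt.comp_hasFDerivWithinAt (f := D.D₂.a j ∘ D.ext₂) (D.coord p)
    (hasDerivAt_inv hne2) h4)
  have hu : UniqueDiffWithinAt ℝ (piQuadrant D.Idx) (D.coord p) :=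
    uniqueDiffOn_convex convex_piQuadrant interior_piQuadrant_nonempty _ (D.coord_mem p)
  have h6 : fderivWithin ℝ (D.c j) (piQuadrant D.Idx) (D.coord p) = _ := h5.fderivWithin hu
  rw [h6, c]
  simp only [Function.comp_apply, add_apply, smul_apply, ContinuousLinearMap.comp_apply,
    smul_eq_mul]
  field_simp
  ring

theorem surjective_of_bTransversal (htrans : BTransversal f₁ f₂) (b : D.EqIdx → ℝ) :
    ∃ v : D.Idx → ℝ, ∀ j, ∑ i, D.γ j i * v i +
      fderivWithin ℝ (D.c j) (piQuadrant D.Idx) (D.coord p) (fun i => D.coord p i * v i) /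
        D.c j (D.coord p) = b j := by
  obtain ⟨v₁, v₂, hv⟩ := htrans p.1 p.2 D.eq D.e₁ D.he₁ D.e₂ D.he₂ D.e D.he D.D₁.mem D.D₂.mem
    D.D₁.map_mem (fun j => if h : j ∉ D.T then b ⟨j, h⟩ else 0)
  refine ⟨Sum.elim (fun i => v₁ i) (fun i => - v₂ i), fun j => ?_⟩
  have h1 := congrFun hv j.1
  rw [dif_pos j.2, Pi.add_apply, D.D₁.bDiff_mulVec, D.D₂.bDiff_mulVec] at h1
  rw [D.fderivWithin_c, Fintype.sum_sum_type, ← h1]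
  have h2 : D.ext₁ (fun i => D.coord p i * Sum.elim (fun i => v₁ i.1) (fun i => - v₂ i.1) i) =
      WithLp.toLp 2 fun i => D.e₁.coord p.1 i * v₁ i := by
    ext i
    by_cases hi : i ∈ D.D₁.S
    · have : D.e₁.coord p.1 i = 0 := D.D₁.S_subset hi
      simp [ext₁, extendZero_of_mem _ hi, this]
    · simp [ext₁, extendZero_of_notMem _ hi, coord]
  have h3 : D.ext₂ (fun i => D.coord p i * Sum.elim (fun i => v₁ i.1) (fun i => - v₂ i.1) i) =
      - WithLp.toLp 2 fun i => D.e₂.coord p.2 i * v₂ i := by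
    ext i
    by_cases hi : i ∈ D.D₂.S
    · have : D.e₂.coord p.2 i = 0 := D.D₂.S_subset hi
      simp [ext₂, extendZero_of_mem _ hi, this]
    · simp [ext₂, extendZero_of_notMem _ hi, coord]
  have h4 := sum_extendZero (S := D.D₁.S) (α := fun i => (D.D₁.α j i : ℝ))
    (fun i hi => by simp [D.D₁.α_eq_zero_of_notMem j i j.2 hi]) v₁
  have h5 := sum_extendZero (S := D.D₂.S) (α := fun i => (D.D₂.α j i : ℝ))
    (fun i hi => by simp [D.D₂.α_eq_zero_of_notMem j i j.2 hi]) v₂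
  rw [h2, h3, h4, h5, map_neg]
  simp only [γ, Sum.elim_inl, Sum.elim_inr, Int.cast_natCast, Int.cast_neg, neg_mul_neg]
  ring

end FiberModel

end

end

noncomputable section

section

open scoped Classical

variable {X₁ X₂ Y : Type u} [TopologicalSpace X₁] [CornerAtlas X₁] [TopologicalSpace X₂]
  [CornerAtlas X₂] [TopologicalSpace Y] [CornerAtlas Y]
  {f₁ : X₁ → Y} {f₂ : X₂ → Y} {F₁ : Face X₁} {F₂ : Face X₂} {p : X₁ × X₂}

theorem fiberD_subset_prod : fiberD f₁ f₂ F₁ F₂ ⊆ F₁.1 ×ˢ F₂.1 :=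
  closure_minimal (fun _ hq => ⟨F₁.int_subset hq.1, F₂.int_subset hq.2.1⟩)
    (F₁.isClosed.prod F₂.isClosed)

theorem eq_of_mem_fiberD [T2Space Y] (hf₁ : Continuous f₁) (hf₂ : Continuous f₂)
    (hp : p ∈ fiberD f₁ f₂ F₁ F₂) : f₁ p.1 = f₂ p.2 :=
  closure_minimal (t := {q : X₁ × X₂ | f₁ q.1 = f₂ q.2}) (fun _ hq => hq.2.2)
    (isClosed_eq (hf₁.comp continuous_fst) (hf₂.comp continuous_snd)) hp

variable [IsManifoldWithCorners X₁] [IsManifoldWithCorners X₂] [hY : IsManifoldWithCorners Y]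

theorem exists_fiberModel (hf₁ : IsInteriorBMap f₁) (hf₂ : IsInteriorBMap f₂)
    (hp : p ∈ fiberD f₁ f₂ F₁ F₂) {e₁ : CornerChart X₁} {e₂ : CornerChart X₂}
    (he₁ : e₁ ∈ CornerAtlas.charts) (he₂ : e₂ ∈ CornerAtlas.charts) (hp₁ : p.1 ∈ e₁.source)
    (hp₂ : p.2 ∈ e₂.source) :
    ∃ D : FiberModel f₁ f₂ F₁ F₂ p, D.e₁ = e₁ ∧ D.e₂ = e₂ := by
  have := hY.t2
  obtain ⟨e, he, hpe⟩ := exists_chart (f₁ p.1)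
  have heq := eq_of_mem_fiberD hf₁.1.1 hf₂.1.1 hp
  have hpF := fiberD_subset_prod hp
  obtain ⟨r, hr⟩ : (fiberInt f₁ f₂ F₁ F₂).Nonempty := closure_nonempty_iff.1 ⟨p, hp⟩
  have h1 : ∀ q ∈ F₁.int, f₁ q ∈ (faceAt (f₁ r.1)).int := fun q hq =>
    hf₁.isBMap.faceOf_eq (hq.trans hr.1.symm)
  have h2 : ∀ q ∈ F₂.int, f₂ q ∈ (faceAt (f₁ r.1)).int := fun q hq => by
    rw [hr.2.2]
    exact hf₂.isBMap.faceOf_eq (hq.trans hr.2.1.symm)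
  have hG : f₁ p.1 ∈ (faceAt (f₁ r.1)).1 := by
    have := map_mem_closure hf₁.1.1 (show p.1 ∈ closure F₁.int by rw [F₁.closure_int]; exact hpF.1) h1
    rwa [Face.closure_int] at this
  obtain ⟨T, -, hT, -⟩ := (faceAt (f₁ r.1)).exists_local_form he hpe hG
  obtain ⟨D₁⟩ := exists_monoForm hf₁ h1 he₁ he hp₁ hpe hpF.1 hT
  obtain ⟨D₂⟩ := exists_monoForm hf₂ h2 he₂ he hp₂ (by rwa [← heq]) hpF.2 (by rwa [← heq])
  refine ⟨⟨e₁, e₂, e, he₁, he₂, he, T, D₁, D₂, hp, heq, faceAt (f₁ r.1),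
    hf₁.isBMap.isFaceImage hr.1, ?_, hG, hT⟩, rfl, rfl⟩
  rw [hr.2.2]
  exact hf₂.isBMap.isFaceImage hr.2.1

namespace FiberModel

variable (D : FiberModel f₁ f₂ F₁ F₂ p)

/-- The monoids of the faces of `F₁` and `F₂` in terms of coordinates. -/
structure IsLabelling
    (σ₁ : {K : Hypersurface X₁ // (faceAt p.1).1 ⊆ K.1 ∧ ¬ F₁.1 ⊆ K.1} ≃
      {a : {i // i ∉ D.D₁.S} // D.e₁.coord p.1 a.1 = 0})
    (σ₂ : {K : Hypersurface X₂ // (faceAt p.2).1 ⊆ K.1 ∧ ¬ F₂.1 ⊆ K.1} ≃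
      {a : {i // i ∉ D.D₂.S} // D.e₂.coord p.2 a.1 = 0}) : Prop where
  left : ∀ K, IsDefiningCoord D.e₁ K.1.1 p.1 (σ₁ K).1.1
  right : ∀ K, IsDefiningCoord D.e₂ K.1.1 p.2 (σ₂ K).1.1

theorem exists_isLabelling : ∃ σ₁ σ₂, D.IsLabelling σ₁ σ₂ := by
  have hpF := fiberD_subset_prod D.mem
  obtain ⟨σ₁, h₁⟩ := exists_hypersurface_equiv D.he₁ D.D₁.mem hpF.1 D.D₁.int_iff
  obtain ⟨σ₂, h₂⟩ := exists_hypersurface_equiv D.he₂ D.D₂.mem hpF.2 D.D₂.int_iff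
  exact ⟨σ₁, σ₂, h₁, h₂⟩

variable {σ₁ : {K : Hypersurface X₁ // (faceAt p.1).1 ⊆ K.1 ∧ ¬ F₁.1 ⊆ K.1} ≃
      {a : {i // i ∉ D.D₁.S} // D.e₁.coord p.1 a.1 = 0}}
    {σ₂ : {K : Hypersurface X₂ // (faceAt p.2).1 ⊆ K.1 ∧ ¬ F₂.1 ⊆ K.1} ≃
      {a : {i // i ∉ D.D₂.S} // D.e₂.coord p.2 a.1 = 0}}

theorem mem_fiberMonoid_iff (hσ : D.IsLabelling σ₁ σ₂) (hf₁ : IsInteriorBMap f₁)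
    (hf₂ : IsInteriorBMap f₂) (x : FaceMonoid F₁ (faceAt p.1) × FaceMonoid F₂ (faceAt p.2)) :
    x ∈ fiberMonoid f₁ f₂ F₁ (faceAt p.1) F₂ (faceAt p.2) D.G (faceAt (f₁ p.1)) ↔
    ∀ j : D.EqIdx, ∑ a : {a : {i // i ∉ D.D₁.S} // D.e₁.coord p.1 a.1 = 0},
      D.D₁.α j a.1.1 * x.1 (σ₁.symm a) =
      ∑ a : {a : {i // i ∉ D.D₂.S} // D.e₂.coord p.2 a.1 = 0}, D.D₂.α j a.1.1 * x.2 (σ₂.symm a) := by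
  have key : ∀ (H : Hypersurface Y) (j : Fin D.e.1), IsDefiningCoord D.e H.1 (f₁ p.1) j →
      (bPush f₁ F₁ (faceAt p.1) x.1 H = bPush f₂ F₂ (faceAt p.2) x.2 H ↔
      ∑ a : {a : {i // i ∉ D.D₁.S} // D.e₁.coord p.1 a.1 = 0}, D.D₁.α j a.1.1 * x.1 (σ₁.symm a) =
      ∑ a : {a : {i // i ∉ D.D₂.S} // D.e₂.coord p.2 a.1 = 0},
        D.D₂.α j a.1.1 * x.2 (σ₂.symm a)) := by
    intro H j hj
    rw [D.D₁.bPush_eq hf₁ D.he₁ D.he hσ.left hj,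
      D.D₂.bPush_eq hf₂ D.he₂ D.he hσ.right (by rw [← D.eq]; exact hj)]
  constructor
  · intro hx j
    by_cases hj : D.e.coord (f₁ p.1) j = 0
    · obtain ⟨H, hH⟩ := exists_hypersurface D.he D.D₁.map_mem (i := j.1) hj
      refine (key H j hH).1 (hx H (H.faceOf_subset_iff.2 (hH.mem_zeros_iff.2 hj)) fun h => ?_)
      exact j.2 ((hH.subset_iff D.mem_G D.int_iff).1 h)
    · have h1 := D.D₁.exponent_pos_mem j hj
      have h2 := D.D₂.exponent_pos_mem j (by rw [← D.eq]; exact hj)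
      simp [h1, h2]
  · intro hx H hGH hFH
    obtain ⟨j, hj⟩ := H.exists_isDefiningCoord D.he D.D₁.map_mem (H.faceOf_subset_iff.1 hGH)
    exact (key H j hj).2 (hx ⟨j, fun h => hFH ((hj.subset_iff D.mem_G D.int_iff).2 h)⟩)

/-- The components of an element of the fiber product of monoids, as exponents. -/
def exponents (σ₁ : {K : Hypersurface X₁ // (faceAt p.1).1 ⊆ K.1 ∧ ¬ F₁.1 ⊆ K.1} ≃
      {a : {i // i ∉ D.D₁.S} // D.e₁.coord p.1 a.1 = 0})
    (σ₂ : {K : Hypersurface X₂ // (faceAt p.2).1 ⊆ K.1 ∧ ¬ F₂.1 ⊆ K.1} ≃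
      {a : {i // i ∉ D.D₂.S} // D.e₂.coord p.2 a.1 = 0}) :
    FaceMonoid F₁ (faceAt p.1) × FaceMonoid F₂ (faceAt p.2) →+ ({i // D.coord p i = 0} → ℕ) where
  toFun x
    | ⟨.inl a, h⟩ => x.1 (σ₁.symm ⟨a, h⟩)
    | ⟨.inr a, h⟩ => x.2 (σ₂.symm ⟨a, h⟩)
  map_zero' := by ext ⟨i | i, h⟩ <;> rfl
  map_add' x y := by ext ⟨i | i, h⟩ <;> rfl

theorem exponents_bijective : Function.Bijective (D.exponents σ₁ σ₂) := by
  let _ := Fintype.ofEquiv _ σ₁.symm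
  let _ := Fintype.ofEquiv _ σ₂.symm
  constructor
  · intro x y h
    refine Prod.ext (Finsupp.ext fun K => ?_) (Finsupp.ext fun K => ?_)
    · have := congrFun h ⟨.inl (σ₁ K).1, (σ₁ K).2⟩
      simpa [exponents] using this
    · have := congrFun h ⟨.inr (σ₂ K).1, (σ₂ K).2⟩
      simpa [exponents] using this
  · intro n
    refine ⟨(Finsupp.equivFunOnFinite.symm fun K => n ⟨.inl (σ₁ K).1, (σ₁ K).2⟩,
      Finsupp.equivFunOnFinite.symm fun K => n ⟨.inr (σ₂ K).1, (σ₂ K).2⟩), ?_⟩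
    ext ⟨i | i, h⟩ <;> simp [exponents]

theorem sum_γ (j : D.EqIdx) (x : FaceMonoid F₁ (faceAt p.1) × FaceMonoid F₂ (faceAt p.2)) :
    ∑ i : {i // D.coord p i = 0}, D.γ j i * (D.exponents σ₁ σ₂ x i : ℤ) =
    ∑ a : {a : {i // i ∉ D.D₁.S} // D.e₁.coord p.1 a.1 = 0},
      (D.D₁.α j a.1.1 * x.1 (σ₁.symm a) : ℤ) -
      ∑ a : {a : {i // i ∉ D.D₂.S} // D.e₂.coord p.2 a.1 = 0},
        (D.D₂.α j a.1.1 * x.2 (σ₂.symm a) : ℤ) := by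
  rw [← (Equiv.subtypeSum (p := fun i => D.coord p i = 0)).symm.sum_comp, Fintype.sum_sum_type,
    sub_eq_add_neg, ← Finset.sum_neg_distrib]
  congr 1
  refine Finset.sum_congr rfl fun a _ => ?_
  exact neg_mul _ _

theorem mem_fiberMonoid_iff' (hσ : D.IsLabelling σ₁ σ₂) (hf₁ : IsInteriorBMap f₁)
    (hf₂ : IsInteriorBMap f₂) (x : FaceMonoid F₁ (faceAt p.1) × FaceMonoid F₂ (faceAt p.2)) :
    x ∈ fiberMonoid f₁ f₂ F₁ (faceAt p.1) F₂ (faceAt p.2) D.G (faceAt (f₁ p.1)) ↔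
    ∀ j : D.EqIdx, ∑ i : {i // D.coord p i = 0},
      D.γ j i * (D.exponents σ₁ σ₂ x i : ℤ) = 0 := by
  rw [D.mem_fiberMonoid_iff hσ hf₁ hf₂]
  refine forall_congr' fun j => ?_
  rw [D.sum_γ, sub_eq_zero]
  exact_mod_cast Iff.rfl

/-- The monomial system of equations of the fiber product in local coordinates. -/
theorem exists_system (hf₁ : IsInteriorBMap f₁) (hf₂ : IsInteriorBMap f₂)
    (htrans : BTransversal f₁ f₂) (hsmooth : SmoothFiberMonoids f₁ f₂) :
    ∃ (m : ℕ) (S : MonomialSystem D.Idx D.EqIdx (Fin m)),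
      S.z₀ = D.coord p ∧ S.γ = D.γ ∧ S.sol = D.sol := by
  have hpF := fiberD_subset_prod D.mem
  obtain ⟨σ₁, σ₂, hσ⟩ := D.exists_isLabelling
  obtain ⟨m, ⟨φ⟩⟩ := hsmooth F₁ (faceAt p.1) F₂ (faceAt p.2) D.G (faceAt (f₁ p.1))
    (F₁.faceOf_subset_iff.2 hpF.1) (F₂.faceOf_subset_iff.2 hpF.2) D.isFaceImage₁ D.isFaceImage₂
    (hf₁.isBMap.isFaceImage (mem_int_faceAt _))
    (by rw [D.eq]; exact hf₂.isBMap.isFaceImage (mem_int_faceAt _))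
    ⟨p, D.mem, mem_int_faceAt _, mem_int_faceAt _⟩
  have hbasis := IsKernelBasis.of_addEquiv
    (γ := fun (j : D.EqIdx) (i : {i // D.coord p i = 0}) => D.γ j i)
    ((D.exponents σ₁ σ₂).comp (AddSubmonoid.subtype _))
    (D.exponents_bijective.1.comp Subtype.val_injective) (fun n => by
      obtain ⟨x, rfl⟩ := (D.exponents_bijective (σ₁ := σ₁) (σ₂ := σ₂)).2 n
      rw [← D.mem_fiberMonoid_iff' hσ hf₁ hf₂]
      constructor
      · rintro ⟨y, hy⟩
        rw [← D.exponents_bijective.1 hy]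
        exact y.2
      · exact fun hx => ⟨⟨x, hx⟩, rfl⟩) φ
  refine ⟨m, ⟨D.coord p, D.γ, D.c, fun i k => if h : D.coord p i = 0 then
    D.exponents σ₁ σ₂ (φ.symm (Pi.single k 1)) ⟨i, h⟩ else 0, D.coord_mem p, ?_,
    fun i k h => dif_neg h, D.smoothGerm_c, D.c_pos, ?_, D.coord_mem_closure,
    D.surjective_of_bTransversal htrans⟩, rfl, rfl, rfl⟩
  · rintro j (i | i) hi
    · simp [γ, D.D₁.α_eq_zero j i hi]
    · simp [γ, D.D₂.α_eq_zero j i hi]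
  · convert hbasis with i k
    exact dif_pos i.2

end FiberModel

end

end

set_option linter.unusedSectionVars false

noncomputable section

section

variable {Y : Type u} [TopologicalSpace Y] [CornerAtlas Y] {n : ℕ} {x₀ : EuclideanSpace ℝ (Fin n)}
  {g g' : EuclideanSpace ℝ (Fin n) → Y}

theorem BGerm.congr (hx₀ : x₀ ∈ quadrant n) (hg : BGerm x₀ g) (h : g' =ᶠ[𝓝[quadrant n] x₀] g) :
    BGerm x₀ g' := by
  have h0 : g' x₀ = g x₀ := h.self_of_nhdsWithin hx₀
  refine ⟨?_, fun e he hge j => ?_⟩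
  · rw [h0]; exact hg.1.congr' h.symm
  · rw [h0] at hge
    rcases hg.2 e he hge j with ⟨α, hα⟩ | hz
    · exact .inl ⟨α, hα.congr (h.mono fun x hx => congrArg (fun y => e.coord y j) hx)⟩
    · right
      filter_upwards [h, hz] with x hx hz
      rw [hx, hz]

theorem BGerm.smoothGerm (hg : BGerm x₀ g) {e : CornerChart Y}
    (he : e ∈ CornerAtlas.charts) (hge : g x₀ ∈ e.source) :
    SmoothGerm (quadrant n) x₀ (fun x => e.coord (g x)) :=
  SmoothGerm.euclidean fun j => smoothGerm_of_monoGerm_or_zero (hg.2 e he hge j)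

theorem BGerm.eventually_continuousWithinAt (hg : BGerm x₀ g) :
    ∀ᶠ x in 𝓝[quadrant n] x₀, ContinuousWithinAt g (quadrant n) x := by
  obtain ⟨e, he, hge⟩ := exists_chart (g x₀)
  have h1 := hg.1.eventually (e.isOpen_source.mem_nhds hge)
  filter_upwards [h1, eventually_eventually_nhdsWithin.2 h1, hg.smoothGerm he hge]
    with x hx hx' hs
  have h2 : Tendsto (fun x => e.coord (g x)) (𝓝[quadrant n] x) (𝓝[quadrant e.1] (e.coord (g x))) :=
    tendsto_nhdsWithin_iff.2 ⟨hs.continuousWithinAt, Eventually.of_forall fun _ => e.coord_mem _⟩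
  refine ((CornerChart.tendsto_param hx).comp h2).congr' ?_
  filter_upwards [hx'] with y hy using CornerChart.param_coord hy

end

theorem eventually_eventually_openQuadrant {n : ℕ} {x₀ : EuclideanSpace ℝ (Fin n)}
    {P : EuclideanSpace ℝ (Fin n) → Prop} (h : ∀ᶠ x in 𝓝[openQuadrant n] x₀, P x) :
    ∀ᶠ x' in 𝓝[quadrant n] x₀, ∀ᶠ x in 𝓝[openQuadrant n] x', P x := by
  rw [eventually_nhdsWithin_iff] at h
  filter_upwards [mem_nhdsWithin_of_mem_nhds (eventually_eventually_nhds.2 h)] with x hx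
  exact eventually_nhdsWithin_iff.2 hx

/-- Charts from local inverse maps. -/
theorem exists_cornerChart {A : Type u} [TopologicalSpace A] {a₀ : A} {n : ℕ}
    {T : A → EuclideanSpace ℝ (Fin n)} {H : EuclideanSpace ℝ (Fin n) → A} {P : A → Prop}
    (hT : ∀ᶠ a in 𝓝 a₀, T a ∈ quadrant n ∧ H (T a) = a ∧ ContinuousAt T a)
    (hH : ∀ᶠ x in 𝓝[quadrant n] (T a₀), T (H x) = x ∧ ContinuousWithinAt H (quadrant n) x)
    (hP : ∀ᶠ a in 𝓝 a₀, P a) :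
    ∃ φ : OpenPartialHomeomorph A (EuclideanQuadrant n),
      let e : CornerChart A := ⟨n, φ⟩
      a₀ ∈ e.source ∧ ∀ a ∈ e.source, P a ∧ e.coord a = T a ∧
        ∀ x ∈ quadrant n, e.param x = H x := by
  set I := modelWithCornersEuclideanQuadrant n
  have hIs : ∀ x ∈ quadrant n, I (I.symm x) = x := fun x hx => I.right_inv' hx
  obtain ⟨U, hU, hUo, haU⟩ := eventually_nhds_iff.1 (hT.and hP)
  obtain ⟨V, hVo, haV, hV⟩ := mem_nhdsWithin.1 hH
  have hI : Continuous I := I.continuous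
  have hmem : ∀ y : EuclideanQuadrant n, I y ∈ quadrant n := fun y => y.2
  have hTU : ContinuousOn T U := fun a ha => (hU a ha).1.2.2.continuousWithinAt
  have hHV : ContinuousOn (fun y => H (I y)) (I ⁻¹' V) := by
    intro y hy
    have h1 : ContinuousWithinAt H (quadrant n) (I y) := (hV ⟨hy, hmem y⟩).2
    exact h1.comp hI.continuousWithinAt fun z _ => hmem z
  let φ : OpenPartialHomeomorph A (EuclideanQuadrant n) :=
    { toFun := fun a => I.symm (T a)
      invFun := fun y => H (I y)
      source := U ∩ T ⁻¹' V
      target := I ⁻¹' V ∩ (fun y => H (I y)) ⁻¹' U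
      map_source' := by
        rintro a ⟨haU, haV⟩
        have h1 := (hU a haU).1
        refine ⟨?_, ?_⟩
        · change I (I.symm (T a)) ∈ V
          rw [hIs _ h1.1]; exact haV
        · change H (I (I.symm (T a))) ∈ U
          rw [hIs _ h1.1, h1.2.1]; exact haU
      map_target' := by
        rintro y ⟨hyV, hyU⟩
        have h1 : T (H (I y)) = I y := (hV ⟨hyV, hmem y⟩).1
        exact ⟨hyU, show T (H (I y)) ∈ V by rw [h1]; exact hyV⟩
      left_inv' := by
        rintro a ⟨haU, haV⟩
        have h1 := (hU a haU).1
        change H (I (I.symm (T a))) = a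
        rw [hIs _ h1.1, h1.2.1]
      right_inv' := by
        rintro y ⟨hyV, hyU⟩
        have h1 : T (H (I y)) = I y := (hV ⟨hyV, hmem y⟩).1
        change I.symm (T (H (I y))) = y
        rw [h1, I.left_inv]
      open_source := hTU.isOpen_inter_preimage hUo hVo
      open_target := hHV.isOpen_inter_preimage (hVo.preimage hI) hUo
      continuousOn_toFun := I.continuous_symm.comp_continuousOn (hTU.mono inter_subset_left)
      continuousOn_invFun := hHV.mono inter_subset_left }
  refine ⟨φ, ⟨haU, haV⟩, fun a ha => ⟨(hU a ha.1).2, hIs _ (hU a ha.1).1.1,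
    fun x hx => congrArg H (hIs x hx)⟩⟩

section

open scoped Classical

variable {X₁ X₂ Y : Type u} [TopologicalSpace X₁] [CornerAtlas X₁] [TopologicalSpace X₂]
  [CornerAtlas X₂] [TopologicalSpace Y] [CornerAtlas Y]

/-- Germs at a point of a quadrant of b-maps into `D(F₁, F₂)` which map the interior to the
interior. -/
structure FiberGerm (f₁ : X₁ → Y) (f₂ : X₂ → Y) (F₁ : Face X₁) (F₂ : Face X₂) {n : ℕ}
    (x₀ : EuclideanSpace ℝ (Fin n)) (g : EuclideanSpace ℝ (Fin n) → X₁ × X₂) : Prop where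
  fst : BGerm x₀ (fun x => (g x).1)
  snd : BGerm x₀ (fun x => (g x).2)
  int : ∀ᶠ x in 𝓝[openQuadrant n] x₀, g x ∈ fiberInt f₁ f₂ F₁ F₂

variable {f₁ : X₁ → Y} {f₂ : X₂ → Y} {F₁ : Face X₁} {F₂ : Face X₂} {n : ℕ}
  {x₀ : EuclideanSpace ℝ (Fin n)} {g g' : EuclideanSpace ℝ (Fin n) → X₁ × X₂}

namespace FiberGerm

theorem congr (hx₀ : x₀ ∈ quadrant n) (hg : FiberGerm f₁ f₂ F₁ F₂ x₀ g)
    (h : g' =ᶠ[𝓝[quadrant n] x₀] g) : FiberGerm f₁ f₂ F₁ F₂ x₀ g' := by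
  refine ⟨hg.fst.congr hx₀ (h.mono fun x hx => congrArg Prod.fst hx),
    hg.snd.congr hx₀ (h.mono fun x hx => congrArg Prod.snd hx), ?_⟩
  filter_upwards [hg.int, nhdsWithin_mono _ (openQuadrant_subset n) h] with x hx hx'
  rw [hx']; exact hx

theorem eventually_continuousWithinAt (hg : FiberGerm f₁ f₂ F₁ F₂ x₀ g) :
    ∀ᶠ x in 𝓝[quadrant n] x₀, ContinuousWithinAt g (quadrant n) x := by
  filter_upwards [hg.fst.eventually_continuousWithinAt, hg.snd.eventually_continuousWithinAt]
    with x h1 h2 using h1.prodMk h2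

theorem tendsto (hg : FiberGerm f₁ f₂ F₁ F₂ x₀ g) : Tendsto g (𝓝[quadrant n] x₀) (𝓝 (g x₀)) :=
  hg.fst.1.prodMk_nhds hg.snd.1

theorem eventually_mem_fiberD (hg : FiberGerm f₁ f₂ F₁ F₂ x₀ g) :
    ∀ᶠ x in 𝓝[quadrant n] x₀, g x ∈ fiberD f₁ f₂ F₁ F₂ := by
  filter_upwards [hg.eventually_continuousWithinAt, eventually_eventually_openQuadrant hg.int,
    self_mem_nhdsWithin] with x h1 h2 hxQ
  have := nhdsWithin_openQuadrant_neBot hxQ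
  exact mem_closure_of_tendsto (h1.tendsto.mono_left (nhdsWithin_mono _ (openQuadrant_subset n))) h2

end FiberGerm

namespace FiberModel

variable {p : X₁ × X₂} (D : FiberModel f₁ f₂ F₁ F₂ p)

/-- Near `p`, germs of maps into `D(F₁, F₂)` have monomial coordinates. -/
theorem eventually_monoGerm_coord : ∀ᶠ q in 𝓝 p, ∀ (N : ℕ) (y₀ : EuclideanSpace ℝ (Fin N))
    (g : EuclideanSpace ℝ (Fin N) → X₁ × X₂), y₀ ∈ quadrant N → g y₀ = q →
    FiberGerm f₁ f₂ F₁ F₂ y₀ g → (∀ i, ∃ α, MonoGerm y₀ (fun y => D.coord (g y) i) α) ∧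
      ∀ᶠ y in 𝓝[openQuadrant N] y₀, D.coord (g y) ∈ D.sol := by
  have h1 : ∀ᶠ q in 𝓝 p, q.1 ∈ F₁.int ↔ D.e₁.zeros q.1 = D.D₁.S :=
    continuousAt_fst.eventually D.D₁.int_iff
  have h2 : ∀ᶠ q in 𝓝 p, q.2 ∈ F₂.int ↔ D.e₂.zeros q.2 = D.D₂.S :=
    continuousAt_snd.eventually D.D₂.int_iff
  filter_upwards [D.eventually_source, eventually_eventually_nhds.2 h1,
    eventually_eventually_nhds.2 h2, eventually_eventually_nhds.2 D.eventually_coord_mem_sol]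
    with q hs h1 h2 h3 N y₀ g hy₀ hgq hg
  subst hgq
  have := nhdsWithin_openQuadrant_neBot hy₀
  have ht := hg.tendsto.mono_left (nhdsWithin_mono _ (openQuadrant_subset N))
  refine ⟨?_, ?_⟩
  · rintro (i | i)
    · refine (hg.fst.2 D.e₁ D.he₁ hs.1 i.1).resolve_right fun h0 => ?_
      obtain ⟨y, hy, hy', hy''⟩ := ((h0.filter_mono (nhdsWithin_mono _ (openQuadrant_subset N))).and
        (hg.int.and (ht.eventually h1))).exists
      exact i.2 ((hy''.1 hy'.1).subset hy)
    · refine (hg.snd.2 D.e₂ D.he₂ hs.2 i.1).resolve_right fun h0 => ?_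
      obtain ⟨y, hy, hy', hy''⟩ := ((h0.filter_mono (nhdsWithin_mono _ (openQuadrant_subset N))).and
        (hg.int.and (ht.eventually h2))).exists
      exact i.2 ((hy''.1 hy'.2.1).subset hy)
  · filter_upwards [hg.int, ht.eventually h3] with y hy hy' using hy' hy

variable [IsManifoldWithCorners X₁] [IsManifoldWithCorners X₂]

/-- Families of monomials which solve the equations give germs of maps into `D(F₁, F₂)`. -/
theorem eventually_fiberGerm_param (hf₁ : Continuous f₁) (hf₂ : Continuous f₂) :
    ∀ᶠ z in 𝓝[piQuadrant D.Idx] (D.coord p), ∀ (N : ℕ) (y₀ : EuclideanSpace ℝ (Fin N))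
    (g : EuclideanSpace ℝ (Fin N) → D.Idx → ℝ), y₀ ∈ quadrant N → g y₀ = z →
    (∀ i, ∃ α, MonoGerm y₀ (fun y => g y i) α) → (∀ᶠ y in 𝓝[openQuadrant N] y₀, g y ∈ D.sol) →
    FiberGerm f₁ f₂ F₁ F₂ y₀ (fun y => D.param (g y)) := by
  filter_upwards [eventually_eventually_nhdsWithin.2 D.eventually_coord_param,
    D.eventually_coord_param, eventually_eventually_nhdsWithin.2 (D.eventually_param_mem hf₁ hf₂)]
    with z h1 h1z h2 N y₀ g hy₀ hgz hg hsol
  subst hgz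
  choose α hα using hg
  have hgs : SmoothGerm (quadrant N) y₀ g := SmoothGerm.pi fun i => (hα i).smoothGerm
  have hgt : Tendsto g (𝓝[quadrant N] y₀) (𝓝[piQuadrant D.Idx] (g y₀)) := by
    refine tendsto_nhdsWithin_iff.2 ⟨(hgs.continuousWithinAt hy₀).tendsto, ?_⟩
    filter_upwards [eventually_all.2 fun i => (hα i).nonneg] with y hy using hy
  have h3 := hgt.eventually h1
  have hc1 : Tendsto (fun y => D.ext₁ (g y)) (𝓝[quadrant N] y₀)
      (𝓝[quadrant D.e₁.1] (D.e₁.coord (D.param (g y₀)).1)) := by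
    rw [h1z.2.2.2.1]
    refine tendsto_nhdsWithin_iff.2 ⟨(D.ext₁.continuous.tendsto _).comp
      (hgs.continuousWithinAt hy₀).tendsto, ?_⟩
    filter_upwards [(tendsto_nhdsWithin_iff.1 hgt).2] with y hy using extendZero_mem hy
  have hc2 : Tendsto (fun y => D.ext₂ (g y)) (𝓝[quadrant N] y₀)
      (𝓝[quadrant D.e₂.1] (D.e₂.coord (D.param (g y₀)).2)) := by
    rw [h1z.2.2.2.2]
    refine tendsto_nhdsWithin_iff.2 ⟨(D.ext₂.continuous.tendsto _).comp
      (hgs.continuousWithinAt hy₀).tendsto, ?_⟩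
    filter_upwards [(tendsto_nhdsWithin_iff.1 hgt).2] with y hy using extendZero_mem hy
  refine ⟨BGerm.of_chart hy₀ ((CornerChart.tendsto_param h1z.2.1).comp hc1) D.he₁ h1z.2.1 fun j => ?_,
    BGerm.of_chart hy₀ ((CornerChart.tendsto_param h1z.2.2.1).comp hc2) D.he₂ h1z.2.2.1 fun j => ?_,
    ?_⟩
  · by_cases hj : j ∈ D.D₁.S
    · right
      filter_upwards [h3] with y hy
      rw [hy.2.2.2.1, ext₁, extendZero_of_mem _ hj]
    · left
      refine ⟨_, (hα (.inl ⟨j, hj⟩)).congr ?_⟩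
      filter_upwards [h3] with y hy
      rw [hy.2.2.2.1, ext₁, extendZero_of_notMem _ hj]
  · by_cases hj : j ∈ D.D₂.S
    · right
      filter_upwards [h3] with y hy
      rw [hy.2.2.2.2, ext₂, extendZero_of_mem _ hj]
    · left
      refine ⟨_, (hα (.inr ⟨j, hj⟩)).congr ?_⟩
      filter_upwards [h3] with y hy
      rw [hy.2.2.2.2, ext₂, extendZero_of_notMem _ hj]
  · filter_upwards [hsol, nhdsWithin_mono _ (openQuadrant_subset N) (hgt.eventually h2)]
      with y hy hy' using hy' hy

end FiberModel

/-- The charts of `D(F₁, F₂)`. -/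
structure IsResChart (f₁ : X₁ → Y) (f₂ : X₂ → Y) (F₁ : Face X₁) (F₂ : Face X₂) {W : Type u}
    [TopologicalSpace W] (h : W → X₁ × X₂) (e : CornerChart W) : Prop where
  fiberGerm : ∀ w ∈ e.source, FiberGerm f₁ f₂ F₁ F₂ (e.coord w) (fun x => h (e.param x))
  lift : ∀ (N : ℕ) (y₀ : EuclideanSpace ℝ (Fin N)) (φ : EuclideanSpace ℝ (Fin N) → W),
    y₀ ∈ quadrant N → φ y₀ ∈ e.source → FiberGerm f₁ f₂ F₁ F₂ y₀ (fun y => h (φ y)) →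
    ∀ j, ∃ α, MonoGerm y₀ (fun y => e.coord (φ y) j) α

/-- A homeomorphism `h` of `W` onto `D(F₁, F₂)`, such that b-maps into `D(F₁, F₂)` lift. -/
structure IsRes (f₁ : X₁ → Y) (f₂ : X₂ → Y) (F₁ : Face X₁) (F₂ : Face X₂) {W : Type u}
    [TopologicalSpace W] [CornerAtlas W] (h : W → X₁ × X₂) : Prop where
  isEmbedding : IsEmbedding h
  range_eq : range h = fiberD f₁ f₂ F₁ F₂
  chart : ∀ e ∈ CornerAtlas.charts (X := W), IsResChart f₁ f₂ F₁ F₂ h e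

end

end

set_option linter.unusedSectionVars false

noncomputable section

section

open scoped Classical

variable {X₁ X₂ Y : Type u} [TopologicalSpace X₁] [CornerAtlas X₁] [TopologicalSpace X₂]
  [CornerAtlas X₂] [TopologicalSpace Y] [CornerAtlas Y]
  {f₁ : X₁ → Y} {f₂ : X₂ → Y} {F₁ : Face X₁} {F₂ : Face X₂} {p : X₁ × X₂}

theorem MonomialSystem.Resolution.tendsto_H {ι J κ : Type} [Fintype ι] [Fintype κ]
    {S : MonomialSystem ι J κ} (R : S.Resolution) :
    Tendsto R.H (𝓝[quadrant R.n] (R.T S.z₀)) (𝓝[piQuadrant ι] (R.H (R.T S.z₀))) := by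
  have hs : SmoothGerm (quadrant R.n) (R.T S.z₀) R.H := SmoothGerm.pi fun i =>
    (R.monoGerm i).smoothGerm
  refine tendsto_nhdsWithin_iff.2 ⟨(hs.continuousWithinAt R.mem).tendsto, ?_⟩
  filter_upwards [eventually_all.2 fun i => (R.monoGerm i).nonneg] with y hy using hy

theorem MonomialSystem.Resolution.H_center {ι J κ : Type} [Fintype ι] [Fintype κ]
    {S : MonomialSystem ι J κ} (R : S.Resolution) : R.H (R.T S.z₀) = S.z₀ :=
  (R.right_inv.self_of_nhdsWithin S.mem_closure).1

namespace FiberModel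

variable (D : FiberModel f₁ f₂ F₁ F₂ p)

theorem eventually_coord_mem_closure :
    ∀ᶠ q in 𝓝 p, q ∈ fiberD f₁ f₂ F₁ F₂ → D.coord q ∈ closure D.sol := by
  filter_upwards [D.eventually_source, eventually_eventually_nhds.2 D.eventually_coord_mem_sol]
    with q hs hq hqD
  have : (𝓝[fiberInt f₁ f₂ F₁ F₂] q).NeBot := mem_closure_iff_nhdsWithin_neBot.1 hqD
  exact mem_closure_of_tendsto ((D.continuousAt_coord hs.1 hs.2).tendsto.mono_left
    nhdsWithin_le_nhds) (eventually_nhdsWithin_iff.2 hq)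

variable [IsManifoldWithCorners X₁] [IsManifoldWithCorners X₂]
  {m : ℕ} {S : MonomialSystem D.Idx D.EqIdx (Fin m)}

/-- The local parametrization of `D(F₁, F₂)` given by a resolution of the local equations. -/
theorem eventually_fiberGerm_resolution (hf₁ : Continuous f₁) (hf₂ : Continuous f₂)
    (hz₀ : S.z₀ = D.coord p) (hsol : S.sol = D.sol) (R : S.Resolution) :
    ∀ᶠ x in 𝓝[quadrant R.n] (R.T S.z₀), FiberGerm f₁ f₂ F₁ F₂ x (fun x => D.param (R.H x)) := by
  have h1 := R.tendsto_H
  rw [R.H_center] at h1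
  have h2 := eventually_eventually_openQuadrant R.mem_sol
  filter_upwards [h1.eventually (hz₀ ▸ D.eventually_fiberGerm_param hf₁ hf₂),
    eventually_all.2 fun i => (R.monoGerm i).eventually, h2, self_mem_nhdsWithin]
    with x hx hm hs hxQ
  exact hx _ x R.H hxQ rfl (fun i => ⟨_, hm i⟩) (by rw [← hsol]; exact hs)

theorem exists_isResChart (hf₁ : Continuous f₁) (hf₂ : Continuous f₂) (hz₀ : S.z₀ = D.coord p)
    (hsol : S.sol = D.sol) (R : S.Resolution) :
    ∃ e : CornerChart (fiberD f₁ f₂ F₁ F₂), (⟨p, D.mem⟩ : fiberD f₁ f₂ F₁ F₂) ∈ e.source ∧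
      IsResChart f₁ f₂ F₁ F₂ Subtype.val e := by
  set T : fiberD f₁ f₂ F₁ F₂ → EuclideanSpace ℝ (Fin R.n) := fun q => R.T (D.coord q.1) with hTdef
  set H : EuclideanSpace ℝ (Fin R.n) → fiberD f₁ f₂ F₁ F₂ := fun x =>
    if h : D.param (R.H x) ∈ fiberD f₁ f₂ F₁ F₂ then ⟨_, h⟩ else ⟨p, D.mem⟩ with hHdef
  set a₀ : fiberD f₁ f₂ F₁ F₂ := ⟨p, D.mem⟩ with ha₀
  have hTa₀ : T a₀ = R.T S.z₀ := by simp only [hTdef, ha₀, hz₀]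
  have hx₀ := R.mem
  have hval : Tendsto (Subtype.val : fiberD f₁ f₂ F₁ F₂ → X₁ × X₂) (𝓝 a₀) (𝓝 p) :=
    continuous_subtype_val.tendsto a₀
  have hgerm := D.eventually_fiberGerm_resolution hf₁ hf₂ hz₀ hsol R
  have hmemD := (hgerm.self_of_nhdsWithin hx₀).eventually_mem_fiberD
  have hHval : ∀ᶠ x in 𝓝[quadrant R.n] (R.T S.z₀), (H x).1 = D.param (R.H x) := by
    filter_upwards [hmemD] with x hx
    simp only [hHdef, dif_pos hx]
  have hcoordt : Tendsto (fun q : fiberD f₁ f₂ F₁ F₂ => D.coord q.1) (𝓝 a₀)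
      (𝓝[closure S.sol] S.z₀) := by
    rw [hz₀, hsol]
    refine tendsto_nhdsWithin_iff.2 ⟨(D.continuousAt_coord D.D₁.mem D.D₂.mem).tendsto.comp hval, ?_⟩
    filter_upwards [hval.eventually D.eventually_coord_mem_closure] with q hq using hq q.2
  have hcoordc : ∀ᶠ a in 𝓝 a₀, ContinuousAt (fun q : fiberD f₁ f₂ F₁ F₂ => D.coord q.1) a := by
    filter_upwards [hval.eventually D.eventually_source] with a ha
    exact (D.continuousAt_coord ha.1 ha.2).comp continuous_subtype_val.continuousAt
  have hcl : ∀ᶠ a in 𝓝 a₀, D.coord a.1 ∈ closure S.sol := by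
    filter_upwards [hval.eventually D.eventually_coord_mem_closure] with a ha
    rw [hsol]; exact ha a.2
  have hTc : ∀ᶠ a in 𝓝 a₀, ContinuousAt T a := by
    filter_upwards [hcoordc, hcoordt.eventually R.right_inv, eventually_eventually_nhds.2 hcl]
      with a h1 h2 h3
    have h4 : Tendsto (fun q : fiberD f₁ f₂ F₁ F₂ => D.coord q.1) (𝓝 a)
        (𝓝[closure S.sol] (D.coord a.1)) := tendsto_nhdsWithin_iff.2 ⟨h1, h3⟩
    exact h2.2.2.tendsto.comp h4
  have hTt : Tendsto T (𝓝 a₀) (𝓝[quadrant R.n] (R.T S.z₀)) := by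
    refine tendsto_nhdsWithin_iff.2 ⟨hTa₀ ▸ hTc.self_of_nhds, ?_⟩
    filter_upwards [hcoordt.eventually R.right_inv] with a ha using ha.2.1
  have hT : ∀ᶠ a in 𝓝 a₀, T a ∈ quadrant R.n ∧ H (T a) = a ∧ ContinuousAt T a := by
    filter_upwards [hcoordt.eventually R.right_inv, hTc, hTt.eventually hHval,
      hval.eventually D.eventually_param_coord] with a h1 h2 h3 h4
    refine ⟨h1.2.1, Subtype.ext ?_, h2⟩
    have ha := fiberD_subset_prod a.2
    rw [h3]
    change D.param (R.H (R.T (D.coord a.1))) = a.1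
    rw [h1.1, h4 ha.1 ha.2]
  have hHt := R.tendsto_H
  rw [R.H_center] at hHt
  have hHc : ∀ᶠ x in 𝓝[quadrant R.n] (R.T S.z₀), ContinuousWithinAt H (quadrant R.n) x := by
    filter_upwards [(hgerm.self_of_nhdsWithin hx₀).eventually_continuousWithinAt, hHval,
      eventually_eventually_nhdsWithin.2 hHval] with x h1 h2 h3
    refine tendsto_subtype_rng.2 ?_
    rw [h2]
    refine h1.tendsto.congr' ?_
    filter_upwards [h3] with y hy using hy.symm
  have hH : ∀ᶠ x in 𝓝[quadrant R.n] (T a₀), T (H x) = x ∧ ContinuousWithinAt H (quadrant R.n) x := by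
    rw [hTa₀]
    filter_upwards [hHc, hHval, R.left_inv, hHt.eventually (hz₀ ▸ D.eventually_coord_param)]
      with x h1 h2 h3 h4
    refine ⟨?_, h1⟩
    change R.T (D.coord (H x).1) = x
    rw [h2, h4.1, h3]
  have hP : ∀ᶠ a in 𝓝 a₀, FiberGerm f₁ f₂ F₁ F₂ (T a) (fun x => (H x).1) ∧
      ∀ (N : ℕ) (y₀ : EuclideanSpace ℝ (Fin N))
        (φ : EuclideanSpace ℝ (Fin N) → fiberD f₁ f₂ F₁ F₂),
        y₀ ∈ quadrant N → φ y₀ = a → FiberGerm f₁ f₂ F₁ F₂ y₀ (fun y => (φ y).1) →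
        ∀ j, ∃ α, MonoGerm y₀ (fun y => T (φ y) j) α := by
    have h1 := hTt.eventually (hgerm.and (eventually_eventually_nhdsWithin.2 hHval))
    have hle : 𝓝[closure S.sol] S.z₀ ≤ 𝓝[piQuadrant D.Idx] S.z₀ :=
      nhdsWithin_mono _ S.closure_sol_subset
    filter_upwards [h1, hcoordt.eventually (hle R.lift), hval.eventually D.eventually_monoGerm_coord,
      hTt.eventually self_mem_nhdsWithin] with a h1 h2 h3 hTa
    refine ⟨h1.1.congr hTa h1.2, fun N y₀ φ hy₀ hφ hg => ?_⟩
    obtain ⟨h4, h5⟩ := h3 N y₀ _ hy₀ (congrArg Subtype.val hφ) hg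
    exact h2 N y₀ (fun y => D.coord (φ y).1) hy₀ (by rw [hφ]) h4 (by rw [hsol]; exact h5)
  obtain ⟨φ, ha₀, hφ⟩ := exists_cornerChart hT hH hP
  refine ⟨⟨R.n, φ⟩, ha₀, ⟨fun w hw => ?_, fun N y₀ ψ hy₀ hψ hg j => ?_⟩⟩
  · obtain ⟨⟨h1, -⟩, h2, h3⟩ := hφ w hw
    have hQ := CornerChart.coord_mem ⟨R.n, φ⟩ w
    rw [h2] at hQ ⊢
    refine h1.congr hQ ?_
    filter_upwards [self_mem_nhdsWithin] with x hx using congrArg Subtype.val (h3 x hx)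
  · obtain ⟨⟨-, h1⟩, -⟩ := hφ _ hψ
    obtain ⟨α, hα⟩ := h1 N y₀ ψ hy₀ rfl hg j
    have hψt : Tendsto ψ (𝓝[quadrant N] y₀) (𝓝 (ψ y₀)) := tendsto_subtype_rng.2 hg.tendsto
    refine ⟨α, hα.congr ?_⟩
    filter_upwards [hψt.eventually ((CornerChart.isOpen_source ⟨R.n, φ⟩).mem_nhds hψ)] with y hy
    exact congrArg (fun v : EuclideanSpace ℝ (Fin R.n) => v j) (hφ _ hy).2.1

end FiberModel

/-- `D(F₁, F₂)` as a manifold with corners. -/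
@[reducible]
def fiberAtlas (f₁ : X₁ → Y) (f₂ : X₂ → Y) (F₁ : Face X₁) (F₂ : Face X₂)
    (h : ∀ q : fiberD f₁ f₂ F₁ F₂, ∃ e : CornerChart (fiberD f₁ f₂ F₁ F₂),
      IsResChart f₁ f₂ F₁ F₂ Subtype.val e ∧ q ∈ e.source) :
    CornerAtlas (fiberD f₁ f₂ F₁ F₂) where
  charts := {e | IsResChart f₁ f₂ F₁ F₂ Subtype.val e}
  cover := h
  compatible e he e' he' q hq := by
    have hq' : e.param (e.coord q) = q := CornerChart.param_coord hq.1
    have h1 := (he' : IsResChart _ _ _ _ _ _).lift _ (e.coord q) e.param (e.coord_mem q)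
      (by rw [hq']; exact hq.2) ((he : IsResChart _ _ _ _ _ _).fiberGerm q hq.1)
    choose α hα using h1
    exact (SmoothGerm.euclidean fun j => (hα j).smoothGerm).self_of_mem (e.coord_mem q)

variable [IsManifoldWithCorners X₁] [IsManifoldWithCorners X₂] [IsManifoldWithCorners Y]

theorem exists_isRes (hf₁ : IsInteriorBMap f₁) (hf₂ : IsInteriorBMap f₂)
    (htrans : BTransversal f₁ f₂) (hsmooth : SmoothFiberMonoids f₁ f₂) (F₁ : Face X₁)
    (F₂ : Face X₂) : ∃ _ : CornerAtlas (fiberD f₁ f₂ F₁ F₂),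
      IsRes f₁ f₂ F₁ F₂ (Subtype.val : fiberD f₁ f₂ F₁ F₂ → X₁ × X₂) := by
  have hcover : ∀ q : fiberD f₁ f₂ F₁ F₂, ∃ e : CornerChart (fiberD f₁ f₂ F₁ F₂),
      IsResChart f₁ f₂ F₁ F₂ Subtype.val e ∧ q ∈ e.source := by
    intro q
    obtain ⟨e₁, he₁, hq₁⟩ := exists_chart q.1.1
    obtain ⟨e₂, he₂, hq₂⟩ := exists_chart q.1.2
    obtain ⟨D, -, -⟩ := exists_fiberModel hf₁ hf₂ q.2 he₁ he₂ hq₁ hq₂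
    obtain ⟨m, S, hz₀, -, hsol⟩ := D.exists_system hf₁ hf₂ htrans hsmooth
    obtain ⟨R, -⟩ := S.exists_resolution
    obtain ⟨e, he, he'⟩ := D.exists_isResChart hf₁.1.1 hf₂.1.1 hz₀ hsol R
    exact ⟨e, he', he⟩
  let A := fiberAtlas f₁ f₂ F₁ F₂ hcover
  exact ⟨A, { isEmbedding := .subtypeVal, range_eq := Subtype.range_val, chart := fun e he => he }⟩

end

end

set_option linter.unusedSectionVars false

noncomputable section

theorem sum_subtype_of_eq_zero {ι M : Type*} [Fintype ι] [AddCommMonoid M] {p : ι → Prop}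
    [DecidablePred p] (f : ι → M) (h : ∀ i, ¬ p i → f i = 0) : ∑ i : {i // p i}, f i = ∑ i, f i := by
  rw [← Fintype.sum_subtype_add_sum_subtype p f,
    Fintype.sum_eq_zero (fun i : {i // ¬ p i} => f i) fun i => h i i.2, add_zero]

section

variable {n m : ℕ} {x₀ : EuclideanSpace ℝ (Fin n)}

/-- The limit at `x₀` of `xᵢ ∂ᵢu / u`. -/
def limLogDeriv (x₀ : EuclideanSpace ℝ (Fin n)) (u : EuclideanSpace ℝ (Fin n) → ℝ) (i : Fin n) : ℝ :=
  limUnder (𝓝[openQuadrant n] x₀)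
    (fun x => x i * fderiv ℝ u x (EuclideanSpace.single i 1) / u x)

theorem MonoGerm.hasLogDeriv_lim {u : EuclideanSpace ℝ (Fin n) → ℝ} {α : Fin n → ℕ}
    (hx₀ : x₀ ∈ quadrant n) (hu : MonoGerm x₀ u α) (i : Fin n) :
    HasLogDeriv x₀ u i (limLogDeriv x₀ u i) := hu.hasLogDeriv hx₀ i

theorem MonoGerm.differentiableAt_and_ne_zero {u : EuclideanSpace ℝ (Fin n) → ℝ} {α : Fin n → ℕ}
    (hu : MonoGerm x₀ u α) :
    ∀ᶠ x in 𝓝[openQuadrant n] x₀, DifferentiableAt ℝ u x ∧ u x ≠ 0 := by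
  have hle := nhdsWithin_mono x₀ (openQuadrant_subset n)
  filter_upwards [hle hu.smoothGerm, hle hu.pos, self_mem_nhdsWithin] with x h1 h2 hx
  exact ⟨(ContDiffWithinAt.contDiffAt h1 (quadrant_mem_nhds hx)).differentiableAt (by simp),
    (h2 hx).ne'⟩

/-- The chain rule for logarithmic derivatives of monomials. -/
theorem MonoGerm.limLogDeriv_comp (hx₀ : x₀ ∈ quadrant n)
    {φ : EuclideanSpace ℝ (Fin n) → EuclideanSpace ℝ (Fin m)} {A : Fin m → Fin n → ℕ}
    (hφ : ∀ j, MonoGerm x₀ (fun x => φ x j) (A j)) {u : EuclideanSpace ℝ (Fin m) → ℝ}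
    {β : Fin m → ℕ} (hu : MonoGerm (φ x₀) u β) (i : Fin n) :
    limLogDeriv x₀ (fun x => u (φ x)) i =
      ∑ j, limLogDeriv (φ x₀) u j * limLogDeriv x₀ (fun x => φ x j) i := by
  have hy₀ : φ x₀ ∈ quadrant m := fun j => (hφ j).nonneg.self_of_nhdsWithin hx₀
  exact (HasLogDeriv.comp hx₀ hφ (fun j => (hφ j).hasLogDeriv_lim hx₀ i)
    (fun j => hu.hasLogDeriv_lim hy₀ j) hu.differentiableAt_and_ne_zero).limUnder_eq hx₀

theorem limLogDeriv_coord (hx₀ : x₀ ∈ quadrant n) {u : EuclideanSpace ℝ (Fin n) → ℝ} {j : Fin n}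
    (hu : ∀ᶠ x in 𝓝[quadrant n] x₀, u x = x j) (i : Fin n) :
    limLogDeriv x₀ u i = if i = j then 1 else 0 :=
  ((HasLogDeriv.coord j).congr
    (hu.filter_mono (nhdsWithin_mono x₀ (openQuadrant_subset n)))).limUnder_eq hx₀

theorem limLogDeriv_congr (hx₀ : x₀ ∈ quadrant n) {u v : EuclideanSpace ℝ (Fin n) → ℝ} {α : Fin n → ℕ}
    (hu : MonoGerm x₀ u α) (h : v =ᶠ[𝓝[quadrant n] x₀] u) (i : Fin n) :
    limLogDeriv x₀ v i = limLogDeriv x₀ u i :=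
  ((hu.hasLogDeriv_lim hx₀ i).congr
    (h.filter_mono (nhdsWithin_mono x₀ (openQuadrant_subset n)))).limUnder_eq hx₀

/-- The exponents of the coordinate functions. -/
theorem monoGerm_coord (i : Fin n) : MonoGerm x₀ (fun x => x i) (Pi.single i 1) := by
  refine ⟨fun _ => 1, SmoothGerm.const 1, Eventually.of_forall fun x => ⟨one_pos, ?_⟩⟩
  rw [one_mul, Finset.prod_eq_single i (fun k _ hk => by simp [hk]) (by simp)]
  simp

/-- Germs of b-maps between quadrants which are inverse to each other. -/
structure IsBInverse (x₀ : EuclideanSpace ℝ (Fin n)) (y₀ : EuclideanSpace ℝ (Fin m))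
    (φ : EuclideanSpace ℝ (Fin n) → EuclideanSpace ℝ (Fin m))
    (χ : EuclideanSpace ℝ (Fin m) → EuclideanSpace ℝ (Fin n))
    (B : Fin m → Fin n → ℕ) (C : Fin n → Fin m → ℕ) : Prop where
  mem : x₀ ∈ quadrant n
  map_eq : φ x₀ = y₀
  monoGerm : ∀ k, MonoGerm x₀ (fun x => φ x k) (B k)
  monoGerm_inv : ∀ i, MonoGerm y₀ (fun y => χ y i) (C i)
  left_inv : ∀ᶠ x in 𝓝[quadrant n] x₀, χ (φ x) = x
  right_inv : ∀ᶠ y in 𝓝[quadrant m] y₀, φ (χ y) = y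

namespace IsBInverse

variable {y₀ : EuclideanSpace ℝ (Fin m)} {φ : EuclideanSpace ℝ (Fin n) → EuclideanSpace ℝ (Fin m)}
  {χ : EuclideanSpace ℝ (Fin m) → EuclideanSpace ℝ (Fin n)} {B : Fin m → Fin n → ℕ}
  {C : Fin n → Fin m → ℕ}

theorem symm (h : IsBInverse x₀ y₀ φ χ B C) : IsBInverse y₀ x₀ χ φ C B := by
  refine ⟨?_, ?_, h.monoGerm_inv, h.monoGerm, h.right_inv, h.left_inv⟩
  · rw [← h.map_eq]
    exact fun j => (h.monoGerm j).nonneg.self_of_nhdsWithin h.mem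
  · rw [← h.map_eq]
    exact h.left_inv.self_of_nhdsWithin h.mem

theorem le (h : IsBInverse x₀ y₀ φ χ B C) : n ≤ m := by
  obtain rfl := h.map_eq
  exact (card_le_of_leftInverse h.mem
    ((SmoothGerm.euclidean fun k => (h.monoGerm k).smoothGerm).self_of_mem h.mem)
    ((SmoothGerm.euclidean fun k => (h.monoGerm_inv k).smoothGerm).self_of_mem h.symm.mem)
    (tendsto_nhdsWithin_iff.1 (tendsto_quadrant_of_monoGerm h.mem h.monoGerm)).2 h.left_inv).1

theorem eq (h : IsBInverse x₀ y₀ φ χ B C) : n = m := le_antisymm h.le h.symm.le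

theorem exponent_eq_zero (h : IsBInverse x₀ y₀ φ χ B C) {k : Fin m} {i : Fin n} (hk : y₀ k ≠ 0)
    (hi : x₀ i = 0) : B k i = 0 :=
  (h.monoGerm k).exponent_eq_zero h.mem (by rwa [h.map_eq]) hi

/-- The matrices of exponents are inverse to each other. -/
theorem sum_mul (h : IsBInverse x₀ y₀ φ χ B C) {i i' : Fin n} (hi' : x₀ i' = 0) :
    ∑ k : {k // y₀ k = 0}, C i k * B k i' = if i = i' then 1 else 0 := by
  classical
  have h1 : MonoGerm x₀ (fun x => χ (φ x) i) (∑ k, C i k • B k) :=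
    MonoGerm.comp h.mem h.monoGerm (by rw [h.map_eq]; exact h.monoGerm_inv i)
  have h2 := h1.exponent_unique h.mem ((monoGerm_coord i).congr
    (h.left_inv.mono fun x hx => congrArg (fun v => v i) hx)) hi'
  rw [Finset.sum_apply] at h2
  simp only [Pi.smul_apply, smul_eq_mul, Pi.single_apply, eq_comm (a := i')] at h2
  rw [← h2]
  exact sum_subtype_of_eq_zero (fun k => C i k * B k i') fun k hk => by
    rw [h.exponent_eq_zero hk hi', mul_zero]

theorem limLogDeriv_mul (h : IsBInverse x₀ y₀ φ χ B C) (i i' : Fin n) :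
    ∑ k, limLogDeriv y₀ (fun y => χ y i) k * limLogDeriv x₀ (fun x => φ x k) i' =
      if i' = i then 1 else 0 := by
  have h1 := MonoGerm.limLogDeriv_comp h.mem h.monoGerm (u := fun y => χ y i)
    (by rw [h.map_eq]; exact h.monoGerm_inv i) i'
  rw [h.map_eq] at h1
  rw [← h1]
  exact limLogDeriv_coord h.mem (h.left_inv.mono fun x hx => congrArg (fun v => v i) hx) i'

theorem eq_zero_of_limLogDeriv (h : IsBInverse x₀ y₀ φ χ B C) {v : Fin n → ℝ}
    (hv : ∀ k, ∑ i, limLogDeriv x₀ (fun x => φ x k) i * v i = 0) : v = 0 := by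
  funext i
  have h1 : ∑ i', (∑ k, limLogDeriv y₀ (fun y => χ y i) k * limLogDeriv x₀ (fun x => φ x k) i') *
      v i' = 0 := by
    simp only [Finset.sum_mul, mul_assoc]
    rw [Finset.sum_comm]
    simp [← Finset.mul_sum, hv]
  simpa [h.limLogDeriv_mul] using h1

end IsBInverse

/-- Logarithmic derivatives of the pull-back of `a z^γ` by a family of monomials. -/
theorem hasLogDeriv_mul_prod {ι : Type} [Fintype ι] (hx₀ : x₀ ∈ quadrant n)
    {g : EuclideanSpace ℝ (Fin n) → ι → ℝ} {A : ι → Fin n → ℕ}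
    (hg : ∀ i, MonoGerm x₀ (fun x => g x i) (A i)) {a : (ι → ℝ) → ℝ}
    (ha : SmoothGerm (piQuadrant ι) (g x₀) a) (ha0 : 0 < a (g x₀)) (γ : ι → ℤ) (b : Fin n) :
    HasLogDeriv x₀ (fun x => a (g x) * ∏ i, g x i ^ γ i) b
      (fderivWithin ℝ a (piQuadrant ι) (g x₀)
        (fun i => g x₀ i * limLogDeriv x₀ (fun x => g x i) b) / a (g x₀) +
        ∑ i, γ i * limLogDeriv x₀ (fun x => g x i) b) := by
  have hgs : SmoothGerm (quadrant n) x₀ g := SmoothGerm.pi fun i => (hg i).smoothGerm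
  have hle := nhdsWithin_mono x₀ (openQuadrant_subset n)
  have hL := fun i => (hg i).hasLogDeriv_lim hx₀ b
  refine (HasLogDeriv.comp_pos (uniqueDiffOn_convex convex_piQuadrant
    interior_piQuadrant_nonempty) hx₀ hgs ?_ ha ha0 ?_).mul
    (HasLogDeriv.prod Finset.univ fun i _ => (hL i).zpow (γ i))
  · refine tendsto_nhdsWithin_iff.2 ⟨(hgs.continuousWithinAt hx₀).tendsto, ?_⟩
    filter_upwards [eventually_all.2 fun i => (hg i).nonneg] with y hy using hy
  · refine tendsto_pi_nhds.2 fun i => ?_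
    refine ((hL i).tendsto_mul_fderiv
      (((hg i).smoothGerm.continuousWithinAt hx₀).tendsto.mono_left hle)).congr' ?_
    filter_upwards [eventually_all.2 fun i => (hg i).differentiableAt_and_ne_zero] with x hx
    rw [fderiv_pi (fun i => (hx i).1)]
    rfl

end

namespace IsKernelBasis

variable {J V κ κ' : Type} [Fintype V] [Fintype κ] [Fintype κ'] {γ : J → V → ℤ} {M : V → κ → ℕ}

/-- Change of basis. -/
theorem mul_of_inverse [DecidableEq κ] [DecidableEq κ'] (h : IsKernelBasis γ M) {C : κ → κ' → ℕ} {C' : κ' → κ → ℕ}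
    (h1 : ∀ k k', ∑ b, C k b * C' b k' = if k = k' then 1 else 0)
    (h2 : ∀ b b', ∑ k, C' b k * C k b' = if b = b' then 1 else 0) :
    IsKernelBasis γ (fun i b => ∑ k, M i k * C k b) := by
  have hassoc : ∀ (p : κ' → ℕ) (i : V), ∑ b, (∑ k, M i k * C k b) * p b =
      ∑ k, M i k * ∑ b, C k b * p b := by
    intro p i
    simp only [Finset.sum_mul, Finset.mul_sum, mul_assoc]
    exact Finset.sum_comm
  refine ⟨fun j b => ?_, fun n hn => ?_, fun p q hpq => ?_⟩
  · push_cast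
    simp only [Finset.mul_sum]
    rw [Finset.sum_comm]
    refine Finset.sum_eq_zero fun k _ => ?_
    simp only [← mul_assoc]
    rw [← Finset.sum_mul, h.ker, zero_mul]
  · obtain ⟨p, hp⟩ := h.span n hn
    refine ⟨fun b => ∑ k, C' b k * p k, fun i => ?_⟩
    rw [hassoc, hp]
    refine Finset.sum_congr rfl fun k _ => ?_
    congr 1
    simp only [Finset.mul_sum, ← mul_assoc]
    rw [Finset.sum_comm]
    simp [← Finset.sum_mul, h1]
  · simp only [hassoc] at hpq
    have h3 := h.inj _ _ hpq
    funext b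
    have h4 : ∀ r : κ' → ℕ, ∑ k, C' b k * ∑ b', C k b' * r b' = r b := by
      intro r
      simp only [Finset.mul_sum, ← mul_assoc]
      rw [Finset.sum_comm]
      simp [← Finset.sum_mul, h2]
    rw [← h4 p, ← h4 q]
    exact Finset.sum_congr rfl fun k _ => congrArg _ (congrFun h3 k)

end IsKernelBasis

end

set_option linter.unusedSectionVars false

noncomputable section

section

open scoped Classical

variable {X₁ X₂ Y : Type u} [TopologicalSpace X₁] [CornerAtlas X₁] [TopologicalSpace X₂]
  [CornerAtlas X₂] [TopologicalSpace Y] [CornerAtlas Y]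
  {f₁ : X₁ → Y} {f₂ : X₂ → Y} {F₁ : Face X₁} {F₂ : Face X₂}
  {W : Type u} [TopologicalSpace W] [CornerAtlas W] {h : W → X₁ × X₂}

/-- The local form of a map `h` into `D(F₁, F₂)` in coordinates: its components are monomials whose
exponents freely generate the monoid of `D(F₁, F₂)`, and its b-differential is injective. -/
structure FiberModel.IsAdapted {w : W} (D : FiberModel f₁ f₂ F₁ F₂ (h w)) (e : CornerChart W)
    (A : D.Idx → Fin e.1 → ℕ) : Prop where
  monoGerm : ∀ i, MonoGerm (e.coord w) (fun x => D.coord (h (e.param x)) i) (A i)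
  basis : IsKernelBasis (fun (j : D.EqIdx) (i : {i // D.coord (h w) i = 0}) => D.γ j i)
    (fun i (b : {b // e.coord w b = 0}) => A i b)
  card : e.1 + Fintype.card D.EqIdx = Fintype.card D.Idx
  inj : ∀ v : Fin e.1 → ℝ, (∀ i, ∑ b, limLogDeriv (e.coord w)
    (fun x => D.coord (h (e.param x)) i) b * v b = 0) → v = 0

namespace IsRes

variable [IsManifoldWithCorners X₁] [IsManifoldWithCorners X₂]

theorem mem (hh : IsRes f₁ f₂ F₁ F₂ h) (w : W) : h w ∈ fiberD f₁ f₂ F₁ F₂ := by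
  rw [← hh.range_eq]; exact mem_range_self w

theorem exists_isBInverse (hh : IsRes f₁ f₂ F₁ F₂ h) (hf₁ : Continuous f₁) (hf₂ : Continuous f₂)
    {e : CornerChart W} (he : e ∈ CornerAtlas.charts) {w : W} (hw : w ∈ e.source)
    (D : FiberModel f₁ f₂ F₁ F₂ (h w)) {m : ℕ} {S : MonomialSystem D.Idx D.EqIdx (Fin m)}
    (hz₀ : S.z₀ = D.coord (h w)) (hsol : S.sol = D.sol) (R : S.Resolution) :
    ∃ φ χ B C, IsBInverse (e.coord w) (R.T S.z₀) φ χ B C ∧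
      ∀ᶠ x in 𝓝[quadrant e.1] (e.coord w), D.coord (h (e.param x)) = R.H (φ x) := by
  have hx₀ := e.coord_mem w
  have hy₀ := R.mem
  have hpw : e.param (e.coord w) = w := CornerChart.param_coord hw
  have hg := (hh.chart e he).fiberGerm w hw
  have hgt := hg.tendsto
  rw [hpw] at hgt
  have hgD := hgt.eventually D.eventually_coord_mem_closure
  have hct : Tendsto (fun x => D.coord (h (e.param x))) (𝓝[quadrant e.1] (e.coord w))
      (𝓝[closure S.sol] S.z₀) := by
    rw [hz₀, hsol]
    refine tendsto_nhdsWithin_iff.2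
      ⟨(D.continuousAt_coord D.D₁.mem D.D₂.mem).tendsto.comp hgt, ?_⟩
    filter_upwards [hgD] with x hx using hx (hh.mem _)
  -- the first map
  obtain ⟨h1, h2⟩ := D.eventually_monoGerm_coord.self_of_nhds e.1 (e.coord w) _ hx₀ (by rw [hpw]) hg
  have h3 := R.lift.self_of_nhdsWithin S.z₀_mem e.1 (e.coord w) _ hx₀
    (by rw [hpw, hz₀]) h1 (by rw [hsol]; exact h2)
  choose B hB using h3
  -- the second map
  have : Nonempty W := ⟨w⟩
  set c : EuclideanSpace ℝ (Fin R.n) → W := fun y => Function.invFun h (D.param (R.H y)) with hc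
  have hgerm := D.eventually_fiberGerm_resolution hf₁ hf₂ hz₀ hsol R
  have hcv : ∀ᶠ y in 𝓝[quadrant R.n] (R.T S.z₀), h (c y) = D.param (R.H y) := by
    filter_upwards [(hgerm.self_of_nhdsWithin hy₀).eventually_mem_fiberD] with y hy
    rw [← hh.range_eq] at hy
    exact Function.invFun_eq hy
  have hparam : D.param (D.coord (h w)) = h w :=
    have hF := fiberD_subset_prod D.mem
    D.eventually_param_coord.self_of_nhds hF.1 hF.2
  have hcw : c (R.T S.z₀) = w := by
    refine hh.isEmbedding.injective ?_
    rw [hcv.self_of_nhdsWithin hy₀, R.H_center, hz₀, hparam]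
  have hcg : FiberGerm f₁ f₂ F₁ F₂ (R.T S.z₀) (fun y => h (c y)) :=
    (hgerm.self_of_nhdsWithin hy₀).congr hy₀ hcv
  have h4 := (hh.chart e he).lift R.n (R.T S.z₀) c hy₀ (by rw [hcw]; exact hw) hcg
  choose C hC using h4
  have hctend : Tendsto c (𝓝[quadrant R.n] (R.T S.z₀)) (𝓝 w) := by
    rw [hh.isEmbedding.tendsto_nhds_iff]
    have := hcg.tendsto
    rwa [hcw] at this
  have hRH := R.tendsto_H
  rw [R.H_center] at hRH
  refine ⟨fun x => R.T (D.coord (h (e.param x))), fun y => e.coord (c y), B, C,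
    ⟨hx₀, by rw [hpw, hz₀], hB, hC, ?_, ?_⟩, ?_⟩
  · filter_upwards [hct.eventually R.right_inv, hgt.eventually D.eventually_param_coord,
      CornerChart.eventually_coord_param hw] with x hx1 hx2 hx3
    have hF := fiberD_subset_prod (hh.mem (e.param x))
    have : c (R.T (D.coord (h (e.param x)))) = e.param x := by
      simp only [hc]
      rw [hx1.1, hx2 hF.1 hF.2]
      exact Function.leftInverse_invFun hh.isEmbedding.injective _
    rw [this, hx3.2]
  · filter_upwards [hcv, hctend.eventually (e.isOpen_source.mem_nhds hw), R.left_inv,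
      hRH.eventually (hz₀ ▸ D.eventually_coord_param)] with y hy1 hy2 hy3 hy4
    rw [CornerChart.param_coord hy2, hy1, hy4.1, hy3]
  · filter_upwards [hct.eventually R.right_inv] with x hx using hx.1.symm

end IsRes

theorem MonomialSystem.Resolution.exponent_eq_sum {ι J κ : Type} [Fintype ι] [Fintype κ]
    {S : MonomialSystem ι J κ} (R : S.Resolution) (f : Fin R.n → ℕ)
    (hf : ∀ k, R.T S.z₀ k ≠ 0 → f k = 0) (i : ι) : ∑ k, R.A i k * f k = ∑ k, S.M i k * f (R.emb k) := by
  have h1 := sum_subtype_of_eq_zero (p := fun k => R.T S.z₀ k = 0) (fun k => R.A i k * f k)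
    fun k hk => by rw [hf k hk, mul_zero]
  rw [← h1]
  let σ : κ ≃ {k // R.T S.z₀ k = 0} := Equiv.ofBijective
    (fun k => ⟨R.emb k, (R.zero_iff _).2 ⟨k, rfl⟩⟩) ⟨fun k k' hk => R.emb_inj (congrArg Subtype.val hk),
      fun b => by
        obtain ⟨k, hk⟩ := (R.zero_iff b).1 b.2
        exact ⟨k, Subtype.ext hk⟩⟩
  rw [← σ.sum_comp]
  exact Finset.sum_congr rfl fun k _ => by
    change R.A i (R.emb k) * f (R.emb k) = _
    rw [R.A_emb]

theorem MonomialSystem.Resolution.sum_emb {ι J κ : Type} [Fintype ι] [Fintype κ]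
    {S : MonomialSystem ι J κ} (R : S.Resolution) (f : Fin R.n → ℕ) :
    ∑ k : {k // R.T S.z₀ k = 0}, f k = ∑ k, f (R.emb k) := by
  let σ : κ ≃ {k // R.T S.z₀ k = 0} := Equiv.ofBijective
    (fun k => ⟨R.emb k, (R.zero_iff _).2 ⟨k, rfl⟩⟩) ⟨fun k k' hk => R.emb_inj (congrArg Subtype.val hk),
      fun b => by
        obtain ⟨k, hk⟩ := (R.zero_iff b).1 b.2
        exact ⟨k, Subtype.ext hk⟩⟩
  exact (σ.sum_comp _).symm

namespace IsRes

variable [IsManifoldWithCorners X₁] [IsManifoldWithCorners X₂] [IsManifoldWithCorners Y]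

theorem exists_isAdapted (hh : IsRes f₁ f₂ F₁ F₂ h) (hf₁ : IsInteriorBMap f₁)
    (hf₂ : IsInteriorBMap f₂) (htrans : BTransversal f₁ f₂) (hsmooth : SmoothFiberMonoids f₁ f₂)
    {e : CornerChart W} (he : e ∈ CornerAtlas.charts) {w : W} (hw : w ∈ e.source)
    (D : FiberModel f₁ f₂ F₁ F₂ (h w)) : ∃ A, D.IsAdapted e A := by
  obtain ⟨m, S, hz₀, hγ, hsol⟩ := D.exists_system hf₁ hf₂ htrans hsmooth
  obtain ⟨R, hR⟩ := S.exists_resolution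
  obtain ⟨φ, χ, B, C, hB, hH⟩ := hh.exists_isBInverse hf₁.1.1 hf₂.1.1 he hw D hz₀ hsol R
  have hmono : ∀ i, MonoGerm (e.coord w) (fun x => R.H (φ x) i) (∑ k, R.A i k • B k) := fun i =>
    MonoGerm.comp hB.mem hB.monoGerm (by rw [hB.map_eq]; exact R.monoGerm i)
  have hcongr : ∀ i, (fun x => D.coord (h (e.param x)) i) =ᶠ[𝓝[quadrant e.1] (e.coord w)]
      fun x => R.H (φ x) i := fun i => hH.mono fun x hx => congrFun hx i
  refine ⟨fun i => ∑ k, R.A i k • B k, fun i => (hmono i).congr (hcongr i), ?_, ?_, ?_⟩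
  · have hbasis : ∀ z, S.z₀ = z → IsKernelBasis (fun (j : D.EqIdx) (i : {i // z i = 0}) => D.γ j i)
        (fun i (b : {b // e.coord w b = 0}) => (∑ k, R.A i k • B k) b) := by
      rintro _ rfl
      have h1 := S.basis.mul_of_inverse (κ' := {b // e.coord w b = 0})
        (C := fun k b => B (R.emb k) b) (C' := fun b k => C b (R.emb k)) (fun k k' => ?_)
        (fun b b' => ?_)
      · rw [hγ] at h1
        convert h1 using 3 with i b
        rw [Finset.sum_apply]
        exact R.exponent_eq_sum (fun k => B k b)
          (fun k hk => hB.exponent_eq_zero hk b.2) i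
      · rw [hB.symm.sum_mul ((R.zero_iff _).2 ⟨k', rfl⟩)]
        simp [R.emb_inj.eq_iff]
      · rw [← R.sum_emb fun k => C b k * B k b', hB.sum_mul b'.2]
        simp [Subtype.ext_iff]
    exact hbasis _ hz₀
  · rw [hB.eq, hR]
  · intro v hv
    refine hB.eq_zero_of_limLogDeriv fun k => ?_
    obtain ⟨d, hd, a, β, ha, ha0, hpow⟩ := R.exists_eq_pow k
    have hx₀ := hB.mem
    have hHφ : R.H (φ (e.coord w)) = S.z₀ := by rw [hB.map_eq, R.H_center]
    have hφt := tendsto_quadrant_of_monoGerm hx₀ hB.monoGerm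
    rw [hB.map_eq] at hφt
    have h1 := fun b => hasLogDeriv_mul_prod hx₀ hmono (a := a) (by rw [hHφ]; exact ha)
      (by rw [hHφ]; exact ha0) (fun i => (β i : ℤ)) b
    have h2 := fun b => (((hB.monoGerm k).hasLogDeriv_lim hx₀ b).pow d).unique hx₀
      ((h1 b).congr (by
        filter_upwards [(hφt.eventually hpow).filter_mono
          (nhdsWithin_mono _ (openQuadrant_subset _))] with x hx
        simp only [zpow_natCast]
        exact hx.symm))
    have h3 : ∀ i, ∑ b, limLogDeriv (e.coord w) (fun x => R.H (φ x) i) b * v b = 0 := fun i => by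
      rw [← hv i]
      exact Finset.sum_congr rfl fun b _ => by
        rw [limLogDeriv_congr hx₀ (hmono i) (hcongr i) b]
    have h4 : (d : ℝ) * ∑ b, limLogDeriv (e.coord w) (fun x => φ x k) b * v b = 0 := by
      rw [Finset.mul_sum]
      simp only [← mul_assoc, h2, add_mul, div_mul_eq_mul_div]
      rw [Finset.sum_add_distrib, ← Finset.sum_div]
      have h5 : ∑ b, fderivWithin ℝ a (piQuadrant D.Idx) (R.H (φ (e.coord w)))
          (fun i => R.H (φ (e.coord w)) i * limLogDeriv (e.coord w) (fun x => R.H (φ x) i) b) *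
            v b = 0 := by
        have h6 : ∑ b, v b • (fun i => R.H (φ (e.coord w)) i *
            limLogDeriv (e.coord w) (fun x => R.H (φ x) i) b) = 0 := by
          funext i
          rw [Finset.sum_apply]
          have := congrArg (fun t => R.H (φ (e.coord w)) i * t) (h3 i)
          simp only [mul_zero, Finset.mul_sum] at this
          rw [Pi.zero_apply, ← this]
          exact Finset.sum_congr rfl fun b _ => by simp only [Pi.smul_apply, smul_eq_mul]; ring
        rw [← map_zero (fderivWithin ℝ a (piQuadrant D.Idx) (R.H (φ (e.coord w)))), ← h6, map_sum]
        exact Finset.sum_congr rfl fun b _ => by rw [map_smul, smul_eq_mul, mul_comm]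
      rw [h5, zero_div, zero_add]
      simp only [Finset.sum_mul, mul_assoc]
      rw [Finset.sum_comm]
      simp only [← Finset.mul_sum, h3, mul_zero, Finset.sum_const_zero]
    exact (mul_eq_zero.1 h4).resolve_left (by exact_mod_cast hd)

end IsRes

end

end

set_option linter.unusedSectionVars false

noncomputable section

/-! ## Paracompactness -/

theorem exists_locallyFinite_subset_isCompact (X : Type u) [TopologicalSpace X] [ParacompactSpace X]
    [WeaklyLocallyCompactSpace X] : ∃ U K : X → Set X, (∀ i, IsOpen (U i)) ∧ ⋃ i, U i = univ ∧
      LocallyFinite U ∧ (∀ i, IsCompact (K i)) ∧ ∀ i, U i ⊆ K i := by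
  choose K hK hKn using fun x : X => exists_compact_mem_nhds x
  obtain ⟨U, hUo, hUc, hUf, hUK⟩ := precise_refinement (fun x => interior (K x))
    (fun x => isOpen_interior)
    (eq_univ_of_forall fun x => mem_iUnion.2 ⟨x, mem_interior_iff_mem_nhds.2 (hKn x)⟩)
  exact ⟨U, K, hUo, hUc, hUf, hK, fun x => (hUK x).trans interior_subset⟩

theorem paracompactSpace_of_locallyFinite {X ι : Type u} [TopologicalSpace X] {U K : ι → Set X}
    (hUo : ∀ i, IsOpen (U i)) (hUc : ⋃ i, U i = univ) (hUf : LocallyFinite U)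
    (hK : ∀ i, IsCompact (K i)) (hUK : ∀ i, U i ⊆ K i) : ParacompactSpace X where
  locallyFinite_refinement α s hso hsc := by
    choose T hT using fun i => (hK i).elim_finite_subcover s hso (by rw [hsc]; exact subset_univ _)
    refine ⟨Σ i, T i, fun b => U b.1 ∩ s b.2, fun b => (hUo _).inter (hso _),
      eq_univ_of_forall fun x => ?_, fun x => ?_, fun b => ⟨b.2, inter_subset_right⟩⟩
    · obtain ⟨i, hi⟩ := mem_iUnion.1 (hUc.symm ▸ mem_univ x : x ∈ ⋃ i, U i)
      obtain ⟨a, ha, hxa⟩ := mem_iUnion₂.1 (hT i (hUK i hi))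
      exact mem_iUnion.2 ⟨⟨i, a, ha⟩, hi, hxa⟩
    · obtain ⟨N, hN, hfin⟩ := hUf x
      refine ⟨N, hN, (hfin.biUnion fun i _ => finite_range (Sigma.mk i)).subset ?_⟩
      rintro ⟨i, a⟩ ⟨y, hy, hyN⟩
      exact mem_biUnion (x := i) ⟨y, hy.1, hyN⟩ (mem_range_self a)

theorem paracompactSpace_prod (X Z : Type u) [TopologicalSpace X] [TopologicalSpace Z]
    [ParacompactSpace X] [ParacompactSpace Z] [WeaklyLocallyCompactSpace X]
    [WeaklyLocallyCompactSpace Z] : ParacompactSpace (X × Z) := by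
  obtain ⟨U, K, hUo, hUc, hUf, hK, hUK⟩ := exists_locallyFinite_subset_isCompact X
  obtain ⟨V, L, hVo, hVc, hVf, hL, hVL⟩ := exists_locallyFinite_subset_isCompact Z
  refine paracompactSpace_of_locallyFinite (U := fun i : X × Z => U i.1 ×ˢ V i.2)
    (K := fun i => K i.1 ×ˢ L i.2) (fun i => (hUo _).prod (hVo _))
    (eq_univ_of_forall fun x => ?_) (fun x => ?_) (fun i => (hK _).prod (hL _))
    fun i => prod_mono (hUK _) (hVL _)
  · obtain ⟨i, hi⟩ := mem_iUnion.1 (hUc.symm ▸ mem_univ x.1 : x.1 ∈ ⋃ i, U i)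
    obtain ⟨j, hj⟩ := mem_iUnion.1 (hVc.symm ▸ mem_univ x.2 : x.2 ∈ ⋃ i, V i)
    exact mem_iUnion.2 ⟨(i, j), hi, hj⟩
  · obtain ⟨N, hN, hfin⟩ := hUf x.1
    obtain ⟨N', hN', hfin'⟩ := hVf x.2
    refine ⟨N ×ˢ N', prod_mem_nhds hN hN', (hfin.prod hfin').subset ?_⟩
    rintro ⟨i, j⟩ ⟨y, hy, hyN⟩
    exact ⟨⟨y.1, hy.1, hyN.1⟩, ⟨y.2, hy.2, hyN.2⟩⟩

theorem paracompactSpace_sigma {ι : Type u} {M : ι → Type u} [∀ i, TopologicalSpace (M i)]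
    [∀ i, ParacompactSpace (M i)] : ParacompactSpace (Σ i, M i) where
  locallyFinite_refinement α s hso hsc := by
    choose t hto htc htf hts using fun i => precise_refinement (fun a => Sigma.mk i ⁻¹' s a)
      (fun a => (hso a).preimage continuous_sigmaMk) (by rw [← preimage_iUnion, hsc, preimage_univ])
    refine ⟨ι × α, fun b => Sigma.mk b.1 '' t b.1 b.2,
      fun b => isOpenMap_sigmaMk _ (hto _ _), eq_univ_of_forall ?_, ?_, fun b => ⟨b.2, ?_⟩⟩
    · rintro ⟨i, x⟩
      obtain ⟨a, ha⟩ := mem_iUnion.1 ((htc i).symm ▸ mem_univ x : x ∈ ⋃ a, t i a)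
      exact mem_iUnion.2 ⟨(i, a), x, ha, rfl⟩
    · rintro ⟨i, x⟩
      obtain ⟨N, hN, hfin⟩ := htf i x
      refine ⟨Sigma.mk i '' N, IsOpenEmbedding.sigmaMk.isOpenMap.image_mem_nhds hN,
        (hfin.image (Prod.mk i)).subset ?_⟩
      rintro ⟨j, a⟩ ⟨_, ⟨y, hy, rfl⟩, ⟨z, hz, hzy⟩⟩
      obtain ⟨rfl, h⟩ := Sigma.mk.inj_iff.1 hzy
      obtain rfl := eq_of_heq h
      exact ⟨a, ⟨z, hy, hz⟩, rfl⟩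
    · rintro _ ⟨x, hx, rfl⟩
      exact hts _ _ hx

theorem CornerAtlas.weaklyLocallyCompactSpace (X : Type u) [TopologicalSpace X] [CornerAtlas X] :
    WeaklyLocallyCompactSpace X where
  exists_compact_mem_nhds p := by
    obtain ⟨e, -, hp⟩ := exists_chart p
    have hc : IsClosed {x : EuclideanSpace ℝ (Fin e.1) | ∀ i, 0 ≤ x i} := isClosed_quadrant e.1
    have : LocallyCompactSpace (EuclideanQuadrant e.1) := hc.isClosedEmbedding_subtypeVal.locallyCompactSpace
    obtain ⟨K, hK, hKt, hKc⟩ := LocallyCompactSpace.local_compact_nhds (e.2 p) e.2.target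
      (e.2.open_target.mem_nhds (e.2.map_source hp))
    refine ⟨e.2.symm '' K, hKc.image_of_continuousOn (e.2.continuousOn_symm.mono hKt), ?_⟩
    rw [← e.2.left_inv hp]
    exact e.2.symm.image_mem_nhds (e.2.map_source hp) hK

/-! ## Embedded hypersurfaces -/

section

variable {X : Type u} [TopologicalSpace X] [CornerAtlas X]

/-- Boundary hypersurfaces are embedded if a function which is locally constant along the strata
separates the coordinate hypersurfaces of each chart. -/
theorem exists_isDefiningCoord_of_separating {α : Type*} (τ : X → α)
    (hτ : ∀ q, ∀ᶠ q' in 𝓝 q, codim q' = codim q → τ q' = τ q)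
    (hsep : ∀ e ∈ CornerAtlas.charts (X := X), ∀ p ∈ e.source, ∃ N ∈ 𝓝 p, ∀ q ∈ N, ∀ q' ∈ N,
      ∀ i j, e.zeros q = {i} → e.zeros q' = {j} → τ q = τ q' → i = j)
    (H : Hypersurface X) (e : CornerChart X) (he : e ∈ CornerAtlas.charts) (p : X)
    (hp : p ∈ e.source ∩ H.1) : ∃ i, IsDefiningCoord e H.1 p i := by
  obtain ⟨r, hr, hrH⟩ : ∃ r, codim r = 1 ∧ H.1 = faceOf r := H.2
  obtain ⟨N, hNo, hpN, hNs, hN⟩ := exists_nhds_faceOf_eq he hp.1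
  obtain ⟨N', hN', hN's⟩ := hsep e he p hp.1
  have hfreq : ∀ q ∈ H.1, ∃ᶠ q' in 𝓝 q, faceOf q' = H.1 := by
    intro q hq
    rw [hrH, faceOf_eq_closure, mem_closure_iff_frequently] at hq
    refine hq.mono fun q' hq' => ?_
    rw [hrH]; exact faceOf_eq_of_mem_stratum hq'
  have hzeros : ∀ q ∈ N, faceOf q = H.1 → ∃ i, e.zeros q = {i} := by
    intro q hq hqH
    rw [← ncard_eq_one, ← codim_eq he (hNs hq), ← hr]
    exact codim_eq_of_faceOf_eq (hqH.trans hrH)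
  obtain ⟨q₀, hq₀, hq₀N, hq₀N'⟩ := ((hfreq p hp.2).and_eventually
    (Filter.inter_mem (hNo.mem_nhds hpN) hN')).exists
  obtain ⟨i, hi⟩ := hzeros q₀ hq₀N hq₀
  refine ⟨i, ?_⟩
  filter_upwards [hNo.mem_nhds hpN, eventually_mem_nhds_iff.2 hN'] with q hqN hqN'
  have hqN₁ : ∀ᶠ q' in 𝓝 q, q' ∈ N := hNo.mem_nhds hqN
  have hqN₂ : ∀ᶠ q' in 𝓝 q, q' ∈ N' := hqN'
  constructor
  · intro hq
    by_contra hne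
    have h1 : ∀ᶠ q' in 𝓝 q, e.coord q' i ≠ 0 :=
      ((PiLp.continuous_apply 2 _ i).continuousAt.comp
        (CornerChart.continuousAt_coord (hNs hqN))).eventually_ne hne
    obtain ⟨q', hq', h2, h3, h4⟩ := ((hfreq q hq).and_eventually (h1.and (hqN₁.and hqN₂))).exists
    obtain ⟨j, hj⟩ := hzeros q' h3 hq'
    have := hN's q₀ hq₀N' q' h4 i j hi hj (eq_of_faceOf_eq hτ (hq₀.trans hq'.symm))
    subst this
    have : i ∈ e.zeros q' := by rw [hj]; rfl
    exact h2 this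
  · intro hq
    have h1 : ({i} : Set (Fin e.1)) ⊆ e.zeros q := singleton_subset_iff.2 hq
    rw [← H.isClosed.closure_eq, mem_closure_iff_frequently]
    refine ((CornerChart.frequently_zeros_eq (hNs hqN) h1).and_eventually hqN₁).mono ?_
    rintro q' ⟨h2, h3⟩
    rw [← hq₀, hN q₀ hq₀N q' h3 (hi.trans h2.symm)]
    exact mem_faceOf_self q'

end

/-! ## Disjoint unions -/

section

variable {ι : Type u} {M : ι → Type u} [∀ i, TopologicalSpace (M i)] [∀ i, CornerAtlas (M i)]

theorem CornerChart.coord_sigma {i : ι} (e : CornerChart (M i)) (q : M i) :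
    (CornerChart.sigma i e).coord ⟨i, q⟩ = e.coord q := by
  simp only [CornerChart.coord, CornerChart.sigma]
  exact congrArg _ (OpenPartialHomeomorph.lift_openEmbedding_apply _ _)

theorem CornerChart.mem_source_sigma {i : ι} (e : CornerChart (M i)) (q : M i) :
    (⟨i, q⟩ : Σ i, M i) ∈ (CornerChart.sigma i e).source ↔ q ∈ e.source :=
  sigma_mk_injective.mem_set_image

theorem CornerChart.zeros_sigma {i : ι} (e : CornerChart (M i)) (q : M i) :
    (CornerChart.sigma i e).zeros ⟨i, q⟩ = e.zeros q := by
  ext j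
  change (CornerChart.sigma i e).coord ⟨i, q⟩ j = 0 ↔ e.coord q j = 0
  rw [CornerChart.coord_sigma]

theorem CornerChart.sigma_mem_charts {i : ι} {e : CornerChart (M i)} (he : e ∈ CornerAtlas.charts) :
    CornerChart.sigma i e ∈ CornerAtlas.charts (X := Σ i, M i) := ⟨i, e, he, rfl⟩

theorem codim_sigma {i : ι} (q : M i) : codim (⟨i, q⟩ : Σ i, M i) = codim q := by
  obtain ⟨e, he, hq⟩ := exists_chart q
  rw [codim_eq he hq, codim_eq (CornerChart.sigma_mem_charts he)
    ((CornerChart.mem_source_sigma e q).2 hq)]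
  exact congrArg Set.ncard (CornerChart.zeros_sigma e q)

theorem nhds_sigma_mk {i : ι} (q : M i) : 𝓝 (⟨i, q⟩ : Σ i, M i) = map (Sigma.mk i) (𝓝 q) :=
  (IsOpenEmbedding.sigmaMk.map_nhds_eq q).symm

theorem IsManifoldWithCorners.sigma (h : ∀ i, IsManifoldWithCorners (M i)) :
    IsManifoldWithCorners (Σ i, M i) where
  t2 := have := fun i => (h i).t2; inferInstance
  paracompact := have := fun i => (h i).paracompact; paracompactSpace_sigma
  embedded := by
    refine exists_isDefiningCoord_of_separating
      (fun p => (⟨p.1, faceOf p.2⟩ : Σ i, Set (M i))) ?_ ?_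
    · rintro ⟨i, q⟩
      rw [nhds_sigma_mk, eventually_map]
      obtain ⟨e, he, hq⟩ := exists_chart q
      obtain ⟨N, hNo, hqN, -, hN⟩ := exists_nhds_faceOf_eq he hq
      filter_upwards [hNo.mem_nhds hqN, eventually_codim_eq_iff he hq] with q' hq' h1 h2
      rw [codim_sigma, codim_sigma] at h2
      exact congrArg (Sigma.mk i) (hN q' hq' q hqN (h1.1 h2))
    · rintro _ ⟨i, e, he, rfl⟩ _ ⟨p, hp, rfl⟩
      obtain ⟨N, hNo, hpN, -, -, hN⟩ := exists_nhds_faceOf_eq_iff he hp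
      refine ⟨Sigma.mk i '' N, IsOpenEmbedding.sigmaMk.isOpenMap.image_mem_nhds (hNo.mem_nhds hpN),
        ?_⟩
      rintro _ ⟨q, hq, rfl⟩ _ ⟨q', hq', rfl⟩ j j' hj hj' h1
      have h2 : faceOf q = faceOf q' := eq_of_heq (Sigma.mk.inj_iff.1 h1).2
      rw [hN q hq q' hq', ← CornerChart.zeros_sigma, ← CornerChart.zeros_sigma, hj, hj'] at h2
      exact singleton_injective h2

end

end

set_option linter.unusedSectionVars false

noncomputable section

section

open scoped Classical

variable {X₁ X₂ Y : Type u} [TopologicalSpace X₁] [CornerAtlas X₁] [TopologicalSpace X₂]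
  [CornerAtlas X₂] [TopologicalSpace Y] [CornerAtlas Y]
  {f₁ : X₁ → Y} {f₂ : X₂ → Y} {F₁ : Face X₁} {F₂ : Face X₂}

variable [hX₁ : IsManifoldWithCorners X₁] [hX₂ : IsManifoldWithCorners X₂]

/-- Near `p`, the smallest faces containing the components of a point of `D(F₁, F₂)` are determined
by the coordinates which vanish. -/
theorem FiberModel.exists_nhds_faceOf_eq_iff {p : X₁ × X₂} (D : FiberModel f₁ f₂ F₁ F₂ p) :
    ∃ N ∈ 𝓝 p, ∀ q ∈ N, ∀ q' ∈ N, q ∈ fiberD f₁ f₂ F₁ F₂ → q' ∈ fiberD f₁ f₂ F₁ F₂ →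
      (faceOf q.1 = faceOf q'.1 ∧ faceOf q.2 = faceOf q'.2 ↔
        ∀ i, D.coord q i = 0 ↔ D.coord q' i = 0) := by
  obtain ⟨N₁, hN₁o, hpN₁, -, -, hN₁⟩ := _root_.exists_nhds_faceOf_eq_iff D.he₁ D.D₁.mem
  obtain ⟨N₂, hN₂o, hpN₂, -, -, hN₂⟩ := _root_.exists_nhds_faceOf_eq_iff D.he₂ D.D₂.mem
  have h1 : ∀ᶠ q : X₁ × X₂ in 𝓝 p, q.1 ∈ N₁ := continuousAt_fst.eventually (hN₁o.mem_nhds hpN₁)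
  have h2 : ∀ᶠ q : X₁ × X₂ in 𝓝 p, q.2 ∈ N₂ := continuousAt_snd.eventually (hN₂o.mem_nhds hpN₂)
  refine ⟨_, (h1.and h2).and ((continuousAt_fst.eventually D.D₁.mem_iff).and
    (continuousAt_snd.eventually D.D₂.mem_iff)), ?_⟩
  rintro q ⟨⟨hq1, hq2⟩, hq3, hq4⟩ q' ⟨⟨hq1', hq2'⟩, hq3', hq4'⟩ hqD hqD'
  have hF := fiberD_subset_prod hqD
  have hF' := fiberD_subset_prod hqD'
  rw [hN₁ _ hq1 _ hq1', hN₂ _ hq2 _ hq2']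
  constructor
  · rintro ⟨h3, h4⟩ (i | i)
    · exact (Set.ext_iff.1 h3 i.1 :)
    · exact (Set.ext_iff.1 h4 i.1 :)
  · intro h
    refine ⟨Set.ext fun i => ?_, Set.ext fun i => ?_⟩
    · by_cases hi : i ∈ D.D₁.S
      · exact iff_of_true (hq3.1 hF.1 hi) (hq3'.1 hF'.1 hi)
      · exact h (.inl ⟨i, hi⟩)
    · by_cases hi : i ∈ D.D₂.S
      · exact iff_of_true (hq4.1 hF.2 hi) (hq4'.1 hF'.2 hi)
      · exact h (.inr ⟨i, hi⟩)

variable {W : Type u} [TopologicalSpace W] [CornerAtlas W] {h : W → X₁ × X₂}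

theorem FiberModel.IsAdapted.eventually_coord_eq_zero_iff {w : W} {D : FiberModel f₁ f₂ F₁ F₂ (h w)}
    {e : CornerChart W} {A : D.Idx → Fin e.1 → ℕ} (hA : D.IsAdapted e A) (hw : w ∈ e.source) :
    ∀ᶠ q in 𝓝 w, ∀ i, D.coord (h q) i = 0 ↔ ∃ b ∈ e.zeros q, A i b ≠ 0 := by
  filter_upwards [(CornerChart.tendsto_coord hw).eventually
    (eventually_all.2 fun i => (hA.monoGerm i).eq_zero_iff), e.isOpen_source.mem_nhds hw]
    with q hq hqs i
  have := hq i
  rwa [CornerChart.param_coord hqs] at this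

/-- Each coordinate hypersurface has a coordinate of `D(F₁, F₂)` which vanishes only there. -/
theorem FiberModel.IsAdapted.eventually_mem_zeros_iff {w : W} {D : FiberModel f₁ f₂ F₁ F₂ (h w)}
    {e : CornerChart W} {A : D.Idx → Fin e.1 → ℕ} (hA : D.IsAdapted e A) (hw : w ∈ e.source)
    {b : Fin e.1} (hb : e.coord w b = 0) :
    ∃ i, ∀ᶠ q in 𝓝 w, b ∈ e.zeros q ↔ D.coord (h q) i = 0 := by
  obtain ⟨i, hi, hi'⟩ := hA.basis.exists_row ⟨b, hb⟩
  refine ⟨i.1, ?_⟩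
  filter_upwards [hA.eventually_coord_eq_zero_iff hw, CornerChart.eventually_zeros_subset hw]
    with q h1 h2
  rw [h1]
  refine ⟨fun h => ⟨b, h, hi⟩, ?_⟩
  rintro ⟨b', hb', hne⟩
  have : b' = b := by
    by_contra hbb
    exact hne (hi' ⟨b', h2 hb'⟩ fun h => hbb (congrArg Subtype.val h))
  rwa [this] at hb'

variable [IsManifoldWithCorners Y]

namespace IsRes

/-- Near each point of `W`, the smallest faces are determined by their images. -/
theorem exists_nhds_faceOf_iff (hh : IsRes f₁ f₂ F₁ F₂ h) (hf₁ : IsInteriorBMap f₁)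
    (hf₂ : IsInteriorBMap f₂) (htrans : BTransversal f₁ f₂) (hsmooth : SmoothFiberMonoids f₁ f₂)
    {e : CornerChart W} (he : e ∈ CornerAtlas.charts) {w : W} (hw : w ∈ e.source) :
    ∃ N ∈ 𝓝 w, ∀ q ∈ N, ∀ q' ∈ N, e.zeros q = e.zeros q' ↔
      faceOf (h q).1 = faceOf (h q').1 ∧ faceOf (h q).2 = faceOf (h q').2 := by
  obtain ⟨e₁, he₁, hp₁⟩ := exists_chart (h w).1
  obtain ⟨e₂, he₂, hp₂⟩ := exists_chart (h w).2
  obtain ⟨D, -, -⟩ := exists_fiberModel hf₁ hf₂ (hh.mem w) he₁ he₂ hp₁ hp₂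
  obtain ⟨A, hA⟩ := hh.exists_isAdapted hf₁ hf₂ htrans hsmooth he hw D
  obtain ⟨N, hN, hNf⟩ := D.exists_nhds_faceOf_eq_iff
  choose r hr using fun b : {b // e.coord w b = 0} => hA.eventually_mem_zeros_iff hw b.2
  have hN' : ∀ᶠ q in 𝓝 w, h q ∈ N := hh.isEmbedding.continuous.continuousAt hN
  refine ⟨_, hN'.and
    ((eventually_all.2 hr).and ((CornerChart.eventually_zeros_subset hw).and
      (hA.eventually_coord_eq_zero_iff hw))), ?_⟩
  rintro q ⟨h1, h2, h3, h4⟩ q' ⟨h1', h2', h3', h4'⟩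
  rw [hNf _ h1 _ h1' (hh.mem q) (hh.mem q')]
  constructor
  · intro h i
    rw [h4, h4', h]
  · intro hi
    ext b
    by_cases hb : e.coord w b = 0
    · rw [h2 ⟨b, hb⟩, h2' ⟨b, hb⟩, hi]
    · exact iff_of_false (fun h => hb (h3 h)) (fun h => hb (h3' h))

theorem eventually_faceOf_eq_iff (hh : IsRes f₁ f₂ F₁ F₂ h) (hf₁ : IsInteriorBMap f₁)
    (hf₂ : IsInteriorBMap f₂) (htrans : BTransversal f₁ f₂) (hsmooth : SmoothFiberMonoids f₁ f₂)
    (w : W) : ∀ᶠ q in 𝓝 w, codim q = codim w ↔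
      faceOf (h q).1 = faceOf (h w).1 ∧ faceOf (h q).2 = faceOf (h w).2 := by
  obtain ⟨e, he, hw⟩ := exists_chart w
  obtain ⟨N, hN, hNf⟩ := hh.exists_nhds_faceOf_iff hf₁ hf₂ htrans hsmooth he hw
  filter_upwards [hN, eventually_codim_eq_iff he hw] with q h1 h2
  rw [h2, hNf q h1 w (mem_of_mem_nhds hN)]

theorem isManifoldWithCorners (hh : IsRes f₁ f₂ F₁ F₂ h) (hf₁ : IsInteriorBMap f₁)
    (hf₂ : IsInteriorBMap f₂) (htrans : BTransversal f₁ f₂) (hsmooth : SmoothFiberMonoids f₁ f₂) :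
    IsManifoldWithCorners W where
  t2 := have := hX₁.t2; have := hX₂.t2; hh.isEmbedding.t2Space
  paracompact := by
    have := hX₁.paracompact
    have := hX₂.paracompact
    have := CornerAtlas.weaklyLocallyCompactSpace X₁
    have := CornerAtlas.weaklyLocallyCompactSpace X₂
    have := paracompactSpace_prod X₁ X₂
    exact IsClosedEmbedding.paracompactSpace (e := h)
      ⟨hh.isEmbedding, by rw [hh.range_eq]; exact isClosed_closure⟩
  embedded := by
    refine exists_isDefiningCoord_of_separating (fun w => (faceOf (h w).1, faceOf (h w).2)) ?_ ?_
    · intro w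
      filter_upwards [hh.eventually_faceOf_eq_iff hf₁ hf₂ htrans hsmooth w] with q hq h1
      exact Prod.ext_iff.2 (hq.1 h1)
    · intro e he w hw
      obtain ⟨N, hN, hNf⟩ := hh.exists_nhds_faceOf_iff hf₁ hf₂ htrans hsmooth he hw
      refine ⟨N, hN, fun q hq q' hq' i j hi hj h1 => ?_⟩
      have := (hNf q hq q' hq').2 (Prod.ext_iff.1 h1)
      rw [hi, hj] at this
      exact singleton_injective this

end IsRes

end

end

set_option linter.unusedSectionVars false

noncomputable section

section

open scoped Classical

variable {X₁ X₂ Y : Type u} [TopologicalSpace X₁] [CornerAtlas X₁] [TopologicalSpace X₂]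
  [CornerAtlas X₂] [TopologicalSpace Y] [CornerAtlas Y]
  {f₁ : X₁ → Y} {f₂ : X₂ → Y} {F₁ : Face X₁} {F₂ : Face X₂}

namespace FiberModel

variable {p : X₁ × X₂} (D : FiberModel f₁ f₂ F₁ F₂ p)

theorem neBot (D : FiberModel f₁ f₂ F₁ F₂ p) : (𝓝[fiberInt f₁ f₂ F₁ F₂] p).NeBot := mem_closure_iff_nhdsWithin_neBot.1 D.mem

theorem eventually_fiberInt_zeros : ∀ᶠ q in 𝓝[fiberInt f₁ f₂ F₁ F₂] p,
    D.e₁.zeros q.1 = D.D₁.S ∧ D.e₂.zeros q.2 = D.D₂.S := by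
  have h1 : ∀ᶠ q : X₁ × X₂ in 𝓝 p, q.1 ∈ F₁.int ↔ D.e₁.zeros q.1 = D.D₁.S :=
    continuousAt_fst.eventually D.D₁.int_iff
  have h2 : ∀ᶠ q : X₁ × X₂ in 𝓝 p, q.2 ∈ F₂.int ↔ D.e₂.zeros q.2 = D.D₂.S :=
    continuousAt_snd.eventually D.D₂.int_iff
  filter_upwards [nhdsWithin_le_nhds h1, nhdsWithin_le_nhds h2, self_mem_nhdsWithin]
    with q h1 h2 hq using ⟨h1.1 hq.1, h2.1 hq.2.1⟩

theorem eventually_coord₁_eq_zero_iff (i : Fin D.e₁.1) :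
    (∀ᶠ q in 𝓝[fiberInt f₁ f₂ F₁ F₂] p, D.e₁.coord q.1 i = 0) ↔ i ∈ D.D₁.S := by
  have := D.neBot
  constructor
  · intro h
    obtain ⟨q, h1, h2⟩ := (h.and D.eventually_fiberInt_zeros).exists
    rw [← h2.1]; exact h1
  · intro h
    filter_upwards [D.eventually_fiberInt_zeros] with q hq
    rw [← hq.1] at h; exact h

theorem eventually_coord₂_eq_zero_iff (i : Fin D.e₂.1) :
    (∀ᶠ q in 𝓝[fiberInt f₁ f₂ F₁ F₂] p, D.e₂.coord q.2 i = 0) ↔ i ∈ D.D₂.S := by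
  have := D.neBot
  constructor
  · intro h
    obtain ⟨q, h1, h2⟩ := (h.and D.eventually_fiberInt_zeros).exists
    rw [← h2.2]; exact h1
  · intro h
    filter_upwards [D.eventually_fiberInt_zeros] with q hq
    rw [← hq.2] at h; exact h

theorem ext₁_mul {v : Fin D.e₁.1 → ℝ} {v' : D.Idx → ℝ} (hv : ∀ i, v' (.inl i) = v i) :
    D.ext₁ (fun i => D.coord p i * v' i) = WithLp.toLp 2 fun i => D.e₁.coord p.1 i * v i := by
  ext i
  by_cases hi : i ∈ D.D₁.S
  · have : D.e₁.coord p.1 i = 0 := D.D₁.S_subset hi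
    simp [ext₁, extendZero_of_mem _ hi, this]
  · simp [ext₁, extendZero_of_notMem _ hi, coord, hv]

theorem ext₂_mul {v : Fin D.e₂.1 → ℝ} {v' : D.Idx → ℝ} (hv : ∀ i, v' (.inr i) = v i) :
    D.ext₂ (fun i => D.coord p i * v' i) = WithLp.toLp 2 fun i => D.e₂.coord p.2 i * v i := by
  ext i
  by_cases hi : i ∈ D.D₂.S
  · have : D.e₂.coord p.2 i = 0 := D.D₂.S_subset hi
    simp [ext₂, extendZero_of_mem _ hi, this]
  · simp [ext₂, extendZero_of_notMem _ hi, coord, hv]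

theorem tendsto_ext : Tendsto (fun z => (D.ext₁ z, D.ext₂ z)) (𝓝[piQuadrant D.Idx] (D.coord p))
    (𝓝[quadrant D.e₁.1 ×ˢ quadrant D.e₂.1] (D.e₁.coord p.1, D.e₂.coord p.2)) := by
  rw [nhdsWithin_prod_eq]
  exact D.tendsto_ext₁.prodMk D.tendsto_ext₂

theorem fderivWithin_comp_ext {a : EuclideanSpace ℝ (Fin D.e₁.1) × EuclideanSpace ℝ (Fin D.e₂.1) → ℝ}
    (ha : DifferentiableWithinAt ℝ a (quadrant D.e₁.1 ×ˢ quadrant D.e₂.1)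
      (D.e₁.coord p.1, D.e₂.coord p.2)) (u : D.Idx → ℝ) :
    fderivWithin ℝ (fun z => a (D.ext₁ z, D.ext₂ z)) (piQuadrant D.Idx) (D.coord p) u =
      fderivWithin ℝ a (quadrant D.e₁.1 ×ˢ quadrant D.e₂.1) (D.e₁.coord p.1, D.e₂.coord p.2)
        (D.ext₁ u, D.ext₂ u) := by
  have h1 := ha.hasFDerivWithinAt
  have h0 : (D.e₁.coord p.1, D.e₂.coord p.2) = (D.ext₁.prod D.ext₂) (D.coord p) := by
    rw [ContinuousLinearMap.prod_apply, D.ext₁_center, D.ext₂_center]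
  rw [h0] at h1 ⊢
  have h2 := h1.comp (D.coord p) (D.ext₁.prod D.ext₂).hasFDerivWithinAt (s := piQuadrant D.Idx)
    fun z hz => ⟨extendZero_mem hz, extendZero_mem hz⟩
  have hu : UniqueDiffWithinAt ℝ (piQuadrant D.Idx) (D.coord p) :=
    uniqueDiffOn_convex convex_piQuadrant interior_piQuadrant_nonempty _ (D.coord_mem p)
  have h3 := h2.fderivWithin hu
  exact congrArg (fun T => T u) h3

/-- The linear equations of the b-tangent space. -/
def tangentEq : (D.Idx → ℝ) →ₗ[ℝ] (D.EqIdx → ℝ) where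
  toFun v j := ∑ i, D.γ j i * v i +
    fderivWithin ℝ (D.c j) (piQuadrant D.Idx) (D.coord p) (fun i => D.coord p i * v i) /
      D.c j (D.coord p)
  map_add' v w := by
    funext j
    have : (fun i => D.coord p i * (v + w) i) =
      (fun i => D.coord p i * v i) + fun i => D.coord p i * w i := by
      funext i; simp [mul_add]
    rw [this, map_add]
    simp only [Pi.add_apply, mul_add, Finset.sum_add_distrib]
    ring
  map_smul' r v := by
    funext j
    have : (fun i => D.coord p i * (r • v) i) = r • (fun i => D.coord p i * v i) := by
      funext i; simp; ring
    rw [this, map_smul]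
    simp only [Pi.smul_apply, smul_eq_mul, RingHom.id_apply, mul_add, Finset.mul_sum]
    congr 1
    · exact Finset.sum_congr rfl fun i _ => by ring
    · ring

theorem tangentEq_eq_zero {v : (Fin D.e₁.1 → ℝ) × (Fin D.e₂.1 → ℝ)}
    (hv : v ∈ fiberBTangent f₁ f₂ F₁ F₂ D.e₁ D.e₂ p) :
    D.tangentEq (Sum.elim (fun i => v.1 i) (fun i => v.2 i)) = 0 := by
  funext j
  obtain ⟨hv1, hv2, hv3⟩ := hv
  set Q := quadrant D.e₁.1 ×ˢ quadrant D.e₂.1 with hQ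
  set x₀ := (D.e₁.coord p.1, D.e₂.coord p.2) with hx₀
  have hx₀Q : x₀ ∈ Q := ⟨D.e₁.coord_mem _, D.e₂.coord_mem _⟩
  set a : EuclideanSpace ℝ (Fin D.e₁.1) × EuclideanSpace ℝ (Fin D.e₂.1) → ℝ :=
    fun x => D.D₁.a j x.1 * (D.D₂.a j x.2)⁻¹ with ha
  have hf : Tendsto Prod.fst (𝓝[Q] x₀) (𝓝[quadrant D.e₁.1] (D.e₁.coord p.1)) := by
    rw [hQ, hx₀, nhdsWithin_prod_eq]; exact tendsto_fst
  have hs : Tendsto Prod.snd (𝓝[Q] x₀) (𝓝[quadrant D.e₂.1] (D.e₂.coord p.2)) := by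
    rw [hQ, hx₀, nhdsWithin_prod_eq]; exact tendsto_snd
  have h1 : SmoothGerm Q x₀ a := by
    refine SmoothGerm.mul ?_ (SmoothGerm.inv hx₀Q ?_ (D.D₂.pos j).ne')
    · exact SmoothGerm.comp (Q' := quadrant D.e₁.1) (D.D₁.smooth j)
        (SmoothGerm.of_contDiff contDiff_fst) hf
    · exact SmoothGerm.comp (Q' := quadrant D.e₂.1) (D.D₂.smooth j)
        (SmoothGerm.of_contDiff contDiff_snd) hs
  have h2 : ∀ᶠ x in 𝓝[Q] x₀, 0 < a x ∧ ContDiffWithinAt ℝ ∞ a Q x := by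
    filter_upwards [hf.eventually D.D₁.eq, hs.eventually D.D₂.eq, h1] with x hx hx' hx''
    exact ⟨mul_pos (hx j).1 (inv_pos.2 (hx' j).1), hx''⟩
  obtain ⟨U, hU, hUo, hUx⟩ := eventually_nhds_iff.1 (eventually_nhdsWithin_iff.1 h2)
  have h3 := hv3 (fun i => D.D₁.α j i) (fun i => - D.D₂.α j i) a U (hUo.mem_nhds hUx)
    (fun x hx => (hU x hx.2 hx.1).2.mono inter_subset_left) (fun x hx => (hU x hx.2 hx.1).1) (by
      filter_upwards [nhdsWithin_le_nhds D.eventually_coord_mem_sol, self_mem_nhdsWithin,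
        D.eventually_fiberInt_zeros] with q hq hqF hz
      have h4 := (hq hqF).2 j
      rw [D.prod_γ, c, D.ext₁_coord hz.1.ge, D.ext₂_coord hz.2.ge] at h4
      simp only [zpow_neg, zpow_natCast, Finset.prod_inv_distrib]
      rw [mul_assoc]
      exact h4)
  rw [← D.ext₁_mul (v' := Sum.elim (fun i => v.1 i) (fun i => v.2 i)) fun _ => rfl,
    ← D.ext₂_mul (v' := Sum.elim (fun i => v.1 i) (fun i => v.2 i)) fun _ => rfl,
    ← D.fderivWithin_comp_ext ((h1.self_of_mem hx₀Q).differentiableWithinAt (by simp))] at h3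
  have h4 := sum_extendZero (S := D.D₁.S) (α := fun i => (D.D₁.α j i : ℝ))
    (fun i hi => by simp [D.D₁.α_eq_zero_of_notMem j i j.2 hi]) v.1
  have h5 := sum_extendZero (S := D.D₂.S) (α := fun i => (D.D₂.α j i : ℝ))
    (fun i hi => by simp [D.D₂.α_eq_zero_of_notMem j i j.2 hi]) v.2
  have h6 : a (D.e₁.coord p.1, D.e₂.coord p.2) = D.c j (D.coord p) := by
    simp only [ha, c, D.ext₁_center, D.ext₂_center]
  simp only [Int.cast_neg, Int.cast_natCast, neg_mul, Finset.sum_neg_distrib] at h3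
  rw [h4, h5, h6] at h3
  change ∑ i, (D.γ j i : ℝ) * _ + _ = 0
  rw [Fintype.sum_sum_type]
  simp only [γ, Sum.elim_inl, Sum.elim_inr, Int.cast_natCast, Int.cast_neg, neg_mul,
    Finset.sum_neg_distrib]
  exact h3

end FiberModel

variable [IsManifoldWithCorners X₁] [IsManifoldWithCorners X₂]
  {W : Type u} [TopologicalSpace W] [CornerAtlas W] {h : W → X₁ × X₂}

namespace FiberModel

variable {w : W} (D : FiberModel f₁ f₂ F₁ F₂ (h w)) {e : CornerChart W}

/-- The b-differential in the coordinates of `D(F₁, F₂)`. -/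
def tangentMap (e : CornerChart W) : (Fin e.1 → ℝ) →ₗ[ℝ] (D.Idx → ℝ) :=
  Matrix.mulVecLin fun i b => limLogDeriv (e.coord w) (fun x => D.coord (h (e.param x)) i) b

theorem tangentMap_apply (v : Fin e.1 → ℝ) (i : D.Idx) : D.tangentMap e v i =
    ∑ b, limLogDeriv (e.coord w) (fun x => D.coord (h (e.param x)) i) b * v b := rfl

variable (hg : FiberGerm f₁ f₂ F₁ F₂ (e.coord w) (fun x => h (e.param x)))

include hg in
theorem bDiff₁_mulVec (hw : w ∈ e.source) (v : Fin e.1 → ℝ) :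
    (∀ i ∈ D.D₁.S, (bDiff (fun w => (h w).1) e D.e₁ w).mulVec v i = 0) ∧
    ∀ i : {i // i ∉ D.D₁.S}, D.tangentMap e v (.inl i) =
      (bDiff (fun w => (h w).1) e D.e₁ w).mulVec v i := by
  refine ⟨fun i hi => ?_, fun i => rfl⟩
  have h1 : ∀ᶠ x in 𝓝[quadrant e.1] (e.coord w), D.e₁.coord (h (e.param x)).1 i = 0 := by
    have ht := hg.tendsto
    rw [CornerChart.param_coord hw] at ht
    have h2 : ∀ᶠ q : X₁ × X₂ in 𝓝 (h w), q.1 ∈ F₁.1 ↔ D.D₁.S ⊆ D.e₁.zeros q.1 :=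
      continuousAt_fst.eventually D.D₁.mem_iff
    filter_upwards [ht.eventually h2, hg.eventually_mem_fiberD] with x hx hx'
    exact hx.1 (fiberD_subset_prod hx').1 hi
  have h3 : ∀ b, bDiff (fun w => (h w).1) e D.e₁ w i b = 0 := fun b =>
    limUnder_logDeriv_of_eq_zero (e.coord_mem w) h1
  simp only [Matrix.mulVec, dotProduct, h3, zero_mul, Finset.sum_const_zero]

include hg in
theorem bDiff₂_mulVec (hw : w ∈ e.source) (v : Fin e.1 → ℝ) :
    (∀ i ∈ D.D₂.S, (bDiff (fun w => (h w).2) e D.e₂ w).mulVec v i = 0) ∧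
    ∀ i : {i // i ∉ D.D₂.S}, D.tangentMap e v (.inr i) =
      (bDiff (fun w => (h w).2) e D.e₂ w).mulVec v i := by
  refine ⟨fun i hi => ?_, fun i => rfl⟩
  have h1 : ∀ᶠ x in 𝓝[quadrant e.1] (e.coord w), D.e₂.coord (h (e.param x)).2 i = 0 := by
    have ht := hg.tendsto
    rw [CornerChart.param_coord hw] at ht
    have h2 : ∀ᶠ q : X₁ × X₂ in 𝓝 (h w), q.2 ∈ F₂.1 ↔ D.D₂.S ⊆ D.e₂.zeros q.2 :=
      continuousAt_snd.eventually D.D₂.mem_iff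
    filter_upwards [ht.eventually h2, hg.eventually_mem_fiberD] with x hx hx'
    exact hx.1 (fiberD_subset_prod hx').2 hi
  have h3 : ∀ b, bDiff (fun w => (h w).2) e D.e₂ w i b = 0 := fun b =>
    limUnder_logDeriv_of_eq_zero (e.coord_mem w) h1
  simp only [Matrix.mulVec, dotProduct, h3, zero_mul, Finset.sum_const_zero]

include hg in
theorem bDiff_mem_fiberBTangent (hw : w ∈ e.source) (v : Fin e.1 → ℝ) :
    ((bDiff (fun w => (h w).1) e D.e₁ w).mulVec v, (bDiff (fun w => (h w).2) e D.e₂ w).mulVec v) ∈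
      fiberBTangent f₁ f₂ F₁ F₂ D.e₁ D.e₂ (h w) := by
  have hx₀ := e.coord_mem w
  have hpw : h (e.param (e.coord w)) = h w := congrArg h (CornerChart.param_coord hw)
  obtain ⟨hS1, hv1⟩ := D.bDiff₁_mulVec hg hw v
  obtain ⟨hS2, hv2⟩ := D.bDiff₂_mulVec hg hw v
  refine ⟨fun i hi => hS1 i ((D.eventually_coord₁_eq_zero_iff i).1 hi),
    fun i hi => hS2 i ((D.eventually_coord₂_eq_zero_iff i).1 hi), fun γ δ a U hU ha ha0 hrel => ?_⟩
  have hneBot := D.neBot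
  obtain ⟨q₀, hq₀, hq₀z⟩ := (hrel.and D.eventually_fiberInt_zeros).exists
  have hγS : ∀ i ∈ D.D₁.S, γ i = 0 := by
    intro i hi
    by_contra hne
    have h0 : D.e₁.coord q₀.1 i = 0 := by rw [← hq₀z.1] at hi; exact hi
    rw [Finset.prod_eq_zero (i := i) (Finset.mem_univ _) (by rw [h0, zero_zpow _ hne])] at hq₀
    simp at hq₀
  have hδS : ∀ i ∈ D.D₂.S, δ i = 0 := by
    intro i hi
    by_contra hne
    have h0 : D.e₂.coord q₀.2 i = 0 := by rw [← hq₀z.2] at hi; exact hi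
    rw [Finset.prod_eq_zero (i := i) (s := Finset.univ)
      (f := fun j => D.e₂.coord q₀.2 j ^ δ j) (Finset.mem_univ _) (by rw [h0, zero_zpow _ hne])] at hq₀
    simp at hq₀
  obtain ⟨hmono, hsol⟩ := D.eventually_monoGerm_coord.self_of_nhds e.1 (e.coord w) _ hx₀ hpw hg
  choose A hA using hmono
  set Q := quadrant D.e₁.1 ×ˢ quadrant D.e₂.1 with hQ
  set c : (D.Idx → ℝ) → ℝ := fun z => a (D.ext₁ z, D.ext₂ z) with hc
  have hext : (D.ext₁ (D.coord (h w)), D.ext₂ (D.coord (h w))) =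
      (D.e₁.coord (h w).1, D.e₂.coord (h w).2) := by rw [D.ext₁_center, D.ext₂_center]
  have hQ₀ : (D.e₁.coord (h w).1, D.e₂.coord (h w).2) ∈ Q ∩ U :=
    ⟨⟨D.e₁.coord_mem _, D.e₂.coord_mem _⟩, mem_of_mem_nhds hU⟩
  have has : SmoothGerm Q (D.e₁.coord (h w).1, D.e₂.coord (h w).2) a :=
    SmoothGerm.of_contDiffOn hU ha
  have hcs : SmoothGerm (piQuadrant D.Idx) (D.coord (h w)) c := by
    refine SmoothGerm.comp (Q' := Q) (f := fun z => (D.ext₁ z, D.ext₂ z)) ?_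
      (SmoothGerm.of_contDiff (D.ext₁.contDiff.prodMk D.ext₂.contDiff)) ?_
    · rw [hext]; exact has
    · rw [hext]; exact D.tendsto_ext
  have hc0 : 0 < c (D.coord (h w)) := by
    simp only [hc, hext]
    exact ha0 _ hQ₀
  set Γ : D.Idx → ℤ := Sum.elim (fun i => γ i) (fun i => δ i) with hΓ
  have hlog := fun b => hasLogDeriv_mul_prod hx₀ hA (a := c) (by rw [hpw]; exact hcs)
    (by rw [hpw]; exact hc0) Γ b
  have hone : ∀ᶠ x in 𝓝[openQuadrant e.1] (e.coord w),
      c (D.coord (h (e.param x))) * ∏ i, D.coord (h (e.param x)) i ^ Γ i = 1 := by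
    have ht : Tendsto (fun x => h (e.param x)) (𝓝[openQuadrant e.1] (e.coord w))
        (𝓝[fiberInt f₁ f₂ F₁ F₂] (h w)) := by
      refine tendsto_nhdsWithin_iff.2 ⟨?_, hg.int⟩
      have := hg.tendsto.mono_left (nhdsWithin_mono _ (openQuadrant_subset e.1))
      rwa [hpw] at this
    filter_upwards [ht.eventually hrel, ht.eventually D.eventually_fiberInt_zeros] with x hx hz
    rw [Fintype.prod_sum_type]
    simp only [hc, D.ext₁_coord hz.1.ge, D.ext₂_coord hz.2.ge]
    rw [← hx, mul_assoc]
    congr 2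
    · rw [← Fintype.prod_subtype_mul_prod_subtype (fun i => i ∉ D.D₁.S)]
      rw [Finset.prod_eq_one (s := (Finset.univ : Finset {i // ¬ i ∉ D.D₁.S}))
        (fun i _ => by rw [hγS _ (not_not.1 i.2), zpow_zero]), mul_one]
      rfl
    · rw [← Fintype.prod_subtype_mul_prod_subtype (fun i => i ∉ D.D₂.S)]
      rw [Finset.prod_eq_one (s := (Finset.univ : Finset {i // ¬ i ∉ D.D₂.S}))
        (fun i _ => by rw [hδS _ (not_not.1 i.2), zpow_zero]), mul_one]
      rfl
  have hzero := fun b => (hlog b).unique hx₀ ((HasLogDeriv.const one_ne_zero).congr hone)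
  rw [hpw] at hzero
  -- the sum over all components of the vector
  have hsum : fderivWithin ℝ c (piQuadrant D.Idx) (D.coord (h w))
      (fun i => D.coord (h w) i * D.tangentMap e v i) / c (D.coord (h w)) +
      ∑ i, Γ i * D.tangentMap e v i = 0 := by
    have h1 : (fun i => D.coord (h w) i * D.tangentMap e v i) = ∑ b, v b • fun i =>
        D.coord (h w) i * limLogDeriv (e.coord w) (fun x => D.coord (h (e.param x)) i) b := by
      funext i
      rw [tangentMap_apply, Finset.sum_apply, Finset.mul_sum]
      exact Finset.sum_congr rfl fun b _ => by simp only [Pi.smul_apply, smul_eq_mul]; ring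
    rw [h1, map_sum, Finset.sum_div]
    simp only [tangentMap_apply, Finset.mul_sum, map_smul, smul_eq_mul]
    rw [Finset.sum_comm, ← Finset.sum_add_distrib]
    refine Finset.sum_eq_zero fun b _ => ?_
    rw [← mul_zero (v b), ← hzero b, mul_add, Finset.mul_sum, mul_div_assoc]
    congr 1
    exact Finset.sum_congr rfl fun i _ => by ring
  rw [D.fderivWithin_comp_ext ((has.self_of_mem hQ₀.1).differentiableWithinAt (by simp)),
    D.ext₁_mul hv1, D.ext₂_mul hv2, Fintype.sum_sum_type] at hsum
  have h4 := sum_extendZero (S := D.D₁.S) (α := fun i => (γ i : ℝ))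
    (fun i hi => by simp [hγS i hi]) ((bDiff (fun w => (h w).1) e D.e₁ w).mulVec v)
  have h5 := sum_extendZero (S := D.D₂.S) (α := fun i => (δ i : ℝ))
    (fun i hi => by simp [hδS i hi]) ((bDiff (fun w => (h w).2) e D.e₂ w).mulVec v)
  simp only [hΓ, Sum.elim_inl, Sum.elim_inr, hv1, hv2] at hsum
  rw [← h4, ← h5, add_comm] at hsum
  simp only [hc, hext] at hsum
  exact hsum

include hg in
/-- The b-differential is a bijection onto the b-tangent space, if it is injective and the dimensions
agree. -/
theorem bijOn_fiberBTangent (htrans : BTransversal f₁ f₂) (hw : w ∈ e.source)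
    {A : D.Idx → Fin e.1 → ℕ} (hA : D.IsAdapted e A) :
    BijOn (fun v => ((bDiff (fun w => (h w).1) e D.e₁ w).mulVec v,
      (bDiff (fun w => (h w).2) e D.e₂ w).mulVec v)) univ
      (fiberBTangent f₁ f₂ F₁ F₂ D.e₁ D.e₂ (h w)) := by
  have hinj : Function.Injective (D.tangentMap e) := by
    rw [← LinearMap.ker_eq_bot, LinearMap.ker_eq_bot']
    exact fun v hv => hA.inj v fun i => congrFun hv i
  have hle : LinearMap.range (D.tangentMap e) ≤ LinearMap.ker D.tangentEq := by
    rintro _ ⟨v, rfl⟩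
    rw [LinearMap.mem_ker, ← D.tangentEq_eq_zero (D.bDiff_mem_fiberBTangent hg hw v)]
    congr 1
    funext i
    rcases i with i | i
    · exact (D.bDiff₁_mulVec hg hw v).2 i
    · exact (D.bDiff₂_mulVec hg hw v).2 i
  have hsurj : LinearMap.range D.tangentEq = ⊤ := by
    rw [LinearMap.range_eq_top]
    intro b
    obtain ⟨v, hv⟩ := D.surjective_of_bTransversal htrans b
    exact ⟨v, funext hv⟩
  have hrange : LinearMap.range (D.tangentMap e) = LinearMap.ker D.tangentEq := by
    refine Submodule.eq_of_le_of_finrank_eq hle ?_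
    have h1 := LinearMap.finrank_range_add_finrank_ker D.tangentEq
    have h2 := hA.card
    rw [hsurj, finrank_top, Module.finrank_fintype_fun_eq_card,
      Module.finrank_fintype_fun_eq_card] at h1
    rw [LinearMap.finrank_range_of_inj hinj, Module.finrank_fin_fun]
    omega
  refine ⟨fun v _ => D.bDiff_mem_fiberBTangent hg hw v, fun v _ v' _ hvv => hinj ?_, fun t ht => ?_⟩
  · funext i
    rcases i with i | i
    · rw [(D.bDiff₁_mulVec hg hw v).2, (D.bDiff₁_mulVec hg hw v').2]
      exact congrFun (congrArg Prod.fst hvv) i.1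
    · rw [(D.bDiff₂_mulVec hg hw v).2, (D.bDiff₂_mulVec hg hw v').2]
      exact congrFun (congrArg Prod.snd hvv) i.1
  · have h1 : (Sum.elim (fun i => t.1 i) (fun i => t.2 i) : D.Idx → ℝ) ∈ LinearMap.range (D.tangentMap e) := by
      rw [hrange, LinearMap.mem_ker]
      exact D.tangentEq_eq_zero ht
    obtain ⟨v, hv⟩ := h1
    refine ⟨v, mem_univ _, Prod.ext (funext fun i => ?_) (funext fun i => ?_)⟩
    · by_cases hi : i ∈ D.D₁.S
      · rw [ht.1 i ((D.eventually_coord₁_eq_zero_iff i).2 hi)]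
        exact (D.bDiff₁_mulVec hg hw v).1 i hi
      · exact ((D.bDiff₁_mulVec hg hw v).2 ⟨i, hi⟩).symm.trans (congrFun hv (.inl ⟨i, hi⟩))
    · by_cases hi : i ∈ D.D₂.S
      · rw [ht.2.1 i ((D.eventually_coord₂_eq_zero_iff i).2 hi)]
        exact (D.bDiff₂_mulVec hg hw v).1 i hi
      · exact ((D.bDiff₂_mulVec hg hw v).2 ⟨i, hi⟩).symm.trans (congrFun hv (.inr ⟨i, hi⟩))

end FiberModel

end

end

set_option linter.unusedSectionVars false

noncomputable section

section

open scoped Classical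

variable {X₁ X₂ Y : Type u} [TopologicalSpace X₁] [CornerAtlas X₁] [TopologicalSpace X₂]
  [CornerAtlas X₂] [TopologicalSpace Y] [CornerAtlas Y]
  {f₁ : X₁ → Y} {f₂ : X₂ → Y} {F₁ : Face X₁} {F₂ : Face X₂}
  {W : Type u} [TopologicalSpace W] [CornerAtlas W] {h : W → X₁ × X₂}

/-- The hypersurfaces through a point correspond to the vanishing coordinates. -/
theorem exists_hypersurface_equiv_zeros [IsManifoldWithCorners W] {C : Face W}
    (hC : C.int ⊆ mInterior W) {e : CornerChart W} (he : e ∈ CornerAtlas.charts) {w : W}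
    (hw : w ∈ e.source) (hwC : w ∈ C.1) :
    ∃ σ : {K : Hypersurface W // (faceAt w).1 ⊆ K.1 ∧ ¬ C.1 ⊆ K.1} ≃ {b // e.coord w b = 0},
      ∀ K, IsDefiningCoord e K.1.1 w (σ K).1 := by
  obtain ⟨S, -, hS, -⟩ := C.exists_local_form he hw hwC
  obtain rfl : S = ∅ := by
    have h1 := hwC
    rw [← C.closure_int, mem_closure_iff_frequently] at h1
    obtain ⟨q, hq, hqS, hqs⟩ := (h1.and_eventually (hS.and (e.isOpen_source.mem_nhds hw))).exists
    rw [← hqS.1 hq]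
    have h2 := (mem_mInterior_iff he hqs).1 (hC hq)
    exact eq_empty_of_forall_notMem fun i hi => (h2 i).ne' hi
  obtain ⟨σ, hσ⟩ := exists_hypersurface_equiv he hw hwC hS
  exact ⟨σ.trans ⟨fun a => ⟨a.1.1, a.2⟩, fun b => ⟨⟨b.1, notMem_empty _⟩, b.2⟩, fun _ => rfl,
    fun _ => rfl⟩, hσ⟩

theorem bPush_eq_sum {X : Type u} [TopologicalSpace X] [CornerAtlas X] [IsManifoldWithCorners X]
    [IsManifoldWithCorners W] {g : W → X} (hg : IsBMap g) {C : Face W} {F : Face X}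
    (hF : ∀ w ∈ mInterior W, g w ∈ F.int) {e : CornerChart W} (he : e ∈ CornerAtlas.charts) {w : W}
    (hw : w ∈ e.source)
    {σ : {K : Hypersurface W // (faceAt w).1 ⊆ K.1 ∧ ¬ C.1 ⊆ K.1} ≃ {b // e.coord w b = 0}}
    (hσ : ∀ K, IsDefiningCoord e K.1.1 w (σ K).1) {e' : CornerChart X}
    (he' : e' ∈ CornerAtlas.charts) (hw' : g w ∈ e'.source) {H : Hypersurface X}
    (hFH : ¬ F.1 ⊆ H.1) {j : Fin e'.1} (hj : IsDefiningCoord e' H.1 (g w) j) {α : Fin e.1 → ℕ}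
    (hα : MonoGerm (e.coord w) (fun x => e'.coord (g (e.param x)) j) α)
    (u : FaceMonoid C (faceAt w)) :
    bPush g C (faceAt w) u H = ∑ b : {b // e.coord w b = 0}, α b * u (σ.symm b) := by
  let _ : Fintype {K : Hypersurface W // (faceAt w).1 ⊆ K.1 ∧ ¬ C.1 ⊆ K.1} := Fintype.ofEquiv _ σ.symm
  rw [bPush, Finsupp.liftAddHom_apply, Finsupp.sum_fintype _ _ (fun K => by ext; simp),
    Finset.sum_apply, ← σ.sum_comp]
  refine Finset.sum_congr rfl fun K _ => ?_
  have h1 : bExponent g K.1 H = α (σ K).1 :=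
    bExponent_eq hg (fun q hq hqH => hFH ((F.subset_hypersurface_iff H (hF q hq)).2 hqH)) he he'
      hw hw' (K.1.faceOf_subset_iff.1 K.2.1) (hσ K) hj hα
  simp only [AddMonoidHom.coe_mk, ZeroHom.coe_mk, h1, σ.symm_apply_apply]
  rw [mul_comm]

variable [IsManifoldWithCorners X₁] [IsManifoldWithCorners X₂] [IsManifoldWithCorners Y]
  [IsManifoldWithCorners W]

/-- The condition that a map to `D(F₁, F₂)` induces isomorphisms of monoids, in terms of exponents. -/
theorem FiberModel.monoid_iso_iff (hf₁ : IsInteriorBMap f₁) (hf₂ : IsInteriorBMap f₂)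
    (hb₁ : IsBMap fun w => (h w).1) (hb₂ : IsBMap fun w => (h w).2)
    (hint : ∀ w ∈ mInterior W, (h w).1 ∈ F₁.int ∧ (h w).2 ∈ F₂.int)
    {e : CornerChart W} (he : e ∈ CornerAtlas.charts) {w : W} (hw : w ∈ e.source)
    (D : FiberModel f₁ f₂ F₁ F₂ (h w)) {A : D.Idx → Fin e.1 → ℕ}
    (hA : ∀ i, MonoGerm (e.coord w) (fun x => D.coord (h (e.param x)) i) (A i)) {C : Face W}
    (hC : C.int ⊆ mInterior W) (hwC : w ∈ C.1)
    {Φ : FaceMonoid C (faceAt w) →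
        ({K : Hypersurface X₁ // (faceAt (h w).1).1 ⊆ K.1 ∧ ¬ F₁.1 ⊆ K.1} → ℕ) ×
        ({K : Hypersurface X₂ // (faceAt (h w).2).1 ⊆ K.1 ∧ ¬ F₂.1 ⊆ K.1} → ℕ)}
    (hΦ : Φ = fun u => (fun K => bPush (fun w => (h w).1) C (faceAt w) u K.1,
      fun K => bPush (fun w => (h w).2) C (faceAt w) u K.1)) :
    (Function.Injective Φ ∧ range Φ =
      (fun x : FaceMonoid F₁ (faceAt (h w).1) × FaceMonoid F₂ (faceAt (h w).2) => (⇑x.1, ⇑x.2)) ''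
      (fiberMonoid f₁ f₂ F₁ (faceAt (h w).1) F₂ (faceAt (h w).2) D.G (faceAt (f₁ (h w).1)) :
        Set (FaceMonoid F₁ (faceAt (h w).1) × FaceMonoid F₂ (faceAt (h w).2)))) ↔
    IsKernelBasis (fun (j : D.EqIdx) (i : {i // D.coord (h w) i = 0}) => D.γ j i)
      (fun i (b : {b // e.coord w b = 0}) => A i b) := by
  obtain ⟨σ, hσ⟩ := exists_hypersurface_equiv_zeros hC he hw hwC
  obtain ⟨σ₁, σ₂, hl⟩ := D.exists_isLabelling
  let _ : Fintype {K : Hypersurface W // (faceAt w).1 ⊆ K.1 ∧ ¬ C.1 ⊆ K.1} := Fintype.ofEquiv _ σ.symm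
  -- the exponents of an element of the monoid of the face
  set N : FaceMonoid C (faceAt w) → {i // D.coord (h w) i = 0} → ℕ := fun u i =>
    ∑ b : {b // e.coord w b = 0}, A i b * u (σ.symm b) with hN
  set Ψ := (fun x : FaceMonoid F₁ (faceAt (h w).1) × FaceMonoid F₂ (faceAt (h w).2) =>
    ((⇑x.1, ⇑x.2) : ({K : Hypersurface X₁ // (faceAt (h w).1).1 ⊆ K.1 ∧ ¬ F₁.1 ⊆ K.1} → ℕ) ×
        ({K : Hypersurface X₂ // (faceAt (h w).2).1 ⊆ K.1 ∧ ¬ F₂.1 ⊆ K.1} → ℕ))) with hΨdef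
  have hΨ : Function.Injective Ψ := fun x y hxy =>
    Prod.ext (DFunLike.coe_injective (congrArg Prod.fst hxy))
      (DFunLike.coe_injective (congrArg Prod.snd hxy))
  set E := D.exponents σ₁ σ₂ with hE
  have hEb : Function.Bijective E := D.exponents_bijective
  have hΦN : ∀ u x, Φ u = Ψ x ↔ N u = E x := by
    have h1 : ∀ u x, N u = E x → Φ u = Ψ x := by
      intro u x hux
      rw [hΦ]
      refine Prod.ext (funext fun K => ?_) (funext fun K => ?_)
      · change bPush (fun w => (h w).1) C (faceAt w) u K.1 = x.1 K
        rw [bPush_eq_sum hb₁ (fun q hq => (hint q hq).1) he hw hσ D.he₁ D.D₁.mem K.2.2 (hl.left K)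
          (hA (.inl (σ₁ K).1))]
        have h2 := congrFun hux ⟨.inl (σ₁ K).1, (σ₁ K).2⟩
        simp only [hN] at h2
        rw [h2]
        exact congrArg x.1 (σ₁.symm_apply_apply K)
      · change bPush (fun w => (h w).2) C (faceAt w) u K.1 = x.2 K
        rw [bPush_eq_sum hb₂ (fun q hq => (hint q hq).2) he hw hσ D.he₂ D.D₂.mem K.2.2 (hl.right K)
          (hA (.inr (σ₂ K).1))]
        have h2 := congrFun hux ⟨.inr (σ₂ K).1, (σ₂ K).2⟩
        simp only [hN] at h2
        rw [h2]
        exact congrArg x.2 (σ₂.symm_apply_apply K)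
    refine fun u x => ⟨fun hux => ?_, h1 u x⟩
    obtain ⟨y, hy⟩ := hEb.2 (N u)
    rw [← hy, hΨ ((h1 u y hy.symm).symm.trans hux)]
  have hΦΦ : ∀ u u', Φ u = Φ u' ↔ N u = N u' := by
    intro u u'
    obtain ⟨y, hy⟩ := hEb.2 (N u')
    rw [(hΦN u' y).2 hy.symm, hΦN, hy]
  have hmem := fun x => D.mem_fiberMonoid_iff' hl hf₁ hf₂ x
  have hsurj : ∀ p : {b // e.coord w b = 0} → ℕ, ∃ u : FaceMonoid C (faceAt w),
      ∀ b, u (σ.symm b) = p b := fun p =>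
    ⟨Finsupp.equivFunOnFinite.symm fun K => p (σ K), fun b => by simp⟩
  have hext : ∀ u u' : FaceMonoid C (faceAt w), (∀ b, u (σ.symm b) = u' (σ.symm b)) → u = u' :=
    fun u u' huu => Finsupp.ext fun K => by simpa using huu (σ K)
  constructor
  · rintro ⟨hinj, hrange⟩
    refine ⟨fun j k => ?_, fun n hn => ?_, fun p q hpq => ?_⟩
    · obtain ⟨u, hu⟩ := hsurj (Pi.single k 1)
      obtain ⟨x, hx, hxu⟩ := hrange.subset (mem_range_self u)
      have h1 := (hmem x).1 hx j
      rw [← hE, ← (hΦN u x).1 hxu.symm] at h1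
      simpa [hN, hu, Pi.single_apply] using h1
    · obtain ⟨x, rfl⟩ := hEb.2 n
      obtain ⟨u, hu⟩ := hrange.superset (mem_image_of_mem _ ((hmem x).2 hn))
      exact ⟨fun b => u (σ.symm b), fun i => (congrFun ((hΦN u x).1 hu) i).symm⟩
    · obtain ⟨u, hu⟩ := hsurj p
      obtain ⟨u', hu'⟩ := hsurj q
      have h1 : u = u' := hinj ((hΦΦ u u').2 (funext fun i => by
        simp only [hN, hu, hu']; exact hpq i))
      funext b
      rw [← hu, ← hu', h1]
  · intro hbasis
    refine ⟨fun u u' huu => hext u u' fun b => ?_, Subset.antisymm ?_ ?_⟩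
    · exact congrFun (hbasis.inj (fun b => u (σ.symm b)) (fun b => u' (σ.symm b))
        fun i => congrFun ((hΦΦ u u').1 huu) i) b
    · rintro _ ⟨u, rfl⟩
      obtain ⟨x, hx⟩ := hEb.2 (N u)
      refine ⟨x, (hmem x).2 fun j => ?_, ((hΦN u x).2 hx.symm).symm⟩
      rw [← hE, hx]
      simp only [hN]
      push_cast
      simp only [Finset.mul_sum, ← mul_assoc]
      rw [Finset.sum_comm]
      refine Finset.sum_eq_zero fun b _ => ?_
      rw [← Finset.sum_mul, hbasis.ker, zero_mul]
    · rintro _ ⟨x, hx, rfl⟩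
      obtain ⟨p, hp⟩ := hbasis.span _ ((hmem x).1 hx)
      obtain ⟨u, hu⟩ := hsurj p
      refine ⟨u, (hΦN u x).2 (funext fun i => ?_)⟩
      simp only [hN, hu]
      exact (hp i).symm

end

end

set_option linter.unusedSectionVars false

noncomputable section

section

open scoped Classical

variable {X₁ X₂ Y : Type u} [TopologicalSpace X₁] [CornerAtlas X₁] [TopologicalSpace X₂]
  [CornerAtlas X₂] [TopologicalSpace Y] [CornerAtlas Y]
  {f₁ : X₁ → Y} {f₂ : X₂ → Y} {F₁ : Face X₁} {F₂ : Face X₂}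
  {W : Type u} [TopologicalSpace W] [CornerAtlas W] {h : W → X₁ × X₂}

theorem IsFaceImage.unique {f : X₁ → Y} {F : Face X₁} {G G' : Face Y} (hG : IsFaceImage f F G)
    (hG' : IsFaceImage f F G') : G = G' :=
  Subtype.ext (Subset.antisymm (hG.2 G' hG'.1) (hG'.2 G hG.1))

namespace IsRes

theorem isClosedEmbedding (hh : IsRes f₁ f₂ F₁ F₂ h) : IsClosedEmbedding h :=
  ⟨hh.isEmbedding, by rw [hh.range_eq]; exact isClosed_closure⟩

theorem isBMap₁ (hh : IsRes f₁ f₂ F₁ F₂ h) : IsBMap fun w => (h w).1 :=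
  isBMap_of_bGerm fun e he w hw => ((hh.chart e he).fiberGerm w hw).fst

theorem isBMap₂ (hh : IsRes f₁ f₂ F₁ F₂ h) : IsBMap fun w => (h w).2 :=
  isBMap_of_bGerm fun e he w hw => ((hh.chart e he).fiberGerm w hw).snd

theorem mem_fiberInt (hh : IsRes f₁ f₂ F₁ F₂ h) {w : W} (hw : w ∈ mInterior W) :
    h w ∈ fiberInt f₁ f₂ F₁ F₂ := by
  obtain ⟨e, he, hwe⟩ := exists_chart w
  have h1 := ((hh.chart e he).fiberGerm w hwe).int.self_of_nhdsWithin ((mem_mInterior_iff he hwe).1 hw)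
  rwa [CornerChart.param_coord hwe] at h1

variable [IsManifoldWithCorners X₁] [IsManifoldWithCorners X₂] [IsManifoldWithCorners Y]

/-- The faces of `W` are homeomorphic to those of `D(F₁, F₂)`. -/
theorem fiberFaceOf_eq (hh : IsRes f₁ f₂ F₁ F₂ h) (hf₁ : IsInteriorBMap f₁)
    (hf₂ : IsInteriorBMap f₂) (htrans : BTransversal f₁ f₂) (hsmooth : SmoothFiberMonoids f₁ f₂)
    (w : W) : fiberFaceOf f₁ f₂ F₁ F₂ (h w) = h '' faceOf w := by
  have hev := hh.eventually_faceOf_eq_iff hf₁ hf₂ htrans hsmooth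
  rw [faceOf_eq_closure, ← hh.isClosedEmbedding.closure_image_eq, fiberFaceOf]
  congr 1
  set P : Set (X₁ × X₂) :=
    {q | q ∈ fiberD f₁ f₂ F₁ F₂ ∧ faceOf q.1 = faceOf (h w).1 ∧ faceOf q.2 = faceOf (h w).2} with hP
  have hwP : h w ∈ P := ⟨hh.mem w, rfl, rfl⟩
  have hCP : connectedComponentIn P (h w) ⊆ P := connectedComponentIn_subset _ _
  have himage : h '' (h ⁻¹' connectedComponentIn P (h w)) = connectedComponentIn P (h w) :=
    image_preimage_eq_of_subset fun q hq => by rw [hh.range_eq]; exact (hCP hq).1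
  have hpre : IsPreconnected (h ⁻¹' connectedComponentIn P (h w)) := by
    rw [← hh.isEmbedding.isInducing.isPreconnected_image, himage]
    exact isPreconnected_connectedComponentIn
  refine Subset.antisymm ?_ ?_
  · rw [← himage]
    refine image_mono (hpre.subset_connectedComponentIn (mem_connectedComponentIn hwP) fun q hq => ?_)
    refine hpre.eq_of_eventually_eq (P := codim) (fun q hq => ?_) hq (mem_connectedComponentIn hwP)
    filter_upwards [mem_nhdsWithin_of_mem_nhds (hev q), self_mem_nhdsWithin] with q' h1 h2
    rw [h1, (hCP hq).2.1, (hCP hq).2.2]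
    exact (hCP h2).2
  · refine (isPreconnected_connectedComponentIn.image h
      hh.isEmbedding.continuous.continuousOn).subset_connectedComponentIn
      (mem_image_of_mem _ (mem_stratum_self w)) ?_
    rintro _ ⟨q, hq, rfl⟩
    refine ⟨hh.mem q, ?_⟩
    have h1 := eq_of_faceOf_eq (P := fun q => (faceOf (h q).1, faceOf (h q).2)) (fun r => by
      filter_upwards [hev r] with q' h1 h2 using Prod.ext_iff.2 (h1.1 h2))
      (faceOf_eq_of_mem_stratum hq)
    exact Prod.ext_iff.1 h1

theorem mem_mInterior (hh : IsRes f₁ f₂ F₁ F₂ h) (hf₁ : IsInteriorBMap f₁)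
    (hf₂ : IsInteriorBMap f₂) (htrans : BTransversal f₁ f₂) (hsmooth : SmoothFiberMonoids f₁ f₂)
    {w : W} (hw : h w ∈ fiberInt f₁ f₂ F₁ F₂) : w ∈ mInterior W := by
  obtain ⟨e, he, hwe⟩ := exists_chart w
  obtain ⟨e₁, he₁, hp₁⟩ := exists_chart (h w).1
  obtain ⟨e₂, he₂, hp₂⟩ := exists_chart (h w).2
  obtain ⟨D, -, -⟩ := exists_fiberModel hf₁ hf₂ (hh.mem w) he₁ he₂ hp₁ hp₂
  obtain ⟨A, hA⟩ := hh.exists_isAdapted hf₁ hf₂ htrans hsmooth he hwe D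
  rw [mem_mInterior_iff he hwe]
  refine fun b => lt_of_le_of_ne (e.coord_nonneg _ _) fun hb => ?_
  obtain ⟨i, hi⟩ := hA.eventually_mem_zeros_iff hwe hb.symm
  exact ((D.eventually_coord_mem_sol.self_of_nhds hw).1 i).ne' (hi.self_of_nhds.1 hb.symm)

theorem isUniversalResolution (hh : IsRes f₁ f₂ F₁ F₂ h) (hf₁ : IsInteriorBMap f₁)
    (hf₂ : IsInteriorBMap f₂) (htrans : BTransversal f₁ f₂) (hsmooth : SmoothFiberMonoids f₁ f₂) :
    IsUniversalResolution f₁ f₂ F₁ F₂ (fun w => (h w).1) (fun w => (h w).2) where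
  bMap₁ := hh.isBMap₁
  bMap₂ := hh.isBMap₂
  interior w hw := ⟨(hh.mem_fiberInt hw).1, (hh.mem_fiberInt hw).2.1⟩
  mem := hh.mem
  proper := hh.isClosedEmbedding.isProperMap
  bijOn_interior := ⟨fun w hw => hh.mem_fiberInt hw, hh.isEmbedding.injective.injOn, fun p hp => by
    obtain ⟨w, rfl⟩ : p ∈ range h := by rw [hh.range_eq]; exact subset_closure hp
    exact ⟨w, hh.mem_mInterior hf₁ hf₂ htrans hsmooth hp, rfl⟩⟩
  bijOn_bTangent w e he e₁ he₁ e₂ he₂ hw hw₁ hw₂ := by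
    obtain ⟨D, rfl, rfl⟩ := exists_fiberModel hf₁ hf₂ (hh.mem w) he₁ he₂ hw₁ hw₂
    obtain ⟨A, hA⟩ := hh.exists_isAdapted hf₁ hf₂ htrans hsmooth he hw D
    exact D.bijOn_fiberBTangent ((hh.chart e he).fiberGerm w hw) htrans hw hA
  face_le_iff w w' := by
    rw [hh.fiberFaceOf_eq hf₁ hf₂ htrans hsmooth w, hh.fiberFaceOf_eq hf₁ hf₂ htrans hsmooth w',
      image_subset_image_iff hh.isEmbedding.injective]
  face_surj p hp := by
    obtain ⟨w, rfl⟩ : p ∈ range h := by rw [hh.range_eq]; exact hp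
    exact ⟨w, rfl⟩
  monoid_iso w C F hC hwC hF := by
    have := hh.isManifoldWithCorners hf₁ hf₂ htrans hsmooth
    obtain ⟨e, he, hw⟩ := exists_chart w
    obtain ⟨e₁, he₁, hp₁⟩ := exists_chart (h w).1
    obtain ⟨e₂, he₂, hp₂⟩ := exists_chart (h w).2
    obtain ⟨D, -, -⟩ := exists_fiberModel hf₁ hf₂ (hh.mem w) he₁ he₂ hp₁ hp₂
    obtain ⟨A, hA⟩ := hh.exists_isAdapted hf₁ hf₂ htrans hsmooth he hw D
    obtain rfl := hF.unique D.isFaceImage₁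
    exact (D.monoid_iso_iff hf₁ hf₂ hh.isBMap₁ hh.isBMap₂
      (fun w hw => ⟨(hh.mem_fiberInt hw).1, (hh.mem_fiberInt hw).2.1⟩) he hw hA.monoGerm hC hwC
      rfl).2 hA.basis

end IsRes

end

end

set_option linter.unusedSectionVars false

noncomputable section

section LogParam

variable {n m : ℕ}

/-- Extension of the boundary coordinates by `1` in the interior directions. -/
def extendOne (x₀ : EuclideanSpace ℝ (Fin n)) (t : {i // x₀ i = 0} → ℝ) (i : Fin n) : ℝ :=
  if h : x₀ i = 0 then t ⟨i, h⟩ else 1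

/-- Points near `x₀` are `xᵢ = tᵢ exp(eᵢ)` in the boundary directions and `xᵢ = exp(eᵢ)` in the
interior directions. -/
def logParam (x₀ : EuclideanSpace ℝ (Fin n)) (z : ({i // x₀ i = 0} → ℝ) × (Fin n → ℝ)) :
    EuclideanSpace ℝ (Fin n) :=
  WithLp.toLp 2 fun i => extendOne x₀ z.1 i * Real.exp (z.2 i)

variable {x₀ : EuclideanSpace ℝ (Fin n)}

theorem extendOne_nonneg {t : {i // x₀ i = 0} → ℝ} (ht : t ∈ piQuadrant _) (i : Fin n) :
    0 ≤ extendOne x₀ t i := by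
  unfold extendOne
  split_ifs with h
  exacts [ht _, zero_le_one]

theorem logParam_mem {z : ({i // x₀ i = 0} → ℝ) × (Fin n → ℝ)} (hz : z.1 ∈ piQuadrant _) :
    logParam x₀ z ∈ quadrant n :=
  fun i => mul_nonneg (extendOne_nonneg hz i) (Real.exp_pos _).le

theorem contDiff_extendOne (i : Fin n) : ContDiff ℝ ∞ fun t => extendOne x₀ t i := by
  unfold extendOne
  split_ifs with h
  exacts [contDiff_apply ℝ ℝ _, contDiff_const]

theorem contDiff_logParam : ContDiff ℝ ∞ (logParam x₀) := by
  refine contDiff_euclidean.2 fun i => ?_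
  exact ((contDiff_extendOne i).comp contDiff_fst).mul
    (Real.contDiff_exp.comp ((contDiff_apply ℝ ℝ i).comp contDiff_snd))

theorem prod_logParam (z : ({i // x₀ i = 0} → ℝ) × (Fin n → ℝ)) (β : Fin n → ℕ) :
    ∏ i, logParam x₀ z i ^ β i =
      (∏ i, extendOne x₀ z.1 i ^ β i) * Real.exp (∑ i, β i * z.2 i) := by
  rw [Real.exp_sum, ← Finset.prod_mul_distrib]
  refine Finset.prod_congr rfl fun i _ => ?_
  rw [Real.exp_nat_mul, ← mul_pow]
  rfl

theorem prod_extendOne_eq_one {t : {i // x₀ i = 0} → ℝ} {β : Fin n → ℕ}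
    (hβ : ∀ i, x₀ i = 0 → β i = 0) : ∏ i, extendOne x₀ t i ^ β i = 1 := by
  refine Finset.prod_eq_one fun i _ => ?_
  unfold extendOne
  split_ifs with h
  · rw [hβ i h, pow_zero]
  · rw [one_pow]

theorem hasFDerivAt_logParam {e₀ : Fin n → ℝ} (he₀ : logParam x₀ (0, e₀) = x₀) :
    HasFDerivAt (fun e => logParam x₀ (0, e))
      (((PiLp.continuousLinearEquiv 2 ℝ fun _ : Fin n => ℝ).symm :
        (Fin n → ℝ) →L[ℝ] EuclideanSpace ℝ (Fin n)).comp
        (ContinuousLinearMap.pi fun i => x₀ i • ContinuousLinearMap.proj i)) e₀ := by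
  suffices h0 : HasFDerivAt (fun (e : Fin n → ℝ) i => extendOne x₀ 0 i * Real.exp (e i))
      (ContinuousLinearMap.pi fun i => x₀ i • ContinuousLinearMap.proj i) e₀ from
    (((PiLp.continuousLinearEquiv 2 ℝ fun _ : Fin n => ℝ).symm :
      (Fin n → ℝ) →L[ℝ] EuclideanSpace ℝ (Fin n)).hasFDerivAt).comp e₀ h0
  refine hasFDerivAt_pi.2 fun i => ?_
  have h1 : HasFDerivAt (fun e : Fin n → ℝ => e i) (ContinuousLinearMap.proj i) e₀ :=
    hasFDerivAt_apply (𝕜 := ℝ) (F' := fun _ : Fin n => ℝ) i e₀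
  refine (h1.exp.const_mul (extendOne x₀ 0 i)).congr_fderiv ?_
  have h2 : extendOne x₀ 0 i * Real.exp (e₀ i) = x₀ i := congrArg (fun v => v i) he₀
  rw [← h2, mul_smul]

/-- The inverse function theorem for germs of b-maps between quadrants. -/
theorem exists_isBInverse_of_bijective {φ : EuclideanSpace ℝ (Fin n) → EuclideanSpace ℝ (Fin m)}
    {B : Fin m → Fin n → ℕ} (hx₀ : x₀ ∈ quadrant n)
    (hφ : ∀ k, MonoGerm x₀ (fun x => φ x k) (B k)) (π : {i // x₀ i = 0} → Fin m)
    (hπ : ∀ i i' : {i // x₀ i = 0}, B (π i) i' = if i' = i then 1 else 0)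
    (hπs : ∀ k, φ x₀ k = 0 → ∃ i, π i = k)
    (hbij : Function.Bijective
      (Matrix.of fun k i => limLogDeriv x₀ (fun x => φ x k) i : Matrix (Fin m) (Fin n) ℝ).mulVec) :
    ∃ χ C, IsBInverse x₀ (φ x₀) φ χ B C := by
  classical
  set β : Fin m → Fin n → ℕ := fun k i => if x₀ i = 0 then B k i else 0 with hβ
  choose a ha hu using fun k => (hφ k).normalize (β := β k) hx₀ fun i hi => by simp [hβ, hi]
  have ha0 : ∀ k, 0 < a k x₀ := fun k => ((hu k).self_of_nhdsWithin hx₀).1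
  have hy₀ : φ x₀ ∈ quadrant m := fun k => (hφ k).nonneg.self_of_nhdsWithin hx₀
  have hβ1 : ∀ i : {i // x₀ i = 0}, β (π i) = Pi.single i.1 1 := by
    intro i
    funext i'
    by_cases hi' : x₀ i' = 0
    · simp only [hβ, hi', if_true, Pi.single_apply]
      rw [hπ i ⟨i', hi'⟩]
      simp [Subtype.ext_iff]
    · have : i' ≠ i.1 := fun h => hi' (h ▸ i.2)
      simp [hβ, hi', this]
  have hβ0 : ∀ k, φ x₀ k ≠ 0 → β k = 0 := by
    intro k hk
    funext i
    by_cases hi : x₀ i = 0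
    · simpa [hβ, hi] using (hφ k).exponent_eq_zero hx₀ hk hi
    · simp [hβ, hi]
  have hπ0 : ∀ i, φ x₀ (π i) = 0 := by
    intro i
    by_contra h
    have := congrFun (hβ0 _ h) i.1
    rw [hβ1] at this
    simp at this
  have hprodπ : ∀ (i : {i // x₀ i = 0}) (z : Fin n → ℝ), ∏ i', z i' ^ β (π i) i' = z i := by
    intro i z
    rw [hβ1, Finset.prod_eq_single i.1 (fun b _ hb => by simp [hb]) (by simp)]
    simp
  set Φ : ({i // x₀ i = 0} → ℝ) × (Fin n → ℝ) → Fin m → ℝ := fun z k =>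
    Real.log (a k (logParam x₀ z)) + ∑ i, β k i * z.2 i with hΦ
  set T : EuclideanSpace ℝ (Fin m) → {i // x₀ i = 0} → ℝ := fun y i => y (π i) with hT
  set V : EuclideanSpace ℝ (Fin m) → Fin m → ℝ := fun y k =>
    if φ x₀ k = 0 then 0 else Real.log (y k) with hV
  set E : EuclideanSpace ℝ (Fin n) → Fin n → ℝ := fun x i =>
    if h : x₀ i = 0 then -Real.log (a (π ⟨i, h⟩) x) else Real.log (x i) with hE
  have hT0 : T (φ x₀) = 0 := funext hπ0
  have hxpos : ∀ᶠ x in 𝓝[quadrant n] x₀, ∀ i, x₀ i ≠ 0 → 0 < x i := eventually_all.2 fun i => by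
    by_cases hi : x₀ i = 0
    · simp [hi]
    · filter_upwards [eventually_pos_coord (lt_of_le_of_ne (hx₀ i) (Ne.symm hi))] with x hx _
      exact hx
  have hypos : ∀ᶠ y in 𝓝[quadrant m] (φ x₀), ∀ k, φ x₀ k ≠ 0 → 0 < y k :=
    eventually_all.2 fun k => by
      by_cases hk : φ x₀ k = 0
      · simp [hk]
      · filter_upwards [eventually_pos_coord (lt_of_le_of_ne (hy₀ k) (Ne.symm hk))] with x hx _
        exact hx
  have hpar : ∀ᶠ x in 𝓝[quadrant n] x₀,
      logParam x₀ (T (φ x), E x) = x ∧ Φ (T (φ x), E x) = V (φ x) := by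
    filter_upwards [eventually_all.2 hu, hxpos] with x hx hxp
    have h1 : logParam x₀ (T (φ x), E x) = x := by
      ext i
      change extendOne x₀ (T (φ x)) i * Real.exp (E x i) = x i
      by_cases hi : x₀ i = 0
      · simp only [extendOne, hi, hT, hE, dif_pos]
        rw [(hx _).2, hprodπ, Real.exp_neg, Real.exp_log (hx _).1]
        have := (hx (π ⟨i, hi⟩)).1.ne'
        field_simp
      · simp only [extendOne, hi, hE, dif_neg, not_false_eq_true, one_mul]
        exact Real.exp_log (hxp i hi)
    refine ⟨h1, ?_⟩
    funext k
    simp only [hΦ, h1, hV]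
    split_ifs with hk
    · obtain ⟨i, rfl⟩ := hπs k hk
      rw [hβ1, Finset.sum_eq_single i.1 (fun b _ hb => by simp [hb]) (by simp)]
      simp [hE, i.2]
    · have h3 := (hx k).2
      rw [hβ0 k hk] at h3 ⊢
      simp [h3]
  obtain ⟨hpar0, hΦ0⟩ := hpar.self_of_nhdsWithin hx₀
  rw [hT0] at hpar0 hΦ0
  have hmap : ∀ z : ({i // x₀ i = 0} → ℝ) × (Fin n → ℝ), 
      z ∈ piQuadrant {i // x₀ i = 0} ×ˢ (univ : Set (Fin n → ℝ)) → logParam x₀ z ∈ quadrant n :=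
    fun z hz => logParam_mem hz.1
  have hmapt : Tendsto (logParam x₀) (𝓝[piQuadrant _ ×ˢ univ] (0, E x₀)) (𝓝[quadrant n] x₀) := by
    refine tendsto_nhdsWithin_iff.2 ⟨?_, eventually_nhdsWithin_of_forall hmap⟩
    have := (contDiff_logParam (x₀ := x₀)).continuous.continuousWithinAt
      (s := piQuadrant _ ×ˢ univ) (x := (0, E x₀))
    rw [ContinuousWithinAt, hpar0] at this
    exact this
  have h0mem : ((0, E x₀) : ({i // x₀ i = 0} → ℝ) × (Fin n → ℝ)) ∈
      piQuadrant {i // x₀ i = 0} ×ˢ (univ : Set (Fin n → ℝ)) := ⟨fun _ => le_rfl, mem_univ _⟩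
  have hΦs : SmoothGerm (piQuadrant _ ×ˢ univ) (0, E x₀) Φ := by
    refine SmoothGerm.pi fun k => SmoothGerm.add ?_ (SmoothGerm.of_contDiff (by fun_prop))
    refine SmoothGerm.log h0mem ?_ (by rw [hpar0]; exact (ha0 k).ne')
    refine SmoothGerm.comp (Q' := quadrant n) (by rw [hpar0]; exact ha k)
      (SmoothGerm.of_contDiff contDiff_logParam) (by rw [hpar0]; exact hmapt)
  obtain ⟨S, hS, hS0, hΦS, hSΦ⟩ := exists_implicit_function hΦs
    (LinearEquiv.ofBijective (Matrix.mulVecLin (Matrix.of fun k i => limLogDeriv x₀ (fun x => φ x k) i))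
      hbij).toContinuousLinearEquiv (by
    refine hasFDerivAt_pi' (𝕜 := ℝ).2 fun k => ?_
    have hd : DifferentiableWithinAt ℝ (a k) (quadrant n) (logParam x₀ (0, E x₀)) := by
      rw [hpar0]
      exact ((ha k).self_of_mem hx₀).differentiableWithinAt (by simp)
    have h1 := hd.hasFDerivWithinAt.comp_hasFDerivAt (E x₀) (hasFDerivAt_logParam hpar0)
      (Eventually.of_forall fun e => hmap (0, e) ⟨fun _ => le_rfl, mem_univ _⟩)
    have h2 : HasFDerivAt (fun e : Fin n → ℝ => ∑ i, (β k i : ℝ) * e i)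
        (∑ i, (β k i : ℝ) • ContinuousLinearMap.proj i) (E x₀) :=
      HasFDerivAt.fun_sum fun i _ =>
        HasFDerivAt.const_mul (𝕜 := ℝ) (hasFDerivAt_apply (𝕜 := ℝ) (F' := fun _ : Fin n => ℝ) i (E x₀)) _
    refine ((h1.log (by simpa [hpar0] using (ha0 k).ne')).add h2).congr_fderiv ?_
    ext1 v
    have h3 : ∀ i, limLogDeriv x₀ (fun x => φ x k) i = β k i +
        x₀ i * fderivWithin ℝ (a k) (quadrant n) x₀ (EuclideanSpace.single i 1) / a k x₀ :=
      fun i => (MonoGerm.hasLogDeriv' hx₀ (ha k) (hu k) i).limUnder_eq hx₀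
    have h4 : (WithLp.toLp 2 fun i => x₀ i * v i : EuclideanSpace ℝ (Fin n)) =
        ∑ i, (x₀ i * v i) • EuclideanSpace.single i (1 : ℝ) := by
      ext j
      simp [Pi.single_apply]
    have h5 : fderivWithin ℝ (a k) (quadrant n) x₀ (WithLp.toLp 2 fun i => x₀ i * v i) =
        ∑ i, x₀ i * v i * fderivWithin ℝ (a k) (quadrant n) x₀ (EuclideanSpace.single i 1) := by
      rw [h4, map_sum]
      simp
    change (a k (logParam x₀ (0, E x₀)))⁻¹ * fderivWithin ℝ (a k) (quadrant n)
      (logParam x₀ (0, E x₀)) (WithLp.toLp 2 fun i => x₀ i * v i) +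
      (∑ i, (β k i : ℝ) • (ContinuousLinearMap.proj i : (Fin n → ℝ) →L[ℝ] ℝ)) v =
      ∑ i, limLogDeriv x₀ (fun x => φ x k) i * v i
    rw [hpar0, h5, Finset.mul_sum, _root_.sum_apply, ← Finset.sum_add_distrib]
    refine Finset.sum_congr rfl fun i _ => ?_
    rw [h3]
    simp only [_root_.smul_apply, ContinuousLinearMap.proj_apply, smul_eq_mul]
    ring)
  rw [hΦ0] at hS hS0 hΦS
  set ev : EuclideanSpace ℝ (Fin m) → ({i // x₀ i = 0} → ℝ) × (Fin m → ℝ) := fun y => (T y, V y)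
    with hev
  have hev0 : ev (φ x₀) = (0, V (φ x₀)) := by simp only [hev, hT0]
  have hevs : SmoothGerm (quadrant m) (φ x₀) ev := by
    refine (SmoothGerm.pi fun i => smoothGerm_coord _).prodMk (SmoothGerm.pi fun k => ?_)
    by_cases hk : φ x₀ k = 0
    · simpa only [hV, hk, if_true] using SmoothGerm.const 0
    · simpa only [hV, hk, if_false] using (smoothGerm_coord k).log hy₀ hk
  have hevt : Tendsto ev (𝓝[quadrant m] (φ x₀)) (𝓝[piQuadrant _ ×ˢ univ] (0, V (φ x₀))) := by
    rw [← hev0]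
    refine tendsto_nhdsWithin_iff.2 ⟨(hevs.continuousWithinAt hy₀).tendsto, ?_⟩
    filter_upwards [self_mem_nhdsWithin] with y hy using ⟨fun i => hy _, mem_univ _⟩
  have hSs : SmoothGerm (quadrant m) (φ x₀) (fun y => S (ev y)) :=
    SmoothGerm.comp (Q' := piQuadrant _ ×ˢ univ) (by rw [hev0]; exact hS) hevs
      (by rw [hev0]; exact hevt)
  refine ⟨fun y => logParam x₀ (T y, S (ev y)),
    fun i => if h : x₀ i = 0 then Pi.single (π ⟨i, h⟩) 1 else 0, hx₀, rfl, hφ, fun i => ?_, ?_, ?_⟩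
  · refine ⟨fun y => Real.exp (S (ev y) i),
      (hSs.comp_contDiff (g := fun v : Fin n → ℝ => v i) (contDiff_apply ℝ ℝ i)).exp,
      Eventually.of_forall fun y => ⟨Real.exp_pos _, ?_⟩⟩
    change extendOne x₀ (T y) i * Real.exp (S (ev y) i) = _
    rw [mul_comm]
    congr 1
    by_cases hi : x₀ i = 0
    · simp only [extendOne, hi, dif_pos]
      rw [Finset.prod_eq_single (π ⟨i, hi⟩) (fun b _ hb => by simp [hb]) (by simp)]
      simp [hT]
    · simp [extendOne, hi]
  · have hEs : SmoothGerm (quadrant n) x₀ E := by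
      refine SmoothGerm.pi fun i => ?_
      by_cases hi : x₀ i = 0
      · simpa only [hE, hi, dif_pos] using ((ha _).log hx₀ (ha0 _).ne').neg
      · simpa only [hE, hi, dif_neg, not_false_eq_true] using (smoothGerm_coord i).log hx₀ hi
    have hTt := hevt.comp (tendsto_quadrant_of_monoGerm hx₀ hφ)
    have ht : Tendsto (fun x => (T (φ x), E x)) (𝓝[quadrant n] x₀)
        (𝓝[piQuadrant _ ×ˢ univ] (0, E x₀)) := by
      refine tendsto_nhdsWithin_iff.2 ⟨?_, ?_⟩
      · exact ((continuous_fst.tendsto _).comp (tendsto_nhdsWithin_iff.1 hTt).1).prodMk_nhds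
          (hEs.continuousWithinAt hx₀).tendsto
      · exact (tendsto_nhdsWithin_iff.1 hTt).2.mono fun x hx => ⟨hx.1, mem_univ _⟩
    filter_upwards [hpar, ht.eventually hSΦ] with x hx hx'
    have h1 : S (ev (φ x)) = E x := by
      rw [← hx', hx.2]
    simp only [h1, hx.1]
  · have hχt : Tendsto (fun y => logParam x₀ (T y, S (ev y))) (𝓝[quadrant m] (φ x₀))
        (𝓝[quadrant n] x₀) := by
      refine hmapt.comp (tendsto_nhdsWithin_iff.2 ⟨?_, ?_⟩)
      · have h1 := (hSs.continuousWithinAt hy₀).tendsto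
        rw [hev0, hS0] at h1
        exact ((continuous_fst.tendsto _).comp (tendsto_nhdsWithin_iff.1 hevt).1).prodMk_nhds h1
      · exact (tendsto_nhdsWithin_iff.1 hevt).2.mono fun x hx => ⟨hx.1, mem_univ _⟩
    filter_upwards [hχt.eventually (eventually_all.2 hu), hevt.eventually hΦS, hypos]
      with y hy hy' hyp
    ext k
    have h1 : Φ (T y, S (ev y)) k = V y k := congrFun hy' k
    have h2 : φ (logParam x₀ (T y, S (ev y))) k =
        Real.exp (V y k) * ∏ i, extendOne x₀ (T y) i ^ β k i := by
      rw [(hy k).2, prod_logParam, ← h1]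
      simp only [hΦ]
      rw [Real.exp_add, Real.exp_log (hy k).1]
      ring
    rw [h2]
    by_cases hk : φ x₀ k = 0
    · obtain ⟨i, rfl⟩ := hπs k hk
      rw [hprodπ i]
      simp [hV, hk, extendOne, i.2, hT]
    · rw [prod_extendOne_eq_one fun i _ => by rw [hβ0 k hk]; rfl]
      simp only [hV, hk, if_false, mul_one]
      exact Real.exp_log (hyp k hk)

end LogParam

end

set_option linter.unusedSectionVars false

noncomputable section

namespace IsKernelBasis

variable {J V κ κ' : Type} [Fintype V] [Fintype κ] [Fintype κ'] {γ : J → V → ℤ} {M : V → κ → ℕ}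

/-- Bases of a free commutative monoid are unique up to permutations. -/
theorem exists_permutation [DecidableEq κ'] (h : IsKernelBasis γ M) {N : κ → κ' → ℕ}
    (h' : IsKernelBasis γ fun i b => ∑ k, M i k * N k b) :
    ∃ σ : κ' → κ, Function.Surjective σ ∧ ∀ b b', N (σ b) b' = if b' = b then 1 else 0 := by
  classical
  have hspan : ∀ k, ∃ p : κ' → ℕ, ∀ i, M i k = ∑ b, (∑ k', M i k' * N k' b) * p b := fun k =>
    h'.span _ fun j => h.ker j k
  choose P hP using hspan
  have hassoc : ∀ (p : κ' → ℕ) (i : V), ∑ b, (∑ k, M i k * N k b) * p b =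
      ∑ k, M i k * ∑ b, N k b * p b := by
    intro p i
    simp only [Finset.sum_mul, Finset.mul_sum, mul_assoc]
    exact Finset.sum_comm
  have hNP : ∀ k k', ∑ b, N k b * P k' b = if k = k' then 1 else 0 := by
    intro k k'
    refine congrFun (h.inj (fun k => ∑ b, N k b * P k' b) (fun k => if k = k' then 1 else 0)
      fun i => ?_) k
    rw [← hassoc, ← hP]
    simp
  have hPN : ∀ b b', ∑ k, P k b * N k b' = if b = b' then 1 else 0 := by
    intro b b'
    refine congrFun (h'.inj (fun b => ∑ k, P k b * N k b') (fun b => if b = b' then 1 else 0)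
      fun i => ?_) b
    have h1 : ∑ b, (∑ k, M i k * N k b) * ∑ k, P k b * N k b' =
        ∑ k, (∑ b, (∑ k', M i k' * N k' b) * P k b) * N k b' := by
      simp only [Finset.mul_sum, Finset.sum_mul (s := (Finset.univ : Finset κ'))]
      rw [Finset.sum_comm]
      simp only [mul_assoc]
    rw [h1]
    simp [← hP]
  have h1 : ∀ b, ∃ k, P k b = 1 ∧ N k b = 1 := by
    intro b
    have h2 := hPN b b
    rw [if_pos rfl] at h2
    obtain ⟨k, -, hk⟩ := Finset.exists_ne_zero_of_sum_ne_zero (by rw [h2]; exact one_ne_zero)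
    have h3 := Finset.single_le_sum (f := fun k => P k b * N k b) (fun k _ => Nat.zero_le _)
      (Finset.mem_univ k)
    rw [h2] at h3
    have h4 : P k b * N k b = 1 := le_antisymm h3 (Nat.one_le_iff_ne_zero.2 hk)
    exact ⟨k, Nat.eq_one_of_mul_eq_one_right h4, Nat.eq_one_of_mul_eq_one_left h4⟩
  choose σ hσP hσN using h1
  have hrow : ∀ b b', N (σ b) b' = if b' = b then 1 else 0 := by
    intro b b'
    split_ifs with hb
    · rw [hb, hσN]
    · have h2 := hPN b b'
      rw [if_neg (Ne.symm hb), Finset.sum_eq_zero_iff] at h2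
      simpa [hσP] using h2 (σ b) (Finset.mem_univ _)
  refine ⟨σ, fun k => ?_, hrow⟩
  have h2 := hNP k k
  rw [if_pos rfl] at h2
  obtain ⟨b, -, hb⟩ := Finset.exists_ne_zero_of_sum_ne_zero (by rw [h2]; exact one_ne_zero)
  refine ⟨b, ?_⟩
  by_contra hk
  have h3 := hNP k (σ b)
  rw [if_neg (Ne.symm hk), Finset.sum_eq_zero_iff] at h3
  have h4 := h3 b (Finset.mem_univ _)
  rw [hσP, mul_one] at h4
  exact hb (by rw [h4, zero_mul])

end IsKernelBasis

section

open scoped Classical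

variable {X₁ X₂ Y : Type u} [TopologicalSpace X₁] [CornerAtlas X₁] [TopologicalSpace X₂]
  [CornerAtlas X₂] [TopologicalSpace Y] [CornerAtlas Y]
  {f₁ : X₁ → Y} {f₂ : X₂ → Y} {F₁ : Face X₁} {F₂ : Face X₂}
  {W W₀ : Type u} [TopologicalSpace W] [CornerAtlas W] [TopologicalSpace W₀] [CornerAtlas W₀]
  {h : W → X₁ × X₂}

theorem exists_face_int_subset_mInterior (w : W) :
    ∃ C : Face W, C.int ⊆ mInterior W ∧ w ∈ C.1 := by
  obtain ⟨e, he, hw⟩ := exists_chart w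
  obtain ⟨N, hN, hwN, hNe, hNf⟩ := exists_nhds_faceOf_eq he hw
  have h1 := (CornerChart.frequently_zeros_eq hw (empty_subset _)).and_eventually (hN.mem_nhds hwN)
  obtain ⟨q, hq, hqN⟩ := h1.exists
  refine ⟨faceAt q, fun q' hq' => ?_, ?_⟩
  · refine (codim_eq_of_faceOf_eq hq').trans ?_
    refine (mem_mInterior_iff he (hNe hqN)).2 fun i => lt_of_le_of_ne (e.coord_nonneg _ _) fun hi => ?_
    exact (Set.ext_iff.1 hq i).1 hi.symm
  · rw [← (faceAt q).isClosed.closure_eq, mem_closure_iff_frequently]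
    refine h1.mono fun q' hq' => ?_
    change q' ∈ faceOf q
    rw [hNf q hqN q' hq'.2 (hq.trans hq'.1.symm)]
    exact mem_faceOf_self q'

theorem eventually_param_coord_comp {φ : W → W₀} {e : CornerChart W} {e₀ : CornerChart W₀} {w : W}
    (hw : w ∈ e.source) (hw₀ : φ w ∈ e₀.source) (hφc : ContinuousAt φ w) :
    ∀ᶠ x in 𝓝[quadrant e.1] (e.coord w),
      e₀.param (e₀.coord (φ (e.param x))) = φ (e.param x) := by
  filter_upwards [(hφc.tendsto.comp (CornerChart.tendsto_param hw)).eventually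
    (e₀.isOpen_source.mem_nhds hw₀)] with x hx using CornerChart.param_coord hx

/-- The chain rule for b-differentials. -/
theorem bDiff_comp {X : Type u} [TopologicalSpace X] [CornerAtlas X] {φ : W → W₀} {g : W₀ → X}
    (hg : IsBMap g) {e : CornerChart W} {e₀ : CornerChart W₀} (he₀ : e₀ ∈ CornerAtlas.charts)
    {w : W} (hw : w ∈ e.source) (hw₀ : φ w ∈ e₀.source) (hφc : ContinuousAt φ w)
    {B : Fin e₀.1 → Fin e.1 → ℕ}
    (hB : ∀ k, MonoGerm (e.coord w) (fun x => e₀.coord (φ (e.param x)) k) (B k))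
    {e₁ : CornerChart X} (he₁ : e₁ ∈ CornerAtlas.charts) (hw₁ : g (φ w) ∈ e₁.source)
    (v : Fin e.1 → ℝ) :
    (bDiff (fun w => g (φ w)) e e₁ w).mulVec v = (bDiff g e₀ e₁ (φ w)).mulVec
      ((Matrix.of fun k i => limLogDeriv (e.coord w) (fun x => e₀.coord (φ (e.param x)) k) i :
        Matrix (Fin e₀.1) (Fin e.1) ℝ).mulVec v) := by
  have hx₀ := e.coord_mem w
  have hpw : e.param (e.coord w) = w := CornerChart.param_coord hw
  have hφ0 : e₀.coord (φ (e.param (e.coord w))) = e₀.coord (φ w) := by rw [hpw]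
  have ht := tendsto_quadrant_of_monoGerm hx₀ hB
  have hparam := eventually_param_coord_comp hw hw₀ hφc
  rw [Matrix.mulVec_mulVec]
  congr 1
  ext j i
  rw [Matrix.mul_apply]
  simp only [Matrix.of_apply]
  rcases (hg.bGerm he₀ hw₀).2 e₁ he₁ (by
      change g (e₀.param (e₀.coord (φ w))) ∈ _; rwa [CornerChart.param_coord hw₀]) j with ⟨α, hα⟩ | h0
  · rw [← hφ0] at hα
    have h1 := MonoGerm.limLogDeriv_comp hx₀ hB hα i
    simp only [hφ0] at h1
    refine Eq.trans ?_ h1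
    refine limLogDeriv_congr hx₀ (MonoGerm.comp hx₀ hB hα) ?_ i
    filter_upwards [hparam] with x hx
    rw [hx]
  · have h1 : bDiff (fun w => g (φ w)) e e₁ w j i = 0 := by
      refine limUnder_logDeriv_of_eq_zero hx₀ ?_
      rw [← hφ0] at h0
      filter_upwards [hparam, ht.eventually h0] with x hx hx'
      rwa [hx] at hx'
    rw [h1, Finset.sum_eq_zero fun k _ => ?_]
    have h2 : bDiff g e₀ e₁ (φ w) j k = 0 := limUnder_logDeriv_of_eq_zero (e₀.coord_mem _) h0
    rw [h2, zero_mul]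

namespace IsUniversalResolution

theorem fiberGerm (hu : IsUniversalResolution f₁ f₂ F₁ F₂ (fun w => (h w).1) fun w => (h w).2)
    {e : CornerChart W} (he : e ∈ CornerAtlas.charts) {w : W} (hw : w ∈ e.source) :
    FiberGerm f₁ f₂ F₁ F₂ (e.coord w) fun x => h (e.param x) := by
  refine ⟨hu.bMap₁.bGerm he hw, hu.bMap₂.bGerm he hw, ?_⟩
  have h1 := (CornerChart.eventually_coord_param hw).filter_mono
    (nhdsWithin_mono _ (openQuadrant_subset e.1))
  filter_upwards [h1, self_mem_nhdsWithin] with x hx hxQ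
  exact hu.bijOn_interior.mapsTo ((mem_mInterior_iff he hx.1).2 (by rwa [hx.2]))

theorem continuous (hu : IsUniversalResolution f₁ f₂ F₁ F₂ (fun w => (h w).1) fun w => (h w).2) :
    Continuous h := hu.bMap₁.1.1.prodMk hu.bMap₂.1.1

variable [IsManifoldWithCorners X₁] [IsManifoldWithCorners X₂] [IsManifoldWithCorners Y]
  [IsManifoldWithCorners W] {h₀ : W₀ → X₁ × X₂} {φ : W → W₀}

theorem exists_isBInverse (hu : IsUniversalResolution f₁ f₂ F₁ F₂ (fun w => (h₀ (φ w)).1)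
      fun w => (h₀ (φ w)).2) (hh₀ : IsRes f₁ f₂ F₁ F₂ h₀) (hf₁ : IsInteriorBMap f₁)
    (hf₂ : IsInteriorBMap f₂) (htrans : BTransversal f₁ f₂) (hsmooth : SmoothFiberMonoids f₁ f₂)
    {e : CornerChart W} (he : e ∈ CornerAtlas.charts) {w : W} (hw : w ∈ e.source)
    {e₀ : CornerChart W₀} (he₀ : e₀ ∈ CornerAtlas.charts) (hw₀ : φ w ∈ e₀.source) :
    ∃ χ B C, IsBInverse (e.coord w) (e₀.coord (φ w)) (fun x => e₀.coord (φ (e.param x))) χ B C := by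
  have hx₀ := e.coord_mem w
  have hpw : e.param (e.coord w) = w := CornerChart.param_coord hw
  have hφ0 : e₀.coord (φ (e.param (e.coord w))) = e₀.coord (φ w) := by rw [hpw]
  have hφc : Continuous φ := hh₀.isEmbedding.continuous_iff.2 hu.continuous
  have hg := hu.fiberGerm (h := fun w => h₀ (φ w)) he hw
  choose B hB using (hh₀.chart e₀ he₀).lift e.1 (e.coord w) (fun x => φ (e.param x)) hx₀
    (by rwa [hpw]) hg
  obtain ⟨e₁, he₁, hp₁⟩ := exists_chart (h₀ (φ w)).1
  obtain ⟨e₂, he₂, hp₂⟩ := exists_chart (h₀ (φ w)).2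
  obtain ⟨D, rfl, rfl⟩ := exists_fiberModel hf₁ hf₂ (hh₀.mem (φ w)) he₁ he₂ hp₁ hp₂
  obtain ⟨A₀, hA₀⟩ := hh₀.exists_isAdapted hf₁ hf₂ htrans hsmooth he₀ hw₀ D
  obtain ⟨C, hC, hwC⟩ := exists_face_int_subset_mInterior w
  have hparam := eventually_param_coord_comp hw hw₀ hφc.continuousAt
  have hA : ∀ i, MonoGerm (e.coord w) (fun x => D.coord (h₀ (φ (e.param x))) i)
      (∑ k, A₀ i k • B k) := by
    intro i
    refine (MonoGerm.comp hx₀ hB (by rw [hφ0]; exact hA₀.monoGerm i)).congr ?_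
    filter_upwards [hparam] with x hx
    rw [hx]
  have hbasis := (D.monoid_iso_iff (h := fun w => h₀ (φ w)) hf₁ hf₂ hu.bMap₁ hu.bMap₂ hu.interior he
    hw hA hC hwC rfl).1 (hu.monoid_iso w C D.G hC hwC D.isFaceImage₁)
  have hsum : ∀ i (b : {b // e.coord w b = 0}), (∑ k, A₀ i k • B k) b.1 =
      ∑ k : {k // e₀.coord (φ w) k = 0}, A₀ i k * B k b := by
    intro i b
    rw [Finset.sum_apply]
    exact (sum_subtype_of_eq_zero (fun k => A₀ i k * B k b) fun k hk => by
      rw [(hB k).exponent_eq_zero hx₀ (by rwa [hφ0]) b.2, mul_zero]).symm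
  simp only [hsum] at hbasis
  obtain ⟨σ, hσ, hσB⟩ := hA₀.basis.exists_permutation
    (N := fun (k : {k // e₀.coord (φ w) k = 0}) (b : {b // e.coord w b = 0}) => B k b) hbasis
  have hbij : Function.Bijective (Matrix.of fun k i =>
      limLogDeriv (e.coord w) (fun x => e₀.coord (φ (e.param x)) k) i :
        Matrix (Fin e₀.1) (Fin e.1) ℝ).mulVec := by
    have h1 := hu.bijOn_bTangent w e he D.e₁ D.he₁ D.e₂ D.he₂ hw hp₁ hp₂
    have h2 := (hh₀.isUniversalResolution hf₁ hf₂ htrans hsmooth).bijOn_bTangent (φ w) e₀ he₀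
      D.e₁ D.he₁ D.e₂ D.he₂ hw₀ hp₁ hp₂
    have h3 : ∀ v, _ = _ ∧ _ = _ := fun v =>
      ⟨bDiff_comp hh₀.isBMap₁ he₀ hw hw₀ hφc.continuousAt hB D.he₁ hp₁ v,
        bDiff_comp hh₀.isBMap₂ he₀ hw hw₀ hφc.continuousAt hB D.he₂ hp₂ v⟩
    simp only [(h3 _).1, (h3 _).2] at h1
    constructor
    · intro v v' hv
      exact h1.injOn (mem_univ _) (mem_univ _) (by simp only [hv])
    · intro u
      obtain ⟨v, -, hv⟩ := h1.surjOn (h2.mapsTo (mem_univ u))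
      exact ⟨v, h2.injOn (mem_univ _) (mem_univ _) hv⟩
  obtain ⟨χ, C', hχ⟩ := exists_isBInverse_of_bijective hx₀ hB (fun b => (σ b).1) hσB
    (fun k hk => by
      obtain ⟨b, hb⟩ := hσ ⟨k, by rwa [hφ0] at hk⟩
      exact ⟨b, congrArg Subtype.val hb⟩) hbij
  rw [hφ0] at hχ
  exact ⟨χ, B, C', hχ⟩

theorem exists_local_inverse (hu : IsUniversalResolution f₁ f₂ F₁ F₂ (fun w => (h₀ (φ w)).1)
      fun w => (h₀ (φ w)).2) (hh₀ : IsRes f₁ f₂ F₁ F₂ h₀) (hf₁ : IsInteriorBMap f₁)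
    (hf₂ : IsInteriorBMap f₂) (htrans : BTransversal f₁ f₂) (hsmooth : SmoothFiberMonoids f₁ f₂)
    (w : W) : ∃ s : W₀ → W, Tendsto s (𝓝 (φ w)) (𝓝 w) ∧ ∀ᶠ q in 𝓝 (φ w), φ (s q) = q := by
  obtain ⟨e, he, hw⟩ := exists_chart w
  obtain ⟨e₀, he₀, hw₀⟩ := exists_chart (φ w)
  obtain ⟨χ, B, C, hχ⟩ := hu.exists_isBInverse hh₀ hf₁ hf₂ htrans hsmooth he hw he₀ hw₀
  have hφc : Continuous φ := hh₀.isEmbedding.continuous_iff.2 hu.continuous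
  have ht : Tendsto (fun q => e.param (χ (e₀.coord q))) (𝓝 (φ w)) (𝓝 w) := by
    have h1 := tendsto_quadrant_of_monoGerm hχ.symm.mem hχ.monoGerm_inv
    rw [hχ.symm.map_eq] at h1
    exact ((CornerChart.tendsto_param hw).comp h1).comp (CornerChart.tendsto_coord hw₀)
  refine ⟨_, ht, ?_⟩
  filter_upwards [(CornerChart.tendsto_coord hw₀).eventually hχ.right_inv,
    e₀.isOpen_source.mem_nhds hw₀, (hφc.tendsto w).comp ht (e₀.isOpen_source.mem_nhds hw₀)]
    with q h1 h2 h3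
  have h4 : φ (e.param (χ (e₀.coord q))) ∈ e₀.source := h3
  rw [← CornerChart.param_coord h4, h1, CornerChart.param_coord h2]

theorem mem_mInterior_of_map (hu : IsUniversalResolution f₁ f₂ F₁ F₂ (fun w => (h₀ (φ w)).1)
      fun w => (h₀ (φ w)).2) (hh₀ : IsRes f₁ f₂ F₁ F₂ h₀) (hf₁ : IsInteriorBMap f₁)
    (hf₂ : IsInteriorBMap f₂) (htrans : BTransversal f₁ f₂) (hsmooth : SmoothFiberMonoids f₁ f₂)
    {w : W} (hφw : φ w ∈ mInterior W₀) : w ∈ mInterior W := by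
  obtain ⟨e, he, hw⟩ := exists_chart w
  obtain ⟨e₀, he₀, hw₀⟩ := exists_chart (φ w)
  obtain ⟨χ, B, C, hχ⟩ := hu.exists_isBInverse hh₀ hf₁ hf₂ htrans hsmooth he hw he₀ hw₀
  have h1 := (mem_mInterior_iff he₀ hw₀).1 hφw
  refine (mem_mInterior_iff he hw).2 fun b => lt_of_le_of_ne (e.coord_nonneg _ _) fun hb => ?_
  have h2 := hχ.sum_mul (i := b) hb.symm
  rw [if_pos rfl] at h2
  obtain ⟨k, -, -⟩ := Finset.exists_ne_zero_of_sum_ne_zero (by rw [h2]; exact one_ne_zero)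
  exact (h1 k.1).ne' k.2

theorem bijective (hu : IsUniversalResolution f₁ f₂ F₁ F₂ (fun w => (h₀ (φ w)).1)
      fun w => (h₀ (φ w)).2) (hh₀ : IsRes f₁ f₂ F₁ F₂ h₀) (hf₁ : IsInteriorBMap f₁)
    (hf₂ : IsInteriorBMap f₂) (htrans : BTransversal f₁ f₂) (hsmooth : SmoothFiberMonoids f₁ f₂) :
    IsClosedMap φ ∧ Function.Bijective φ := by
  have hclosed : IsClosedMap φ := fun S hS => by
    rw [← hh₀.isEmbedding.injective.preimage_image (φ '' S), ← image_comp]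
    exact (hu.proper.isClosedMap S hS).preimage hh₀.isEmbedding.continuous
  refine ⟨hclosed, fun w w' hww => ?_, fun q => ?_⟩
  · obtain ⟨s, hs, hφs⟩ := hu.exists_local_inverse hh₀ hf₁ hf₂ htrans hsmooth w
    obtain ⟨s', hs', hφs'⟩ := hu.exists_local_inverse hh₀ hf₁ hf₂ htrans hsmooth w'
    rw [← hww] at hs' hφs'
    have h1 : ∃ᶠ q in 𝓝 (φ w), s q = s' q := by
      refine ((frequently_mem_mInterior (φ w)).and_eventually (hφs.and hφs')).mono fun q hq => ?_
      obtain ⟨hq, h1, h2⟩ := hq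
      have hmem : ∀ {w}, φ w = q → w ∈ mInterior W := fun h1 =>
        hu.mem_mInterior_of_map hh₀ hf₁ hf₂ htrans hsmooth (by rwa [h1])
      exact hu.bijOn_interior.injOn (hmem h1) (hmem h2)
        (congrArg h₀ (h1.trans h2.symm) : h₀ (φ (s q)) = h₀ (φ (s' q)))
    have := IsManifoldWithCorners.t2 (X := W)
    exact tendsto_nhds_unique_of_frequently_eq hs hs' h1
  · have h1 : q ∈ closure (range φ) := by
      refine mem_closure_iff_frequently.2 ((frequently_mem_mInterior q).mono fun q' hq' => ?_)
      obtain ⟨w, -, hw⟩ := hu.bijOn_interior.surjOn (hh₀.mem_fiberInt hq')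
      exact ⟨w, hh₀.isEmbedding.injective hw⟩
    rwa [hclosed.isClosed_range.closure_eq] at h1

theorem isRes_comp (hu : IsUniversalResolution f₁ f₂ F₁ F₂ (fun w => (h₀ (φ w)).1)
      fun w => (h₀ (φ w)).2) (hh₀ : IsRes f₁ f₂ F₁ F₂ h₀) (hf₁ : IsInteriorBMap f₁)
    (hf₂ : IsInteriorBMap f₂) (htrans : BTransversal f₁ f₂) (hsmooth : SmoothFiberMonoids f₁ f₂) :
    IsRes f₁ f₂ F₁ F₂ fun w => h₀ (φ w) := by
  obtain ⟨hclosed, hinj, hsurj⟩ := hu.bijective hh₀ hf₁ hf₂ htrans hsmooth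
  have hφc : Continuous φ := hh₀.isEmbedding.continuous_iff.2 hu.continuous
  have hemb : IsEmbedding fun w => h₀ (φ w) := hh₀.isEmbedding.comp
    (IsClosedEmbedding.of_continuous_injective_isClosedMap hφc hinj hclosed).isEmbedding
  refine ⟨hemb, ?_, fun e he => ⟨fun w hw => hu.fiberGerm (h := fun w => h₀ (φ w)) he hw, ?_⟩⟩
  · rw [← hh₀.range_eq]
    exact hsurj.range_comp h₀
  · intro N y₀ c hy₀ hc hg j
    obtain ⟨e₀, he₀, hw₀⟩ := exists_chart (φ (c y₀))
    obtain ⟨χ, B, C, hχ⟩ := hu.exists_isBInverse hh₀ hf₁ hf₂ htrans hsmooth he hc he₀ hw₀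
    choose α hα using (hh₀.chart e₀ he₀).lift N y₀ (fun y => φ (c y)) hy₀ hw₀ hg
    have hct : Tendsto c (𝓝[quadrant N] y₀) (𝓝 (c y₀)) := by
      rw [hemb.tendsto_nhds_iff]
      exact hg.tendsto
    refine ⟨_, (MonoGerm.comp hy₀ hα (hχ.monoGerm_inv j)).congr ?_⟩
    filter_upwards [hct.eventually ((CornerChart.tendsto_coord hc).eventually hχ.left_inv),
      hct.eventually (e.isOpen_source.mem_nhds hc)] with y h1 h2
    rw [CornerChart.param_coord h2] at h1
    rw [h1]

/-- Universal resolutions are homeomorphic to `D(F₁, F₂)`, and b-maps into `D(F₁, F₂)` lift. -/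
theorem isRes {h₁ : W → X₁} {h₂ : W → X₂} (hu : IsUniversalResolution f₁ f₂ F₁ F₂ h₁ h₂)
    (hf₁ : IsInteriorBMap f₁) (hf₂ : IsInteriorBMap f₂) (htrans : BTransversal f₁ f₂)
    (hsmooth : SmoothFiberMonoids f₁ f₂) : IsRes f₁ f₂ F₁ F₂ fun w => (h₁ w, h₂ w) := by
  obtain ⟨_, hh₀⟩ := exists_isRes hf₁ hf₂ htrans hsmooth F₁ F₂
  exact isRes_comp (h₀ := Subtype.val) (φ := fun w => ⟨(h₁ w, h₂ w), hu.mem w⟩) hu hh₀ hf₁ hf₂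
    htrans hsmooth

end IsUniversalResolution

end

end

set_option linter.unusedSectionVars false

noncomputable section

theorem finite_face (X : Type u) [TopologicalSpace X] [CornerAtlas X] [CompactSpace X] :
    Finite (Face X) := by
  have h1 : ∀ p : X, ∃ N ∈ 𝓝 p, (faceOf '' N).Finite := by
    intro p
    obtain ⟨e, he, hp⟩ := exists_chart p
    obtain ⟨N, hN, hpN, -, hNf⟩ := exists_nhds_faceOf_eq he hp
    refine ⟨N, hN.mem_nhds hpN, ?_⟩
    have h2 : (e.zeros '' N).Finite := toFinite _
    have h3 : ∀ S : Set (Fin e.1), ∃ q, S ∈ e.zeros '' N → q ∈ N ∧ e.zeros q = S := fun S => by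
      by_cases hS : S ∈ e.zeros '' N
      · obtain ⟨q, hq⟩ := hS
        exact ⟨q, fun _ => hq⟩
      · exact ⟨p, fun h => absurd h hS⟩
    choose r hr using h3
    refine (h2.image fun S => faceOf (r S)).subset ?_
    rintro _ ⟨q, hq, rfl⟩
    have hS := mem_image_of_mem e.zeros hq
    exact ⟨_, hS, hNf _ (hr _ hS).1 _ hq (hr _ hS).2⟩
  choose N hN hNf using h1
  obtain ⟨t, ht⟩ := isCompact_univ.elim_nhds_subcover N fun p _ => hN p
  have h2 : (range (faceOf (X := X))).Finite := by
    refine (t.finite_toSet.biUnion fun p _ => hNf p).subset ?_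
    rintro _ ⟨q, rfl⟩
    obtain ⟨p, hp, hq⟩ := mem_iUnion₂.1 (ht.2 (mem_univ q))
    exact mem_biUnion hp (mem_image_of_mem _ hq)
  exact Finite.subset h2 (by rintro _ ⟨p, rfl⟩; exact ⟨p, rfl⟩)

section

open scoped Classical

variable {X₁ X₂ Y : Type u} [TopologicalSpace X₁] [CornerAtlas X₁] [TopologicalSpace X₂]
  [CornerAtlas X₂] [TopologicalSpace Y] [CornerAtlas Y] {f₁ : X₁ → Y} {f₂ : X₂ → Y}

theorem setOf_eq_iUnion_fiberD [T2Space Y] (hf₁ : Continuous f₁) (hf₂ : Continuous f₂) :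
    {p : X₁ × X₂ | f₁ p.1 = f₂ p.2} = ⋃ (F₁ : Face X₁) (F₂ : Face X₂), fiberD f₁ f₂ F₁ F₂ := by
  ext p
  simp only [mem_iUnion, mem_ofPred_eq]
  refine ⟨fun hp => ⟨faceAt p.1, faceAt p.2, subset_closure ⟨rfl, rfl, hp⟩⟩, ?_⟩
  rintro ⟨F₁, F₂, hp⟩
  exact eq_of_mem_fiberD hf₁ hf₂ hp

theorem fiberInt_unique {F F' : Face X₁ × Face X₂} {p : X₁ × X₂} (hp : p ∈ fiberInt f₁ f₂ F.1 F.2)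
    (hp' : p ∈ fiberInt f₁ f₂ F'.1 F'.2) : F = F' :=
  Prod.ext (Subtype.ext (hp.1.symm.trans hp'.1)) (Subtype.ext (hp.2.1.symm.trans hp'.2.1))

section Lift

variable {Z : Type u} [TopologicalSpace Z] [CornerAtlas Z] {g₁ : Z → X₁} {g₂ : Z → X₂}

theorem exists_eventually_mem_fiberInt (hg₁ : IsBMap g₁) (hg₂ : IsBMap g₂)
    (hg : f₁ ∘ g₁ = f₂ ∘ g₂) (z : Z) : ∃ F : Face X₁ × Face X₂, ∀ᶠ z' in 𝓝 z, z' ∈ mInterior Z →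
      (g₁ z', g₂ z') ∈ fiberInt f₁ f₂ F.1 F.2 := by
  obtain ⟨e, he, hz⟩ := exists_chart z
  obtain ⟨N₁, hN₁, h1⟩ := (hg₁.bGerm he hz).exists_mem_nhds_faceOf_eq
  obtain ⟨N₂, hN₂, h2⟩ := (hg₂.bGerm he hz).exists_mem_nhds_faceOf_eq
  have hev : ∀ᶠ z' in 𝓝 z, z' ∈ e.source ∧ e.coord z' ∈ N₁ ∧ e.coord z' ∈ N₂ := by
    filter_upwards [e.isOpen_source.mem_nhds hz, CornerChart.tendsto_coord hz hN₁,
      CornerChart.tendsto_coord hz hN₂] with z' h1 h2 h3 using ⟨h1, h2, h3⟩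
  obtain ⟨q, hq, hqs, hq1, hq2⟩ := ((frequently_mem_mInterior z).and_eventually hev).exists
  refine ⟨(faceAt (g₁ q), faceAt (g₂ q)), hev.mono fun z' hz' hz'i => ?_⟩
  have hzero : ∀ i, e.coord z' i = 0 ↔ e.coord q i = 0 := fun i =>
    iff_of_false ((mem_mInterior_iff he hz'.1).1 hz'i i).ne' ((mem_mInterior_iff he hqs).1 hq i).ne'
  have h3 := h1 _ hz'.2.1 _ hq1 hzero
  have h4 := h2 _ hz'.2.2 _ hq2 hzero
  simp only [CornerChart.param_coord hz'.1, CornerChart.param_coord hqs] at h3 h4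
  exact ⟨h3, h4, congrFun hg z'⟩

theorem fiberGerm_of_eventually (hg₁ : IsBMap g₁) (hg₂ : IsBMap g₂) {F : Face X₁ × Face X₂} {z : Z}
    (hF : ∀ᶠ z' in 𝓝 z, z' ∈ mInterior Z → (g₁ z', g₂ z') ∈ fiberInt f₁ f₂ F.1 F.2)
    {e : CornerChart Z} (he : e ∈ CornerAtlas.charts) (hz : z ∈ e.source) :
    FiberGerm f₁ f₂ F.1 F.2 (e.coord z) fun x => (g₁ (e.param x), g₂ (e.param x)) := by
  refine ⟨hg₁.bGerm he hz, hg₂.bGerm he hz, ?_⟩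
  have hle := nhdsWithin_mono (e.coord z) (openQuadrant_subset e.1)
  filter_upwards [hle (CornerChart.eventually_coord_param hz),
    hle ((CornerChart.tendsto_param hz).eventually hF), self_mem_nhdsWithin] with x h1 h2 hx
  exact h2 ((mem_mInterior_iff he h1.1).2 (by rwa [h1.2]))

end Lift

variable [IsManifoldWithCorners X₁] [IsManifoldWithCorners X₂] [IsManifoldWithCorners Y]
  {M : Face X₁ × Face X₂ → Type u} [∀ F, TopologicalSpace (M F)] [∀ F, CornerAtlas (M F)]
  {h : ∀ F, M F → X₁ × X₂}

theorem exists_eventually_eq_sigmaMk {α : Type*} {l : Filter α} {ψ : α → Σ F, M F}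
    {F : Face X₁ × Face X₂} (q₀ : M F) (hψ : ∀ᶠ a in l, (ψ a).1 = F) :
    ∃ c : α → M F, ψ =ᶠ[l] fun a => ⟨F, c a⟩ := by
  refine ⟨fun a => if ha : (ψ a).1 = F then ha ▸ (ψ a).2 else q₀, hψ.mono fun a ha => ?_⟩
  change ψ a = ⟨F, if ha : (ψ a).1 = F then ha ▸ (ψ a).2 else q₀⟩
  clear hψ
  generalize ψ a = p at ha ⊢
  obtain ⟨F', q⟩ := p
  obtain rfl : F' = F := ha
  simp

theorem eventually_fst_eq {α : Type*} {l : Filter α} {ψ : α → Σ F, M F} {p : Σ F, M F}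
    (hψ : Tendsto ψ l (𝓝 p)) : ∀ᶠ a in l, (ψ a).1 = p.1 :=
  mem_of_superset (hψ (isOpen_range_sigmaMk.mem_nhds ⟨p.2, rfl⟩)) fun a ha => by
    obtain ⟨q, hq⟩ := ha
    exact (congrArg Sigma.fst hq).symm

theorem tendsto_sigma_of_isEmbedding (hh : ∀ F, IsEmbedding (h F)) {α : Type*} {l : Filter α}
    {ψ : α → Σ F, M F} {p : Σ F, M F} (hψ : ∀ᶠ a in l, (ψ a).1 = p.1)
    (ht : Tendsto (fun a => h (ψ a).1 (ψ a).2) l (𝓝 (h p.1 p.2))) : Tendsto ψ l (𝓝 p) := by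
  obtain ⟨F, q⟩ := p
  obtain ⟨c, hc⟩ := exists_eventually_eq_sigmaMk q hψ
  refine Tendsto.congr' (EventuallyEq.symm hc) ?_
  refine (continuous_sigmaMk.tendsto q).comp ((hh F).tendsto_nhds_iff.2 ?_)
  exact ht.congr' (hc.mono fun a ha => by rw [ha]; rfl)

theorem monoGerm_coord_sigma (hh : ∀ F, IsRes f₁ f₂ F.1 F.2 (h F)) {e : CornerChart (Σ F, M F)}
    (he : e ∈ CornerAtlas.charts) {N : ℕ} {y₀ : EuclideanSpace ℝ (Fin N)}
    {ψ : EuclideanSpace ℝ (Fin N) → Σ F, M F} (hy₀ : y₀ ∈ quadrant N) (hψ : ψ y₀ ∈ e.source)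
    (ht : Tendsto ψ (𝓝[quadrant N] y₀) (𝓝 (ψ y₀)))
    (hg : FiberGerm f₁ f₂ (ψ y₀).1.1 (ψ y₀).1.2 y₀ fun y => h (ψ y).1 (ψ y).2) (j : Fin e.1) :
    ∃ α, MonoGerm y₀ (fun y => e.coord (ψ y) j) α := by
  obtain ⟨F, e₀, he₀, rfl⟩ := he
  obtain ⟨q, hq, hqψ⟩ := hψ
  have hF : ∀ᶠ y in 𝓝[quadrant N] y₀, (ψ y).1 = F := by
    have := eventually_fst_eq ht
    rwa [← hqψ] at this
  obtain ⟨c, hc⟩ := exists_eventually_eq_sigmaMk q hF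
  have hc0 : ψ y₀ = ⟨F, c y₀⟩ := hc.self_of_nhdsWithin hy₀
  rw [← hqψ] at hg hc0
  obtain rfl : q = c y₀ := by simpa using hc0
  obtain ⟨α, hα⟩ := ((hh F).chart e₀ he₀).lift N y₀ c hy₀ hq
    (hg.congr hy₀ (hc.mono fun y hy =>
      (congrArg (fun p : Σ F, M F => h p.1 p.2) hy).symm)) j
  refine ⟨α, hα.congr (hc.mono fun y hy => ?_)⟩
  change (CornerChart.sigma F e₀).coord (ψ y) j = _
  rw [hy]
  exact congrArg (fun v : EuclideanSpace ℝ (Fin e₀.1) => v j) (CornerChart.coord_sigma e₀ (c y))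

theorem mem_fiberInt_of_mem_mInterior (hh : ∀ F, IsRes f₁ f₂ F.1 F.2 (h F)) {p : Σ F, M F}
    (hp : p ∈ mInterior (Σ F, M F)) : h p.1 p.2 ∈ fiberInt f₁ f₂ p.1.1 p.1.2 :=
  (hh p.1).mem_fiberInt ((codim_sigma p.2).symm.trans hp)

theorem isBMap_sigma {X : Type u} [TopologicalSpace X] [CornerAtlas X] {g : ∀ F, M F → X}
    (hg : ∀ F, IsBMap (g F)) : IsBMap fun p : Σ F, M F => g p.1 p.2 := by
  refine isBMap_of_bGerm ?_
  rintro _ ⟨F, e, he, rfl⟩ _ ⟨q, hq, rfl⟩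
  rw [CornerChart.coord_sigma]
  exact (hg F).bGerm he hq

/-- The disjoint union of the resolutions of all the `D(F₁, F₂)` is the universal fiber product. -/
theorem isUniversalFiberProduct_sigma (hf₁ : Continuous f₁) (hf₂ : Continuous f₂)
    [∀ F, IsManifoldWithCorners (M F)] (hh : ∀ F, IsRes f₁ f₂ F.1 F.2 (h F)) :
    IsUniversalFiberProduct f₁ f₂ (fun p : Σ F, M F => (h p.1 p.2).1)
      fun p : Σ F, M F => (h p.1 p.2).2 := by
  have hY := IsManifoldWithCorners.t2 (X := Y)
  have hT2 := (IsManifoldWithCorners.sigma (M := M) fun _ => inferInstance).t2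
  refine ⟨isBMap_sigma fun F => (hh F).isBMap₁, isBMap_sigma fun F => (hh F).isBMap₂,
    funext fun p => eq_of_mem_fiberD hf₁ hf₂ ((hh p.1).mem p.2), ?_⟩
  intro Z _ _ _ g₁ g₂ hg₁ hg₂ hg
  have hgc : Continuous fun z => (g₁ z, g₂ z) := hg₁.1.1.prodMk hg₂.1.1
  choose ind hind using exists_eventually_mem_fiberInt hg₁ hg₂ hg
  have hloc : ∀ z, ∀ᶠ z' in 𝓝 z, ind z' = ind z := by
    intro z
    filter_upwards [eventually_eventually_nhds.2 (hind z)] with z' hz'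
    obtain ⟨q, hq, h1, h2⟩ := ((frequently_mem_mInterior z').and_eventually
      ((hind z').and hz')).exists
    exact fiberInt_unique (h1 hq) (h2 hq)
  have hlift : ∀ z, ∃ w : M (ind z), h (ind z) w = (g₁ z, g₂ z) := by
    intro z
    obtain ⟨e, he, hz⟩ := exists_chart z
    have h1 := (fiberGerm_of_eventually hg₁ hg₂ (hind z) he hz).eventually_mem_fiberD.self_of_nhdsWithin
      (e.coord_mem z)
    rwa [CornerChart.param_coord hz, ← (hh (ind z)).range_eq] at h1
  obtain ⟨g, hg1, hgh⟩ : ∃ g : Z → Σ F, M F, (fun z => (g z).1) = ind ∧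
      ∀ z, h (g z).1 (g z).2 = (g₁ z, g₂ z) := by
    choose w hw using hlift
    exact ⟨fun z => ⟨ind z, w z⟩, rfl, hw⟩
  subst hg1
  have hcont : Continuous g := continuous_iff_continuousAt.2 fun z =>
    tendsto_sigma_of_isEmbedding (fun F => (hh F).isEmbedding) (hloc z)
      (by simpa only [hgh] using hgc.tendsto z)
  have ht : ∀ {e : CornerChart Z} {z : Z}, z ∈ e.source → Tendsto (fun x => g (e.param x))
      (𝓝[quadrant e.1] (e.coord z)) (𝓝 (g (e.param (e.coord z)))) := fun hz => by
    rw [CornerChart.param_coord hz]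
    exact (hcont.tendsto _).comp (CornerChart.tendsto_param hz)
  have hmono : ∀ e ∈ CornerAtlas.charts (X := Z), ∀ e' ∈ CornerAtlas.charts (X := Σ F, M F),
      ∀ z ∈ e.source, g (e.param (e.coord z)) ∈ e'.source → ∀ j, ∃ α, MonoGerm (e.coord z)
        (fun x => e'.coord (g (e.param x)) j) α := by
    intro e he e' he' z hz hz' j
    refine monoGerm_coord_sigma hh he' (e.coord_mem z) hz' (ht hz) ?_ j
    simp only [hgh, CornerChart.param_coord hz]
    exact fiberGerm_of_eventually hg₁ hg₂ (hind z) he hz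
  refine ⟨g, ⟨⟨?_, ?_⟩, ?_, ?_⟩, ?_⟩
  · exact (isBMap_of_bGerm fun e he z hz =>
      ⟨ht hz, fun e' he' hz' j => Or.inl (hmono e he e' he' z hz hz' j)⟩).1
  · intro e he e' he' z hz hz' j
    obtain ⟨α, hα⟩ := hmono e he e' he' z hz (by rwa [CornerChart.param_coord hz]) j
    exact ⟨α, isMonomialAt_iff.2 hα⟩
  · exact funext fun z => congrArg Prod.fst (hgh z)
  · exact funext fun z => congrArg Prod.snd (hgh z)
  · rintro g' ⟨hg', h1, h2⟩
    have hgh' : ∀ z, h (g' z).1 (g' z).2 = (g₁ z, g₂ z) := fun z =>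
      Prod.ext (congrFun h1 z) (congrFun h2 z)
    funext z
    refine tendsto_nhds_unique_of_frequently_eq (hg'.1.1.tendsto z) (hcont.tendsto z) ?_
    refine (frequently_mem_mInterior z).mono fun z' hz' => ?_
    have h3 := mem_fiberInt_of_mem_mInterior hh (hg'.mapsTo_interior hz')
    rw [hgh'] at h3
    have h4 : (g' z').1 = (g z').1 := fiberInt_unique h3 ((hind z').self_of_nhds hz')
    have h5 := (hgh' z').trans (hgh z').symm
    generalize g' z' = p at h4 h5 ⊢
    generalize g z' = p' at h4 h5 ⊢
    obtain ⟨F, q⟩ := p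
    obtain ⟨F', q'⟩ := p'
    obtain rfl : F = F' := h4
    exact congrArg _ ((hh _).isEmbedding.injective h5)

end

theorem theoremB {X₁ X₂ Y : Type u}
    [TopologicalSpace X₁] [CornerAtlas X₁] [IsManifoldWithCorners X₁]
    [TopologicalSpace X₂] [CornerAtlas X₂] [IsManifoldWithCorners X₂]
    [TopologicalSpace Y] [CornerAtlas Y] [IsManifoldWithCorners Y]
    (f₁ : X₁ → Y) (f₂ : X₂ → Y) (hf₁ : IsInteriorBMap f₁) (hf₂ : IsInteriorBMap f₂)
    (htrans : BTransversal f₁ f₂) (hsmooth : SmoothFiberMonoids f₁ f₂) :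
    -- the set-theoretic fiber product is the union of the `D(F₁, F₂)`
    ({p : X₁ × X₂ | f₁ p.1 = f₂ p.2} = ⋃ (F₁ : Face X₁) (F₂ : Face X₂), fiberD f₁ f₂ F₁ F₂) ∧
    -- which are finite in number if `X₁` and `X₂` are compact
    (CompactSpace X₁ → CompactSpace X₂ →
      {F : Face X₁ × Face X₂ | (fiberD f₁ f₂ F.1 F.2).Nonempty}.Finite) ∧
    -- each of them has a universal resolution
    (∀ (F₁ : Face X₁) (F₂ : Face X₂),
      ∃ (W : Type u) (_ : TopologicalSpace W) (_ : CornerAtlas W) (h₁ : W → X₁) (h₂ : W → X₂),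
        IsManifoldWithCorners W ∧ IsUniversalResolution f₁ f₂ F₁ F₂ h₁ h₂) ∧
    -- for any choice of the universal resolutions, they are homeomorphic to the `D(F₁, F₂)`, and
    -- their disjoint union is a manifold with corners and the universal fiber product
    (∀ (W : Face X₁ → Face X₂ → Type u) [∀ F₁ F₂, TopologicalSpace (W F₁ F₂)]
      [∀ F₁ F₂, CornerAtlas (W F₁ F₂)] [∀ F₁ F₂, IsManifoldWithCorners (W F₁ F₂)]
      (h₁ : ∀ F₁ F₂, W F₁ F₂ → X₁) (h₂ : ∀ F₁ F₂, W F₁ F₂ → X₂),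
      (∀ F₁ F₂, IsUniversalResolution f₁ f₂ F₁ F₂ (h₁ F₁ F₂) (h₂ F₁ F₂)) →
      (∀ F₁ F₂, IsEmbedding (fun w => (h₁ F₁ F₂ w, h₂ F₁ F₂ w)) ∧
        range (fun w => (h₁ F₁ F₂ w, h₂ F₁ F₂ w)) = fiberD f₁ f₂ F₁ F₂) ∧
      IsManifoldWithCorners (Σ F : Face X₁ × Face X₂, W F.1 F.2) ∧
      IsUniversalFiberProduct f₁ f₂
        (P := Σ F : Face X₁ × Face X₂, W F.1 F.2)
        (fun w => h₁ w.1.1 w.1.2 w.2) (fun w => h₂ w.1.1 w.1.2 w.2)) := by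
  have hY := IsManifoldWithCorners.t2 (X := Y)
  refine ⟨setOf_eq_iUnion_fiberD hf₁.1.1 hf₂.1.1, fun _ _ => ?_, fun F₁ F₂ => ?_, ?_⟩
  · have := finite_face X₁
    have := finite_face X₂
    exact toFinite _
  · obtain ⟨_, hh⟩ := exists_isRes hf₁ hf₂ htrans hsmooth F₁ F₂
    exact ⟨_, _, _, _, _, hh.isManifoldWithCorners hf₁ hf₂ htrans hsmooth,
      hh.isUniversalResolution hf₁ hf₂ htrans hsmooth⟩
  · intro W _ _ _ h₁ h₂ hu
    have hh := fun F₁ F₂ => (hu F₁ F₂).isRes hf₁ hf₂ htrans hsmooth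
    exact ⟨fun F₁ F₂ => ⟨(hh F₁ F₂).isEmbedding, (hh F₁ F₂).range_eq⟩,
      IsManifoldWithCorners.sigma fun F => inferInstance,
      isUniversalFiberProduct_sigma (M := fun F => W F.1 F.2)
        (h := fun F w => (h₁ F.1 F.2 w, h₂ F.1 F.2 w)) hf₁.1.1 hf₂.1.1 fun F => hh F.1 F.2⟩

end
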